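/- **Setting.** Let $(M,g)$ be a compact smooth Riemannian $n$-manifold (without boundary) with Riemannian volume measure $V_g$, let $\Omega\subseteq M$ be open, let $k\ge 0$, and let $\mu$ be a finite positive Borel measure on $M$ with $\operatorname{supp}(\mu)\subseteq\overline\Omega$ and $\mu(\Omega)>0$. Let $\langle\cdot,\cdot\rangle_g$ and $|\cdot|$ denote the inner product and norm that $g$ induces on the fibres of $\bigwedge^kT^*M$. Let $L^2(\bigwedge^k\Omega)$ and $L^2(\bigwedge^k\Omega,\mu)$ be the spaces of (classes of) measurable $k$-forms on $\Omega$ that are square-integrable with respect to $V_g$ and $\mu$, respectively, and put $\langle u,v\rangle_\mu:=\int_\Omega\langle u,v\rangle_g\,d\mu$. Let $\Gamma_c^\infty(\bigwedge^k\Omega)$ be the space of smooth $k$-forms with compact support in $\Omega$. Let $W^{1,2}(\bigwedge^k\Omega)$ be the space of all $u\in L^2(\bigwedge^k\Omega)$ whose components in every chart have locally integrable weak first partial derivatives and for which $du\in L^2(\bigwedge^{k+1}\Omega)$ and $d^*u\in L^2(\bigwedge^{k-1}\Omega)$. Here $du$ is computed in charts from the weak partial derivatives, and $d^*u$ is defined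 by $\int_\Omega\langle d^*u,\eta\rangle_g\,dV_g=\int_\Omega\langle u,d\eta\rangle_g\,dV_g$ for all $\eta\in\Gamma_c^\infty(\bigwedge^{k-1}\Omega)$, with $d^*u:=0$ if $k=0$. This space carries the inner product $$\langle u,v\rangle_{W^{1,2}}:=\int_\Omega\big(\langle u,v\rangle_g+\langle du,dv\rangle_g+\langle d^*u,d^*v\rangle_g\big)\,dV_g .$$ Let $W^{1,2}_0(\bigwedge^k\Omega)$ be the closure of $\Gamma_c^\infty(\bigwedge^k\Omega)$ in $W^{1,2}(\bigwedge^k\Omega)$. Assume the Poincaré inequality **(PI)** there is a constant $C>0$ such that $\displaystyle\int_\Omega|u|^2\,d\mu\le C\int_\Omega\big(|du|^2+|d^*u|^2\big)\,dV_g$ for all $u\in\Gamma_c^\infty(\bigwedge^k\Omega)$. Then for every $u\in W_0^{1,2}(\bigwedge^k\Omega)$ there is a unique $\iota(u)\in L^2(\bigwedge^k\Omega,\mu)$ for which some sequence $(u_m)$ in $\Gamma_c^\infty(\bigwedge^k\Omega)$ satisfies $u_m\to u$ in $W^{1,2}(\bigwedge^k\Omega)$ and $u_m\to\iota(u)$ in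 $L^2(\bigwedge^k\Omega,\mu)$. Let $\mathcal N_k:=\{u\in W_0^{1,2}(\bigwedge^k\Omega):\iota(u)=0\}$, and let $\mathcal N_k^\perp$ be its orthogonal complement in $W_0^{1,2}(\bigwedge^k\Omega)$; the map $\iota$ is injective on $\mathcal N_k^\perp$. Put $\operatorname{dom}(\mathcal E):=\iota(\mathcal N_k^\perp)\subseteq L^2(\bigwedge^k\Omega,\mu)$ and, for $u,v\in\mathcal N_k^\perp$, $$\mathcal E(\iota(u),\iota(v)):=\int_\Omega\big(\langle du,dv\rangle_g+\langle d^*u,d^*v\rangle_g\big)\,dV_g,\qquad \mathcal E_*(\iota(u),\iota(v)):=\mathcal E(\iota(u),\iota(v))+\langle\iota(u),\iota(v)\rangle_\mu .$$ **Proposition.** Under these assumptions: (a) $\operatorname{dom}(\mathcal E)$ is dense in $L^2(\bigwedge^k\Omega,\mu)$. (b) $\mathcal E_*$ is an inner product on $\operatorname{dom}(\mathcal E)$, and $\operatorname{dom}(\mathcal E)$ with this inner product is a Hilbert space. (c) Hence the form $\mathcal E$ is closed: if $(f_m)$ is a sequence in $\operatorname{dom}(\mathcal E)$ that converges to $f$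 in $L^2(\bigwedge^k\Omega,\mu)$ and $\mathcal E(f_m-f_l,f_m-f_l)\to0$ as $m,l\to\infty$, then $f\in\operatorname{dom}(\mathcal E)$ and $\mathcal E(f_m-f,f_m-f)\to0$. -/

import Mathlib

open scoped Matrix ContDiff Manifold
open MeasureTheory Bundle

set_option linter.unusedSectionVars false

namespace KreinFeller
noncomputable section

section Pointwise
variable {T : Type*} [AddCommGroup T] [Module ℝ T] [TopologicalSpace T] {n k : ℕ}

/-- The Gram matrix `B(bᵢ, bⱼ)`. -/
def gram (B : T →L[ℝ] T →L[ℝ] ℝ) (b : Fin n → T) : Matrix (Fin n) (Fin n) ℝ :=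
  Matrix.of fun i j => B (b i) (b j)

/-- The inner product induced by `B` on alternating `k`-forms, computed in a frame `b` with Gram
matrix `G`: `(1 / k!) ∑ G⁻¹(i₁, j₁) ⋯ G⁻¹(iₖ, jₖ) α(b_{i₁}, …, b_{iₖ}) β(b_{j₁}, …, b_{jₖ})`.
If `b` is orthonormal this is `∑_{i₁ < ⋯ < iₖ} α(b_{i₁}, …, b_{iₖ}) β(b_{i₁}, …, b_{iₖ})`,
so the products `e^{i₁} ∧ ⋯ ∧ e^{iₖ}` of an orthonormal coframe are orthonormal. -/
def altInner (B : T →L[ℝ] T →L[ℝ] ℝ) (b : Fin n → T) (α β : T [⋀^Fin k]→L[ℝ] ℝ) : ℝ :=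
  (k.factorial : ℝ)⁻¹ * ∑ I : Fin k → Fin n, ∑ J : Fin k → Fin n,
    (∏ m, (gram B b)⁻¹ (I m) (J m)) * α (b ∘ I) * β (b ∘ J)

theorem altInner_add_left (B : T →L[ℝ] T →L[ℝ] ℝ) (b : Fin n → T) (α α' β : T [⋀^Fin k]→L[ℝ] ℝ) :
    altInner B b (α + α') β = altInner B b α β + altInner B b α' β := by
  simp only [altInner, ← mul_add, ← Finset.sum_add_distrib, ContinuousAlternatingMap.add_apply]
  congr! 3
  ring

theorem altInner_smul_left (B : T →L[ℝ] T →L[ℝ] ℝ) (b : Fin n → T) (c : ℝ)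
    (α β : T [⋀^Fin k]→L[ℝ] ℝ) :
    altInner B b (c • α) β = c * altInner B b α β := by
  simp only [altInner, Finset.mul_sum, ContinuousAlternatingMap.smul_apply, smul_eq_mul]
  congr! 2
  ring

theorem gram_symm (B : T →L[ℝ] T →L[ℝ] ℝ) (hB : ∀ v w, B v w = B w v) (b : Fin n → T) :
    (gram B b)ᵀ = gram B b := by
  ext i j; simp [gram, hB (b i)]

theorem altInner_symm (B : T →L[ℝ] T →L[ℝ] ℝ) (hB : ∀ v w, B v w = B w v) (b : Fin n → T)
    (α β : T [⋀^Fin k]→L[ℝ] ℝ) :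
    altInner B b α β = altInner B b β α := by
  have h : ∀ i j, (gram B b)⁻¹ i j = (gram B b)⁻¹ j i := fun i j => by
    conv_lhs => rw [← gram_symm B hB b, ← Matrix.transpose_nonsing_inv]
    rfl
  simp only [altInner]
  rw [Finset.sum_comm]
  refine congrArg _ (Finset.sum_congr rfl fun I _ => Finset.sum_congr rfl fun J _ => ?_)
  rw [Finset.prod_congr rfl fun m _ => h (J m) (I m)]
  ring

theorem gram_posSemidef (B : T →L[ℝ] T →L[ℝ] ℝ) (hB : ∀ v w, B v w = B w v)
    (hpos : ∀ v, 0 ≤ B v v) (b : Fin n → T) : (gram B b).PosSemidef := by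
  refine Matrix.PosSemidef.of_dotProduct_mulVec_nonneg ?_ fun x => ?_
  · ext i j; simp [gram, hB (b i)]
  · have := hpos (∑ i, x i • b i)
    simp only [map_sum, map_smul, sum_apply, smul_apply, smul_eq_mul, Finset.mul_sum] at this
    simp only [gram, dotProduct, Matrix.mulVec, Finset.mul_sum, star_trivial, Matrix.of_apply]
    refine this.trans_eq (Finset.sum_congr rfl fun i _ => Finset.sum_congr rfl fun j _ => ?_)
    rw [hB]
    ring

theorem altInner_self_nonneg (B : T →L[ℝ] T →L[ℝ] ℝ) (hB : ∀ v w, B v w = B w v)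
    (hpos : ∀ v, 0 ≤ B v v) (b : Fin n → T) (α : T [⋀^Fin k]→L[ℝ] ℝ) :
    0 ≤ altInner B b α α := by
  obtain ⟨N, C, hC⟩ := Matrix.posSemidef_iff_eq_sum_vecMulVec.1
    (gram_posSemidef B hB hpos b).inv
  refine mul_nonneg (by positivity) ?_
  have : ∀ i j, (gram B b)⁻¹ i j = ∑ c, C c i * C c j := fun i j => by
    rw [hC]; simp [Matrix.sum_apply, Matrix.vecMulVec_apply]
  have key : ∑ I : Fin k → Fin n, ∑ J : Fin k → Fin n,
      (∏ m, (gram B b)⁻¹ (I m) (J m)) * α (b ∘ I) * α (b ∘ J)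
      = ∑ K : Fin k → Fin N, (∑ I : Fin k → Fin n, (∏ m, C (K m) (I m)) * α (b ∘ I)) ^ 2 := by
    simp_rw [this, Finset.prod_univ_sum, Fintype.piFinset_univ, Finset.sum_mul, sq,
      Finset.sum_mul_sum]
    conv_rhs => rw [Finset.sum_comm]
    congr! 1 with I _
    rw [Finset.sum_comm]
    congr! 2 with K _ J _
    rw [Finset.prod_mul_distrib]; ring
  rw [key]
  exact Finset.sum_nonneg fun _ _ => sq_nonneg _

/-- `altInner` does not depend on the frame. -/
theorem altInner_frame (B : T →L[ℝ] T →L[ℝ] ℝ) (b b' : Fin n → T) (P : Matrix (Fin n) (Fin n) ℝ)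
    (hP : IsUnit P.det) (hb : ∀ j, b' j = ∑ a, P a j • b a) (α β : T [⋀^Fin k]→L[ℝ] ℝ) :
    altInner B b' α β = altInner B b α β := by
  have hG : gram B b' = Pᵀ * gram B b * P := by
    ext i j
    simp only [gram, hb, Matrix.of_apply, Matrix.mul_apply, Matrix.transpose_apply, map_sum,
      map_smul, sum_apply, smul_apply, smul_eq_mul,
      Finset.mul_sum, Finset.sum_mul]
    congr! 2
    ring
  have hG' : (gram B b)⁻¹ = P * (gram B b')⁻¹ * Pᵀ := by
    have hPt : IsUnit Pᵀ.det := by simpa using hP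
    rw [hG, Matrix.mul_inv_rev, Matrix.mul_inv_rev, ← Matrix.mul_assoc, Matrix.mul_nonsing_inv _ hP,
      Matrix.one_mul, Matrix.mul_assoc, Matrix.nonsing_inv_mul _ hPt, Matrix.mul_one]
  have hα : ∀ (γ : T [⋀^Fin k]→L[ℝ] ℝ) (I : Fin k → Fin n),
      γ (b' ∘ I) = ∑ A : Fin k → Fin n, (∏ m, P (A m) (I m)) * γ (b ∘ A) := fun γ I => by
    have : b' ∘ I = fun m => ∑ a, P a (I m) • b a := by ext m; simp [hb]
    rw [this]
    have h2 := γ.toMultilinearMap.map_sum (fun m a => P a (I m) • b a)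
    simp only [MultilinearMap.map_smul_univ] at h2
    simpa [Function.comp_def] using h2
  have hE : ∀ i j, (gram B b)⁻¹ i j = ∑ c : Fin n × Fin n, P i c.1 * (gram B b')⁻¹ c.1 c.2 * P j c.2 := fun i j => by
    rw [hG']
    simp [Matrix.mul_apply, Fintype.sum_prod_type_right, Finset.sum_mul]
  have hprod : ∀ A C : Fin k → Fin n, ∏ m, (gram B b)⁻¹ (A m) (C m) =
      ∑ I : Fin k → Fin n, ∑ J : Fin k → Fin n,
        (∏ m, P (A m) (I m)) * (∏ m, (gram B b')⁻¹ (I m) (J m)) * ∏ m, P (C m) (J m) := by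
    intro A C
    rw [← Fintype.sum_prod_type', ← (Equiv.arrowProdEquivProdArrow (Fin k) _ _).sum_comp]
    rw [Finset.prod_congr rfl fun m _ => hE (A m) (C m), Finset.prod_univ_sum,
      Fintype.piFinset_univ]
    refine Finset.sum_congr rfl fun I _ => ?_
    simp [Finset.prod_mul_distrib, Equiv.arrowProdEquivProdArrow]
  have comm4 : ∀ f : (Fin k → Fin n) → (Fin k → Fin n) → (Fin k → Fin n) → (Fin k → Fin n) → ℝ,
      ∑ I, ∑ J, ∑ A, ∑ C, f I J A C = ∑ A, ∑ C, ∑ I, ∑ J, f I J A C := fun f => by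
    calc _ = ∑ I, ∑ A, ∑ J, ∑ C, f I J A C :=
          Finset.sum_congr rfl fun I _ => Finset.sum_comm
      _ = ∑ A, ∑ I, ∑ J, ∑ C, f I J A C := Finset.sum_comm
      _ = ∑ A, ∑ I, ∑ C, ∑ J, f I J A C :=
          Finset.sum_congr rfl fun A _ => Finset.sum_congr rfl fun I _ => Finset.sum_comm
      _ = _ := Finset.sum_congr rfl fun A _ => Finset.sum_comm
  unfold altInner
  congr 1
  calc _ = ∑ I : Fin k → Fin n, ∑ J : Fin k → Fin n, ∑ A : Fin k → Fin n, ∑ C : Fin k → Fin n,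
        (∏ m, P (A m) (I m)) * (∏ m, (gram B b')⁻¹ (I m) (J m)) * (∏ m, P (C m) (J m)) *
          α (b ∘ A) * β (b ∘ C) := by
        refine Finset.sum_congr rfl fun I _ => Finset.sum_congr rfl fun J _ => ?_
        rw [hα α I, hα β J, mul_assoc, Finset.sum_mul_sum, Finset.mul_sum]
        refine Finset.sum_congr rfl fun A _ => ?_
        rw [Finset.mul_sum]
        refine Finset.sum_congr rfl fun C _ => ?_
        ring
    _ = _ := by
        rw [comm4]
        refine Finset.sum_congr rfl fun A _ => Finset.sum_congr rfl fun C _ => ?_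
        simp_rw [hprod, Finset.sum_mul]

end Pointwise

section Manifold

/-- The model space `ℝⁿ` with its Euclidean norm. -/
abbrev Euc (n : ℕ) := EuclideanSpace ℝ (Fin n)

variable {n : ℕ} {M : Type*} [TopologicalSpace M] [ChartedSpace (Euc n) M]

/-- The coordinate vector field `∂ᵢ` of the chart at `x₀`, at the point `p` of its domain. -/
def frame (x₀ p : M) (i : Fin n) : TangentSpace (𝓡 n) p :=
  mfderiv 𝓘(ℝ, Euc n) (𝓡 n) (extChartAt (𝓡 n) x₀).symm (extChartAt (𝓡 n) x₀ p)
    (EuclideanSpace.single i (1 : ℝ) : Euc n)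

variable (n M) in
/-- Smooth Riemannian metrics on `M`. -/
abbrev SmoothMetric [IsManifold (𝓡 n) ∞ M] :=
  ContMDiffRiemannianMetric (𝓡 n) ∞ (Euc n) (TangentSpace (𝓡 n) : M → Type)

variable [IsManifold (𝓡 n) ∞ M]

theorem frame_eq_symm {x₀ p : M} (hp : p ∈ (chartAt (Euc n) x₀).source) (i : Fin n) :
    frame x₀ p i = (trivializationAt (Euc n) (TangentSpace (𝓡 n)) x₀).symmL ℝ p
      (EuclideanSpace.single i (1 : ℝ) : Euc n) := by
  have : IsManifold (𝓡 n) 1 M := IsManifold.of_le (n := ∞) (by simp)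
  rw [TangentBundle.symmL_trivializationAt hp]
  simp only [frame, modelWithCornersSelf_coe, Set.range_id, mfderivWithin_univ]
  rfl

theorem exists_frame_change {x₀ x₁ p : M} (h₀ : p ∈ (chartAt (Euc n) x₀).source)
    (h₁ : p ∈ (chartAt (Euc n) x₁).source) :
    ∃ P : Matrix (Fin n) (Fin n) ℝ, IsUnit P.det ∧
      ∀ j, frame x₁ p j = ∑ a, P a j • frame x₀ p a := by
  let e (x : M) (hx : p ∈ (chartAt (Euc n) x).source) : Euc n ≃L[ℝ] TangentSpace (𝓡 n) p :=
    ((trivializationAt (Euc n) (TangentSpace (𝓡 n)) x).continuousLinearEquivAt ℝ p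
      (by simpa using hx)).symm
  let b (x : M) (hx : p ∈ (chartAt (Euc n) x).source) :
      Module.Basis (Fin n) ℝ (TangentSpace (𝓡 n) p) :=
    (EuclideanSpace.basisFun (Fin n) ℝ).toBasis.map (e x hx).toLinearEquiv
  have hb : ∀ x hx i, frame x p i = b x hx i := fun x hx i => by
    rw [frame_eq_symm hx]
    simp only [b, Module.Basis.map_apply, OrthonormalBasis.coe_toBasis,
      EuclideanSpace.basisFun_apply]
    exact Trivialization.symmL_apply (R := ℝ) (trivializationAt (Euc n) (TangentSpace (𝓡 n)) x)
      (by simpa using hx) _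
  refine ⟨(b x₀ h₀).toMatrix (b x₁ h₁), ?_, fun j => ?_⟩
  · rw [← Module.Basis.det_apply]
    exact (b x₀ h₀).isUnit_det _
  · simp_rw [hb x₀ h₀, hb x₁ h₁]
    exact ((b x₀ h₀).sum_toMatrix_smul_self (b x₁ h₁) j).symm

theorem continuousOn_gram (g : SmoothMetric n M) (x₀ : M) (i j : Fin n) :
    ContinuousOn (fun p => g.inner p (frame x₀ p i) (frame x₀ p j))
      (chartAt (Euc n) x₀).source := by
  let e := trivializationAt (Euc n) (TangentSpace (𝓡 n)) x₀
  have hs : e.baseSet = (chartAt (Euc n) x₀).source := by simp [e]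
  have hfr : ∀ i, ContMDiffOn (𝓡 n) ((𝓡 n).prod 𝓘(ℝ, Euc n)) ∞
      (fun p => TotalSpace.mk' (Euc n) (E := (TangentSpace (𝓡 n) : M → Type)) p (frame x₀ p i))
      e.baseSet := fun i => by
    rw [e.contMDiffOn_section_baseSet_iff]
    refine (contMDiffOn_const (c := (EuclideanSpace.single i (1 : ℝ) : Euc n))).congr ?_
    intro y hy
    rw [frame_eq_symm (hs ▸ hy)]
    rw [Trivialization.symmL_apply (R := ℝ) _ hy, Trivialization.apply_mk_symm _ hy]
  have := (g.contMDiff.contMDiffOn (s := e.baseSet)).clm_bundle_apply₂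
    (F₃ := ℝ) (E₃ := Bundle.Trivial M ℝ) (hfr i) (hfr j)
  rw [← hs]
  intro p hp
  have h2 := this p hp
  simp only [contMDiffWithinAt_totalSpace] at h2
  exact h2.2.continuousWithinAt


variable (n M) in
/-- Differential `k`-forms on `M`: arbitrary (not necessarily continuous) sections of `⋀ᵏ T*M`. -/
abbrev KForm (k : ℕ) := ∀ p : M, TangentSpace (𝓡 n) p [⋀^Fin k]→L[ℝ] ℝ

variable {k : ℕ}

/-- The pointwise inner product `⟨α, β⟩_g` of two `k`-forms at `p`. -/
def formInner (g : SmoothMetric n M) (p : M) (α β : TangentSpace (𝓡 n) p [⋀^Fin k]→L[ℝ] ℝ) : ℝ :=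
  altInner (g.inner p) (frame p p) α β

theorem formInner_eq_frame (g : SmoothMetric n M) {x₀ p : M} (hp : p ∈ (chartAt (Euc n) x₀).source)
    (α β : TangentSpace (𝓡 n) p [⋀^Fin k]→L[ℝ] ℝ) :
    formInner g p α β = altInner (g.inner p) (frame x₀ p) α β := by
  obtain ⟨P, hP, h⟩ := exists_frame_change hp (mem_chart_source (Euc n) p)
  exact altInner_frame _ _ _ P hP h α β

theorem formInner_add_left (g : SmoothMetric n M) (p : M)
    (α α' β : TangentSpace (𝓡 n) p [⋀^Fin k]→L[ℝ] ℝ) :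
    formInner g p (α + α') β = formInner g p α β + formInner g p α' β :=
  altInner_add_left _ _ _ _ _

theorem formInner_smul_left (g : SmoothMetric n M) (p : M) (c : ℝ)
    (α β : TangentSpace (𝓡 n) p [⋀^Fin k]→L[ℝ] ℝ) :
    formInner g p (c • α) β = c * formInner g p α β :=
  altInner_smul_left _ _ _ _ _

theorem formInner_symm (g : SmoothMetric n M) (p : M)
    (α β : TangentSpace (𝓡 n) p [⋀^Fin k]→L[ℝ] ℝ) :
    formInner g p α β = formInner g p β α :=
  altInner_symm _ (g.symm p) _ _ _

theorem formInner_self_nonneg (g : SmoothMetric n M) (p : M)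
    (α : TangentSpace (𝓡 n) p [⋀^Fin k]→L[ℝ] ℝ) :
    0 ≤ formInner g p α α := by
  refine altInner_self_nonneg _ (g.symm p) (fun v => ?_) _ _
  by_cases hv : v = 0
  · simp [hv]
  · exact (g.pos p v hv).le

theorem two_mul_abs_formInner_le (g : SmoothMetric n M) (p : M)
    (α β : TangentSpace (𝓡 n) p [⋀^Fin k]→L[ℝ] ℝ) :
    2 * |formInner g p α β| ≤ formInner g p α α + formInner g p β β := by
  have h : ∀ c : ℝ, c * c = 1 → 0 ≤ formInner g p α α + 2 * c * formInner g p α β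
      + formInner g p β β := fun c hc => by
    have := formInner_self_nonneg g p (α + c • β)
    rw [formInner_add_left, formInner_smul_left, formInner_symm g p α (α + _),
      formInner_symm g p β (α + _), formInner_add_left, formInner_add_left, formInner_smul_left,
      formInner_smul_left, formInner_symm g p β α] at this
    linear_combination this + formInner g p β β * hc
  have h1 := h 1 (by norm_num)
  have h2 := h (-1) (by norm_num)
  rcases abs_cases (formInner g p α β) with ⟨h, _⟩ | ⟨h, _⟩ <;> rw [h] <;> linarith

variable [MeasurableSpace M]

/-- `u` is measurable with respect to the completion of `ν`: in every chart, so are its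
components. -/
def AEMeasurableForm (ν : Measure M) (u : KForm n M k) : Prop :=
  ∀ (x₀ : M) (I : Fin k → Fin n), AEMeasurable (fun p => u p (frame x₀ p ∘ I))
    (ν.restrict (chartAt (Euc n) x₀).source)


theorem AEMeasurableForm.add {ν : Measure M} {u v : KForm n M k}
    (hu : AEMeasurableForm ν u) (hv : AEMeasurableForm ν v) : AEMeasurableForm ν (u + v) :=
  fun x₀ I => (hu x₀ I).add (hv x₀ I)

theorem AEMeasurableForm.const_smul {ν : Measure M} {u : KForm n M k}
    (hu : AEMeasurableForm ν u) (c : ℝ) : AEMeasurableForm ν (c • u) :=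
  fun x₀ I => (hu x₀ I).const_mul c

variable [BorelSpace M] [CompactSpace M]

theorem AEMeasurableForm.aemeasurable_inner (g : SmoothMetric n M) {ν : Measure M} {u v : KForm n M k}
    (hu : AEMeasurableForm ν u) (hv : AEMeasurableForm ν v) :
    AEMeasurable (fun p => formInner g p (u p) (v p)) ν := by
  have hloc : ∀ x₀ : M, AEMeasurable (fun p => formInner g p (u p) (v p))
      (ν.restrict (chartAt (Euc n) x₀).source) := by
    intro x₀
    have hU : MeasurableSet (chartAt (Euc n) x₀).source := (chartAt (Euc n) x₀).open_source.measurableSet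
    have hinv : ∀ i j, AEMeasurable (fun p => (gram (g.inner p) (frame x₀ p))⁻¹ i j)
        (ν.restrict (chartAt (Euc n) x₀).source) := by
      intro i j
      have hc : ContinuousOn (fun p => gram (g.inner p) (frame x₀ p))
          (chartAt (Euc n) x₀).source :=
        continuousOn_pi.2 fun i => continuousOn_pi.2 fun j => continuousOn_gram g x₀ i j
      have hdet := (Continuous.comp_continuousOn (continuous_id.matrix_det (n := Fin n) (R := ℝ))
        hc).aemeasurable (μ := ν) hU
      have hadj := (Continuous.comp_continuousOn
        ((continuous_id.matrix_adjugate (n := Fin n) (R := ℝ)).matrix_elem i j) hc).aemeasurable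
        (μ := ν) hU
      refine (hdet.inv.mul hadj).congr (Filter.Eventually.of_forall fun p => ?_)
      simp [Matrix.inv_def]
    have : AEMeasurable (fun p => altInner (g.inner p) (frame x₀ p) (u p) (v p))
        (ν.restrict (chartAt (Euc n) x₀).source) := by
      unfold altInner
      refine AEMeasurable.const_mul ?_ _
      refine Finset.aemeasurable_fun_sum _ fun I _ => Finset.aemeasurable_fun_sum _ fun J _ => ?_
      exact ((Finset.aemeasurable_fun_prod _ fun m _ => hinv _ _).mul (hu x₀ I)).mul (hv x₀ J)
    refine this.congr ?_
    filter_upwards [ae_restrict_mem hU] with p hp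
    exact (formInner_eq_frame g hp _ _).symm
  obtain ⟨t, ht⟩ := isCompact_univ.elim_finite_subcover (fun x : M => (chartAt (Euc n) x).source)
    (fun x => (chartAt (Euc n) x).open_source)
    (fun x _ => Set.mem_iUnion.2 ⟨x, mem_chart_source _ x⟩)
  have h := (aemeasurable_iUnion_iff (s := fun x : t => (chartAt (Euc n) (x : M)).source)
    (f := fun p => formInner g p (u p) (v p)) (μ := ν)).2 fun x => hloc x
  have hu : (⋃ x : t, (chartAt (Euc n) (x : M)).source) = Set.univ := by
    refine Set.eq_univ_of_forall fun p => ?_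
    obtain ⟨x, hx, hp⟩ := Set.mem_iUnion₂.1 (ht (Set.mem_univ p))
    exact Set.mem_iUnion.2 ⟨⟨x, hx⟩, hp⟩
  rwa [hu, Measure.restrict_univ] at h

theorem AEMeasurableForm.integrable_inner {g : SmoothMetric n M} {ν : Measure M} {u v : KForm n M k}
    (hu : AEMeasurableForm ν u) (hu' : Integrable (fun p => formInner g p (u p) (u p)) ν)
    (hv : AEMeasurableForm ν v) (hv' : Integrable (fun p => formInner g p (v p) (v p)) ν) :
    Integrable (fun p => formInner g p (u p) (v p)) ν := by
  refine (hu'.add hv').mono' (hu.aemeasurable_inner g hv).aestronglyMeasurable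
    (Filter.Eventually.of_forall fun p => ?_)
  have := two_mul_abs_formInner_le g p (u p) (v p)
  have h0 := abs_nonneg (formInner g p (u p) (v p))
  simp only [Pi.add_apply, Real.norm_eq_abs]
  linarith

/-- The `ν`-measurable `k`-forms `u` with `∫ |u|² dν < ∞`. -/
def l2Forms (g : SmoothMetric n M) (ν : Measure M) (k : ℕ) : Submodule ℝ (KForm n M k) where
  carrier := {u | AEMeasurableForm ν u ∧ Integrable (fun p => formInner g p (u p) (u p)) ν}
  zero_mem' := by
    refine ⟨fun x₀ I => by simp, ?_⟩
    have : ∀ p : M, formInner g p (0 : TangentSpace (𝓡 n) p [⋀^Fin k]→L[ℝ] ℝ) 0 = 0 := fun p => by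
      have := formInner_smul_left g p 0 (0 : TangentSpace (𝓡 n) p [⋀^Fin k]→L[ℝ] ℝ) 0
      simpa using this
    simp [this]
  add_mem' := by
    rintro u v ⟨hu, hu'⟩ ⟨hv, hv'⟩
    refine ⟨hu.add hv, ?_⟩
    have h := hu.integrable_inner hu' hv hv'
    refine ((hu'.add h).add (h.add hv')).congr (Filter.Eventually.of_forall fun p => ?_)
    simp only [Pi.add_apply]
    rw [formInner_add_left, formInner_symm g p (u p) (u p + _),
      formInner_symm g p (v p) (u p + _), formInner_add_left, formInner_add_left,
      formInner_symm g p (v p) (u p)]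
  smul_mem' := by
    rintro c u ⟨hu, hu'⟩
    refine ⟨hu.const_smul c, ?_⟩
    refine (hu'.const_mul (c * c)).congr (Filter.Eventually.of_forall fun p => ?_)
    simp only [Pi.smul_apply]
    rw [formInner_smul_left, formInner_symm g p (u p) (c • u p), formInner_smul_left, mul_assoc]

/-- Square-integrable `k`-forms, before identifying forms that agree `ν`-almost everywhere. -/
def L2Section (g : SmoothMetric n M) (ν : Measure M) (k : ℕ) : Type _ := l2Forms g ν k

instance (g : SmoothMetric n M) (ν : Measure M) (k : ℕ) : AddCommGroup (L2Section g ν k) :=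
  inferInstanceAs (AddCommGroup (l2Forms g ν k))

instance (g : SmoothMetric n M) (ν : Measure M) (k : ℕ) : Module ℝ (L2Section g ν k) :=
  inferInstanceAs (Module ℝ (l2Forms g ν k))

/-- The underlying `k`-form. -/
def L2Section.form {g : SmoothMetric n M} {ν : Measure M} {k : ℕ} : L2Section g ν k →ₗ[ℝ] KForm n M k :=
  (l2Forms g ν k).subtype

theorem L2Section.integrable_inner {g : SmoothMetric n M} {ν : Measure M} (u v : L2Section g ν k) :
    Integrable (fun p => formInner g p (u.form p) (v.form p)) ν :=
  u.2.1.integrable_inner u.2.2 v.2.1 v.2.2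

/-- The semi-definite inner product `∫ ⟨u, v⟩_g dν`. -/
@[reducible]
def l2Core (g : SmoothMetric n M) (ν : Measure M) (k : ℕ) :
    PreInnerProductSpace.Core ℝ (L2Section g ν k) where
  inner u v := ∫ p, formInner g p (u.form p) (v.form p) ∂ν
  conj_inner_symm u v := by simp [formInner_symm g _ (u.form _)]
  re_inner_nonneg u := integral_nonneg fun p => formInner_self_nonneg g p _
  add_left u v w := by
    simp only [map_add, Pi.add_apply, formInner_add_left]
    exact integral_add (u.integrable_inner w) (v.integrable_inner w)
  smul_left u v c := by
    simp [formInner_smul_left, integral_const_mul]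

instance (g : SmoothMetric n M) (ν : Measure M) (k : ℕ) : SeminormedAddCommGroup (L2Section g ν k) :=
  @InnerProductSpace.Core.toSeminormedAddCommGroup ℝ _ _ _ _ (l2Core g ν k)

instance (g : SmoothMetric n M) (ν : Measure M) (k : ℕ) : InnerProductSpace ℝ (L2Section g ν k) :=
  InnerProductSpace.ofCore (l2Core g ν k)

/-- The space of square-integrable `k`-forms with inner product `∫ ⟨u, v⟩_g dν`, two forms being
identified if their difference has norm zero, that is, if they agree `ν`-almost everywhere.
For the restriction of `μ` to `Ω` in place of `ν` this is `L²(⋀ᵏΩ, μ)`. -/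
abbrev L2Form (g : SmoothMetric n M) (ν : Measure M) (k : ℕ) := SeparationQuotient (L2Section g ν k)

/-- The class of a square-integrable form in `L2Form`. -/
def L2Section.toL2 {g : SmoothMetric n M} {ν : Measure M} :
    L2Section g ν k →ₗ[ℝ] L2Form g ν k where
  toFun := SeparationQuotient.mk
  map_add' := SeparationQuotient.mk_add
  map_smul' := SeparationQuotient.mk_smul

theorem L2Section.inner_def {g : SmoothMetric n M} {ν : Measure M} (u v : L2Section g ν k) :
    inner ℝ u v = ∫ p, formInner g p (u.form p) (v.form p) ∂ν := rfl


/-- The expression of a form in the chart at `x₀`: its pullback by the inverse chart. -/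
def pullChart (x₀ : M) (u : KForm n M k) (y : Euc n) : Euc n [⋀^Fin k]→L[ℝ] ℝ :=
  (u ((extChartAt (𝓡 n) x₀).symm y)).compContinuousLinearMap
    (mfderiv 𝓘(ℝ, Euc n) (𝓡 n) (extChartAt (𝓡 n) x₀).symm y)

/-- `u` is a smooth `k`-form with compact support contained in `Ω`. -/
structure IsTestForm (Ω : Set M) (u : KForm n M k) : Prop where
  smooth : ∀ x₀ : M, ContDiffOn ℝ ∞ (pullChart x₀ u) (extChartAt (𝓡 n) x₀).target
  compact_support : ∃ K : Set M, IsCompact K ∧ K ⊆ Ω ∧ ∀ p ∉ K, u p = 0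

/-- The exterior derivative of a smooth form, computed at `p` in the chart at `p`. -/
def extD (u : KForm n M k) : KForm n M (k + 1) := fun p =>
  (extDeriv (pullChart p u) (extChartAt (𝓡 n) p p)).compContinuousLinearMap
    (mfderiv (𝓡 n) 𝓘(ℝ, Euc n) (extChartAt (𝓡 n) p) p)

/-- `f'` is the weak gradient of `f` on the open set `O`: both are locally integrable on `O`, and
`∫ (∂ᵥφ) f = -∫ φ f'(v)` for all `φ ∈ C_c^∞(O)` and all directions `v`. -/
structure HasWeakFDerivOn {F : Type*} [NormedAddCommGroup F] [NormedSpace ℝ F]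
    (f : Euc n → F) (f' : Euc n → Euc n →L[ℝ] F) (O : Set (Euc n)) : Prop where
  locallyIntegrableOn : LocallyIntegrableOn f O
  locallyIntegrableOn_deriv : LocallyIntegrableOn f' O
  integral_eq : ∀ φ : Euc n → ℝ, ContDiff ℝ ∞ φ → HasCompactSupport φ → tsupport φ ⊆ O →
    ∀ v : Euc n, ∫ y, fderiv ℝ φ y v • f y = -∫ y, φ y • f' y v

/-- The part of the image of the chart at `x₀` that corresponds to `Ω`. -/
def chartDomain (Ω : Set M) (x₀ : M) : Set (Euc n) :=
  (extChartAt (𝓡 n) x₀).target ∩ (extChartAt (𝓡 n) x₀).symm ⁻¹' Ω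

/-- On `Ω` the `k`-form `u` has a weak gradient in every chart, and `v = du`: in every chart
`v = ∑ᵣ ∑_I (∂u_I/∂xʳ) dxʳ ∧ dx^I` almost everywhere, with weak partial derivatives. -/
def HasWeakExtDeriv (Ω : Set M) (u : KForm n M k) (v : KForm n M (k + 1)) : Prop :=
  ∀ x₀ : M, ∃ D : Euc n → Euc n →L[ℝ] Euc n [⋀^Fin k]→L[ℝ] ℝ,
    HasWeakFDerivOn (pullChart x₀ u) D (chartDomain Ω x₀) ∧
    ∀ᵐ y ∂volume.restrict (chartDomain Ω x₀),
      pullChart x₀ v y = ContinuousAlternatingMap.alternatizeUncurryFin (D y)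

/-- The Riemannian volume measure `dV_g`: the smallest measure that on the domain of every chart
is at least the image of `√(det g_ij) dx` under the inverse chart. By the change of variables
formula these local measures agree on overlaps, so `dV_g` restricts to each of them. -/
def riemannianVolume (g : SmoothMetric n M) : Measure M :=
  ⨆ x₀ : M, Measure.map (extChartAt (𝓡 n) x₀).symm
    ((volume.restrict (extChartAt (𝓡 n) x₀).target).withDensity fun y =>
      ENNReal.ofReal √(gram (g.inner ((extChartAt (𝓡 n) x₀).symm y))
        (frame x₀ ((extChartAt (𝓡 n) x₀).symm y))).det)

theorem IsTestForm.add {Ω : Set M} {u v : KForm n M k} (hu : IsTestForm Ω u)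
    (hv : IsTestForm Ω v) : IsTestForm Ω (u + v) := by
  refine ⟨fun x₀ => (hu.smooth x₀).add (hv.smooth x₀), ?_⟩
  obtain ⟨K, hK, hKΩ, h⟩ := hu.compact_support
  obtain ⟨K', hK', hKΩ', h'⟩ := hv.compact_support
  refine ⟨K ∪ K', hK.union hK', Set.union_subset hKΩ hKΩ', fun p hp => ?_⟩
  simp only [Set.mem_union, not_or] at hp
  simp [h p hp.1, h' p hp.2]

theorem IsTestForm.const_smul {Ω : Set M} {u : KForm n M k} (hu : IsTestForm Ω u) (c : ℝ) :
    IsTestForm Ω (c • u) := by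
  refine ⟨fun x₀ => (hu.smooth x₀).const_smul c, ?_⟩
  obtain ⟨K, hK, hKΩ, h⟩ := hu.compact_support
  exact ⟨K, hK, hKΩ, fun p hp => by simp [h p hp]⟩

theorem isTestForm_zero {Ω : Set M} : IsTestForm Ω (0 : KForm n M k) := by
  refine ⟨fun x₀ => ?_, ∅, isCompact_empty, Set.empty_subset _, fun p _ => rfl⟩
  exact (contDiffOn_const (c := (0 : Euc n [⋀^Fin k]→L[ℝ] ℝ))).congr fun y _ => by
    exact ContinuousAlternatingMap.ext fun _ => rfl

theorem integrable_smul_of_tsupport {F : Type*} [NormedAddCommGroup F] [NormedSpace ℝ F]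
    {f : Euc n → F} {O : Set (Euc n)} (hf : LocallyIntegrableOn f O) {φ : Euc n → ℝ}
    (hφ : Continuous φ) (hc : HasCompactSupport φ) (hO : tsupport φ ⊆ O) :
    Integrable (fun y => φ y • f y) := by
  have h1 : IntegrableOn f (tsupport φ) := (hf.mono_set hO).integrableOn_isCompact hc
  have h2 := h1.continuousOn_smul hφ.continuousOn hc
  refine (integrableOn_iff_integrable_of_support_subset ?_).1 h2
  intro y hy
  by_contra h
  exact hy (by simp [image_eq_zero_of_notMem_tsupport h])

theorem HasWeakFDerivOn.add {F : Type*} [NormedAddCommGroup F] [NormedSpace ℝ F]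
    {f h : Euc n → F} {f' h' : Euc n → Euc n →L[ℝ] F} {O : Set (Euc n)}
    (hf : HasWeakFDerivOn f f' O) (hh : HasWeakFDerivOn h h' O) :
    HasWeakFDerivOn (f + h) (f' + h') O := by
  have hadd : ∀ {G : Type _} [NormedAddCommGroup G] {a b : Euc n → G}, LocallyIntegrableOn a O →
      LocallyIntegrableOn b O → LocallyIntegrableOn (a + b) O := fun ha hb => ha.add hb
  refine ⟨hadd hf.1 hh.1, hadd hf.2 hh.2, fun φ h1 h2 h3 v => ?_⟩
  have hd : Continuous fun y => fderiv ℝ φ y v :=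
    (h1.continuous_fderiv (by simp)).clm_apply continuous_const
  have hdc : HasCompactSupport fun y => fderiv ℝ φ y v := h2.fderiv_apply ℝ v
  have hds : tsupport (fun y => fderiv ℝ φ y v) ⊆ O :=
    (tsupport_fderiv_apply_subset ℝ v).trans h3
  have e1 : ∀ {k' : Euc n → Euc n →L[ℝ] F}, LocallyIntegrableOn k' O →
      Integrable fun y => φ y • k' y v := fun hk =>
    (integrable_smul_of_tsupport hk h1.continuous h2 h3).apply_continuousLinearMap v
  simp only [Pi.add_apply, smul_add, add_apply]
  rw [integral_add (integrable_smul_of_tsupport hf.1 hd hdc hds)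
      (integrable_smul_of_tsupport hh.1 hd hdc hds), integral_add (e1 hf.2) (e1 hh.2),
    hf.3 φ h1 h2 h3 v, hh.3 φ h1 h2 h3 v, neg_add]

theorem HasWeakFDerivOn.const_smul {F : Type*} [NormedAddCommGroup F] [NormedSpace ℝ F]
    {f : Euc n → F} {f' : Euc n → Euc n →L[ℝ] F} {O : Set (Euc n)}
    (hf : HasWeakFDerivOn f f' O) (c : ℝ) : HasWeakFDerivOn (c • f) (c • f') O := by
  refine ⟨hf.1.smul c, hf.2.smul c, fun φ h1 h2 h3 v => ?_⟩
  have := hf.3 φ h1 h2 h3 v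
  simp only [Pi.smul_apply, smul_apply, smul_comm _ c, integral_smul, this, smul_neg]

theorem HasWeakExtDeriv.add {Ω : Set M} {u u' : KForm n M k} {v v' : KForm n M (k + 1)}
    (h : HasWeakExtDeriv Ω u v) (h' : HasWeakExtDeriv Ω u' v') :
    HasWeakExtDeriv Ω (u + u') (v + v') := by
  intro x₀
  obtain ⟨D, hD, hv⟩ := h x₀
  obtain ⟨D', hD', hv'⟩ := h' x₀
  refine ⟨D + D', hD.add hD', ?_⟩
  filter_upwards [hv, hv'] with y hy hy'
  rw [Pi.add_apply, ContinuousAlternatingMap.alternatizeUncurryFin_add, ← hy, ← hy']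
  rfl

theorem HasWeakExtDeriv.const_smul {Ω : Set M} {u : KForm n M k} {v : KForm n M (k + 1)}
    (h : HasWeakExtDeriv Ω u v) (c : ℝ) : HasWeakExtDeriv Ω (c • u) (c • v) := by
  intro x₀
  obtain ⟨D, hD, hv⟩ := h x₀
  refine ⟨c • D, hD.const_smul c, ?_⟩
  filter_upwards [hv] with y hy
  rw [Pi.smul_apply, ContinuousAlternatingMap.alternatizeUncurryFin_smul, ← hy]
  rfl

theorem locallyIntegrable_zero' {F : Type*} [NormedAddCommGroup F] :
    LocallyIntegrable (0 : Euc n → F) := locallyIntegrable_zero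

theorem hasWeakExtDeriv_zero {Ω : Set M} :
    HasWeakExtDeriv Ω (0 : KForm n M k) (0 : KForm n M (k + 1)) := by
  intro x₀
  have h0 : ∀ {j : ℕ}, pullChart x₀ (0 : KForm n M j) = 0 := by
    intro j
    funext y
    exact ContinuousAlternatingMap.ext fun _ => rfl
  refine ⟨0, ⟨?_, ?_, ?_⟩, ?_⟩
  · rw [h0]; exact locallyIntegrable_zero'.locallyIntegrableOn _
  · exact locallyIntegrable_zero'.locallyIntegrableOn _
  · intro φ _ _ _ v; simp [h0]
  · exact Filter.Eventually.of_forall fun y => by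
      rw [h0, Pi.zero_apply, Pi.zero_apply]
      exact (map_zero (ContinuousAlternatingMap.alternatizeUncurryFinCLM ℝ (Euc n) ℝ)).symm

/-- `w = d*u` on `Ω`, that is, `⟨w, η⟩ = ⟨u, dη⟩` in `L²(Ω, dV_g)` for all smooth
`(k-1)`-forms `η` with compact support in `Ω`; for `0`-forms `d*u = 0`. -/
def HasWeakCodiff (g : SmoothMetric n M) (Ω : Set M) : (k : ℕ) →
    L2Form g ((riemannianVolume g).restrict Ω) k →
    L2Form g ((riemannianVolume g).restrict Ω) (k - 1) → Prop
  | 0, _, w => w = 0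
  | k + 1, u, w => ∀ (a : L2Section g ((riemannianVolume g).restrict Ω) k)
      (b : L2Section g ((riemannianVolume g).restrict Ω) (k + 1)),
      IsTestForm Ω a.form → b.form = extD a.form → inner ℝ w a.toL2 = inner ℝ u b.toL2

theorem HasWeakCodiff.add {g : SmoothMetric n M} {Ω : Set M} : ∀ {k : ℕ}
    {u u' : L2Form g ((riemannianVolume g).restrict Ω) k}
    {w w' : L2Form g ((riemannianVolume g).restrict Ω) (k - 1)},
    HasWeakCodiff g Ω k u w → HasWeakCodiff g Ω k u' w' → HasWeakCodiff g Ω k (u + u') (w + w')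
  | 0, _, _, _, _, h, h' => by
    simp only [HasWeakCodiff] at *
    rw [h, h', add_zero]
  | k + 1, _, _, _, _, h, h' => fun a b ha hb => by
    exact (inner_add_left _ _ _).trans ((congrArg₂ (· + ·) (h a b ha hb) (h' a b ha hb)).trans
      (inner_add_left _ _ _).symm)

theorem HasWeakCodiff.const_smul {g : SmoothMetric n M} {Ω : Set M} (c : ℝ) : ∀ {k : ℕ}
    {u : L2Form g ((riemannianVolume g).restrict Ω) k}
    {w : L2Form g ((riemannianVolume g).restrict Ω) (k - 1)},
    HasWeakCodiff g Ω k u w → HasWeakCodiff g Ω k (c • u) (c • w)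
  | 0, _, _, h => by
    simp only [HasWeakCodiff] at *
    rw [h, smul_zero]
  | k + 1, _, _, h => fun a b ha hb => by
    exact (real_inner_smul_left _ _ _).trans ((congrArg (c * ·) (h a b ha hb)).trans
      (real_inner_smul_left _ _ _).symm)

theorem hasWeakCodiff_zero {g : SmoothMetric n M} {Ω : Set M} : ∀ {k : ℕ}, HasWeakCodiff g Ω k 0 0
  | 0 => rfl
  | k + 1 => fun a b _ _ => by
    exact (inner_zero_left _).trans (inner_zero_left _).symm

/-- Triples `(u, v, w)` of a `k`-form, a `(k+1)`-form and a `(k-1)`-form in `L²(Ω, dV_g)`, with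
inner product `⟨u, u'⟩ + ⟨v, v'⟩ + ⟨w, w'⟩`. (For `k = 0` the last entry will always be `0`.) -/
abbrev FormTriple (g : SmoothMetric n M) (Ω : Set M) (k : ℕ) :=
  WithLp 2 (L2Form g ((riemannianVolume g).restrict Ω) k ×
    WithLp 2 (L2Form g ((riemannianVolume g).restrict Ω) (k + 1) ×
      L2Form g ((riemannianVolume g).restrict Ω) (k - 1)))

/-- The Sobolev space `W^{1,2}(⋀ᵏΩ)`; its element `u` is represented by the triple
`(u, du, d*u)`, so that the inner product of triples is the one of `W^{1,2}`. -/
def sobolev (g : SmoothMetric n M) (Ω : Set M) (k : ℕ) : Submodule ℝ (FormTriple g Ω k) where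
  carrier := {t | (∃ (u : L2Section g ((riemannianVolume g).restrict Ω) k)
      (v : L2Section g ((riemannianVolume g).restrict Ω) (k + 1)),
      u.toL2 = t.fst ∧ v.toL2 = t.snd.fst ∧ HasWeakExtDeriv Ω u.form v.form) ∧
    HasWeakCodiff g Ω k t.fst t.snd.snd}
  zero_mem' := ⟨⟨0, 0, rfl, rfl, by simpa using hasWeakExtDeriv_zero⟩, hasWeakCodiff_zero⟩
  add_mem' := by
    rintro s t ⟨⟨u, v, hu, hv, h⟩, hs⟩ ⟨⟨u', v', hu', hv', h'⟩, ht⟩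
    refine ⟨⟨u + u', v + v', ?_, ?_, by simpa using h.add h'⟩, hs.add ht⟩
    · rw [map_add, hu, hu']; rfl
    · rw [map_add, hv, hv']; rfl
  smul_mem' := by
    rintro c t ⟨⟨u, v, hu, hv, h⟩, ht⟩
    refine ⟨⟨c • u, c • v, ?_, ?_, by simpa using h.const_smul c⟩, ht.const_smul c⟩
    · rw [map_smul, hu]; rfl
    · rw [map_smul, hv]; rfl

section Form
variable (g : SmoothMetric n M) (Ω : Set M) (μ : Measure M) (k : ℕ)

/-- The smooth forms with compact support in `Ω`, as elements `(u, du, d*u)` of `W^{1,2}`. -/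
def testSubmodule : Submodule ℝ (FormTriple g Ω k) where
  carrier := {t | t ∈ sobolev g Ω k ∧ ∃ u : L2Section g ((riemannianVolume g).restrict Ω) k,
    IsTestForm Ω u.form ∧ u.toL2 = t.fst}
  zero_mem' := ⟨zero_mem _, 0, by simpa using isTestForm_zero, rfl⟩
  add_mem' := by
    rintro s t ⟨hs, u, hu, h⟩ ⟨ht, u', hu', h'⟩
    exact ⟨add_mem hs ht, u + u', by simpa using hu.add hu', by rw [map_add, h, h']; rfl⟩
  smul_mem' := by
    rintro c t ⟨ht, u, hu, h⟩
    exact ⟨Submodule.smul_mem _ c ht, c • u, by simpa using hu.const_smul c, by rw [map_smul, h]; rfl⟩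

/-- `W₀^{1,2}(⋀ᵏΩ)`: the closure of the smooth forms with compact support in `W^{1,2}`. -/
def sobolevZero : Submodule ℝ (FormTriple g Ω k) :=
  sobolev g Ω k ⊓ (testSubmodule g Ω k).topologicalClosure

/-- The pairs of the `W^{1,2}`-class and the `L²(μ)`-class of a smooth form with compact
support in `Ω`. -/
def testGraph : Submodule ℝ (FormTriple g Ω k × L2Form g (μ.restrict Ω) k) where
  carrier := {t | t.1 ∈ sobolev g Ω k ∧ ∃ (u : L2Section g ((riemannianVolume g).restrict Ω) k)
    (u' : L2Section g (μ.restrict Ω) k),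
    IsTestForm Ω u.form ∧ u'.form = u.form ∧ u.toL2 = t.1.fst ∧ u'.toL2 = t.2}
  zero_mem' := ⟨zero_mem _, 0, 0, by simpa using isTestForm_zero, by simp, rfl, rfl⟩
  add_mem' := by
    rintro s t ⟨hs, u, v, hu, h, h1, h2⟩ ⟨ht, u', v', hu', h', h1', h2'⟩
    exact ⟨add_mem hs ht, u + u', v + v', by simpa using hu.add hu', by simp [h, h'],
      by rw [map_add, h1, h1']; rfl, by rw [map_add, h2, h2']; rfl⟩
  smul_mem' := by
    rintro c t ⟨ht, u, v, hu, h, h1, h2⟩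
    exact ⟨Submodule.smul_mem _ c ht, c • u, c • v, by simpa using hu.const_smul c, by simp [h],
      by rw [map_smul, h1]; rfl, by rw [map_smul, h2]; rfl⟩

/-- The graph of `ι`. The pair `(u, f)` belongs to it if there is a sequence of smooth forms `u_m`
with compact support in `Ω` such that `u_m → u` in `W^{1,2}` and `u_m → f` in `L²(μ)`, that is, if
`f` is the `L²(μ)`-representative of `u`. -/
def iotaGraph : Submodule ℝ (FormTriple g Ω k × L2Form g (μ.restrict Ω) k) :=
  (testGraph g Ω μ k).topologicalClosure

/-- The space `N` of those `u ∈ W₀^{1,2}` whose `L²(μ)`-representative is zero. -/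
def nullSpace : Submodule ℝ (FormTriple g Ω k) :=
  sobolevZero g Ω k ⊓ (iotaGraph g Ω μ k).comap (LinearMap.inl ℝ _ _)

/-- The orthogonal complement of `N` in `W₀^{1,2}`. -/
def nullPerp : Submodule ℝ (FormTriple g Ω k) := sobolevZero g Ω k ⊓ (nullSpace g Ω μ k)ᗮ

/-- The domain `dom(𝓔) = ι(N^⊥) ⊆ L²(⋀ᵏΩ, μ)`. -/
def formDomain : Submodule ℝ (L2Form g (μ.restrict Ω) k) :=
  (iotaGraph g Ω μ k ⊓ (nullPerp g Ω μ k).comap (LinearMap.fst ℝ _ _)).map (LinearMap.snd ℝ _ _)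

variable {g Ω μ k}

theorem exists_lift (f : formDomain g Ω μ k) :
    ∃ t : FormTriple g Ω k, t ∈ nullPerp g Ω μ k ∧ (t, (f : L2Form g (μ.restrict Ω) k)) ∈ iotaGraph g Ω μ k := by
  obtain ⟨⟨t, f'⟩, ⟨h1, h2⟩, h3⟩ := f.2
  simp only [LinearMap.snd_apply] at h3
  exact ⟨t, h2, h3 ▸ h1⟩

/-- The element `u` of `N^⊥` with `ι(u) = f`, for `f ∈ dom(𝓔)`; it is unique by `eq_lift`. -/
def lift (f : formDomain g Ω μ k) : FormTriple g Ω k := (exists_lift f).choose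

theorem eq_lift {f : formDomain g Ω μ k} {t : FormTriple g Ω k} (ht : t ∈ nullPerp g Ω μ k)
    (h : (t, (f : L2Form g (μ.restrict Ω) k)) ∈ iotaGraph g Ω μ k) : t = lift f := by
  obtain ⟨h1, h2⟩ := (exists_lift f).choose_spec
  have hd : t - lift f ∈ nullPerp g Ω μ k := Submodule.sub_mem _ ht h1
  have hN : t - lift f ∈ nullSpace g Ω μ k := by
    refine ⟨hd.1, ?_⟩
    have := Submodule.sub_mem _ h h2
    rwa [Prod.mk_sub_mk, sub_self] at this
  exact sub_eq_zero.1 (inner_self_eq_zero.1 (hd.2 _ hN))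

/-- The form `𝓔(f, h) = ∫_Ω ⟨df, dh⟩_g + ⟨d*f, d*h⟩_g dV_g` on `dom(𝓔)`. -/
def energy (f h : formDomain g Ω μ k) : ℝ :=
  inner ℝ (lift f).snd.fst (lift h).snd.fst + inner ℝ (lift f).snd.snd (lift h).snd.snd

/-- The form `𝓔_*(f, h) = 𝓔(f, h) + ⟨f, h⟩_μ` on `dom(𝓔)`. -/
def energyStar (f h : formDomain g Ω μ k) : ℝ :=
  energy f h + inner ℝ (f : L2Form g (μ.restrict Ω) k) (h : L2Form g (μ.restrict Ω) k)

variable (g Ω μ k)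

/-- The Poincaré inequality: for some `C > 0`, every smooth `k`-form `u` with compact support in
`Ω` satisfies `∫_Ω |u|² dμ ≤ C ∫_Ω |du|² + |d*u|² dV_g`. Here `t = (u, du, d*u)`. -/
def PoincareInequality : Prop :=
  ∃ C : ℝ, 0 < C ∧ ∀ t ∈ sobolev g Ω k, ∀ (u : L2Section g ((riemannianVolume g).restrict Ω) k),
    IsTestForm Ω u.form → u.toL2 = t.fst →
    ∫ p in Ω, formInner g p (u.form p) (u.form p) ∂μ ≤
      C * (‖t.snd.fst‖ ^ 2 + ‖t.snd.snd‖ ^ 2)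

end Form
end Manifold

/-- `B` is an inner product on `X` for which `X` is complete. -/
def IsHilbert {X : Type*} [AddCommGroup X] [Module ℝ X] (B : X → X → ℝ) : Prop :=
  ∃ c : InnerProductSpace.Core ℝ X, (∀ x y, c.inner x y = B x y) ∧
    @CompleteSpace X c.toNormedAddCommGroup.toUniformSpace

/-- A form `B` on a subspace `D` of `H` is closed: whenever `u_m ∈ D` converges to `f` in `H` and
`B(u_m - u_l, u_m - u_l) → 0` as `m, l → ∞`, then `f ∈ D` and `B(u_m - f, u_m - f) → 0`. -/
def IsClosedForm {H : Type*} [NormedAddCommGroup H] [InnerProductSpace ℝ H] {D : Submodule ℝ H}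
    (B : D → D → ℝ) : Prop :=
  ∀ (u : ℕ → D) (f : H), Filter.Tendsto (fun m => (u m : H)) Filter.atTop (nhds f) →
    (∀ ε > 0, ∃ N, ∀ m ≥ N, ∀ l ≥ N, B (u m - u l) (u m - u l) < ε) →
    ∃ hf : f ∈ D, Filter.Tendsto (fun m => B (u m - ⟨f, hf⟩) (u m - ⟨f, hf⟩)) Filter.atTop (nhds 0)

end
end KreinFeller

set_option maxSynthPendingDepth 3
set_option linter.unusedSectionVars false
open scoped Matrix ContDiff Manifold
open MeasureTheory Bundle

/-! The whole proposition rests on one estimate, `exists_energy_gap`: on `N^⊥` the full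
`W^{1,2}`-norm is bounded by a multiple of the square root of the energy `∫ |du|² + |d*u|² dV_g`.
The Poincaré inequality bounds `ι(u)` in `L²(μ)` but says nothing about the norm of `u` in
`L²(dV_g)`, so the estimate needs a compactness argument (`exists_gap`). If it failed, there would
be unit vectors `a_m` in `N^⊥` whose energies tend to zero. A subsequence converges weakly to some
`b` in `N^⊥`. By the Poincaré inequality `ι(a_m) → 0` in norm. The graph of `ι` is a closed
subspace, hence weakly closed, so it contains `(b, 0)`; therefore `b` lies in `N` and in `N^⊥`, and
`b = 0`. Rellich's theorem now gives `a_m → 0` in `L²(dV_g)`, which together with the vanishing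
energies contradicts `‖a_m‖ = 1`.

Given the gap, a sequence that is Cauchy for `𝓔` has lifts in `N^⊥` that are Cauchy in the space of
triples. Their limit stays in the closed subspace `N^⊥`, and if the sequence itself converges in
`L²(μ)`, closedness of the graph of `ι` identifies the image of the limit. This is (c). For (b), a
Cauchy sequence for `𝓔_*` is Cauchy both in the complete space `L²(μ)` and for `𝓔`, so (c) supplies
the limit. For (a), subtracting the component in `N` does not change `ι(u)`, so `dom(𝓔)` contains
the class of every test form, and these classes have trivial orthogonal complement in `L²(μ)`.

The analytic work comes from the discrepancy between the norm, which sees only `u`, `du` and `d*u`,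
and the space, which asks for all weak first partial derivatives. Gaffney's inequality bridges it:
pointwise, `|∇u|²` differs from the principal part of `|du|² + |d*u|²` by a null Lagrangian
(`gradInner_eq`), whose integral is of lower order (`exists_null_lagrangian_bound`). Since `d*u` is
only defined weakly, the principal part of the codifferential is bounded by testing the defining
identity with that principal part itself (`exists_localized_codiff_bound`). The resulting local
gradient bounds show that the closure of the test forms stays inside `W^{1,2}`
(`testSubmodule_closure_le`) and make Rellich's theorem applicable (`tendsto_norm_fst`).

Among the supporting facts are the completeness of `L²` (`completeSpace_l2Section`), the form of
`dV_g` in a chart (`restrict_riemannianVolume`), the existence of `d*u` in `L²` for test forms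
(`exists_codiff`), and the fact that a Sobolev triple is determined by its first entry
(`eq_zero_of_fst_eq_zero`). -/

namespace KreinFeller
noncomputable section

/-! ### Linear algebra of alternating forms and the pointwise identity behind Gaffney's inequality.
-/

section PointwiseAlgebra
variable {n k : ℕ}

/-- Alternating `k`-forms on `ℝⁿ`. -/
abbrev Alt (n k : ℕ) := Euc n [⋀^Fin k]→L[ℝ] ℝ

/-- The standard basis vectors of `ℝⁿ`. -/
def stdVec (i : Fin n) : Euc n := EuclideanSpace.single i (1 : ℝ)

theorem sum_smul_stdVec (v : Euc n) : ∑ i, v i • stdVec i = v := by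
  ext j
  simp [stdVec, Finset.sum_apply, Pi.single_apply]

/-- The component of an alternating form with multi-index `I`. -/
def comp (I : Fin k → Fin n) : Alt n k →L[ℝ] ℝ :=
  ContinuousAlternatingMap.apply ℝ (Euc n) ℝ (stdVec ∘ I)

@[simp] theorem comp_apply (I : Fin k → Fin n) (α : Alt n k) : comp I α = α (stdVec ∘ I) := rfl

theorem alt_ext {α β : Alt n k} (h : ∀ I, comp I α = comp I β) : α = β := by
  refine ContinuousAlternatingMap.toAlternatingMap_injective ?_
  refine Module.Basis.ext_alternating (EuclideanSpace.basisFun (Fin n) ℝ).toBasis fun I _ => ?_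
  simpa [stdVec, Function.comp_def] using h I

/-- All components of an alternating form. -/
def compL (n k : ℕ) : Alt n k →L[ℝ] ((Fin k → Fin n) → ℝ) := ContinuousLinearMap.pi comp

theorem compL_injective : Function.Injective (compL n k) := fun _ _ h =>
  alt_ext fun I => congrFun h I

instance : FiniteDimensional ℝ (Alt n k) :=
  FiniteDimensional.of_injective (compL n k).toLinearMap compL_injective

/-- A linear left inverse of the component map carries measurability and smoothness of the scalar
components back to the form. -/
theorem exists_compL_leftInverse :
    ∃ r : ((Fin k → Fin n) → ℝ) →L[ℝ] Alt n k, ∀ α, r (compL n k α) = α := by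
  obtain ⟨r, hr⟩ := (compL n k).toLinearMap.exists_leftInverse_of_injective
    (LinearMap.ker_eq_bot.2 compL_injective)
  exact ⟨LinearMap.toContinuousLinearMap r, fun α => LinearMap.congr_fun hr α⟩

theorem aemeasurable_alt {X : Type*} [MeasurableSpace X] {ν : Measure X} {f : X → Alt n k}
    (h : ∀ I, AEMeasurable (fun y => comp I (f y)) ν) : AEStronglyMeasurable f ν := by
  obtain ⟨r, hr⟩ := exists_compL_leftInverse (n := n) (k := k)
  have h1 : AEMeasurable (fun y => compL n k (f y)) ν := aemeasurable_pi_lambda _ h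
  have := r.continuous.comp_aestronglyMeasurable h1.aestronglyMeasurable
  exact this.congr (Filter.Eventually.of_forall fun y => hr _)

/-- The interior product with a vector. -/
def hook (v : Euc n) : Alt n (k + 1) →L[ℝ] Alt n k :=
  (ContinuousLinearMap.apply ℝ (Alt n k) v) ∘L
    (ContinuousAlternatingMap.curryLeftLI (𝕜 := ℝ) (E := Euc n) (F := ℝ)
      (n := k)).toContinuousLinearMap

theorem hook_apply (v : Euc n) (α : Alt n (k + 1)) (w : Fin k → Euc n) :
    hook v α w = α (Matrix.vecCons v w) := rfl

/-- The inner product on alternating forms determined by the inverse Gram matrix `S`, as a bilinear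
map. -/
def matInner (S : Matrix (Fin n) (Fin n) ℝ) : Alt n k →L[ℝ] Alt n k →L[ℝ] ℝ :=
  (k.factorial : ℝ)⁻¹ • ∑ I : Fin k → Fin n, ∑ J : Fin k → Fin n,
    (∏ m, S (I m) (J m)) • (comp I).smulRight (comp J)

theorem matInner_apply (S : Matrix (Fin n) (Fin n) ℝ) (α β : Alt n k) :
    matInner S α β = (k.factorial : ℝ)⁻¹ * ∑ I : Fin k → Fin n, ∑ J : Fin k → Fin n,
      (∏ m, S (I m) (J m)) * α (stdVec ∘ I) * β (stdVec ∘ J) := by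
  simp [matInner, mul_assoc]

theorem matInner_symm {S : Matrix (Fin n) (Fin n) ℝ} (hS : Sᵀ = S) (α β : Alt n k) :
    matInner S α β = matInner S β α := by
  have h : ∀ i j, S i j = S j i := fun i j => congrFun (congrFun hS.symm i) j
  simp only [matInner_apply]
  rw [Finset.sum_comm]
  refine congrArg _ (Finset.sum_congr rfl fun I _ => Finset.sum_congr rfl fun J _ => ?_)
  rw [Finset.prod_congr rfl fun m _ => h (J m) (I m)]
  ring

/-- Expanding by multilinearity, the factorization `Cᵀ * C` turns the quadratic form into a sum of
squares of the values of `α` on tuples of rows of `C`; positivity is read off from it. -/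
theorem matInner_self {N : ℕ} (C : Matrix (Fin N) (Fin n) ℝ) (α : Alt n k) :
    matInner (Cᵀ * C) α α = (k.factorial : ℝ)⁻¹ *
      ∑ K : Fin k → Fin N, α (fun m => ∑ i, C (K m) i • stdVec i) ^ 2 := by
  have hα : ∀ K : Fin k → Fin N, α (fun m => ∑ i, C (K m) i • stdVec i) =
      ∑ I : Fin k → Fin n, (∏ m, C (K m) (I m)) * α (stdVec ∘ I) := fun K => by
    have h2 := α.toMultilinearMap.map_sum (fun m i => C (K m) i • (stdVec i : Euc n))
    simp only [MultilinearMap.map_smul_univ] at h2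
    simpa [Function.comp_def] using h2
  rw [matInner_apply]
  congr 1
  simp_rw [hα, Matrix.mul_apply, Matrix.transpose_apply, Finset.prod_univ_sum,
    Fintype.piFinset_univ, Finset.sum_mul, sq, Finset.sum_mul_sum]
  conv_rhs => rw [Finset.sum_comm]
  congr! 1 with I _
  rw [Finset.sum_comm]
  congr! 2 with K _ J _
  rw [Finset.prod_mul_distrib]; ring

open scoped ComplexOrder MatrixOrder in
theorem exists_isUnit_factor {S : Matrix (Fin n) (Fin n) ℝ} (hS : S.PosDef) :
    ∃ C : Matrix (Fin n) (Fin n) ℝ, IsUnit C.det ∧ S = Cᵀ * C := by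
  obtain ⟨C, hC, h⟩ := CStarAlgebra.isStrictlyPositive_iff_eq_star_mul_self.1
    hS.isStrictlyPositive
  exact ⟨C, (Matrix.isUnit_iff_isUnit_det C).1 hC, by simpa [Matrix.star_eq_conjTranspose] using h⟩

theorem matInner_self_pos {S : Matrix (Fin n) (Fin n) ℝ} (hS : S.PosDef) {α : Alt n k}
    (hα : α ≠ 0) : 0 < matInner S α α := by
  obtain ⟨C, hC, rfl⟩ := exists_isUnit_factor hS
  rw [matInner_self]
  refine mul_pos (by positivity) ((Finset.sum_nonneg fun _ _ => sq_nonneg _).lt_of_ne' fun h0 => ?_)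
  refine hα (ContinuousAlternatingMap.toAlternatingMap_injective ?_)
  -- This equivalence sends the standard basis to the rows of `C`, so a vanishing sum of squares
  -- means that `α` vanishes on all tuples from a basis.
  let e : Euc n ≃ₗ[ℝ] Euc n := by
    refine (WithLp.linearEquiv 2 ℝ (Fin n → ℝ)).trans
      ((Matrix.toLinearEquiv' Cᵀ ?_).trans (WithLp.linearEquiv 2 ℝ (Fin n → ℝ)).symm)
    exact Matrix.invertibleOfIsUnitDet _ (by simpa using hC)
  refine Module.Basis.ext_alternating ((EuclideanSpace.basisFun (Fin n) ℝ).toBasis.map e)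
    fun K _ => ?_
  have h1 := (Finset.sum_eq_zero_iff_of_nonneg fun _ _ => sq_nonneg _).1 h0 K (Finset.mem_univ _)
  have h2 := pow_eq_zero_iff (two_ne_zero) |>.1 h1
  have : ∀ j, (((EuclideanSpace.basisFun (Fin n) ℝ).toBasis.map e) j) =
      ∑ i, C j i • (stdVec i : Euc n) := by
    intro j
    ext l
    simp [e, stdVec, Finset.sum_apply, Pi.single_apply, Matrix.toLinearEquiv']
  simp only [this]
  simpa using h2

theorem matInner_self_nonneg {S : Matrix (Fin n) (Fin n) ℝ} (hS : S.PosDef) (α : Alt n k) :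
    0 ≤ matInner S α α := by
  by_cases h : α = 0
  · simp [h]
  · exact (matInner_self_pos hS h).le

/-- Interior multiplication is adjoint to exterior multiplication. All `k + 1` terms of the
alternatization contribute equally, since moving the `r`-th argument of `α` to the front produces a
second factor `(-1)^r`; the `k + 1` equal terms turn `1 / (k + 1)!` into `1 / k!`. -/
theorem matInner_alternatize (S : Matrix (Fin n) (Fin n) ℝ) (α : Alt n (k + 1))
    (D : Euc n →L[ℝ] Alt n k) :
    matInner S α (ContinuousAlternatingMap.alternatizeUncurryFin D) =
      ∑ i, ∑ j, S i j * matInner S (hook (stdVec i) α) (D (stdVec j)) := by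
  have hterm : ∀ r : Fin (k + 1), ∑ I : Fin (k + 1) → Fin n, ∑ J : Fin (k + 1) → Fin n,
      (∏ m, S (I m) (J m)) * α (stdVec ∘ I) *
        ((-1 : ℝ) ^ (r : ℕ) * D (stdVec (J r)) (r.removeNth (stdVec ∘ J))) =
      ∑ i, ∑ j, ∑ I : Fin k → Fin n, ∑ J : Fin k → Fin n,
        S i j * ((∏ m, S (I m) (J m)) * α (Matrix.vecCons (stdVec i) (stdVec ∘ I)) *
          D (stdVec j) (stdVec ∘ J)) := by
    intro r
    -- Both index tuples are split at position `r`, the slot that carries the derivative.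
    rw [← (Fin.insertNthEquiv (fun _ => Fin n) r).sum_comp, Fintype.sum_prod_type]
    refine Finset.sum_congr rfl fun i _ => ?_
    rw [Finset.sum_comm]
    rw [← (Fin.insertNthEquiv (fun _ => Fin n) r).sum_comp, Fintype.sum_prod_type]
    refine Finset.sum_congr rfl fun j _ => ?_
    rw [Finset.sum_comm]
    refine Finset.sum_congr rfl fun I _ => Finset.sum_congr rfl fun J _ => ?_
    have h1 : (stdVec ∘ r.insertNth i I : Fin (k + 1) → Euc n) =
        r.insertNth (stdVec i) (stdVec ∘ I) := by
      ext1 m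
      refine Fin.succAboveCases r ?_ (fun m => ?_) m <;> simp
    have h2 : r.removeNth (stdVec ∘ r.insertNth j J : Fin (k + 1) → Euc n) = stdVec ∘ J := by
      ext1 m
      simp [Fin.removeNth]
    change (∏ m, S (r.insertNth (α := fun _ => Fin n) i I m) (r.insertNth (α := fun _ => Fin n) j J m)) *
      α (stdVec ∘ r.insertNth i I) * ((-1 : ℝ) ^ (r : ℕ) *
        D (stdVec (r.insertNth (α := fun _ => Fin n) j J r)) (r.removeNth (stdVec ∘ r.insertNth j J))) = _
    rw [h1, h2, Fin.prod_univ_succAbove _ r, ContinuousAlternatingMap.map_insertNth]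
    simp only [Fin.insertNth_apply_same, Fin.insertNth_apply_succAbove]
    have : (-1 : ℝ) ^ (r : ℕ) * (-1 : ℝ) ^ (r : ℕ) = 1 := by
      rw [← mul_pow]; simp
    linear_combination (S i j * ∏ x, S (I x) (J x)) * α (Matrix.vecCons (stdVec i) (stdVec ∘ I)) *
      (D (stdVec j) (stdVec ∘ J)) * this
  rw [matInner_apply]
  simp_rw [ContinuousAlternatingMap.alternatizeUncurryFin_apply, Finset.mul_sum]
  have hsw : ∀ f : (Fin (k + 1) → Fin n) → (Fin (k + 1) → Fin n) → Fin (k + 1) → ℝ,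
      ∑ I, ∑ J, ∑ r, f I J r = ∑ r, ∑ I, ∑ J, f I J r := fun f => by
    rw [Finset.sum_congr rfl fun I _ => Finset.sum_comm, Finset.sum_comm]
  have e1 : ∀ (I J : Fin (k + 1) → Fin n) (r : Fin (k + 1)),
      ((k + 1).factorial : ℝ)⁻¹ * ((∏ m, S (I m) (J m)) * α (stdVec ∘ I) *
        ((-1 : ℤ) ^ (r : ℕ) • D ((stdVec ∘ J) r) (r.removeNth (stdVec ∘ J)))) =
      ((k + 1).factorial : ℝ)⁻¹ * ((∏ m, S (I m) (J m)) * α (stdVec ∘ I) *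
        ((-1 : ℝ) ^ (r : ℕ) * D (stdVec (J r)) (r.removeNth (stdVec ∘ J)))) := by
    intro I J r
    simp
  simp only [matInner_apply]
  have e2 : (((k + 1).factorial : ℝ))⁻¹ * (k + 1) = (k.factorial : ℝ)⁻¹ := by
    rw [Nat.factorial_succ]; push_cast
    field_simp
  calc _ = ((k + 1).factorial : ℝ)⁻¹ * ∑ r : Fin (k + 1), ∑ I : Fin (k + 1) → Fin n,
        ∑ J : Fin (k + 1) → Fin n, (∏ m, S (I m) (J m)) * α (stdVec ∘ I) *
        ((-1 : ℝ) ^ (r : ℕ) * D (stdVec (J r)) (r.removeNth (stdVec ∘ J))) := by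
          rw [← hsw]
          simp only [Finset.mul_sum]
          refine Finset.sum_congr rfl fun I _ => Finset.sum_congr rfl fun J _ =>
            Finset.sum_congr rfl fun r _ => ?_
          simp
    _ = _ := by
      rw [Finset.sum_congr rfl fun r _ => hterm r]
      rw [Finset.sum_const, Finset.card_univ, Fintype.card_fin, nsmul_eq_mul]
      push_cast
      rw [← mul_assoc, e2]
      simp only [Finset.mul_sum, hook_apply]
      refine Finset.sum_congr rfl fun i _ => Finset.sum_congr rfl fun j _ =>
        Finset.sum_congr rfl fun I _ => Finset.sum_congr rfl fun J _ => by ring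

/-- The antiderivation rule for the interior product: the term that feeds `v` to the derivative slot
splits off, and in the others every position is shifted by one, which flips the sign. -/
theorem hook_alternatize (v : Euc n) (D : Euc n →L[ℝ] Alt n (k + 1)) :
    hook v (ContinuousAlternatingMap.alternatizeUncurryFin D) =
      D v - ContinuousAlternatingMap.alternatizeUncurryFin (hook v ∘L D) := by
  ext w
  change _ = D v w - ContinuousAlternatingMap.alternatizeUncurryFin (hook v ∘L D) w
  rw [hook_apply, ContinuousAlternatingMap.alternatizeUncurryFin_apply, Fin.sum_univ_succ,
    ContinuousAlternatingMap.alternatizeUncurryFin_apply, sub_eq_add_neg, ← Finset.sum_neg_distrib]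
  congr 1
  · simp
  · refine Finset.sum_congr rfl fun r _ => ?_
    have : r.succ.removeNth (Matrix.vecCons v w) = Matrix.vecCons v (r.removeNth w) := by
      ext1 m
      refine Fin.cases ?_ (fun m => ?_) m <;> simp [Fin.removeNth]
    rw [this]
    simp [pow_succ, hook_apply]

/-- The principal part of the codifferential, applied to a gradient `D`. -/
def codiffSymbol (S : Matrix (Fin n) (Fin n) ℝ) (D : Euc n →L[ℝ] Alt n (k + 1)) : Alt n k :=
  -∑ i, ∑ j, S i j • hook (stdVec i) (D (stdVec j))

/-- The inner product on gradients of alternating forms. -/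
def gradInner (S : Matrix (Fin n) (Fin n) ℝ) (D : Euc n →L[ℝ] Alt n k) : ℝ :=
  ∑ i, ∑ j, S i j * matInner S (D (stdVec i)) (D (stdVec j))

/-- The bilinear form `S_ia S_bj ⟨ι_i α, ι_b β⟩`, whose antisymmetrization in `a`, `j` measures the
difference between `|∇ω|²` and `|dω|² + |d*ω|²`. -/
def nullForm (S : Matrix (Fin n) (Fin n) ℝ) (a j : Fin n) :
    Alt n (k + 1) →L[ℝ] Alt n (k + 1) →L[ℝ] ℝ :=
  ∑ i, ∑ b, (S i a * S b j) •
    ((matInner S ∘L hook (stdVec i)).flip ∘L hook (stdVec b)).flip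

theorem nullForm_apply (S : Matrix (Fin n) (Fin n) ℝ) (a j : Fin n) (α β : Alt n (k + 1)) :
    nullForm S a j α β = ∑ i, ∑ b, S i a * S b j *
      matInner S (hook (stdVec i) α) (hook (stdVec b) β) := by
  simp [nullForm]

theorem matInner_codiffSymbol (S : Matrix (Fin n) (Fin n) ℝ) (D : Euc n →L[ℝ] Alt n (k + 1))
    (β : Alt n k) : matInner S (codiffSymbol S D) β =
      -∑ i, ∑ j, S i j * matInner S (hook (stdVec i) (D (stdVec j))) β := by
  simp [codiffSymbol]

/-- The symbol-level Weitzenböck identity. The square of the codifferential symbol is the sum of the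
null forms at `(D_a, D_j)`. By adjunction and the antiderivation rule, the square of the
alternatization is the gradient term minus the null forms with `D_a` and `D_j` exchanged. The two
together miss the full gradient only by an antisymmetric expression. -/
theorem gradInner_eq {S : Matrix (Fin n) (Fin n) ℝ} (hS : Sᵀ = S) (D : Euc n →L[ℝ] Alt n (k + 1)) :
    gradInner S D + ∑ a, ∑ j, (nullForm S a j (D (stdVec a)) (D (stdVec j)) -
        nullForm S a j (D (stdVec j)) (D (stdVec a))) =
      matInner S (ContinuousAlternatingMap.alternatizeUncurryFin D)
        (ContinuousAlternatingMap.alternatizeUncurryFin D) +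
      matInner S (codiffSymbol S D) (codiffSymbol S D) := by
  have h : ∀ i j, S i j = S j i := fun i j => congrFun (congrFun hS.symm i) j
  have e1 : matInner S (codiffSymbol S D) (codiffSymbol S D) =
      ∑ a, ∑ j, nullForm S a j (D (stdVec a)) (D (stdVec j)) := by
    rw [matInner_codiffSymbol]
    simp only [codiffSymbol, map_neg, map_sum, map_smul, smul_eq_mul, nullForm_apply,
      Finset.mul_sum, mul_neg, Finset.sum_neg_distrib, neg_neg]
    rw [Finset.sum_comm]
    refine Finset.sum_congr rfl fun a _ => ?_
    rw [Finset.sum_comm]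
    conv_rhs => rw [Finset.sum_comm]
    conv_lhs => rw [Finset.sum_comm]
    conv_rhs => rw [Finset.sum_comm]
    simp only [← mul_assoc]
    conv_lhs => enter [2, x]; rw [Finset.sum_comm]
    rw [Finset.sum_comm]
  have e2 : matInner S (ContinuousAlternatingMap.alternatizeUncurryFin D)
      (ContinuousAlternatingMap.alternatizeUncurryFin D) = gradInner S D -
      ∑ a, ∑ j, nullForm S a j (D (stdVec j)) (D (stdVec a)) := by
    rw [matInner_alternatize]
    simp only [hook_alternatize, map_sub, sub_apply, mul_sub,
      Finset.sum_sub_distrib, gradInner]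
    congr 1
    simp only [matInner_symm hS (ContinuousAlternatingMap.alternatizeUncurryFin _) (D _),
      matInner_alternatize, nullForm_apply, ContinuousLinearMap.comp_apply, Finset.mul_sum]
    have hsw : ∀ f : Fin n → Fin n → Fin n → Fin n → ℝ,
        ∑ i, ∑ j, ∑ a, ∑ b, f i j a b = ∑ b, ∑ j, ∑ a, ∑ i, f i j a b := fun f => by
      simp only [← Fintype.sum_prod_type']
      refine Fintype.sum_equiv
        ⟨fun p => (p.2.2.2, p.2.1, p.2.2.1, p.1), fun p => (p.2.2.2, p.2.1, p.2.2.1, p.1),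
          fun _ => rfl, fun _ => rfl⟩ _ _ fun p => rfl
    rw [hsw]
    refine Finset.sum_congr rfl fun b _ => Finset.sum_congr rfl fun j _ =>
      Finset.sum_congr rfl fun a _ => Finset.sum_congr rfl fun i _ => ?_
    rw [h i j]
    rw [h j i]
    ring
  rw [e1, e2, Finset.sum_congr rfl fun a _ => Finset.sum_sub_distrib _ _, Finset.sum_sub_distrib]
  ring

/-- With `S = Cᵀ * C` this is a sum of squared norms of the combinations of the `D (stdVec i)` with
coefficients from the rows of `C`; if all of them vanish, applying `C⁻¹` shows that `D` vanishes. -/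
theorem gradInner_pos {S : Matrix (Fin n) (Fin n) ℝ} (hS : S.PosDef) {D : Euc n →L[ℝ] Alt n k}
    (hD : D ≠ 0) : 0 < gradInner S D := by
  obtain ⟨C, hC, hSC⟩ := exists_isUnit_factor hS
  have e : gradInner S D = ∑ c, matInner S (∑ i, C c i • D (stdVec i))
      (∑ i, C c i • D (stdVec i)) := by
    simp only [gradInner, map_sum, map_smul, sum_apply, smul_apply, smul_eq_mul, Finset.mul_sum]
    have hij : ∀ i j, S i j = ∑ c, C c i * C c j := fun i j => by
      rw [hSC]; simp [Matrix.mul_apply]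
    rw [Finset.sum_congr rfl fun i _ => Finset.sum_congr rfl fun j _ =>
      congrArg (· * matInner S (D (stdVec i)) (D (stdVec j))) (hij i j)]
    simp only [Finset.sum_mul]
    rw [Finset.sum_congr rfl fun i _ => Finset.sum_comm, Finset.sum_comm]
    refine Finset.sum_congr rfl fun c _ => ?_
    rw [Finset.sum_comm]
    refine Finset.sum_congr rfl fun i _ => Finset.sum_congr rfl fun j _ => by ring
  rw [e]
  refine (Finset.sum_nonneg fun _ _ => matInner_self_nonneg hS _).lt_of_ne' fun h0 => hD ?_
  have h1 : ∀ c, ∑ i, C c i • D (stdVec i) = 0 := fun c => by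
    by_contra hc
    have := (Finset.sum_eq_zero_iff_of_nonneg fun _ _ => matInner_self_nonneg hS _).1 h0 c
      (Finset.mem_univ _)
    exact (matInner_self_pos hS hc).ne' this
  have h2 : ∀ j, D (stdVec j) = 0 := fun j => by
    have : ∑ c, C⁻¹ j c • ∑ i, C c i • D (stdVec i) = 0 := by simp [h1]
    simp only [Finset.smul_sum, smul_smul] at this
    rw [Finset.sum_comm] at this
    simp only [← Finset.sum_smul] at this
    have hinv := Matrix.nonsing_inv_mul C hC
    have hji : ∀ i, ∑ c, C⁻¹ j c * C c i = if j = i then 1 else 0 := fun i => by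
      rw [← Matrix.mul_apply, hinv, Matrix.one_apply]
    simpa [hji] using this
  ext1 v
  rw [← sum_smul_stdVec v]
  simp [h2]

theorem contDiffOn_matInner {F : Type*} [NormedAddCommGroup F] [NormedSpace ℝ F] {m : WithTop ℕ∞}
    {S : F → Matrix (Fin n) (Fin n) ℝ} {s : Set F}
    (hS : ∀ i j, ContDiffOn ℝ m (fun y => S y i j) s) :
    ContDiffOn ℝ m (fun y => matInner (k := k) (S y)) s := by
  unfold matInner
  refine (contDiffOn_const (c := (k.factorial : ℝ)⁻¹)).smul
    (ContDiffOn.sum fun I _ => ContDiffOn.sum fun J _ => ?_)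
  exact (contDiffOn_prod fun l _ => hS _ _).smul contDiffOn_const

theorem continuousOn_matInner {X : Type*} [TopologicalSpace X]
    {S : X → Matrix (Fin n) (Fin n) ℝ} {s : Set X} (hS : ContinuousOn S s) :
    ContinuousOn (fun y => matInner (k := k) (S y)) s := by
  have hij : ∀ i j, ContinuousOn (fun y => S y i j) s := fun i j =>
    continuousOn_pi.1 (continuousOn_pi.1 hS i) j
  unfold matInner
  refine (continuousOn_const (c := (k.factorial : ℝ)⁻¹)).smul
    (continuousOn_finsetSum _ fun I _ => continuousOn_finsetSum _ fun J _ => ?_)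
  exact (continuousOn_finsetProd _ fun l _ => hij _ _).smul continuousOn_const

/-- The minimum of `q` over the compact product of `K` and the unit sphere is positive, and
quadratic homogeneity extends the bound to all vectors. It yields uniform ellipticity of the metric
over compact sets. -/
theorem exists_pos_mul_sq_norm_le {X V : Type*} [TopologicalSpace X] [NormedAddCommGroup V]
    [NormedSpace ℝ V] [FiniteDimensional ℝ V] {K : Set X} (hK : IsCompact K) {q : X → V → ℝ}
    (hq : ContinuousOn (fun p : X × V => q p.1 p.2) (K ×ˢ Set.univ))
    (hsmul : ∀ x, ∀ (t : ℝ) v, q x (t • v) = t ^ 2 * q x v)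
    (hpos : ∀ x ∈ K, ∀ v, v ≠ 0 → 0 < q x v) :
    ∃ c > 0, ∀ x ∈ K, ∀ v, c * ‖v‖ ^ 2 ≤ q x v := by
  have : ProperSpace V := FiniteDimensional.proper ℝ V
  have hKS : IsCompact (K ×ˢ Metric.sphere (0 : V) 1) := hK.prod (isCompact_sphere _ _)
  have hq0 : ∀ x, q x 0 = 0 := fun x => by simpa using hsmul x 0 0
  rcases (K ×ˢ Metric.sphere (0 : V) 1).eq_empty_or_nonempty with he | hne
  -- The product is empty if `K` is empty or `V` is trivial, and then any constant works.
  · refine ⟨1, one_pos, fun x hx v => ?_⟩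
    by_cases hv : v = 0
    · simp [hv, hq0]
    · exfalso
      have : (x, ‖v‖⁻¹ • v) ∈ K ×ˢ Metric.sphere (0 : V) 1 :=
        ⟨hx, by simp [norm_smul, hv]⟩
      simp [he] at this
  · obtain ⟨p, hp, hmin⟩ := hKS.exists_isMinOn hne
      (hq.mono (Set.prod_mono le_rfl (Set.subset_univ _)))
    have hp2 : p.2 ≠ 0 := fun h => by
      have := hp.2
      simp [h] at this
    refine ⟨q p.1 p.2, hpos _ hp.1 _ hp2, fun x hx v => ?_⟩
    by_cases hv : v = 0
    · simp [hv, hq0]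
    · have hm : (x, ‖v‖⁻¹ • v) ∈ K ×ˢ Metric.sphere (0 : V) 1 :=
        ⟨hx, by simp [norm_smul, hv]⟩
      have h1 := hmin hm
      simp only [Set.mem_ofPred_eq, hsmul] at h1
      have hvp : 0 < ‖v‖ ^ 2 := by positivity
      rw [inv_pow, inv_mul_eq_div, le_div_iff₀ hvp] at h1
      exact h1

theorem exists_matInner_lower {X : Type*} [TopologicalSpace X] {K : Set X} (hK : IsCompact K)
    {S : X → Matrix (Fin n) (Fin n) ℝ} (hS : ContinuousOn S K) (hpos : ∀ x ∈ K, (S x).PosDef) :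
    ∃ c > 0, ∀ x ∈ K, ∀ α : Alt n k, c * ‖α‖ ^ 2 ≤ matInner (S x) α α := by
  refine exists_pos_mul_sq_norm_le hK ?_ (fun x t v => ?_) fun x hx v hv =>
    matInner_self_pos (hpos x hx) hv
  · have h1 : ContinuousOn (fun p : X × Alt n k => matInner (k := k) (S p.1)) (K ×ˢ Set.univ) :=
      (continuousOn_matInner hS).comp continuousOn_fst fun p hp => hp.1
    exact (h1.clm_apply continuousOn_snd).clm_apply continuousOn_snd
  · simp; ring

theorem exists_gradInner_lower {X : Type*} [TopologicalSpace X] {K : Set X} (hK : IsCompact K)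
    {S : X → Matrix (Fin n) (Fin n) ℝ} (hS : ContinuousOn S K) (hpos : ∀ x ∈ K, (S x).PosDef) :
    ∃ c > 0, ∀ x ∈ K, ∀ D : Euc n →L[ℝ] Alt n k, c * ‖D‖ ^ 2 ≤ gradInner (S x) D := by
  refine exists_pos_mul_sq_norm_le hK ?_ (fun x t v => ?_) fun x hx v hv =>
    gradInner_pos (hpos x hx) hv
  · have h1 : ContinuousOn (fun p : X × (Euc n →L[ℝ] Alt n k) => matInner (k := k) (S p.1))
        (K ×ˢ Set.univ) :=
      (continuousOn_matInner hS).comp continuousOn_fst fun p hp => hp.1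
    have hij : ∀ i j, ContinuousOn (fun p : X × (Euc n →L[ℝ] Alt n k) => S p.1 i j)
        (K ×ˢ Set.univ) := fun i j =>
      (continuousOn_pi.1 (continuousOn_pi.1 hS i) j).comp continuousOn_fst fun p hp => hp.1
    have hD : ∀ i, ContinuousOn (fun p : X × (Euc n →L[ℝ] Alt n k) => p.2 (stdVec i))
        (K ×ˢ Set.univ) := fun i => continuousOn_snd.clm_apply continuousOn_const
    refine continuousOn_finsetSum _ fun i _ => continuousOn_finsetSum _ fun j _ => ?_
    exact (hij i j).mul ((h1.clm_apply (hD i)).clm_apply (hD j))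
  · simp only [gradInner, smul_apply, map_smul, smul_eq_mul, Finset.mul_sum]
    refine Finset.sum_congr rfl fun i _ => Finset.sum_congr rfl fun j _ => by ring

theorem exists_matInner_upper {X : Type*} [TopologicalSpace X] {K : Set X} (hK : IsCompact K)
    {S : X → Matrix (Fin n) (Fin n) ℝ} (hS : ContinuousOn S K) :
    ∃ C > 0, ∀ x ∈ K, ∀ α β : Alt n k, |matInner (S x) α β| ≤ C * ‖α‖ * ‖β‖ := by
  obtain ⟨C, hC⟩ := hK.exists_bound_of_continuousOn (continuousOn_matInner (k := k) hS)
  refine ⟨max C 1, by positivity, fun x hx α β => ?_⟩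
  exact ((matInner (S x)).le_of_opNorm₂_le_of_le ((hC x hx).trans (le_max_left _ _)) le_rfl le_rfl)

end PointwiseAlgebra

/-! ### Integration by parts for bilinear expressions and null Lagrangians. -/

section IntegrationByParts
variable {n : ℕ} {V W : Type*} [NormedAddCommGroup V] [NormedSpace ℝ V]
  [NormedAddCommGroup W] [NormedSpace ℝ W]

theorem integral_fderiv_eq_zero_of_compactSupport {f : Euc n → ℝ} (hf : ContDiff ℝ 1 f)
    (hc : HasCompactSupport f) (v : Euc n) : ∫ y, fderiv ℝ f y v = 0 := by
  have h1 : Integrable fun y => fderiv ℝ f y v :=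
    ((hf.continuous_fderiv one_ne_zero).clm_apply continuous_const).integrable_of_hasCompactSupport
      (hc.fderiv_apply ℝ v)
  have := integral_mul_fderiv_eq_neg_fderiv_mul_of_integrable (μ := volume) (𝕜 := ℝ)
    (f := fun _ : Euc n => (1 : ℝ)) (g := f) (v := v) (by simp) (by simpa using h1)
    (by simpa using hf.continuous.integrable_of_hasCompactSupport hc)
    (fun _ _ => differentiableAt_const _) (fun _ _ => hf.differentiable one_ne_zero _)
  simpa using this

theorem continuous_of_tsupport_subset {X Y : Type*} [TopologicalSpace X] [TopologicalSpace Y]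
    [Zero Y] {f : X → Y} {O : Set X} (hO : IsOpen O) (hf : ContinuousOn f O)
    (hs : tsupport f ⊆ O) : Continuous f :=
  continuous_of_tsupport fun _ hx => hf.continuousAt (hO.mem_nhds (hs hx))

theorem tsupport_subset_of_eq_zero {X Y Z : Type*} [TopologicalSpace X] [Zero Y] [Zero Z]
    {f : X → Y} {h : X → Z} (hh : ∀ x, f x = 0 → h x = 0) : tsupport h ⊆ tsupport f :=
  closure_mono fun x hx h0 => hx (hh x h0)

theorem integrable_of_tsupport_subset {F : Type*} [NormedAddCommGroup F] {f : Euc n → F}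
    {O K : Set (Euc n)} (hO : IsOpen O)
    (hK : IsCompact K) (hKO : K ⊆ O) (hf : ContinuousOn f O) (hs : tsupport f ⊆ K) :
    Integrable f :=
  (continuous_of_tsupport_subset hO hf (hs.trans hKO)).integrable_of_hasCompactSupport
    (hK.of_isClosed_subset (isClosed_tsupport f) hs)

/-- The product rule for `B(u, η)`, integrated over `ℝⁿ`. -/
theorem integral_bilinear_product_rule {B : Euc n → V →L[ℝ] W →L[ℝ] ℝ} {u : Euc n → V}
    {η : Euc n → W} {O K : Set (Euc n)} (hO : IsOpen O) (hK : IsCompact K) (hKO : K ⊆ O)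
    (hB : ContDiffOn ℝ 1 B O) (hu : ContDiff ℝ 1 u) (hs : tsupport u ⊆ K)
    (hη : ContDiffOn ℝ 1 η O) (v : Euc n) :
    Integrable (fun y => fderiv ℝ B y v (u y) (η y)) ∧
    Integrable (fun y => B y (fderiv ℝ u y v) (η y)) ∧
    Integrable (fun y => B y (u y) (fderiv ℝ η y v)) ∧
    (∫ y, fderiv ℝ B y v (u y) (η y)) + (∫ y, B y (fderiv ℝ u y v) (η y)) +
      ∫ y, B y (u y) (fderiv ℝ η y v) = 0 := by
  have hdB : ContinuousOn (fun y => fderiv ℝ B y v) O :=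
    (hB.continuousOn_fderiv_of_isOpen hO le_rfl).clm_apply continuousOn_const
  have hdη : ContinuousOn (fun y => fderiv ℝ η y v) O :=
    (hη.continuousOn_fderiv_of_isOpen hO le_rfl).clm_apply continuousOn_const
  have hdu : Continuous fun y => fderiv ℝ u y v :=
    (hu.continuous_fderiv one_ne_zero).clm_apply continuous_const
  have i1 : Integrable (fun y => fderiv ℝ B y v (u y) (η y)) := by
    refine integrable_of_tsupport_subset hO hK hKO
      ((hdB.clm_apply hu.continuous.continuousOn).clm_apply hη.continuousOn)
      ((tsupport_subset_of_eq_zero fun x hx => ?_).trans hs)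
    simp [hx]
  have i2 : Integrable (fun y => B y (fderiv ℝ u y v) (η y)) := by
    refine integrable_of_tsupport_subset hO hK hKO
      ((hB.continuousOn.clm_apply hdu.continuousOn).clm_apply hη.continuousOn)
      (((tsupport_subset_of_eq_zero fun x hx => ?_).trans
        (tsupport_fderiv_apply_subset (f := u) ℝ v)).trans hs)
    simp [hx]
  have i3 : Integrable (fun y => B y (u y) (fderiv ℝ η y v)) := by
    refine integrable_of_tsupport_subset hO hK hKO
      ((hB.continuousOn.clm_apply hu.continuous.continuousOn).clm_apply hdη)
      ((tsupport_subset_of_eq_zero fun x hx => ?_).trans hs)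
    simp [hx]
  refine ⟨i1, i2, i3, ?_⟩
  have hts : tsupport (fun y => B y (u y) (η y)) ⊆ K :=
    (tsupport_subset_of_eq_zero fun x hx => by simp [hx]).trans hs
  have hF : ContDiff ℝ 1 fun y => B y (u y) (η y) := by
    refine contDiff_iff_contDiffAt.2 fun x => ?_
    by_cases hx : x ∉ tsupport fun y => B y (u y) (η y)
    · exact (contDiffAt_const (c := (0 : ℝ))).congr_of_eventuallyEq
        (notMem_tsupport_iff_eventuallyEq.1 hx)
    rw [not_not] at hx
    have hxO := hO.mem_nhds (hKO (hts hx))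
    exact ((hB.contDiffAt hxO).clm_apply hu.contDiffAt).clm_apply (hη.contDiffAt hxO)
  have h0 := integral_fderiv_eq_zero_of_compactSupport hF
    (hK.of_isClosed_subset (isClosed_tsupport _) hts) v
  rw [← integral_add i1 i2]
  erw [← integral_add (i1.add i2) i3]
  rw [← h0]
  refine integral_congr_ae (Filter.Eventually.of_forall fun y => ?_)
  by_cases hy : y ∈ O
  · have hyO := hO.mem_nhds hy
    have d1 := ((hB.contDiffAt hyO).differentiableAt one_ne_zero).hasFDerivAt
    have d2 := (hu.differentiable one_ne_zero y).hasFDerivAt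
    have d3 := ((hη.contDiffAt hyO).differentiableAt one_ne_zero).hasFDerivAt
    have := ((d1.clm_apply d2).clm_apply d3).fderiv
    simp only [this]
    simp
    ring
  -- Off `O` nothing is known about `B` and `η`, but `u` and its derivative vanish there.
  · have hyK : y ∉ tsupport u := fun h => hy (hKO (hs h))
    have h1 : u y = 0 := image_eq_zero_of_notMem_tsupport hyK
    have h2 : fderiv ℝ u y = 0 := image_eq_zero_of_notMem_tsupport
      fun h => hyK (tsupport_fderiv_subset ℝ h)
    have h3 : fderiv ℝ (fun y => B y (u y) (η y)) y = 0 := image_eq_zero_of_notMem_tsupport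
      fun h => hy (hKO (hts (tsupport_fderiv_subset ℝ h)))
    simp [h1, h2, h3]

theorem integral_mul_norm_le {F G : Type*} [NormedAddCommGroup F] [NormedAddCommGroup G]
    {X : Type*} [MeasurableSpace X] {ν : Measure X} {f : X → F} {g : X → G} (hf : MemLp f 2 ν)
    (hg : MemLp g 2 ν) :
    ∫ y, ‖f y‖ * ‖g y‖ ∂ν ≤ √(∫ y, ‖f y‖ ^ 2 ∂ν) * √(∫ y, ‖g y‖ ^ 2 ∂ν) := by
  have := integral_mul_norm_le_Lp_mul_Lq (μ := ν) (f := fun y => ‖f y‖) (g := fun y => ‖g y‖)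
    Real.HolderConjugate.two_two (by simpa using hf.norm) (by simpa using hg.norm)
  simpa [Real.sqrt_eq_rpow] using this

theorem exists_fderiv_bound {F : Type*} [NormedAddCommGroup F] [NormedSpace ℝ F] {B : Euc n → F}
    {O K : Set (Euc n)} (hO : IsOpen O) (hK : IsCompact K) (hKO : K ⊆ O)
    (hB : ContDiffOn ℝ 1 B O) (v : Euc n) : ∃ C, ∀ y ∈ K, ‖fderiv ℝ B y v‖ ≤ C :=
  hK.exists_bound_of_continuousOn
    (((hB.continuousOn_fderiv_of_isOpen hO le_rfl).clm_apply continuousOn_const).mono hKO)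

/-- The integral of `B(∂ᵥu, ∂_wu) - B(∂_wu, ∂ᵥu)` is of lower order. -/
theorem exists_null_lagrangian_bound {B : Euc n → V →L[ℝ] V →L[ℝ] ℝ} {O K : Set (Euc n)}
    (hO : IsOpen O) (hK : IsCompact K) (hKO : K ⊆ O) (hB : ContDiffOn ℝ 1 B O) (v w : Euc n) :
    ∃ C, ∀ u : Euc n → V, ContDiff ℝ 2 u → tsupport u ⊆ K →
      Integrable (fun y => B y (fderiv ℝ u y v) (fderiv ℝ u y w) -
        B y (fderiv ℝ u y w) (fderiv ℝ u y v)) ∧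
      |∫ y, (B y (fderiv ℝ u y v) (fderiv ℝ u y w) - B y (fderiv ℝ u y w) (fderiv ℝ u y v))| ≤
        C * ∫ y, ‖u y‖ * ‖fderiv ℝ u y‖ := by
  obtain ⟨C₁, hC₁⟩ := exists_fderiv_bound hO hK hKO hB v
  obtain ⟨C₂, hC₂⟩ := exists_fderiv_bound hO hK hKO hB w
  refine ⟨C₁ * ‖w‖ + C₂ * ‖v‖, fun u hu hs => ?_⟩
  have hd : ∀ x : Euc n, ContDiff ℝ 1 fun y => fderiv ℝ u y x := fun x =>
    (hu.fderiv_right (m := 1) (by norm_num)).clm_apply contDiff_const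
  have h1 : ContDiff ℝ 1 u := hu.of_le (by norm_num)
  obtain ⟨a1, a2, a3, a4⟩ := integral_bilinear_product_rule hO hK hKO hB h1 hs
    (hd w).contDiffOn v
  obtain ⟨b1, b2, b3, b4⟩ := integral_bilinear_product_rule hO hK hKO hB h1 hs
    (hd v).contDiffOn w
  refine ⟨a2.sub b2, ?_⟩
  -- Moving one derivative in each of the two terms leaves `B(u, ∂ᵥ∂_w u)` and `B(u, ∂_w∂ᵥu)`. These
  -- cancel by the symmetry of second derivatives, and only terms with a derivative of `B` survive.
  have hsymm : ∀ y, fderiv ℝ (fun z => fderiv ℝ u z w) y v = fderiv ℝ (fun z => fderiv ℝ u z v) y w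
      := fun y => by
    have hdd : DifferentiableAt ℝ (fderiv ℝ u) y :=
      (hu.fderiv_right (m := 1) (by norm_num)).differentiable one_ne_zero y
    rw [fderiv_clm_apply hdd (differentiableAt_const _),
      fderiv_clm_apply hdd (differentiableAt_const _)]
    simp only [fderiv_fun_const, Pi.zero_apply, ContinuousLinearMap.comp_zero, zero_add,
      ContinuousLinearMap.flip_apply]
    exact (hu.contDiffAt.isSymmSndFDerivAt (by simp [minSmoothness_of_isRCLikeNormedField])).eq v w
  have e : ∫ y, B y (u y) (fderiv ℝ (fun z => fderiv ℝ u z w) y v) =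
      ∫ y, B y (u y) (fderiv ℝ (fun z => fderiv ℝ u z v) y w) := by simp only [hsymm]
  rw [integral_sub a2 b2]
  have key : (∫ y, B y (fderiv ℝ u y v) (fderiv ℝ u y w)) -
      ∫ y, B y (fderiv ℝ u y w) (fderiv ℝ u y v) =
      ∫ y, (fderiv ℝ B y w (u y) (fderiv ℝ u y v) - fderiv ℝ B y v (u y) (fderiv ℝ u y w)) := by
    rw [integral_sub b1 a1]
    linarith
  rw [key, ← integral_const_mul, ← Real.norm_eq_abs]
  refine norm_integral_le_of_norm_le ?_ (Filter.Eventually.of_forall fun y => ?_)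
  · refine Integrable.const_mul ?_ _
    refine (h1.continuous.norm.mul
      (h1.continuous_fderiv one_ne_zero).norm).integrable_of_hasCompactSupport ?_
    refine hK.of_isClosed_subset (isClosed_tsupport _)
      ((tsupport_subset_of_eq_zero fun x hx => ?_).trans hs)
    simp [hx]
  · by_cases hy : y ∈ K
    · have e1 := (fderiv ℝ B y w).le_of_opNorm₂_le_of_le (hC₂ y hy) (le_refl ‖u y‖)
        ((fderiv ℝ u y).le_opNorm v)
      have e2 := (fderiv ℝ B y v).le_of_opNorm₂_le_of_le (hC₁ y hy) (le_refl ‖u y‖)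
        ((fderiv ℝ u y).le_opNorm w)
      calc _ ≤ _ := norm_sub_le _ _
        _ ≤ _ := add_le_add e1 e2
        _ = _ := by ring
    · have hyK : y ∉ tsupport u := fun h => hy (hs h)
      have h1 : u y = 0 := image_eq_zero_of_notMem_tsupport hyK
      simp [h1]

end IntegrationByParts

/-! ### Gaffney's inequality in a coordinate domain. -/

section LocalGaffney
variable {n k : ℕ}

/-- `S` is the inverse Gram matrix and `ρ` the volume density of a smooth metric on the open set
`O`. -/
structure IsLocalMetric (O : Set (Euc n)) (S : Euc n → Matrix (Fin n) (Fin n) ℝ)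
    (ρ : Euc n → ℝ) : Prop where
  isOpen : IsOpen O
  smooth_inv : ∀ i j, ContDiffOn ℝ ∞ (fun y => S y i j) O
  posDef : ∀ y ∈ O, (S y).PosDef
  smooth_dens : ContDiffOn ℝ ∞ ρ O
  dens_pos : ∀ y ∈ O, 0 < ρ y

variable {O : Set (Euc n)} {S : Euc n → Matrix (Fin n) (Fin n) ℝ} {ρ : Euc n → ℝ}

theorem IsLocalMetric.continuousOn_inv (h : IsLocalMetric O S ρ) : ContinuousOn S O :=
  continuousOn_pi.2 fun i => continuousOn_pi.2 fun j => (h.smooth_inv i j).continuousOn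

theorem IsLocalMetric.symm (h : IsLocalMetric O S ρ) {y : Euc n} (hy : y ∈ O) :
    (S y)ᵀ = S y := by
  simpa [Matrix.IsHermitian] using (h.posDef y hy).1

theorem IsLocalMetric.contDiffOn_matInner (h : IsLocalMetric O S ρ) :
    ContDiffOn ℝ ∞ (fun y => ρ y • matInner (k := k) (S y)) O :=
  h.smooth_dens.smul (KreinFeller.contDiffOn_matInner h.smooth_inv)

/-- The bilinear form `ρ S_ij ⟨ι_i α, β⟩`, summed over `i`. -/
def hookForm (S : Matrix (Fin n) (Fin n) ℝ) (r : ℝ) (j : Fin n) :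
    Alt n (k + 1) →L[ℝ] Alt n k →L[ℝ] ℝ :=
  ∑ i, (r * S i j) • (matInner S ∘L hook (stdVec i))

theorem hookForm_apply (S : Matrix (Fin n) (Fin n) ℝ) (r : ℝ) (j : Fin n) (α : Alt n (k + 1))
    (β : Alt n k) : hookForm S r j α β =
      ∑ i, r * S i j * matInner S (hook (stdVec i) α) β := by
  simp [hookForm]

theorem IsLocalMetric.contDiffOn_hookForm (h : IsLocalMetric O S ρ) (j : Fin n) :
    ContDiffOn ℝ ∞ (fun y => hookForm (k := k) (S y) (ρ y) j) O := by
  unfold hookForm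
  refine ContDiffOn.sum fun i _ => ?_
  refine (h.smooth_dens.mul (h.smooth_inv i j)).smul ?_
  exact (KreinFeller.contDiffOn_matInner h.smooth_inv).clm_comp contDiffOn_const

theorem IsLocalMetric.contDiffOn_nullForm (h : IsLocalMetric O S ρ) (a j : Fin n) :
    ContDiffOn ℝ ∞ (fun y => ρ y • nullForm (k := k) (S y) a j) O := by
  unfold nullForm
  refine h.smooth_dens.smul (ContDiffOn.sum fun i _ => ContDiffOn.sum fun b _ => ?_)
  refine ((h.smooth_inv i a).mul (h.smooth_inv b j)).smul ?_
  have h1 : ContDiffOn ℝ ∞ (fun y => matInner (S y) ∘L hook (k := k) (stdVec i)) O :=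
    (KreinFeller.contDiffOn_matInner h.smooth_inv).clm_comp contDiffOn_const
  have h2 : ContDiffOn ℝ ∞ (fun y => (matInner (S y) ∘L hook (k := k) (stdVec i)).flip) O :=
    (ContinuousLinearMap.flipₗᵢ ℝ (Alt n (k + 1)) (Alt n k) ℝ).contDiff.comp_contDiffOn h1
  have h3 : ContDiffOn ℝ ∞ (fun y => (matInner (S y) ∘L hook (k := k) (stdVec i)).flip ∘L
      hook (stdVec b)) O := h2.clm_comp contDiffOn_const
  exact (ContinuousLinearMap.flipₗᵢ ℝ (Alt n (k + 1)) (Alt n (k + 1)) ℝ).contDiff.comp_contDiffOn h3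

/-- Green's formula for the exterior derivative, with a lower order error term. -/
theorem IsLocalMetric.exists_green_bound (h : IsLocalMetric O S ρ) {K : Set (Euc n)}
    (hK : IsCompact K) (hKO : K ⊆ O) :
    ∃ C, 0 ≤ C ∧ ∀ (u : Euc n → Alt n (k + 1)) (η : Euc n → Alt n k), ContDiff ℝ 1 u →
      tsupport u ⊆ K → ContDiffOn ℝ 1 η O →
      Integrable (fun y => ρ y * matInner (S y) (u y)
        (ContinuousAlternatingMap.alternatizeUncurryFin (fderiv ℝ η y))) ∧
      Integrable (fun y => ρ y * matInner (S y) (codiffSymbol (S y) (fderiv ℝ u y)) (η y)) ∧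
      |(∫ y, ρ y * matInner (S y) (u y)
          (ContinuousAlternatingMap.alternatizeUncurryFin (fderiv ℝ η y))) -
        ∫ y, ρ y * matInner (S y) (codiffSymbol (S y) (fderiv ℝ u y)) (η y)| ≤
        C * ∫ y, ‖u y‖ * ‖η y‖ := by
  have hB : ∀ j, ContDiffOn ℝ 1 (fun y => hookForm (k := k) (S y) (ρ y) j) O := fun j =>
    (h.contDiffOn_hookForm j).of_le (by simp)
  choose c hc using fun j => exists_fderiv_bound h.isOpen hK hKO (hB j) (stdVec j)
  refine ⟨∑ j, |c j|, Finset.sum_nonneg fun _ _ => abs_nonneg _, fun u η hu hs hη => ?_⟩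
  have hr := fun j => integral_bilinear_product_rule h.isOpen hK hKO (hB j) hu hs hη (stdVec j)
  have e1 : ∀ y, ρ y * matInner (S y) (u y)
      (ContinuousAlternatingMap.alternatizeUncurryFin (fderiv ℝ η y)) =
      ∑ j, hookForm (S y) (ρ y) j (u y) (fderiv ℝ η y (stdVec j)) := fun y => by
    rw [matInner_alternatize, Finset.sum_comm, Finset.mul_sum]
    refine Finset.sum_congr rfl fun j _ => ?_
    rw [hookForm_apply, Finset.mul_sum]
    exact Finset.sum_congr rfl fun i _ => by ring
  have e2 : ∀ y, ρ y * matInner (S y) (codiffSymbol (S y) (fderiv ℝ u y)) (η y) =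
      -∑ j, hookForm (S y) (ρ y) j (fderiv ℝ u y (stdVec j)) (η y) := fun y => by
    rw [matInner_codiffSymbol, Finset.sum_comm, mul_neg, Finset.mul_sum]
    congr 1
    refine Finset.sum_congr rfl fun j _ => ?_
    rw [hookForm_apply, Finset.mul_sum]
    exact Finset.sum_congr rfl fun i _ => by ring
  simp only [e1, e2]
  refine ⟨integrable_finsetSum _ fun j _ => (hr j).2.2.1,
    (integrable_finsetSum _ fun j _ => (hr j).2.1).neg, ?_⟩
  rw [integral_neg, integral_finsetSum _ fun j _ => (hr j).2.2.1,
    integral_finsetSum _ fun j _ => (hr j).2.1, sub_neg_eq_add, ← Finset.sum_add_distrib,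
    Finset.sum_mul]
  refine (Finset.abs_sum_le_sum_abs _ _).trans (Finset.sum_le_sum fun j _ => ?_)
  have h4 := (hr j).2.2.2
  -- The error consists of the terms in which the derivative falls on the metric coefficients, and
  -- these derivatives are bounded on `K`.
  have h5 : (∫ y, hookForm (S y) (ρ y) j (u y) (fderiv ℝ η y (stdVec j))) +
      ∫ y, hookForm (S y) (ρ y) j (fderiv ℝ u y (stdVec j)) (η y) =
      -∫ y, fderiv ℝ (fun y => hookForm (S y) (ρ y) j) y (stdVec j) (u y) (η y) := by linarith
  rw [h5, abs_neg, ← integral_const_mul, ← Real.norm_eq_abs]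
  refine norm_integral_le_of_norm_le (Integrable.const_mul ?_ _)
    (Filter.Eventually.of_forall fun y => ?_)
  · refine integrable_of_tsupport_subset h.isOpen hK hKO
      (hu.continuous.continuousOn.norm.mul hη.continuousOn.norm)
      ((tsupport_subset_of_eq_zero fun x hx => ?_).trans hs)
    simp [hx]
  · by_cases hy : y ∈ K
    · calc _ ≤ c j * ‖u y‖ * ‖η y‖ :=
            (fderiv ℝ (fun y => hookForm (S y) (ρ y) j) y (stdVec j)).le_of_opNorm₂_le_of_le
              (hc j y hy) le_rfl le_rfl
        _ ≤ |c j| * ‖u y‖ * ‖η y‖ := by gcongr; exact le_abs_self _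
        _ = _ := by ring
    · have hyK : y ∉ tsupport u := fun h => hy (hs h)
      have h1 : u y = 0 := image_eq_zero_of_notMem_tsupport hyK
      simp [h1]

/-- For functions the exterior derivative already is the full gradient, so degree zero needs neither
Gaffney's inequality nor the codifferential. -/
theorem norm_le_norm_alternatizeUncurryFin (D : Euc n →L[ℝ] Alt n 0) :
    ‖D‖ ≤ ‖ContinuousAlternatingMap.alternatizeUncurryFin D‖ := by
  refine D.opNorm_le_bound (norm_nonneg _) fun v => ?_
  refine ContinuousAlternatingMap.opNorm_le_bound _ (by positivity) fun w => ?_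
  have h1 := (ContinuousAlternatingMap.alternatizeUncurryFin D).le_opNorm fun _ => v
  simp only [ContinuousAlternatingMap.alternatizeUncurryFin_apply, Finset.prod_const] at h1
  rw [Subsingleton.elim w (Fin.removeNth 0 fun _ => v)]
  simpa using h1

/-- Young's inequality `b * √x ≤ (b ^ 2 + x) / 2` allows half of `x` to be absorbed on the left. -/
theorem sq_le_of_sq_le_add_mul {x a b : ℝ} (h : x ≤ a + b * √x) (hx : 0 ≤ x) :
    x ≤ 2 * a + b ^ 2 := by
  nlinarith [Real.sq_sqrt hx, sq_nonneg (b - √x)]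

/-- The final absorption in Gaffney's inequality. In the application `X`, `Y` and `A` are the
integrals of the squared gradient, form and exterior derivative, `B` is the energy of the
codifferential symbol, `N` the null Lagrangian, and `I` the mixed integral that bounds it. -/
theorem le_of_absorb {X Y A B N I q b L : ℝ} (hX : 0 ≤ X) (hY : 0 ≤ Y) (hA : 0 ≤ A) (hB : 0 ≤ B)
    (hq : 0 < q) (hb : 0 ≤ b) (hL : 0 ≤ L) (main : q * X ≤ L * A + B - N) (hN : |N| ≤ b * I)
    (hI : I ≤ √Y * √X) : X ≤ (2 * q⁻¹ * (L + 1) + (q⁻¹ * b) ^ 2) * (A + B + Y) := by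
  have hi : 0 ≤ q⁻¹ := by positivity
  have m2 : X ≤ q⁻¹ * (L * A + B) + (q⁻¹ * b * √Y) * √X := by
    have : q * X ≤ (L * A + B) + b * (√Y * √X) := by
      have h1 := (abs_le.1 hN).1
      have h2 : b * I ≤ b * (√Y * √X) := mul_le_mul_of_nonneg_left hI hb
      linarith
    calc X = q⁻¹ * (q * X) := by field_simp
      _ ≤ q⁻¹ * ((L * A + B) + b * (√Y * √X)) := mul_le_mul_of_nonneg_left this hi
      _ = _ := by ring
  have m3 := sq_le_of_sq_le_add_mul m2 hX
  rw [mul_pow, Real.sq_sqrt hY] at m3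
  have t1 : L * A + B ≤ (L + 1) * (A + B + Y) := by
    nlinarith [mul_nonneg hL hB, mul_nonneg hL hY]
  have t2 : q⁻¹ * (L * A + B) ≤ q⁻¹ * ((L + 1) * (A + B + Y)) := mul_le_mul_of_nonneg_left t1 hi
  have t3 : (q⁻¹ * b) ^ 2 * Y ≤ (q⁻¹ * b) ^ 2 * (A + B + Y) :=
    mul_le_mul_of_nonneg_left (by linarith) (sq_nonneg _)
  linarith

/-- This is `gradInner_eq` multiplied by the density `q`, which lies between `r` and `R`. Gradient
and exterior derivative are replaced by Euclidean norms, but the null form is kept exact, because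
only its integral is small. -/
theorem gaffney_pointwise {S : Matrix (Fin n) (Fin n) ℝ} (hS : Sᵀ = S) (hp : S.PosDef)
    (D : Euc n →L[ℝ] Alt n (k + 1)) {c A R r q : ℝ} (hlow : c * ‖D‖ ^ 2 ≤ gradInner S D)
    (hup : |matInner S (ContinuousAlternatingMap.alternatizeUncurryFin D)
      (ContinuousAlternatingMap.alternatizeUncurryFin D)| ≤
        A * ‖ContinuousAlternatingMap.alternatizeUncurryFin D‖ *
          ‖ContinuousAlternatingMap.alternatizeUncurryFin D‖)
    (hr : 0 ≤ r) (hc : 0 ≤ c) (hrq : r ≤ q) (hqR : q ≤ R) :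
    r * c * ‖D‖ ^ 2 ≤ R * A * ‖ContinuousAlternatingMap.alternatizeUncurryFin D‖ ^ 2 +
      q * matInner S (codiffSymbol S D) (codiffSymbol S D) -
      q * ∑ a, ∑ j, (nullForm S a j (D (stdVec a)) (D (stdVec j)) -
        nullForm S a j (D (stdVec j)) (D (stdVec a))) := by
  have g1 := gradInner_eq hS D
  have g6 := (abs_le.1 hup).2
  have g7 := matInner_self_nonneg hp (ContinuousAlternatingMap.alternatizeUncurryFin D)
  have g8 : 0 ≤ q := hr.trans hrq
  have e1 : r * c * ‖D‖ ^ 2 ≤ q * gradInner S D := by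
    calc _ = r * (c * ‖D‖ ^ 2) := by ring
      _ ≤ _ := mul_le_mul hrq hlow (by positivity) g8
  have e2 := mul_le_mul hqR g6 g7 (g8.trans hqR)
  rw [eq_sub_of_add_eq g1, mul_sub, mul_add] at e1
  linarith

/-- **Gaffney's inequality** for forms with compact support in a coordinate domain. -/
theorem IsLocalMetric.exists_gaffney (h : IsLocalMetric O S ρ) {K : Set (Euc n)}
    (hK : IsCompact K) (hKO : K ⊆ O) :
    ∃ C, 0 ≤ C ∧ ∀ u : Euc n → Alt n (k + 1), ContDiff ℝ 2 u → tsupport u ⊆ K →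
      ∫ y, ‖fderiv ℝ u y‖ ^ 2 ≤ C * ((∫ y, ‖ContinuousAlternatingMap.alternatizeUncurryFin
        (fderiv ℝ u y)‖ ^ 2) +
        (∫ y, ρ y * matInner (S y) (codiffSymbol (S y) (fderiv ℝ u y))
          (codiffSymbol (S y) (fderiv ℝ u y))) + ∫ y, ‖u y‖ ^ 2) := by
  have hSK := h.continuousOn_inv.mono hKO
  obtain ⟨c, hc, hlow⟩ := exists_gradInner_lower (k := k + 1) hK hSK fun y hy =>
    h.posDef y (hKO hy)
  obtain ⟨A, hA, hup⟩ := exists_matInner_upper (k := k + 1 + 1) hK hSK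
  obtain ⟨R, hR⟩ := hK.exists_bound_of_continuousOn (h.smooth_dens.continuousOn.mono hKO)
  obtain ⟨r, hr, hrK⟩ : ∃ r > 0, ∀ y ∈ K, r ≤ ρ y := by
    rcases K.eq_empty_or_nonempty with rfl | hne
    · exact ⟨1, one_pos, by simp⟩
    · obtain ⟨p, hp, hmin⟩ := hK.exists_isMinOn hne (h.smooth_dens.continuousOn.mono hKO)
      exact ⟨ρ p, h.dens_pos _ (hKO hp), fun y hy => hmin hy⟩
  have hB : ∀ a j, ContDiffOn ℝ 1 (fun y => ρ y • nullForm (k := k) (S y) a j) O := fun a j =>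
    (h.contDiffOn_nullForm a j).of_le (by simp)
  -- The density is part of the coefficients of the null Lagrangian, so its derivatives enter the
  -- constants `b a j` as well.
  choose b hb using fun a j => exists_null_lagrangian_bound h.isOpen hK hKO (hB a j)
    (stdVec a) (stdVec j)
  set b' := ∑ a, ∑ j, |b a j| with hb'
  have hb'0 : 0 ≤ b' := Finset.sum_nonneg fun _ _ => Finset.sum_nonneg fun _ _ => abs_nonneg _
  refine ⟨2 * (r * c)⁻¹ * (|R| * A + 1) + ((r * c)⁻¹ * b') ^ 2, by positivity, fun u hu hs => ?_⟩
  have h1 : ContDiff ℝ 1 u := hu.of_le (by norm_num)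
  have hdu : Continuous (fderiv ℝ u) := h1.continuous_fderiv one_ne_zero
  have hz : ∀ y, y ∉ K → u y = 0 ∧ fderiv ℝ u y = 0 := fun y hy =>
    ⟨image_eq_zero_of_notMem_tsupport fun h => hy (hs h),
      image_eq_zero_of_notMem_tsupport fun h => hy (hs (tsupport_fderiv_subset ℝ h))⟩
  have hcu : HasCompactSupport u := hK.of_isClosed_subset (isClosed_tsupport _) hs
  have hcdu : HasCompactSupport (fderiv ℝ u) := hcu.fderiv ℝ
  have altZ : ContinuousAlternatingMap.alternatizeUncurryFin (0 : Euc n →L[ℝ] Alt n (k + 1)) = 0 :=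
    map_zero (ContinuousAlternatingMap.alternatizeUncurryFinCLM ℝ (Euc n) ℝ)
  have i1 : Integrable fun y => ‖ContinuousAlternatingMap.alternatizeUncurryFin
      (fderiv ℝ u y)‖ ^ 2 := by
    refine Continuous.integrable_of_hasCompactSupport ?_ ?_
    · exact (((ContinuousAlternatingMap.alternatizeUncurryFinCLM ℝ (Euc n) ℝ).continuous.comp
        hdu).norm).pow 2
    · exact hcdu.mono' (subset_closure.trans (tsupport_subset_of_eq_zero fun x hx => by
        simp [hx, altZ]))
  have iu : MemLp u 2 := h1.continuous.memLp_of_hasCompactSupport hcu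
  have idu : MemLp (fderiv ℝ u) 2 := hdu.memLp_of_hasCompactSupport hcdu
  have cδ : ContinuousOn (fun y => codiffSymbol (S y) (fderiv ℝ u y)) O := by
    unfold codiffSymbol
    refine (continuousOn_finsetSum _ fun i _ => continuousOn_finsetSum _ fun j _ => ?_).neg
    exact (h.smooth_inv i j).continuousOn.smul ((hook (stdVec i)).continuous.comp_continuousOn
      (hdu.continuousOn.clm_apply continuousOn_const))
  have i2 : Integrable fun y => ρ y * matInner (S y) (codiffSymbol (S y) (fderiv ℝ u y))
      (codiffSymbol (S y) (fderiv ℝ u y)) := by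
    refine integrable_of_tsupport_subset h.isOpen hK hKO (h.smooth_dens.continuousOn.mul
      (((continuousOn_matInner h.continuousOn_inv).clm_apply cδ).clm_apply cδ)) ?_
    refine ((tsupport_subset_of_eq_zero fun x hx => ?_).trans (tsupport_fderiv_subset ℝ)).trans hs
    simp [hx, codiffSymbol]
  have hnull : ∀ a j, Integrable (fun y => ρ y *
      (nullForm (S y) a j (fderiv ℝ u y (stdVec a)) (fderiv ℝ u y (stdVec j)) -
        nullForm (S y) a j (fderiv ℝ u y (stdVec j)) (fderiv ℝ u y (stdVec a)))) ∧
      |∫ y, ρ y * (nullForm (S y) a j (fderiv ℝ u y (stdVec a)) (fderiv ℝ u y (stdVec j)) -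
        nullForm (S y) a j (fderiv ℝ u y (stdVec j)) (fderiv ℝ u y (stdVec a)))| ≤
        |b a j| * ∫ y, ‖u y‖ * ‖fderiv ℝ u y‖ := fun a j => by
    obtain ⟨q1, q2⟩ := hb a j u hu hs
    simp only [smul_apply, smul_eq_mul, ← mul_sub] at q1 q2
    refine ⟨q1, q2.trans ?_⟩
    exact mul_le_mul_of_nonneg_right (le_abs_self _)
      (integral_nonneg fun _ => mul_nonneg (norm_nonneg _) (norm_nonneg _))
  have i3 : Integrable fun y => ∑ a, ∑ j, ρ y *
      (nullForm (S y) a j (fderiv ℝ u y (stdVec a)) (fderiv ℝ u y (stdVec j)) -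
        nullForm (S y) a j (fderiv ℝ u y (stdVec j)) (fderiv ℝ u y (stdVec a))) :=
    integrable_finsetSum _ fun a _ => integrable_finsetSum _ fun j _ => (hnull a j).1
  set N := ∫ y, ∑ a, ∑ j, ρ y *
      (nullForm (S y) a j (fderiv ℝ u y (stdVec a)) (fderiv ℝ u y (stdVec j)) -
        nullForm (S y) a j (fderiv ℝ u y (stdVec j)) (fderiv ℝ u y (stdVec a))) with hN
  have hNle : |N| ≤ b' * ∫ y, ‖u y‖ * ‖fderiv ℝ u y‖ := by
    rw [hN, integral_finsetSum _ fun a _ => integrable_finsetSum _ fun j _ => (hnull a j).1,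
      hb', Finset.sum_mul]
    refine (Finset.abs_sum_le_sum_abs _ _).trans (Finset.sum_le_sum fun a _ => ?_)
    rw [integral_finsetSum _ fun j _ => (hnull a j).1, Finset.sum_mul]
    exact (Finset.abs_sum_le_sum_abs _ _).trans (Finset.sum_le_sum fun j _ => (hnull a j).2)
  have hCS := integral_mul_norm_le iu idu
  set X := ∫ y, ‖fderiv ℝ u y‖ ^ 2 with hX
  set Y := ∫ y, ‖u y‖ ^ 2 with hY
  set A1 := ∫ y, ‖ContinuousAlternatingMap.alternatizeUncurryFin (fderiv ℝ u y)‖ ^ 2 with hA1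
  set A2 := ∫ y, ρ y * matInner (S y) (codiffSymbol (S y) (fderiv ℝ u y))
      (codiffSymbol (S y) (fderiv ℝ u y)) with hA2
  have hX0 : 0 ≤ X := integral_nonneg fun _ => by positivity
  have hY0 : 0 ≤ Y := integral_nonneg fun _ => by positivity
  have hA10 : 0 ≤ A1 := integral_nonneg fun _ => by positivity
  have hA20 : 0 ≤ A2 := integral_nonneg fun y => by
    by_cases hy : y ∈ K
    · exact mul_nonneg (h.dens_pos y (hKO hy)).le (matInner_self_nonneg (h.posDef y (hKO hy)) _)
    · simp [(hz y hy).2, codiffSymbol]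
  -- The pointwise inequality is integrated over all of `ℝⁿ`; outside `K` both sides vanish.
  have main : r * c * X ≤ |R| * A * A1 + A2 - N := by
    rw [hX, hA1, hA2, hN, ← integral_const_mul, ← integral_const_mul,
      ← integral_add (i1.const_mul _) i2]
    erw [← integral_sub ((i1.const_mul _).add i2) i3]
    refine integral_mono ?_ (((i1.const_mul _).add i2).sub i3) fun y => ?_
    · exact ((memLp_two_iff_integrable_sq_norm idu.1).1 idu).const_mul _
    by_cases hy : y ∈ K
    · have g4 := hrK y hy
      have g5 : ρ y ≤ |R| := (le_abs_self _).trans ((hR y hy).trans (le_abs_self _))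
      simp only [← Finset.mul_sum]
      exact gaffney_pointwise (h.symm (hKO hy)) (h.posDef y (hKO hy)) (fderiv ℝ u y)
        (hlow y hy _) (hup y hy _ _) hr.le hc.le g4 g5
    · simp [(hz y hy).2, altZ, codiffSymbol]
  have hrc : 0 < r * c := by positivity
  exact le_of_absorb hX0 hY0 hA10 hA20 hrc hb'0 (by positivity) main hNle hCS

end LocalGaffney

/-! ### Rellich's theorem in Euclidean space, by mollification. -/

section Rellich
variable {n : ℕ}

theorem sub_eq_integral_fderiv {f : Euc n → ℝ} (hf : ContDiff ℝ 1 f) (x z : Euc n) :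
    f x - f (x - z) = ∫ s in (0 : ℝ)..1, fderiv ℝ f (x - s • z) z := by
  have hd : ∀ s : ℝ, HasDerivAt (fun s : ℝ => f (x - s • z)) (-fderiv ℝ f (x - s • z) z) s := by
    intro s
    have h1 := (hf.differentiable one_ne_zero (x - s • z)).hasFDerivAt
    have h2 : HasDerivAt (fun s : ℝ => x - s • z) (-z) s := by
      simpa using ((hasDerivAt_id s).smul_const z).const_sub x
    have h3 := h1.comp_hasDerivAt s h2
    rw [map_neg] at h3
    exact h3
  have hc : Continuous fun s : ℝ => -fderiv ℝ f (x - s • z) z :=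
    (((hf.continuous_fderiv one_ne_zero).comp (by fun_prop : Continuous fun s : ℝ =>
      x - s • z)).clm_apply continuous_const).neg
  have := intervalIntegral.integral_eq_sub_of_hasDerivAt (fun s _ => hd s)
    (hc.intervalIntegrable 0 1)
  rw [intervalIntegral.integral_neg] at this
  simp at this
  linarith

/-- The difference is the integral of the derivative along the segment from `x - z` to `x`. After
exchanging the integrals, each slice is bounded by Cauchy–Schwarz and the translation invariance of
Lebesgue measure. -/
theorem abs_integral_mul_sub_translate_le {f : Euc n → ℝ} (hf : ContDiff ℝ 1 f)
    (hc : HasCompactSupport f) (z : Euc n) :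
    |∫ x, f x * (f x - f (x - z))| ≤
      ‖z‖ * (√(∫ x, ‖f x‖ ^ 2) * √(∫ x, ‖fderiv ℝ f x‖ ^ 2)) := by
  have hdf : Continuous (fderiv ℝ f) := hf.continuous_fderiv one_ne_zero
  have hcont : Continuous fun p : Euc n × ℝ => f p.1 * fderiv ℝ f (p.1 - p.2 • z) z :=
    (hf.continuous.comp continuous_fst).mul ((hdf.comp (by fun_prop)).clm_apply continuous_const)
  have hint : Integrable (fun p : Euc n × ℝ => f p.1 * fderiv ℝ f (p.1 - p.2 • z) z)
      (volume.prod (volume.restrict (Set.Ioc (0 : ℝ) 1))) := by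
    have h1 : IntegrableOn (fun p : Euc n × ℝ => f p.1 * fderiv ℝ f (p.1 - p.2 • z) z)
        (tsupport f ×ˢ Set.Icc (0 : ℝ) 1) (volume.prod volume) :=
      hcont.continuousOn.integrableOn_compact (hc.prod isCompact_Icc)
    rw [IntegrableOn, ← Measure.prod_restrict] at h1
    have h2 : Integrable (fun p : Euc n × ℝ => f p.1 * fderiv ℝ f (p.1 - p.2 • z) z)
        ((volume.restrict (tsupport f)).prod (volume.restrict (Set.Ioc (0 : ℝ) 1))) := by
      rw [Measure.prod_restrict] at h1 ⊢
      exact IntegrableOn.mono_set h1 (Set.prod_mono le_rfl Set.Ioc_subset_Icc_self)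
    have h3 : (volume : Measure (Euc n)).prod (volume.restrict (Set.Ioc (0 : ℝ) 1)) =
        (volume.restrict Set.univ).prod (volume.restrict (Set.Ioc (0 : ℝ) 1)) := by
      rw [Measure.restrict_univ]
    rw [h3, Measure.prod_restrict]
    rw [Measure.prod_restrict] at h2
    -- The factor `f p.1` vanishes off the support, so integrability over a compact set suffices.
    refine IntegrableOn.of_forall_sdiff_eq_zero h2
      (MeasurableSet.univ.prod measurableSet_Ioc) fun p hp => ?_
    have : p.1 ∉ tsupport f := fun h => hp.2 ⟨h, hp.1.2⟩
    simp [image_eq_zero_of_notMem_tsupport this]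
  have e1 : ∫ x, f x * (f x - f (x - z)) =
      ∫ s in Set.Ioc (0 : ℝ) 1, ∫ x, f x * fderiv ℝ f (x - s • z) z := by
    rw [← integral_integral_swap hint]
    refine integral_congr_ae (Filter.Eventually.of_forall fun x => ?_)
    simp only
    rw [sub_eq_integral_fderiv hf, intervalIntegral.integral_of_le zero_le_one,
      integral_const_mul]
  rw [e1, ← Real.norm_eq_abs]
  have hb : ∀ s ∈ Set.Ioc (0 : ℝ) 1, ‖∫ x, f x * fderiv ℝ f (x - s • z) z‖ ≤
      ‖z‖ * (√(∫ x, ‖f x‖ ^ 2) * √(∫ x, ‖fderiv ℝ f x‖ ^ 2)) := by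
    intro s _
    have m1 : MemLp f 2 := hf.continuous.memLp_of_hasCompactSupport hc
    have m2 : MemLp (fun x => fderiv ℝ f (x - s • z)) 2 := by
      refine Continuous.memLp_of_hasCompactSupport (hdf.comp (by fun_prop)) ?_
      exact (hc.fderiv ℝ).comp_homeomorph (Homeomorph.subRight (s • z))
    have h1 := integral_mul_norm_le m1 m2
    rw [integral_sub_right_eq_self (fun x => ‖fderiv ℝ f x‖ ^ 2) (s • z)] at h1
    refine (norm_integral_le_of_norm_le (g := fun x => ‖z‖ * (‖f x‖ * ‖fderiv ℝ f (x - s • z)‖))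
      ((m1.norm.integrable_mul m2.norm).const_mul _)
      (Filter.Eventually.of_forall fun x => ?_)).trans ?_
    · rw [norm_mul]
      calc _ ≤ ‖f x‖ * (‖fderiv ℝ f (x - s • z)‖ * ‖z‖) := by
            gcongr; exact ContinuousLinearMap.le_opNorm _ _
        _ = _ := by ring
    · rw [integral_const_mul]
      gcongr
  have := norm_setIntegral_le_of_norm_le_const (μ := (volume : Measure ℝ))
    (s := Set.Ioc (0 : ℝ) 1) (by simp) hb
  simpa using this

/-- Mollification averages translations by vectors shorter than `ε`, so the translation estimate is
averaged against `ψ`. Testing against `f` itself is enough for Rellich's theorem and avoids an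
estimate of the norm of the difference. -/
theorem abs_integral_mul_sub_mollify_le {f : Euc n → ℝ} (hf : ContDiff ℝ 1 f)
    (hc : HasCompactSupport f) {ψ : Euc n → ℝ} (hψ : Continuous ψ) (hψ0 : ∀ z, 0 ≤ ψ z)
    (hψ1 : ∫ z, ψ z = 1) {ε : ℝ} (hs : Function.support ψ ⊆ Metric.ball 0 ε)
    (hψc : HasCompactSupport ψ) :
    |∫ x, f x * (f x - ∫ z, ψ z * f (x - z))| ≤
      ε * (√(∫ x, ‖f x‖ ^ 2) * √(∫ x, ‖fderiv ℝ f x‖ ^ 2)) := by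
  set R := √(∫ x, ‖f x‖ ^ 2) * √(∫ x, ‖fderiv ℝ f x‖ ^ 2) with hR
  have hR0 : 0 ≤ R := by positivity
  have iψ : Integrable ψ := hψ.integrable_of_hasCompactSupport hψc
  have e1 : ∀ x, f x * (f x - ∫ z, ψ z * f (x - z)) =
      ∫ z, ψ z * (f x * (f x - f (x - z))) := fun x => by
    have i1 : Integrable fun z => ψ z * f (x - z) :=
      (hψ.mul (hf.continuous.comp (by fun_prop))).integrable_of_hasCompactSupport hψc.mul_right
    have : f x = ∫ z, ψ z * f x := by rw [integral_mul_const, hψ1, one_mul]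
    have h2 : f x - ∫ z, ψ z * f (x - z) = ∫ z, (ψ z * f x - ψ z * f (x - z)) := by
      rw [integral_sub (iψ.mul_const _) i1, ← this]
    rw [h2, ← integral_const_mul]
    refine integral_congr_ae (Filter.Eventually.of_forall fun z => ?_)
    simp only
    ring
  simp only [e1]
  rw [integral_integral_swap_of_hasCompactSupport
    (f := fun x z => ψ z * (f x * (f x - f (x - z))))]
  · simp only [integral_const_mul]
    rw [← Real.norm_eq_abs]
    refine (norm_integral_le_of_norm_le (g := fun z => ψ z * (ε * R)) (iψ.mul_const _)
      (Filter.Eventually.of_forall fun z => ?_)).trans ?_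
    · rw [norm_mul, Real.norm_of_nonneg (hψ0 z)]
      by_cases hz : ψ z = 0
      · simp [hz]
      · refine mul_le_mul_of_nonneg_left ?_ (hψ0 z)
        refine (abs_integral_mul_sub_translate_le hf hc z).trans ?_
        have : ‖z‖ < ε := by simpa using hs hz
        exact mul_le_mul_of_nonneg_right this.le hR0
    · rw [integral_mul_const, hψ1, one_mul]
  · have := hf.continuous
    fun_prop
  · refine HasCompactSupport.of_support_subset_isCompact (hc.prod hψc) fun p hp => ?_
    constructor
    · by_contra h
      exact hp (by simp [Function.uncurry, image_eq_zero_of_notMem_tsupport h])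
    · by_contra h
      exact hp (by simp [Function.uncurry, image_eq_zero_of_notMem_tsupport h])

/-- **Rellich's theorem**, for a sequence that converges weakly to zero. -/
theorem tendsto_integral_sq_of_weakly_null {K : Set (Euc n)} (hK : IsCompact K)
    {f : ℕ → Euc n → ℝ} (hf : ∀ m, ContDiff ℝ 1 (f m)) (hs : ∀ m, tsupport (f m) ⊆ K) {C : ℝ}
    (hC : ∀ m, ∫ x, ‖f m x‖ ^ 2 ≤ C) (hC' : ∀ m, ∫ x, ‖fderiv ℝ (f m) x‖ ^ 2 ≤ C)
    (hw : ∀ φ : Euc n → ℝ, Continuous φ → HasCompactSupport φ →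
      Filter.Tendsto (fun m => ∫ x, φ x * f m x) Filter.atTop (nhds 0)) :
    Filter.Tendsto (fun m => ∫ x, ‖f m x‖ ^ 2) Filter.atTop (nhds 0) := by
  have hc : ∀ m, HasCompactSupport (f m) := fun m =>
    hK.of_isClosed_subset (isClosed_tsupport _) (hs m)
  have hC0 : 0 ≤ C := (integral_nonneg fun _ => by positivity).trans (hC 0)
  have hm : ∀ m, MemLp (f m) 2 := fun m => (hf m).continuous.memLp_of_hasCompactSupport (hc m)
  rw [Metric.tendsto_atTop]
  intro δ hδ
  obtain ⟨ε, hε, hεC⟩ : ∃ ε > 0, ε * C < δ / 2 :=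
    -- The summand `1` guards against `C = 0`.
    ⟨δ / 2 / (C + 1), by positivity, by
      rw [div_mul_eq_mul_div, div_lt_iff₀ (by positivity)]; nlinarith⟩
  let φ : ContDiffBump (0 : Euc n) := ⟨ε / 2, ε, by positivity, by linarith⟩
  let ψ : Euc n → ℝ := φ.normed volume
  have hψ : Continuous ψ := φ.continuous_normed
  have hψc : HasCompactSupport ψ := φ.hasCompactSupport_normed
  have hψ0 : ∀ z, 0 ≤ ψ z := φ.nonneg_normed
  have hψ1 : ∫ z, ψ z = 1 := φ.integral_normed
  have hψs : Function.support ψ ⊆ Metric.ball 0 ε := (φ.support_normed_eq).subset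
  -- The squared norm of `f m` splits into the pairing of `f m` with `f m - h m`, which is at most
  -- `ε * C`, and the pairing of `f m` with the mollification `h m`, which tends to zero.
  let h : ℕ → Euc n → ℝ := fun m x => ∫ z, ψ z * f m (x - z)
  have hh : ∀ m x, h m x = ∫ y, ψ (x - y) * f m y := fun m x => by
    rw [← integral_sub_left_eq_self (fun y => ψ (x - y) * f m y) volume x]
    simp [h]
  obtain ⟨B, hB⟩ := hψ.bounded_above_of_compact_support hψc
  have hhb : ∀ m x, ‖h m x‖ ≤ B * (√C * √(volume.real K)) := fun m x => by
    have hB0 : 0 ≤ B := (norm_nonneg _).trans (hB 0)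
    have hfK : ∫ y, ‖f m y‖ ≤ √C * √(volume.real K) := by
      have h1 : ∫ y, ‖f m y‖ = ∫ y in K, ‖f m y‖ * ‖(1 : ℝ)‖ := by
        rw [← setIntegral_eq_integral_of_forall_compl_eq_zero (s := K)]
        · simp
        · intro y hy
          rw [image_eq_zero_of_notMem_tsupport fun hy' => hy (hs m hy'), norm_zero]
      rw [h1]
      have : IsFiniteMeasure (volume.restrict K) := ⟨by simpa using hK.measure_lt_top⟩
      refine (integral_mul_norm_le ((hm m).restrict K) (memLp_const 1)).trans ?_
      refine mul_le_mul (Real.sqrt_le_sqrt ?_) ?_ (Real.sqrt_nonneg _) (Real.sqrt_nonneg _)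
      · refine (setIntegral_le_integral ?_ (Filter.Eventually.of_forall fun _ => by
          positivity)).trans (hC m)
        exact (memLp_two_iff_integrable_sq_norm (hm m).1).1 (hm m)
      · simp
    rw [hh]
    refine (norm_integral_le_of_norm_le (g := fun y => B * ‖f m y‖)
      (((hf m).continuous.integrable_of_hasCompactSupport (hc m)).norm.const_mul _)
      (Filter.Eventually.of_forall fun y => ?_)).trans ?_
    · rw [norm_mul]
      gcongr
      exact hB _
    · rw [integral_const_mul]
      gcongr
  have hhm : ∀ m, StronglyMeasurable (h m) := fun m => by
    have : Continuous fun p : Euc n × Euc n => ψ p.2 * f m (p.1 - p.2) :=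
      (hψ.comp continuous_snd).mul ((hf m).continuous.comp (by fun_prop))
    exact this.stronglyMeasurable.integral_prod_right (ν := volume)
  have : IsFiniteMeasure (volume.restrict K) := ⟨by simpa using hK.measure_lt_top⟩
  -- At each `x` the value `h m x` is the pairing of `f m` with a fixed test function, so it tends
  -- to zero by hypothesis. The uniform bound `hhb` on the finite measure space `K` permits
  -- dominated convergence.
  have hh0 : Filter.Tendsto (fun m => ∫ x in K, ‖h m x‖ ^ 2) Filter.atTop (nhds 0) := by
    have h0 : ∫ x in K, ‖(0 : ℝ)‖ ^ 2 = 0 := by simp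
    rw [← h0]
    refine tendsto_integral_of_dominated_convergence
      (fun _ => (B * (√C * √(volume.real K))) ^ 2) (fun m => ?_) (integrable_const _)
      (fun m => Filter.Eventually.of_forall fun x => ?_) (Filter.Eventually.of_forall fun x => ?_)
    · exact ((hhm m).norm.pow 2).aestronglyMeasurable
    · rw [Real.norm_of_nonneg (by positivity)]
      exact pow_le_pow_left₀ (norm_nonneg _) (hhb m x) 2
    · have := hw (fun y => ψ (x - y)) (hψ.comp (by fun_prop))
        (hψc.comp_homeomorph (Homeomorph.subLeft x))
      simp only [← hh] at this
      exact this.norm.pow 2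
  have hsq : Filter.Tendsto (fun m => √C * √(∫ x in K, ‖h m x‖ ^ 2)) Filter.atTop (nhds 0) := by
    simpa using ((Real.continuous_sqrt.tendsto _).comp hh0).const_mul (√C)
  obtain ⟨N, hN⟩ := (Metric.tendsto_atTop.1 hsq) (δ / 2) (by positivity)
  refine ⟨N, fun m hmN => ?_⟩
  have h1 := hN m hmN
  rw [Real.dist_0_eq_abs, abs_of_nonneg (by positivity)] at h1
  rw [Real.dist_0_eq_abs, abs_of_nonneg (integral_nonneg fun _ => by positivity)]
  have hhL : MemLp (h m) 2 (volume.restrict K) :=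
    MemLp.of_bound (hhm m).aestronglyMeasurable _ (Filter.Eventually.of_forall (hhb m))
  have hprod : ∫ x, f m x * h m x ≤ √C * √(∫ x in K, ‖h m x‖ ^ 2) := by
    have e : ∫ x, f m x * h m x = ∫ x in K, f m x * h m x := by
      rw [← setIntegral_eq_integral_of_forall_compl_eq_zero (s := K)]
      intro y hy
      rw [image_eq_zero_of_notMem_tsupport fun hy' => hy (hs m hy'), zero_mul]
    rw [e]
    have e2 : ∫ x in K, ‖f m x * h m x‖ = ∫ x in K, ‖f m x‖ * ‖h m x‖ := by simp only [norm_mul]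
    refine ((Real.le_norm_self _).trans ((norm_integral_le_integral_norm _).trans_eq e2)).trans
      ((integral_mul_norm_le ((hm m).restrict K) hhL).trans ?_)
    gcongr
    refine (setIntegral_le_integral ?_ (Filter.Eventually.of_forall fun _ => by
          positivity)).trans (hC m)
    exact (memLp_two_iff_integrable_sq_norm (hm m).1).1 (hm m)
  have hdiff := abs_integral_mul_sub_mollify_le (hf m) (hc m) hψ hψ0 hψ1 hψs hψc
  have i1 : Integrable fun x => f m x * f m x :=
    (hm m).integrable_mul (hm m)
  have i2 : Integrable fun x => f m x * h m x := by
    refine (((hf m).continuous.integrable_of_hasCompactSupport (hc m)).mul_bdd (c := _)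
      (hhm m).aestronglyMeasurable (Filter.Eventually.of_forall (hhb m)))
  have e3 : ∫ x, f m x * (f m x - h m x) = (∫ x, ‖f m x‖ ^ 2) - ∫ x, f m x * h m x := by
    simp only [mul_sub]
    rw [integral_sub i1 i2]
    congr 1
    refine integral_congr_ae (Filter.Eventually.of_forall fun x => ?_)
    simp [sq]
  have h5 := (abs_le.1 hdiff).2
  change ∫ x, f m x * (f m x - h m x) ≤ _ at h5
  rw [e3] at h5
  have h6 : ε * (√(∫ x, ‖f m x‖ ^ 2) * √(∫ x, ‖fderiv ℝ (f m) x‖ ^ 2)) ≤ ε * C := by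
    refine mul_le_mul_of_nonneg_left ?_ hε.le
    calc _ ≤ √C * √C := by
          gcongr
          · exact hC m
          · exact hC' m
      _ = C := Real.mul_self_sqrt hC0
  linarith

end Rellich

/-! ### Coordinate expressions of forms and their transformation under changes of chart. -/

section Charts
variable {n k : ℕ} {M : Type*} [TopologicalSpace M] [ChartedSpace (Euc n) M]

/-- The coordinates given by the chart at `x`. -/
abbrev coord (x : M) : M → Euc n := extChartAt (𝓡 n) x

/-- The inverse of the chart at `x`. -/
abbrev coordInv (x : M) : Euc n → M := (extChartAt (𝓡 n) x).symm

/-- The image of the chart at `x`. -/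
abbrev coordTarget (x : M) : Set (Euc n) := (extChartAt (𝓡 n) x).target

/-- The derivative of the inverse chart, in the model space. -/
def coordInvDeriv (x : M) (y : Euc n) : Euc n →L[ℝ] Euc n :=
  mfderiv 𝓘(ℝ, Euc n) (𝓡 n) (extChartAt (𝓡 n) x).symm y

/-- The derivative of the chart, in the model space. -/
def coordDeriv (x p : M) : Euc n →L[ℝ] Euc n :=
  mfderiv (𝓡 n) 𝓘(ℝ, Euc n) (extChartAt (𝓡 n) x) p

/-- The coordinate change. -/
def coordChange (x x' : M) (y : Euc n) : Euc n := coord x' (coordInv x y)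

theorem isOpen_coordTarget (x : M) : IsOpen (coordTarget (n := n) x) := isOpen_extChartAt_target x

theorem coordInv_mem {x : M} {y : Euc n} (hy : y ∈ coordTarget x) :
    coordInv x y ∈ (chartAt (Euc n) x).source := by
  rw [← extChartAt_source (𝓡 n)]
  exact (extChartAt (𝓡 n) x).map_target hy

theorem coord_mem {x p : M} (hp : p ∈ (chartAt (Euc n) x).source) :
    coord (n := n) x p ∈ coordTarget x :=
  (extChartAt (𝓡 n) x).map_source (by simpa using hp)

theorem coordInv_coord {x p : M} (hp : p ∈ (chartAt (Euc n) x).source) :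
    coordInv (n := n) x (coord x p) = p :=
  (extChartAt (𝓡 n) x).left_inv (by simpa using hp)

theorem coord_coordInv {x : M} {y : Euc n} (hy : y ∈ coordTarget x) :
    coord x (coordInv x y) = y :=
  (extChartAt (𝓡 n) x).right_inv hy

theorem isOpen_overlap (x : M) {U : Set M} (hU : IsOpen U) :
    IsOpen (coordTarget x ∩ coordInv (n := n) x ⁻¹' U) :=
  (continuousOn_extChartAt_symm x).isOpen_inter_preimage (isOpen_coordTarget x) hU

variable [IsManifold (𝓡 n) ∞ M]

theorem mdifferentiableAt_coordInv {x : M} {y : Euc n} (hy : y ∈ coordTarget x) :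
    MDifferentiableAt 𝓘(ℝ, Euc n) (𝓡 n) (coordInv x) y := by
  have : IsManifold (𝓡 n) 1 M := IsManifold.of_le (n := ∞) (by simp)
  have := mdifferentiableWithinAt_extChartAt_symm (I := 𝓡 n) hy
  rwa [modelWithCornersSelf_coe, Set.range_id, mdifferentiableWithinAt_univ] at this

theorem mdifferentiableAt_coord {x p : M} (hp : p ∈ (chartAt (Euc n) x).source) :
    MDifferentiableAt (𝓡 n) 𝓘(ℝ, Euc n) (coord (n := n) x) p := by
  have : IsManifold (𝓡 n) 1 M := IsManifold.of_le (n := ∞) (by simp)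
  exact mdifferentiableAt_extChartAt hp

theorem contDiffAt_coordChange {x x' : M} {y : Euc n} (hy : y ∈ coordTarget x)
    (hy' : coordInv x y ∈ (chartAt (Euc n) x').source) :
    ContDiffAt ℝ ∞ (coordChange x x') y := by
  have h1 := (contMDiffOn_extChartAt_symm (I := 𝓡 n) (n := ∞) x).contMDiffAt
    ((isOpen_coordTarget x).mem_nhds hy)
  have h2 := contMDiffAt_extChartAt' (I := 𝓡 n) (n := ∞) hy'
  exact contMDiffAt_iff_contDiffAt.1 (h2.comp y h1)

theorem coordDeriv_comp_coordInvDeriv {x x' : M} {y : Euc n} (hy : y ∈ coordTarget x)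
    (hy' : coordInv x y ∈ (chartAt (Euc n) x').source) :
    coordDeriv x' (coordInv x y) ∘L coordInvDeriv x y = fderiv ℝ (coordChange x x') y := by
  rw [← mfderiv_eq_fderiv]
  exact (mfderiv_comp y (mdifferentiableAt_coord hy') (mdifferentiableAt_coordInv hy)).symm

theorem coordDeriv_comp_self {x : M} {y : Euc n} (hy : y ∈ coordTarget x) :
    coordDeriv x (coordInv x y) ∘L coordInvDeriv x y = ContinuousLinearMap.id ℝ (Euc n) := by
  rw [coordDeriv_comp_coordInvDeriv hy (coordInv_mem hy), ← fderiv_id (x := y)]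
  refine Filter.EventuallyEq.fderiv_eq ?_
  filter_upwards [(isOpen_coordTarget x).mem_nhds hy] with z hz
  exact coord_coordInv hz

/-- The derivative of a map into `M`, in the model space. -/
def modelDeriv (f : Euc n → M) (y : Euc n) : Euc n →L[ℝ] Euc n :=
  mfderiv 𝓘(ℝ, Euc n) (𝓡 n) f y

theorem modelDeriv_comp {f : Euc n → M} {h : Euc n → Euc n} {y : Euc n}
    (hf : MDifferentiableAt 𝓘(ℝ, Euc n) (𝓡 n) f (h y)) (hh : DifferentiableAt ℝ h y) :
    modelDeriv (f ∘ h) y = modelDeriv f (h y) ∘L fderiv ℝ h y := by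
  have h1 := mfderiv_comp y hf (mdifferentiableAt_iff_differentiableAt.2 hh)
  rw [mfderiv_eq_fderiv] at h1
  exact h1

theorem modelDeriv_congr {f e : Euc n → M} {y : Euc n} (h : f =ᶠ[nhds y] e) :
    modelDeriv f y = modelDeriv e y := h.mfderiv_eq

theorem coordInvDeriv_comp_fderiv {x x' : M} {y : Euc n} (hy : y ∈ coordTarget x)
    (hy' : coordInv x y ∈ (chartAt (Euc n) x').source) :
    coordInvDeriv x' (coordChange x x' y) ∘L fderiv ℝ (coordChange x x') y =
      coordInvDeriv x y := by
  have h2 : coordInv (n := n) x' ∘ coordChange x x' =ᶠ[nhds y] coordInv x := by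
    filter_upwards [(isOpen_overlap x (chartAt (Euc n) x').open_source).mem_nhds ⟨hy, hy'⟩]
      with z hz
    exact coordInv_coord hz.2
  have h4 := (contDiffAt_coordChange hy hy').differentiableAt (by simp)
  have h5 : MDifferentiableAt 𝓘(ℝ, Euc n) (𝓡 n) (coordInv x') (coordChange x x' y) :=
    mdifferentiableAt_coordInv (coord_mem hy')
  have h6 := modelDeriv_comp h5 h4
  have h7 := modelDeriv_congr h2
  exact h6.symm.trans h7

/-- A form on `M`, with values in the fixed space of forms on `ℝⁿ`. -/
def rawForm (u : KForm n M k) : M → Alt n k := u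

theorem pullChart_eq (x : M) (u : KForm n M k) (y : Euc n) :
    pullChart x u y = (rawForm u (coordInv x y)).compContinuousLinearMap (coordInvDeriv x y) := rfl

/-- The chart expressions of a form are related by pullback. -/
theorem pullChart_eq_pullback (u : KForm n M k) {x x' : M} {y : Euc n} (hy : y ∈ coordTarget x)
    (hy' : coordInv x y ∈ (chartAt (Euc n) x').source) :
    pullChart x u y = (pullChart x' u (coordChange x x' y)).compContinuousLinearMap
      (fderiv ℝ (coordChange x x') y) := by
  have h1 : coordInv x' (coordChange x x' y) = coordInv x y := coordInv_coord hy'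
  rw [pullChart_eq, pullChart_eq, h1, ← coordInvDeriv_comp_fderiv hy hy']
  rfl

theorem frame_eq_coordInvDeriv {x : M} {y : Euc n} (hy : y ∈ coordTarget x) (i : Fin n) :
    frame x (coordInv x y) i = coordInvDeriv x y (stdVec i) := by
  have : frame x (coordInv x y) i = coordInvDeriv x (coord x (coordInv x y)) (stdVec i) := rfl
  rw [this, coord_coordInv hy]

theorem comp_pullChart (u : KForm n M k) {x : M} {y : Euc n} (hy : y ∈ coordTarget x)
    (I : Fin k → Fin n) :
    comp I (pullChart x u y) = u (coordInv x y) (frame x (coordInv x y) ∘ I) := by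
  have : frame x (coordInv x y) ∘ I = fun m => coordInvDeriv x y (stdVec (I m)) :=
    funext fun m => frame_eq_coordInvDeriv hy (I m)
  rw [this]
  rfl

/-- The exterior derivative is computed by the same formula in every chart. -/
theorem pullChart_extD {u : KForm n M k}
    (hu : ∀ x : M, ContDiffOn ℝ ∞ (pullChart x u) (coordTarget x)) (x : M) {y : Euc n}
    (hy : y ∈ coordTarget x) : pullChart x (extD u) y = extDeriv (pullChart x u) y := by
  set p := coordInv x y with hp
  have hyp : coordInv x y ∈ (chartAt (Euc n) p).source := mem_chart_source _ p
  have h1 : pullChart x (extD u) y = (extDeriv (pullChart p u)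
      (coordChange x p y)).compContinuousLinearMap (fderiv ℝ (coordChange x p) y) := by
    rw [← coordDeriv_comp_coordInvDeriv hy hyp]
    rfl
  -- At `p` the form `extD u` is computed in the chart at `p` itself; naturality of the exterior
  -- derivative under the transition map carries the computation to the chart at `x`.
  have h2 : extDeriv (pullChart x u) y = extDeriv (fun z => (pullChart p u
      (coordChange x p z)).compContinuousLinearMap (fderiv ℝ (coordChange x p) z)) y := by
    refine congrArg _ (Filter.EventuallyEq.fderiv_eq ?_)
    filter_upwards [(isOpen_overlap x (chartAt (Euc n) p).open_source).mem_nhds ⟨hy, hyp⟩]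
      with z hz
    exact pullChart_eq_pullback u hz.1 hz.2
  rw [h1, h2, extDeriv_pullback (r := ∞)]
  · exact ((hu p).contDiffAt ((isOpen_coordTarget p).mem_nhds (coord_mem hyp))).differentiableAt
      (by simp)
  · exact contDiffAt_coordChange hy hyp
  · rw [minSmoothness_of_isRCLikeNormedField]
    exact WithTop.coe_le_coe.2 le_top

/-- The components of a pullback are polynomials in the entries of the linear map, with the
components of the form as coefficients. -/
theorem contDiffAt_compContinuousLinearMap {F : Type*} [NormedAddCommGroup F] [NormedSpace ℝ F]
    {m : WithTop ℕ∞} {α : F → Alt n k} {L : F → Euc n →L[ℝ] Euc n} {y : F}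
    (hα : ContDiffAt ℝ m α y) (hL : ContDiffAt ℝ m L y) :
    ContDiffAt ℝ m (fun z => (α z).compContinuousLinearMap (L z)) y := by
  have key : ∀ (β : Alt n k) (A : Euc n →L[ℝ] Euc n) (I : Fin k → Fin n),
      comp I (β.compContinuousLinearMap A) =
        ∑ J : Fin k → Fin n, (∏ l, A (stdVec (I l)) (J l)) * comp J β := fun β A I => by
    have h2 := β.toMultilinearMap.map_sum (fun l i => A (stdVec (I l)) i • (stdVec i : Euc n))
    simp only [MultilinearMap.map_smul_univ, sum_smul_stdVec] at h2
    simpa [Function.comp_def] using h2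
  obtain ⟨r, hr⟩ := exists_compL_leftInverse (n := n) (k := k)
  have h1 : ContDiffAt ℝ m (fun z => compL n k ((α z).compContinuousLinearMap (L z))) y := by
    refine contDiffAt_pi.2 fun I => ?_
    have : (fun z => compL n k ((α z).compContinuousLinearMap (L z)) I) = fun z =>
        ∑ J : Fin k → Fin n, (∏ l, L z (stdVec (I l)) (J l)) * comp J (α z) :=
      funext fun z => key _ _ I
    rw [this]
    refine ContDiffAt.sum fun J _ => ?_
    refine (contDiffAt_prod fun l _ => ?_).mul ((comp J).contDiff.contDiffAt.comp y hα)
    exact (EuclideanSpace.proj (𝕜 := ℝ) (J l)).contDiff.contDiffAt.comp y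
      (hL.clm_apply contDiffAt_const)
  exact (r.contDiff.contDiffAt.comp y h1).congr_of_eventuallyEq
    (Filter.Eventually.of_forall fun z => (hr _).symm)

open Classical in
/-- The form on `M` that is `w` in the chart at `x` and vanishes outside of the chart domain. -/
def pushChart (x : M) (w : Euc n → Alt n k) : KForm n M k := fun p =>
  if p ∈ (chartAt (Euc n) x).source then
    (w (coord x p)).compContinuousLinearMap (coordDeriv x p) else 0

theorem pushChart_of_mem {x p : M} (w : Euc n → Alt n k) (hp : p ∈ (chartAt (Euc n) x).source) :
    rawForm (pushChart x w) p = (w (coord x p)).compContinuousLinearMap (coordDeriv x p) :=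
  if_pos hp

theorem pushChart_of_notMem {x p : M} (w : Euc n → Alt n k)
    (hp : p ∉ (chartAt (Euc n) x).source) : rawForm (pushChart x w) p = 0 :=
  if_neg hp

theorem pullChart_pushChart {x : M} (w : Euc n → Alt n k) {y : Euc n} (hy : y ∈ coordTarget x) :
    pullChart x (pushChart x w) y = w y := by
  rw [pullChart_eq, pushChart_of_mem w (coordInv_mem hy), coord_coordInv hy]
  have : ((w y).compContinuousLinearMap (coordDeriv x (coordInv x y))).compContinuousLinearMap
      (coordInvDeriv x y) = (w y).compContinuousLinearMap
        (coordDeriv x (coordInv x y) ∘L coordInvDeriv x y) := rfl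
  rw [this, coordDeriv_comp_self hy]
  rfl

/-- In another chart, over the domain of the chart at `x`, the form is the pullback of `w` by a
smooth transition map. Elsewhere the point avoids `K`, which is closed because `M` is Hausdorff, so
the form vanishes nearby. -/
theorem isTestForm_pushChart [T2Space M] {x : M} {Ω : Set M} {w : Euc n → Alt n k} {K : Set M}
    (hK : IsCompact K) (hKx : K ⊆ (chartAt (Euc n) x).source) (hKΩ : K ⊆ Ω)
    (hw : ContDiffOn ℝ ∞ w (coordTarget x))
    (hz : ∀ p ∈ (chartAt (Euc n) x).source, p ∉ K → w (coord x p) = 0) :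
    IsTestForm Ω (pushChart x w) := by
  have hzero : ∀ p, p ∉ K → rawForm (pushChart x w) p = 0 := fun p hp => by
    by_cases hpx : p ∈ (chartAt (Euc n) x).source
    · rw [pushChart_of_mem w hpx, hz p hpx hp]
      rfl
    · exact pushChart_of_notMem w hpx
  refine ⟨fun x' y hy => ContDiffAt.contDiffWithinAt ?_, K, hK, hKΩ, hzero⟩
  by_cases hyK : coordInv x' y ∈ (chartAt (Euc n) x).source
  · have h1 : ContDiffAt ℝ ∞ (fun z => (w (coordChange x' x z)).compContinuousLinearMap
        (fderiv ℝ (coordChange x' x) z)) y := by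
      have hc := contDiffAt_coordChange hy hyK
      refine contDiffAt_compContinuousLinearMap ?_ (hc.fderiv_right (by simp))
      exact (hw.contDiffAt ((isOpen_coordTarget x).mem_nhds (coord_mem hyK))).comp y hc
    refine h1.congr_of_eventuallyEq ?_
    filter_upwards [(isOpen_overlap x' (chartAt (Euc n) x).open_source).mem_nhds ⟨hy, hyK⟩]
      with z hz
    rw [pullChart_eq_pullback _ hz.1 hz.2, show pullChart x (pushChart x w)
      (coordChange x' x z) = _ from pullChart_pushChart w (coord_mem hz.2)]
  · have h1 : coordInv x' y ∈ Kᶜ := fun h => hyK (hKx h)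
    refine (contDiffAt_const (c := (0 : Alt n k))).congr_of_eventuallyEq ?_
    filter_upwards [(isOpen_overlap x' hK.isClosed.isOpen_compl).mem_nhds ⟨hy, h1⟩] with z hz
    rw [pullChart_eq, hzero _ hz.2]
    rfl

end Charts

/-! ### The metric and the Riemannian volume in charts. -/

section ChartMetric
variable {n k : ℕ} {M : Type*} [TopologicalSpace M] [ChartedSpace (Euc n) M]
  [IsManifold (𝓡 n) ∞ M]

/-- The Gram matrix of the metric in the chart at `x`. -/
def chartGram (g : SmoothMetric n M) (x : M) (y : Euc n) : Matrix (Fin n) (Fin n) ℝ :=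
  gram (g.inner (coordInv x y)) (frame x (coordInv x y))

/-- The inverse Gram matrix of the metric in the chart at `x`. -/
def chartInv (g : SmoothMetric n M) (x : M) (y : Euc n) : Matrix (Fin n) (Fin n) ℝ :=
  (chartGram g x y)⁻¹

/-- The volume density in the chart at `x`. -/
def chartDens (g : SmoothMetric n M) (x : M) (y : Euc n) : ℝ := √(chartGram g x y).det

/-- The metric at `p` as a bilinear form on the model space. -/
def rawMetric (g : SmoothMetric n M) (p : M) : Euc n →L[ℝ] Euc n →L[ℝ] ℝ := g.inner p

theorem rawMetric_symm (g : SmoothMetric n M) (p : M) (v w : Euc n) :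
    rawMetric g p v w = rawMetric g p w v := g.symm p v w

theorem rawMetric_pos (g : SmoothMetric n M) (p : M) {v : Euc n} (hv : v ≠ 0) :
    0 < rawMetric g p v v := g.pos p v hv

theorem contMDiffOn_gram (g : SmoothMetric n M) (x₀ : M) (i j : Fin n) :
    ContMDiffOn (𝓡 n) 𝓘(ℝ, ℝ) ∞ (fun p => g.inner p (frame x₀ p i) (frame x₀ p j))
      (chartAt (Euc n) x₀).source := by
  let e := trivializationAt (Euc n) (TangentSpace (𝓡 n)) x₀
  have hs : e.baseSet = (chartAt (Euc n) x₀).source := by simp [e]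
  have hfr : ∀ i, ContMDiffOn (𝓡 n) ((𝓡 n).prod 𝓘(ℝ, Euc n)) ∞
      (fun p => TotalSpace.mk' (Euc n) (E := (TangentSpace (𝓡 n) : M → Type)) p (frame x₀ p i))
      e.baseSet := fun i => by
    rw [e.contMDiffOn_section_baseSet_iff]
    refine (contMDiffOn_const (c := (EuclideanSpace.single i (1 : ℝ) : Euc n))).congr ?_
    intro y hy
    rw [frame_eq_symm (hs ▸ hy)]
    rw [Trivialization.symmL_apply (R := ℝ) _ hy, Trivialization.apply_mk_symm _ hy]
  have := (g.contMDiff.contMDiffOn (s := e.baseSet)).clm_bundle_apply₂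
    (F₃ := ℝ) (E₃ := Bundle.Trivial M ℝ) (hfr i) (hfr j)
  rw [← hs]
  intro p hp
  have h2 := this p hp
  simp only [contMDiffWithinAt_totalSpace] at h2
  exact h2.2

theorem contDiffOn_chartGram (g : SmoothMetric n M) (x : M) (i j : Fin n) :
    ContDiffOn ℝ ∞ (fun y => chartGram g x y i j) (coordTarget x) := by
  have h := (contMDiffOn_gram g x i j).comp
    (contMDiffOn_extChartAt_symm (I := 𝓡 n) (n := ∞) x) fun y hy => coordInv_mem hy
  exact contMDiffOn_iff_contDiffOn.1 h

theorem chartGram_apply (g : SmoothMetric n M) {x : M} {y : Euc n} (hy : y ∈ coordTarget x)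
    (i j : Fin n) : chartGram g x y i j = rawMetric g (coordInv x y)
      (coordInvDeriv x y (stdVec i)) (coordInvDeriv x y (stdVec j)) := by
  rw [← frame_eq_coordInvDeriv hy, ← frame_eq_coordInvDeriv hy]
  rfl

theorem chartGram_dotProduct (g : SmoothMetric n M) {x : M} {y : Euc n} (hy : y ∈ coordTarget x)
    (a b : Fin n → ℝ) : a ⬝ᵥ chartGram g x y *ᵥ b = rawMetric g (coordInv x y)
      (coordInvDeriv x y (WithLp.toLp 2 a)) (coordInvDeriv x y (WithLp.toLp 2 b)) := by
  have h : ∀ c : Fin n → ℝ, WithLp.toLp 2 c = ∑ i, c i • (stdVec i : Euc n) := fun c =>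
    (sum_smul_stdVec (WithLp.toLp 2 c)).symm
  rw [h a, h b]
  simp only [dotProduct, Matrix.mulVec, chartGram_apply g hy, map_sum, map_smul,
    sum_apply, smul_apply, smul_eq_mul, Finset.mul_sum]
  refine Finset.sum_comm.trans ?_
  refine Finset.sum_congr rfl fun i _ => Finset.sum_congr rfl fun j _ => ?_
  ring

theorem chartGram_posDef (g : SmoothMetric n M) {x : M} {y : Euc n} (hy : y ∈ coordTarget x) :
    (chartGram g x y).PosDef := by
  refine Matrix.PosDef.of_dotProduct_mulVec_pos ?_ fun {c} hc => ?_
  · ext i j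
    simp only [Matrix.conjTranspose_apply, star_trivial, chartGram_apply g hy]
    exact rawMetric_symm _ _ _ _
  · rw [star_trivial, chartGram_dotProduct g hy]
    refine rawMetric_pos _ _ fun h => hc ?_
    have h1 := congrArg (coordDeriv x (coordInv x y)) h
    rw [← ContinuousLinearMap.comp_apply, coordDeriv_comp_self hy, map_zero] at h1
    exact congrArg WithLp.ofLp h1

theorem isLocalMetric_chart (g : SmoothMetric n M) (x : M) :
    IsLocalMetric (coordTarget x) (chartInv g x) (chartDens g x) := by
  have hG := contDiffOn_chartGram g x
  have hdet : ContDiffOn ℝ ∞ (fun y => (chartGram g x y).det) (coordTarget x) := by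
    simp only [Matrix.det_apply]
    exact ContDiffOn.sum fun σ _ => (contDiffOn_prod fun i _ => hG _ _).const_smul _
  have hadj : ∀ i j, ContDiffOn ℝ ∞ (fun y => (chartGram g x y).adjugate i j)
      (coordTarget x) := fun i j => by
    simp only [Matrix.adjugate_apply, Matrix.det_apply]
    refine ContDiffOn.sum fun σ _ => (contDiffOn_prod fun l _ => ?_).const_smul _
    by_cases hl : σ l = j
    · simp only [hl, Matrix.updateRow_self]
      exact contDiffOn_const
    · simp only [Matrix.updateRow_ne hl]
      exact hG _ _
  have hpos : ∀ y ∈ coordTarget x, 0 < (chartGram g x y).det := fun y hy =>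
    (chartGram_posDef g hy).det_pos
  refine ⟨isOpen_coordTarget x, fun i j => ?_, fun y hy => (chartGram_posDef g hy).inv,
    hdet.sqrt fun y hy => (hpos y hy).ne', fun y hy => Real.sqrt_pos.2 (hpos y hy)⟩
  refine ((hdet.inv fun y hy => (hpos y hy).ne').mul (hadj i j)).congr fun y hy => ?_
  simp [chartInv, Matrix.inv_def]

theorem formInner_coordInv (g : SmoothMetric n M) {x : M} {y : Euc n} (hy : y ∈ coordTarget x)
    (u v : KForm n M k) : formInner g (coordInv x y) (u (coordInv x y)) (v (coordInv x y)) =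
      matInner (chartInv g x y) (pullChart x u y) (pullChart x v y) := by
  rw [formInner_eq_frame g (coordInv_mem hy), matInner_apply]
  simp only [altInner, ← comp_apply, comp_pullChart _ hy]
  rfl

/-- The Gram matrices are related by `G = Pᵀ * G' * P` with `P` the Jacobian matrix of the
coordinate change; the square root of the determinant picks up `|det P|`. -/
theorem chartDens_eq (g : SmoothMetric n M) {x x' : M} {y : Euc n} (hy : y ∈ coordTarget x)
    (hy' : coordInv x y ∈ (chartAt (Euc n) x').source) :
    chartDens g x y = |(fderiv ℝ (coordChange x x') y).det| *
      chartDens g x' (coordChange x x' y) := by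
  set L := fderiv ℝ (coordChange x x') y with hL
  set P : Matrix (Fin n) (Fin n) ℝ := Matrix.of fun a j => L (stdVec j) a with hP
  have hmem : coordChange x x' y ∈ coordTarget x' := coord_mem hy'
  have hpt : coordInv x' (coordChange x x' y) = coordInv x y := coordInv_coord hy'
  have hvec : ∀ j, coordInvDeriv x y (stdVec j) =
      ∑ a, P a j • coordInvDeriv x' (coordChange x x' y) (stdVec a) := fun j => by
    rw [← coordInvDeriv_comp_fderiv hy hy', ContinuousLinearMap.comp_apply, ← hL,
      ← sum_smul_stdVec (L (stdVec j)), map_sum]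
    simp [hP]
  have hG : chartGram g x y = Pᵀ * chartGram g x' (coordChange x x' y) * P := by
    ext i j
    rw [chartGram_apply g hy, hvec, hvec]
    simp only [Matrix.mul_apply, Matrix.transpose_apply, chartGram_apply g hmem, hpt, map_sum,
      map_smul, sum_apply, smul_apply, smul_eq_mul,
      Finset.mul_sum, Finset.sum_mul]
    congr! 2
    ring
  have hdet : L.det = P.det := by
    have : P = LinearMap.toMatrix (EuclideanSpace.basisFun (Fin n) ℝ).toBasis
        (EuclideanSpace.basisFun (Fin n) ℝ).toBasis (L : Euc n →ₗ[ℝ] Euc n) := by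
      ext a j
      simp [LinearMap.toMatrix_apply, hP, stdVec]
    rw [this, LinearMap.det_toMatrix]
  rw [chartDens, hG, Matrix.det_mul, Matrix.det_mul, Matrix.det_transpose, hdet, mul_right_comm,
    Real.sqrt_mul (mul_self_nonneg _), Real.sqrt_mul_self_eq_abs, chartDens]

variable [MeasurableSpace M] [BorelSpace M]

/-- The inverse chart as a map on its domain. -/
def coordEmb (x : M) (z : coordTarget (n := n) x) : M := coordInv x (z : Euc n)

/-- The inverse chart on its domain is an open embedding. Transport along a measurable embedding
moves integrals and null sets without measurability assumptions on the integrand. -/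
theorem measurableEmbedding_coordEmb (x : M) : MeasurableEmbedding (coordEmb (n := n) x) := by
  have hc : Continuous (coordEmb (n := n) x) :=
    continuousOn_iff_continuous_domRestrict.1 (continuousOn_extChartAt_symm (I := 𝓡 n) x)
  have ho : Topology.IsOpenEmbedding (coordEmb (n := n) x) := by
    refine Topology.IsOpenEmbedding.of_continuous_injective_isOpenMap hc ?_ ?_
    · intro y z h
      have := congrArg (coord (n := n) x) h
      simp only [coordEmb] at this
      rw [coord_coordInv y.2, coord_coordInv z.2] at this
      exact Subtype.ext this
    · intro U hU
      have h1 : IsOpen (Subtype.val '' U) := (isOpen_coordTarget x).isOpenMap_subtype_val U hU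
      have h2 : coordEmb x '' U = (chartAt (Euc n) x).source ∩ coord x ⁻¹' (Subtype.val '' U) := by
        ext p
        constructor
        · rintro ⟨z, hz, rfl⟩
          exact ⟨coordInv_mem z.2, z, hz, (coord_coordInv z.2).symm⟩
        · rintro ⟨hp, z, hz, hzp⟩
          exact ⟨z, hz, by rw [coordEmb, hzp, coordInv_coord hp]⟩
      rw [h2, ← extChartAt_source (𝓡 n)]
      exact (continuousOn_extChartAt x).isOpen_inter_preimage (isOpen_extChartAt_source x) h1
  exact ho.measurableEmbedding

/-- The Riemannian measure on the domain of the chart at `x`. -/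
def chartMeasure (g : SmoothMetric n M) (x : M) : Measure M :=
  Measure.map (coordInv x) ((volume.restrict (coordTarget x)).withDensity fun y =>
    ENNReal.ofReal (chartDens g x y))

theorem riemannianVolume_eq (g : SmoothMetric n M) : riemannianVolume g = ⨆ x, chartMeasure g x :=
  rfl

theorem measurableSet_coord_preimage {x : M} {A : Set M} (hA : MeasurableSet A) :
    MeasurableSet (coordTarget (n := n) x ∩ coordInv x ⁻¹' A) := by
  have h := (MeasurableEmbedding.subtype_coe (isOpen_coordTarget x).measurableSet).measurableSet_image.2
    ((measurableEmbedding_coordEmb (n := n) x).measurable hA)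
  convert h using 1
  ext y
  constructor
  · exact fun hy => ⟨⟨y, hy.1⟩, hy.2, rfl⟩
  · rintro ⟨z, hz, rfl⟩
    exact ⟨z.2, hz⟩

theorem aemeasurable_coordInv (x : M) :
    AEMeasurable (coordInv (n := n) x) (volume.restrict (coordTarget x)) :=
  (continuousOn_extChartAt_symm x).aemeasurable (isOpen_coordTarget x).measurableSet

theorem chartMeasure_apply (g : SmoothMetric n M) (x : M) {A : Set M} (hA : MeasurableSet A) :
    chartMeasure g x A =
      ∫⁻ y in coordTarget x ∩ coordInv x ⁻¹' A, ENNReal.ofReal (chartDens g x y) := by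
  rw [chartMeasure, Measure.map_apply_of_aemeasurable
    ((aemeasurable_coordInv x).mono_ac (withDensity_absolutelyContinuous _ _)) hA,
    withDensity_apply', Measure.restrict_restrict' (isOpen_coordTarget x).measurableSet,
    Set.inter_comm]

/-- On overlaps the local measures agree: the change of variables formula for the transition map
produces exactly the Jacobian factor of `chartDens_eq`. -/
theorem chartMeasure_inter (g : SmoothMetric n M) (x x' : M) {A : Set M} (hA : MeasurableSet A)
    (hAx : A ⊆ (chartAt (Euc n) x).source) :
    chartMeasure g x' A = chartMeasure g x (A ∩ (chartAt (Euc n) x').source) := by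
  rw [chartMeasure_apply g x' hA, chartMeasure_apply g x
    (hA.inter (chartAt (Euc n) x').open_source.measurableSet)]
  set s := coordTarget (n := n) x' ∩ coordInv x' ⁻¹' A
  have hs : ∀ y ∈ s, y ∈ coordTarget x' ∧ coordInv x' y ∈ (chartAt (Euc n) x).source :=
    fun y hy => ⟨hy.1, hAx hy.2⟩
  have him : coordChange x' x '' s = coordTarget (n := n) x ∩
      coordInv x ⁻¹' (A ∩ (chartAt (Euc n) x').source) := by
    ext z
    constructor
    · rintro ⟨y, hy, rfl⟩
      refine ⟨coord_mem (hs y hy).2, ?_⟩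
      have : coordInv x (coordChange x' x y) = coordInv x' y := coordInv_coord (hs y hy).2
      rw [Set.mem_preimage, this]
      exact ⟨hy.2, coordInv_mem hy.1⟩
    · rintro ⟨hz, hzA, hzx⟩
      refine ⟨coord x' (coordInv x z), ⟨coord_mem hzx, ?_⟩, ?_⟩
      · rw [Set.mem_preimage, coordInv_coord hzx]
        exact hzA
      · rw [coordChange, coordInv_coord hzx, coord_coordInv hz]
  have hinj : Set.InjOn (coordChange x' x) s := by
    intro y hy z hz h
    have h1 : coordInv x' y = coordInv x' z := by
      have := congrArg (coordInv (n := n) x) h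
      rwa [show coordInv x (coordChange x' x y) = _ from coordInv_coord (hs y hy).2,
        show coordInv x (coordChange x' x z) = _ from coordInv_coord (hs z hz).2] at this
    rw [← coord_coordInv hy.1, h1, coord_coordInv hz.1]
  rw [← him, lintegral_image_eq_lintegral_abs_det_fderiv_mul volume
    (measurableSet_coord_preimage hA) (f' := fderiv ℝ (coordChange x' x)) (fun y hy =>
      ((contDiffAt_coordChange (hs y hy).1 (hs y hy).2).differentiableAt
        (by simp)).hasFDerivAt.hasFDerivWithinAt) hinj]
  refine setLIntegral_congr_fun (measurableSet_coord_preimage hA) fun y hy => ?_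
  rw [chartDens_eq g (hs y hy).1 (hs y hy).2, ENNReal.ofReal_mul (abs_nonneg _)]

/-- Only the upper bound needs an argument. On `U` every chart measure is dominated by the one of
the chart at `x`, so that measure plus the part of the volume off `U` is an upper bound for the
supremum; restricting to `U` removes the second summand. -/
theorem restrict_riemannianVolume (g : SmoothMetric n M) (x : M) :
    (riemannianVolume g).restrict (chartAt (Euc n) x).source = chartMeasure g x := by
  set U := (chartAt (Euc n) x).source with hU
  have hUm : MeasurableSet U := (chartAt (Euc n) x).open_source.measurableSet
  have hself : (chartMeasure g x).restrict U = chartMeasure g x := by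
    ext A hA
    rw [Measure.restrict_apply hA, chartMeasure_apply g x hA, chartMeasure_apply g x (hA.inter hUm)]
    congr 2
    ext y
    simp only [Set.mem_inter_iff, Set.mem_preimage, hU]
    exact ⟨fun h => ⟨h.1, h.2.1⟩, fun h => ⟨h.1, h.2, coordInv_mem h.1⟩⟩
  have hle : ∀ x', chartMeasure g x' ≤ riemannianVolume g := fun x' => by
    rw [riemannianVolume_eq]
    exact le_iSup (chartMeasure g) x'
  refine le_antisymm ?_ ?_
  · have h1 : riemannianVolume g ≤ chartMeasure g x + (riemannianVolume g).restrict Uᶜ := by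
      conv_lhs => rw [riemannianVolume_eq]
      refine iSup_le fun x' => ?_
      rw [← Measure.restrict_add_restrict_compl (μ := chartMeasure g x') hUm]
      refine add_le_add ?_ (Measure.restrict_mono le_rfl (hle x'))
      refine Measure.le_iff.2 fun A hA => ?_
      rw [Measure.restrict_apply hA, chartMeasure_inter g x x' (hA.inter hUm) Set.inter_subset_right]
      exact measure_mono fun p hp => hp.1.1
    refine (Measure.restrict_mono le_rfl h1).trans ?_
    rw [Measure.restrict_add, hself, Measure.restrict_restrict hUm, Set.inter_compl_self,
      Measure.restrict_empty, add_zero]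
  · rw [← hself]
    exact Measure.restrict_mono le_rfl (hle x)

theorem chartMeasure_eq_map (g : SmoothMetric n M) (x : M) : chartMeasure g x =
    Measure.map (coordEmb x) ((Measure.comap Subtype.val volume).withDensity
      fun z : coordTarget (n := n) x => ENNReal.ofReal (chartDens g x (z : Euc n))) := by
  have hT := (isOpen_coordTarget (n := n) x).measurableSet
  ext A hA
  rw [chartMeasure_apply g x hA, (measurableEmbedding_coordEmb x).map_apply,
    withDensity_apply _ ((measurableEmbedding_coordEmb (n := n) x).measurable hA),
    setLIntegral_subtype hT _ fun y => ENNReal.ofReal (chartDens g x y)]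
  congr 2
  ext y
  constructor
  · exact fun hy => ⟨⟨y, hy.1⟩, hy.2, rfl⟩
  · rintro ⟨z, hz, rfl⟩
    exact ⟨z.2, hz⟩

theorem measurable_chartDens (g : SmoothMetric n M) (x : M) :
    Measurable fun z : coordTarget (n := n) x => chartDens g x (z : Euc n) :=
  (continuousOn_iff_continuous_domRestrict.1
    (isLocalMetric_chart g x).smooth_dens.continuousOn).measurable

/-- The density is positive, so the null sets are those of Lebesgue measure. -/
theorem ae_chartMeasure_iff (g : SmoothMetric n M) (x : M) {P : M → Prop} :
    (∀ᵐ p ∂chartMeasure g x, P p) ↔ ∀ᵐ y ∂volume.restrict (coordTarget (n := n) x), P (coordInv x y) := by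
  rw [chartMeasure_eq_map, (measurableEmbedding_coordEmb x).ae_map_iff,
    ae_withDensity_iff (measurable_chartDens g x).ennreal_ofReal,
    ae_restrict_iff_subtype (isOpen_coordTarget x).measurableSet]
  have h : ∀ z : coordTarget (n := n) x, ENNReal.ofReal (chartDens g x (z : Euc n)) ≠ 0 := fun z => by
    simpa using (isLocalMetric_chart g x).dens_pos z z.2
  simp only [ne_eq, h, not_false_eq_true, true_imp_iff]
  rfl

theorem integral_chartMeasure (g : SmoothMetric n M) (x : M) (f : M → ℝ) :
    ∫ p, f p ∂chartMeasure g x = ∫ y in coordTarget x, chartDens g x y * f (coordInv x y) := by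
  rw [chartMeasure_eq_map, (measurableEmbedding_coordEmb x).integral_map,
    ← integral_subtype_comap (isOpen_coordTarget x).measurableSet]
  rw [integral_withDensity_eq_integral_toReal_smul (measurable_chartDens g x).ennreal_ofReal
    (by simp)]
  refine integral_congr_ae (Filter.Eventually.of_forall fun z => ?_)
  simp only [smul_eq_mul]
  rw [ENNReal.toReal_ofReal ((isLocalMetric_chart g x).dens_pos z z.2).le]
  rfl

theorem integrable_chartMeasure_iff (g : SmoothMetric n M) (x : M) {f : M → ℝ} :
    Integrable f (chartMeasure g x) ↔
      IntegrableOn (fun y => chartDens g x y * f (coordInv x y)) (coordTarget x) := by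
  rw [chartMeasure_eq_map, (measurableEmbedding_coordEmb x).integrable_map_iff,
    integrable_withDensity_iff_integrable_smul' (measurable_chartDens g x).ennreal_ofReal
    (by simp), integrableOn_iff_comap_subtypeVal (isOpen_coordTarget x).measurableSet]
  refine integrable_congr (Filter.Eventually.of_forall fun z => ?_)
  simp only [smul_eq_mul, Function.comp_apply]
  rw [ENNReal.toReal_ofReal ((isLocalMetric_chart g x).dens_pos z z.2).le]
  rfl

theorem aemeasurable_chartMeasure_iff (g : SmoothMetric n M) (x : M) {f : M → ℝ} :
    AEMeasurable f (chartMeasure g x) ↔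
      AEMeasurable (fun y => f (coordInv x y)) (volume.restrict (coordTarget (n := n) x)) := by
  have hT := (isOpen_coordTarget (n := n) x).measurableSet
  rw [chartMeasure_eq_map, (measurableEmbedding_coordEmb x).aemeasurable_map_iff]
  have h1 : AEMeasurable (fun y => f (coordInv x y)) (volume.restrict (coordTarget (n := n) x)) ↔
      AEMeasurable (f ∘ coordEmb (n := n) x) (Measure.comap Subtype.val volume) := by
    rw [← map_comap_subtype_coe hT, (MeasurableEmbedding.subtype_coe hT).aemeasurable_map_iff]
    rfl
  have h : ∀ z : coordTarget (n := n) x, ENNReal.ofReal (chartDens g x (z : Euc n)) ≠ 0 := fun z => by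
    simpa using (isLocalMetric_chart g x).dens_pos z z.2
  rw [h1]
  exact ⟨fun H => H.mono_ac (withDensity_absolutelyContinuous'
    (measurable_chartDens g x).ennreal_ofReal.aemeasurable (Filter.Eventually.of_forall h)),
    fun H => H.mono_ac (withDensity_absolutelyContinuous _ _)⟩

theorem chartMeasure_lt_top (g : SmoothMetric n M) (x : M) {K : Set M} (hK : IsCompact K)
    (hKx : K ⊆ (chartAt (Euc n) x).source) (hKm : MeasurableSet K) : chartMeasure g x K < ⊤ := by
  rw [chartMeasure_apply g x hKm]
  have h1 : coordTarget (n := n) x ∩ coordInv x ⁻¹' K = coord (n := n) x '' K := by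
    ext y
    constructor
    · exact fun hy => ⟨coordInv (n := n) x y, hy.2, coord_coordInv hy.1⟩
    · rintro ⟨p, hp, rfl⟩
      exact ⟨coord_mem (hKx hp), by
        rwa [Set.mem_preimage, show coordInv (n := n) x (coord x p) = p from
          coordInv_coord (hKx hp)]⟩
  have h2 : IsCompact (coord (n := n) x '' K) :=
    hK.image_of_continuousOn ((continuousOn_extChartAt (I := 𝓡 n) x).mono (by rwa [extChartAt_source]))
  rw [h1]
  have h3 : ContinuousOn (chartDens g x) (coord (n := n) x '' K) :=
    (isLocalMetric_chart g x).smooth_dens.continuousOn.mono (h1 ▸ Set.inter_subset_left)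
  exact (h3.integrableOn_compact h2).lintegral_lt_top

end ChartMetric

/-! ### Partitions of unity, smooth forms, and finiteness of the volume. -/

section TestForms
variable {n k : ℕ} {M : Type*} [TopologicalSpace M] [ChartedSpace (Euc n) M]
  [IsManifold (𝓡 n) ∞ M]

/-- A finite smooth partition of unity subordinate to chart domains. -/
structure IsChartPartition (n : ℕ) {M : Type*} [TopologicalSpace M] [ChartedSpace (Euc n) M]
    (t : Finset M) (χ : M → M → ℝ) : Prop where
  smooth : ∀ x, ContMDiff (𝓡 n) 𝓘(ℝ, ℝ) ∞ (χ x)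
  nonneg : ∀ x p, 0 ≤ χ x p
  subordinate : ∀ x, tsupport (χ x) ⊆ (chartAt (Euc n) x).source
  sum_eq_one : ∀ p, ∑ x ∈ t, χ x p = 1

variable (n M) in
theorem exists_isChartPartition [T2Space M] [CompactSpace M] :
    ∃ (t : Finset M) (χ : M → M → ℝ), IsChartPartition n t χ := by
  obtain ⟨f, hf⟩ := SmoothPartitionOfUnity.exists_isSubordinate_chartAt_source (𝓡 n) M
  have hfin := f.locallyFinite.finite_nonempty_of_compact
  refine ⟨hfin.toFinset, fun x => f x, fun x => (f x).contMDiff, fun x p => f.nonneg x p,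
    fun x => hf x, fun p => ?_⟩
  rw [← f.sum_eq_one (Set.mem_univ p)]
  refine (finsum_eq_sum_of_support_subset _ fun x hx => ?_).symm
  rw [Finset.mem_coe, Set.Finite.mem_toFinset]
  exact ⟨p, hx⟩

theorem contDiffOn_comp_coordInv {φ : M → ℝ} (hφ : ContMDiff (𝓡 n) 𝓘(ℝ, ℝ) ∞ φ) (x : M) :
    ContDiffOn ℝ ∞ (fun y => φ (coordInv (n := n) x y)) (coordTarget x) :=
  contMDiffOn_iff_contDiffOn.1
    (hφ.comp_contMDiffOn (contMDiffOn_extChartAt_symm (I := 𝓡 n) (n := ∞) x))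

theorem pullChart_smul (x : M) (φ : M → ℝ) (u : KForm n M k) (y : Euc n) :
    pullChart x (fun p => φ p • u p) y = φ (coordInv x y) • pullChart x u y := rfl

theorem IsTestForm.smul_of_tsupport {Ω Ω' : Set M} {u : KForm n M k} (hu : IsTestForm Ω' u)
    {φ : M → ℝ} (hφ : ContMDiff (𝓡 n) 𝓘(ℝ, ℝ) ∞ φ) (hc : HasCompactSupport φ)
    (hΩ : tsupport φ ⊆ Ω) : IsTestForm Ω fun p => φ p • u p := by
  refine ⟨fun x => (contDiffOn_comp_coordInv hφ x).smul (hu.smooth x), _, hc, hΩ, fun p hp => ?_⟩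
  have h0 : φ p = 0 := image_eq_zero_of_notMem_tsupport hp
  rw [h0]
  exact zero_smul ℝ (rawForm u p)

theorem IsTestForm.smul {Ω : Set M} {u : KForm n M k} (hu : IsTestForm Ω u)
    {φ : M → ℝ} (hφ : ContMDiff (𝓡 n) 𝓘(ℝ, ℝ) ∞ φ) : IsTestForm Ω fun p => φ p • u p := by
  obtain ⟨K, hK, hKΩ, h⟩ := hu.compact_support
  refine ⟨fun x => (contDiffOn_comp_coordInv hφ x).smul (hu.smooth x), K, hK, hKΩ, fun p hp => ?_⟩
  rw [h p hp]
  exact smul_zero (A := Alt n k) _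

theorem formInner_coord (g : SmoothMetric n M) {x p : M} (hp : p ∈ (chartAt (Euc n) x).source)
    (u v : KForm n M k) : formInner g p (u p) (v p) =
      matInner (chartInv g x (coord x p)) (pullChart x u (coord x p))
        (pullChart x v (coord x p)) := by
  have h := formInner_coordInv g (coord_mem hp) u v
  have h2 : coordInv (n := n) x (coord x p) = p := coordInv_coord hp
  rw [← h, h2]

theorem continuousOn_coord (x : M) :
    ContinuousOn (coord (n := n) x) (chartAt (Euc n) x).source := by
  rw [← extChartAt_source (𝓡 n)]
  exact continuousOn_extChartAt x

theorem continuousOn_pullChart_coord {u : KForm n M k} {x : M}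
    (hu : ContDiffOn ℝ ∞ (pullChart x u) (coordTarget x)) :
    ContinuousOn (fun p => pullChart x u (coord x p)) (chartAt (Euc n) x).source :=
  hu.continuousOn.comp (continuousOn_coord x) fun _ hp => coord_mem hp

theorem continuous_formInner (g : SmoothMetric n M) {u v : KForm n M k}
    (hu : ∀ x : M, ContDiffOn ℝ ∞ (pullChart x u) (coordTarget x))
    (hv : ∀ x : M, ContDiffOn ℝ ∞ (pullChart x v) (coordTarget x)) :
    Continuous fun p => formInner g p (u p) (v p) := by
  refine continuous_iff_continuousAt.2 fun x => ?_
  have hU := (chartAt (Euc n) x).open_source.mem_nhds (mem_chart_source (Euc n) x)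
  have h1 : ContinuousOn (fun p => matInner (k := k) (chartInv g x (coord x p)))
      (chartAt (Euc n) x).source :=
    (continuousOn_matInner (isLocalMetric_chart g x).continuousOn_inv).comp
      (continuousOn_coord x) fun _ hp => coord_mem hp
  have h2 := (h1.clm_apply (continuousOn_pullChart_coord (hu x))).clm_apply
    (continuousOn_pullChart_coord (hv x))
  refine (h2.continuousAt hU).congr ?_
  filter_upwards [hU] with p hp
  exact (formInner_coord g hp u v).symm

variable [MeasurableSpace M] [BorelSpace M]

theorem aemeasurableForm_of_smooth {u : KForm n M k}
    (hu : ∀ x : M, ContDiffOn ℝ ∞ (pullChart x u) (coordTarget x)) (ν : Measure M) :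
    AEMeasurableForm ν u := by
  intro x I
  have h1 := (comp I).continuous.comp_continuousOn (continuousOn_pullChart_coord (hu x))
  refine (h1.congr fun p hp => ?_).aemeasurable (chartAt (Euc n) x).open_source.measurableSet
  have h := comp_pullChart u (coord_mem hp) I
  have h2 : coordInv (n := n) x (coord x p) = p := coordInv_coord hp
  rw [h2] at h
  exact h.symm

variable [CompactSpace M]

theorem mem_l2Forms_of_smooth (g : SmoothMetric n M) {u : KForm n M k}
    (hu : ∀ x : M, ContDiffOn ℝ ∞ (pullChart x u) (coordTarget x)) (ν : Measure M)
    [IsFiniteMeasure ν] : u ∈ l2Forms g ν k := by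
  refine ⟨aemeasurableForm_of_smooth hu ν, ?_⟩
  have hc := continuous_formInner g hu hu
  obtain ⟨C, hC⟩ := isCompact_univ.exists_bound_of_continuousOn hc.continuousOn
  exact Integrable.of_bound hc.aestronglyMeasurable C
    (Filter.Eventually.of_forall fun p => hC p (Set.mem_univ p))

/-- A smooth form as a square-integrable form. -/
def smoothSection (g : SmoothMetric n M) (ν : Measure M) [IsFiniteMeasure ν] (u : KForm n M k)
    (hu : ∀ x : M, ContDiffOn ℝ ∞ (pullChart x u) (coordTarget x)) : L2Section g ν k :=
  ⟨u, mem_l2Forms_of_smooth g hu ν⟩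

theorem smoothSection_form (g : SmoothMetric n M) (ν : Measure M) [IsFiniteMeasure ν]
    (u : KForm n M k) (hu : ∀ x : M, ContDiffOn ℝ ∞ (pullChart x u) (coordTarget x)) :
    (smoothSection g ν u hu).form = u := rfl

theorem smooth_extD {u : KForm n M k}
    (hu : ∀ x : M, ContDiffOn ℝ ∞ (pullChart x u) (coordTarget x)) (x : M) :
    ContDiffOn ℝ ∞ (pullChart x (extD u)) (coordTarget x) := by
  refine ContDiffOn.congr ?_ fun y hy => pullChart_extD hu x hy
  have h1 : ContDiffOn ℝ ∞ (fderiv ℝ (pullChart x u)) (coordTarget x) :=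
    (hu x).fderiv_of_isOpen (isOpen_coordTarget x) (by simp)
  exact (ContinuousAlternatingMap.alternatizeUncurryFinCLM ℝ (Euc n) ℝ).contDiff.comp_contDiffOn h1

theorem extD_eq_zero {u : KForm n M k} {K : Set M} (hK : IsClosed K) (hz : ∀ p ∉ K, u p = 0) :
    ∀ p ∉ K, extD u p = 0 := fun p hp => by
  have h0 : pullChart p u =ᶠ[nhds (coord p p)] fun _ => 0 := by
    have h1 : coord p p ∈ coordTarget (n := n) p ∩ coordInv p ⁻¹' Kᶜ := by
      refine ⟨coord_mem (mem_chart_source _ p), ?_⟩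
      rw [Set.mem_preimage, show coordInv (n := n) p (coord p p) = p from
        coordInv_coord (mem_chart_source _ p)]
      exact hp
    filter_upwards [(isOpen_overlap p hK.isOpen_compl).mem_nhds h1] with y hy
    have : rawForm u (coordInv p y) = 0 := hz _ hy.2
    rw [pullChart_eq, this]
    rfl
  have h2 : extDeriv (pullChart p u) (coord p p) = 0 := by
    rw [extDeriv, h0.fderiv_eq, fderiv_fun_const]
    exact map_zero (ContinuousAlternatingMap.alternatizeUncurryFinCLM ℝ (Euc n) ℝ)
  have h3 : rawForm (KreinFeller.extD u) p =
    (extDeriv (pullChart p u) (coord p p)).compContinuousLinearMap (coordDeriv p p) := rfl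
  rw [h2] at h3
  exact h3

/-- The supports of the finitely many functions of the partition cover `M`, and each is a compact
subset of a chart domain, on which the density is bounded. -/
theorem isFiniteMeasure_riemannianVolume [T2Space M] (g : SmoothMetric n M) :
    IsFiniteMeasure (riemannianVolume g) := by
  obtain ⟨t, χ, h⟩ := exists_isChartPartition n M
  have hcov : Set.univ ⊆ ⋃ x ∈ t, tsupport (χ x) := fun p _ => by
    by_contra hp
    simp only [Set.mem_iUnion, not_exists] at hp
    have := h.sum_eq_one p
    rw [Finset.sum_eq_zero fun x hx => image_eq_zero_of_notMem_tsupport (hp x hx)] at this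
    exact zero_ne_one this
  refine ⟨(measure_mono hcov).trans_lt ((measure_biUnion_finset_le _ _).trans_lt
    (ENNReal.sum_lt_top.2 fun x _ => ?_))⟩
  have hK : IsCompact (tsupport (χ x)) := (isClosed_tsupport _).isCompact
  have := chartMeasure_lt_top g x hK (h.subordinate x) (isClosed_tsupport _).measurableSet
  rwa [← restrict_riemannianVolume, Measure.restrict_apply (isClosed_tsupport _).measurableSet,
    Set.inter_eq_left.2 (h.subordinate x)] at this

end TestForms

/-! ### Finite minima, measurable selection, and norms in `L²`. -/

theorem exists_pos_forall_le {α : Type*} (t : Finset α) {f : α → ℝ} (hf : ∀ x ∈ t, 0 < f x) :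
    ∃ a > 0, ∀ x ∈ t, a ≤ f x := by
  classical
  induction t using Finset.induction_on with
  | empty => exact ⟨1, one_pos, by simp⟩
  | insert x t _ ih =>
    obtain ⟨a, ha, h⟩ := ih fun y hy => hf y (Finset.mem_insert_of_mem hy)
    refine ⟨min a (f x), lt_min ha (hf x (Finset.mem_insert_self _ _)), fun y hy => ?_⟩
    rcases Finset.mem_insert.1 hy with rfl | hy
    · exact min_le_right _ _
    · exact (min_le_left _ _).trans (h y hy)

/-- By induction, the set added last takes priority. Outside the union the selection is arbitrary,
which is why measurability is only claimed inside it. -/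
theorem exists_measurable_selection {X ι : Type*} [MeasurableSpace X] [Nonempty ι]
    {A : ι → Set X} (hA : ∀ i, MeasurableSet (A i)) (t : Finset ι) :
    ∃ c : X → ι, (∀ p ∈ ⋃ i ∈ t, A i, c p ∈ t ∧ p ∈ A (c p)) ∧
      ∀ i, MeasurableSet ((⋃ i ∈ t, A i) ∩ {p | c p = i}) := by
  classical
  induction t using Finset.induction_on with
  | empty => exact ⟨fun _ => Classical.arbitrary ι, by simp⟩
  | insert a t _ ih =>
    obtain ⟨c, h1, h2⟩ := ih
    refine ⟨fun p => if p ∈ A a then a else c p, fun p hp => ?_, fun i => ?_⟩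
    · by_cases hpa : p ∈ A a
      · simp [hpa]
      · simp only [Finset.set_biUnion_insert, Set.mem_union, hpa, false_or] at hp
        simpa [hpa] using ⟨Or.inr (h1 p hp).1, (h1 p hp).2⟩
    · have : (⋃ j ∈ insert a t, A j) ∩ {p | (if p ∈ A a then a else c p) = i} =
          (if a = i then A a else ∅) ∪ ((A a)ᶜ ∩ ((⋃ i ∈ t, A i) ∩ {p | c p = i})) := by
        ext p
        rcases eq_or_ne a i with rfl | hai <;> by_cases hpa : p ∈ A a <;> simp [*]
      rw [this]
      refine MeasurableSet.union ?_ ((hA a).compl.inter (h2 i))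
      split_ifs
      exacts [hA a, MeasurableSet.empty]

theorem integral_norm_sq_eq_norm_toLp {X F : Type*} [MeasurableSpace X] [NormedAddCommGroup F]
    {ν : Measure X} {f : X → F} (hf : MemLp f 2 ν) : ‖hf.toLp f‖ ^ 2 = ∫ x, ‖f x‖ ^ 2 ∂ν := by
  have h := hf.eLpNorm_eq_integral_rpow_norm (by norm_num) (by norm_num)
  have h0 : 0 ≤ ∫ x, ‖f x‖ ^ 2 ∂ν := integral_nonneg fun _ => by positivity
  rw [Lp.norm_toLp, h, ENNReal.toReal_ofReal (by positivity)]
  norm_num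
  rw [← Real.sqrt_eq_rpow, Real.sq_sqrt h0]

/-! ### Completeness of the space of square-integrable forms. -/

section Complete
variable {n k : ℕ} {M : Type*} [TopologicalSpace M] [ChartedSpace (Euc n) M]
  [IsManifold (𝓡 n) ∞ M]

/-- A measurable choice, for every point, of one of finitely many charts. -/
structure IsChartChoice (n : ℕ) {M : Type*} [TopologicalSpace M] [ChartedSpace (Euc n) M]
    [MeasurableSpace M] (t : Finset M) (K : M → Set M) (c : M → M) : Prop where
  mem : ∀ p, c p ∈ t
  measurable : ∀ x, MeasurableSet {p | c p = x}
  compact : ∀ x, IsCompact (K x)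
  subset : ∀ x, K x ⊆ (chartAt (Euc n) x).source
  mem_compact : ∀ p, p ∈ K (c p)

theorem IsChartChoice.mem_source [MeasurableSpace M] {t : Finset M} {K : M → Set M} {c : M → M}
    (h : IsChartChoice n t K c) (p : M) : p ∈ (chartAt (Euc n) (c p)).source :=
  h.subset _ (h.mem_compact p)

variable (n M) in
theorem exists_isChartChoice [T2Space M] [CompactSpace M] [MeasurableSpace M] [BorelSpace M] :
    ∃ (t : Finset M) (K : M → Set M) (c : M → M), IsChartChoice n t K c := by
  rcases isEmpty_or_nonempty M with hM | hM
  · exact ⟨∅, fun _ => ∅, id, fun p => isEmptyElim p, fun p => isEmptyElim p,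
      fun p => isEmptyElim p, fun p => isEmptyElim p, fun p => isEmptyElim p⟩
  obtain ⟨t, χ, h⟩ := exists_isChartPartition n M
  obtain ⟨c, h1, h2⟩ := exists_measurable_selection
    (fun x => (isClosed_tsupport (χ x)).measurableSet) t
  have hcov : (⋃ x ∈ t, tsupport (χ x)) = Set.univ := by
    refine Set.eq_univ_of_forall fun p => ?_
    by_contra hp
    simp only [Set.mem_iUnion, not_exists] at hp
    have := h.sum_eq_one p
    rw [Finset.sum_eq_zero fun x hx => image_eq_zero_of_notMem_tsupport (hp x hx)] at this
    exact zero_ne_one this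
  simp only [hcov, Set.mem_univ, true_imp_iff, Set.univ_inter] at h1 h2
  exact ⟨t, _, c, fun p => (h1 p).1, h2, fun x => (isClosed_tsupport (χ x)).isCompact,
    h.subordinate, fun p => (h1 p).2⟩

/-- The components of a form with respect to the chosen charts. -/
def trivialize (c : M → M) (u : KForm n M k) (p : M) : Alt n k :=
  pullChart (c p) u (coord (c p) p)

/-- The form with given components with respect to the chosen charts. -/
def untrivialize (c : M → M) (F : M → Alt n k) : KForm n M k := fun p =>
  (F p).compContinuousLinearMap (coordDeriv (c p) p)

theorem coordDeriv_comp_coord {x x' p : M} (hx : p ∈ (chartAt (Euc n) x).source)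
    (hx' : p ∈ (chartAt (Euc n) x').source) :
    coordDeriv x' p ∘L coordInvDeriv x (coord x p) =
      fderiv ℝ (coordChange (n := n) x x') (coord x p) := by
  have h2 : coordInv (n := n) x (coord x p) = p := coordInv_coord hx
  have h3 := coordDeriv_comp_coordInvDeriv (x' := x') (coord_mem hx) (by rwa [h2])
  rwa [h2] at h3

theorem coordDeriv_comp_coord_self {x p : M} (hx : p ∈ (chartAt (Euc n) x).source) :
    coordDeriv x p ∘L coordInvDeriv x (coord x p) = ContinuousLinearMap.id ℝ (Euc n) := by
  have h2 : coordInv (n := n) x (coord x p) = p := coordInv_coord hx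
  have h3 := coordDeriv_comp_self (coord_mem hx)
  rwa [h2] at h3

theorem pullChart_untrivialize {c : M → M} {F : M → Alt n k} {x p : M}
    (hx : p ∈ (chartAt (Euc n) x).source) (hc : p ∈ (chartAt (Euc n) (c p)).source) :
    pullChart x (untrivialize c F) (coord x p) =
      (F p).compContinuousLinearMap (fderiv ℝ (coordChange x (c p)) (coord x p)) := by
  have h2 : coordInv (n := n) x (coord x p) = p := coordInv_coord hx
  have h4 : pullChart x (untrivialize c F) (coord x p) = (rawForm (untrivialize c F)
    (coordInv x (coord x p))).compContinuousLinearMap (coordInvDeriv x (coord x p)) := rfl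
  rw [h4, h2, ← coordDeriv_comp_coord hx hc]
  rfl

theorem trivialize_untrivialize {c : M → M} (hc : ∀ p, p ∈ (chartAt (Euc n) (c p)).source)
    (F : M → Alt n k) : trivialize c (untrivialize c F) = F := by
  funext p
  rw [trivialize, pullChart_untrivialize (hc p) (hc p), ← coordDeriv_comp_coord (hc p) (hc p),
    coordDeriv_comp_coord_self (hc p)]
  rfl

theorem continuous_compContinuousLinearMap :
    Continuous fun q : Alt n k × (Euc n →L[ℝ] Euc n) => q.1.compContinuousLinearMap q.2 :=
  continuous_iff_continuousAt.2 fun _ =>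
    (contDiffAt_compContinuousLinearMap (m := 0) contDiffAt_fst contDiffAt_snd).continuousAt

variable [MeasurableSpace M] [BorelSpace M] {t : Finset M} {K : M → Set M} {c : M → M}

/-- Each point is read in one of finitely many charts and only inside a compact subset of its
domain, where the metric is uniformly comparable with the Euclidean one. -/
theorem IsChartChoice.exists_bounds (h : IsChartChoice n t K c) (g : SmoothMetric n M) :
    ∃ a > 0, ∃ b > 0, ∀ (u : KForm n M k) (p : M),
      a * ‖trivialize c u p‖ ^ 2 ≤ formInner g p (u p) (u p) ∧
      formInner g p (u p) (u p) ≤ b * ‖trivialize c u p‖ ^ 2 := by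
  have hK : ∀ x, IsCompact (coord (n := n) x '' K x) := fun x =>
    (h.compact x).image_of_continuousOn ((continuousOn_coord x).mono (h.subset x))
  have hsub : ∀ x, coord (n := n) x '' K x ⊆ coordTarget x := by
    rintro x _ ⟨p, hp, rfl⟩
    exact coord_mem (h.subset x hp)
  choose a ha1 ha using fun x => exists_matInner_lower (k := k) (hK x)
    ((isLocalMetric_chart g x).continuousOn_inv.mono (hsub x))
    fun y hy => (isLocalMetric_chart g x).posDef y (hsub x hy)
  choose b hb1 hb using fun x => exists_matInner_upper (k := k) (hK x)
    ((isLocalMetric_chart g x).continuousOn_inv.mono (hsub x))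
  obtain ⟨a', ha', hle⟩ := exists_pos_forall_le t fun x _ => ha1 x
  refine ⟨a', ha', ∑ x ∈ t, b x + 1, by
    have := Finset.sum_nonneg fun x (_ : x ∈ t) => (hb1 x).le
    positivity, fun u p => ?_⟩
  have hm : coord (n := n) (c p) p ∈ coord (c p) '' K (c p) := ⟨p, h.mem_compact p, rfl⟩
  rw [formInner_coord g (h.mem_source p)]
  constructor
  · exact (mul_le_mul_of_nonneg_right (hle _ (h.mem p)) (sq_nonneg _)).trans (ha _ _ hm _)
  · have h1 := (le_abs_self _).trans (hb _ _ hm (trivialize c u p) (trivialize c u p))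
    rw [mul_assoc, ← sq] at h1
    refine h1.trans (mul_le_mul_of_nonneg_right ?_ (sq_nonneg _))
    have := Finset.single_le_sum (fun x _ => (hb1 x).le) (h.mem p)
    linarith

theorem IsChartChoice.aemeasurable_of_pieces (h : IsChartChoice n t K c) {ν : Measure M}
    {f : M → ℝ} (hf : ∀ x, AEMeasurable f (ν.restrict {p | c p = x})) : AEMeasurable f ν := by
  have h1 := (aemeasurable_iUnion_iff (s := fun x : t => {p | c p = (x : M)}) (f := f)
    (μ := ν)).2 fun x => hf x
  have hu : (⋃ x : t, {p | c p = (x : M)}) = Set.univ :=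
    Set.eq_univ_of_forall fun p => Set.mem_iUnion.2 ⟨⟨c p, h.mem p⟩, rfl⟩
  rwa [hu, Measure.restrict_univ] at h1

theorem IsChartChoice.aestronglyMeasurable_trivialize (h : IsChartChoice n t K c) {ν : Measure M}
    {u : KForm n M k} (hu : AEMeasurableForm ν u) : AEStronglyMeasurable (trivialize c u) ν := by
  refine aemeasurable_alt fun I => h.aemeasurable_of_pieces fun x => ?_
  refine ((hu x I).mono_measure (Measure.restrict_mono
    (fun p hp => hp ▸ h.mem_source p) le_rfl)).congr ?_
  filter_upwards [ae_restrict_mem (h.measurable x)] with p hp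
  have h1 := h.mem_source p
  rw [hp] at h1
  have h2 := comp_pullChart u (coord_mem h1) I
  have h3 : coordInv (n := n) x (coord x p) = p := coordInv_coord h1
  rw [h3] at h2
  rw [trivialize, hp]
  exact h2.symm

/-- Where the chosen chart is the one at `x'`, the components in the chart at `x` arise from `F` by
pullback along the derivative of the transition map, which is continuous on the overlap. -/
theorem IsChartChoice.aemeasurableForm_untrivialize (h : IsChartChoice n t K c) {ν : Measure M}
    {F : M → Alt n k} (hF : AEStronglyMeasurable F ν) :
    AEMeasurableForm ν (untrivialize c F) := by
  intro x I
  refine h.aemeasurable_of_pieces fun x' => ?_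
  set U := (chartAt (Euc n) x).source with hU
  set U' := (chartAt (Euc n) x').source with hU'
  have hUo : IsOpen U := (chartAt (Euc n) x).open_source
  have hUo' : IsOpen U' := (chartAt (Euc n) x').open_source
  have hsub : {p | c p = x'} ⊆ U' := fun p hp => by
    have := h.mem_source p
    rwa [show c p = x' from hp] at this
  have hL : ContinuousOn (fun p => fderiv ℝ (coordChange (n := n) x x') (coord x p)) (U ∩ U') := by
    intro p hp
    have h2 : coordInv (n := n) x (coord x p) = p := coordInv_coord hp.1
    have h1 : ContDiffAt ℝ ∞ (fderiv ℝ (coordChange x x')) (coord x p) :=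
      (contDiffAt_coordChange (coord_mem hp.1) (h2.symm ▸ hp.2)).fderiv_right (by simp)
    exact h1.continuousAt.comp_continuousWithinAt
      ((continuousOn_coord x p hp.1).mono Set.inter_subset_left)
  have h1 : AEStronglyMeasurable (fun p => (F p).compContinuousLinearMap
      (fderiv ℝ (coordChange (n := n) x x') (coord x p))) ((ν.restrict U).restrict {p | c p = x'}) := by
    have hLm := (hL.aestronglyMeasurable (hUo.inter hUo').measurableSet (μ := ν)).mono_measure
      (ν := (ν.restrict U).restrict {p | c p = x'}) (by
        rw [Measure.restrict_restrict (h.measurable x'), Set.inter_comm]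
        exact Measure.restrict_mono (Set.inter_subset_inter_right _ hsub) le_rfl)
    exact continuous_compContinuousLinearMap.comp_aestronglyMeasurable
      (hF.restrict.restrict.prodMk hLm)
  refine (((comp I).continuous.comp_aestronglyMeasurable h1).aemeasurable).congr ?_
  filter_upwards [ae_restrict_mem (h.measurable x'),
    ae_restrict_of_ae (ae_restrict_mem hUo.measurableSet)] with p hp hpU
  have h2 := comp_pullChart (untrivialize c F) (coord_mem hpU) I
  have h3 : coordInv (n := n) x (coord x p) = p := coordInv_coord hpU
  rw [h3, pullChart_untrivialize hpU (h.mem_source p), hp] at h2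
  exact h2

variable [CompactSpace M]

theorem IsChartChoice.memLp_trivialize (h : IsChartChoice n t K c) {g : SmoothMetric n M}
    {ν : Measure M} (u : L2Section g ν k) : MemLp (trivialize c u.form) 2 ν := by
  obtain ⟨a, ha, b, hb, hab⟩ := h.exists_bounds (k := k) g
  have h1 := h.aestronglyMeasurable_trivialize u.2.1
  refine (memLp_two_iff_integrable_sq_norm h1).2 ?_
  refine (u.2.2.const_mul a⁻¹).mono' (h1.norm.pow 2) (Filter.Eventually.of_forall fun p => ?_)
  rw [Real.norm_of_nonneg (by positivity), ← div_eq_inv_mul, le_div_iff₀ ha, mul_comm]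
  exact (hab u.form p).1

theorem L2Section.norm_sq {g : SmoothMetric n M} {ν : Measure M} (u : L2Section g ν k) :
    ‖u‖ ^ 2 = ∫ p, formInner g p (u.form p) (u.form p) ∂ν :=
  (real_inner_self_eq_norm_sq u).symm

theorem IsChartChoice.exists_section (h : IsChartChoice n t K c) (g : SmoothMetric n M)
    {ν : Measure M} {F : M → Alt n k} (hF : MemLp F 2 ν) :
    ∃ u : L2Section g ν k, trivialize c u.form = F := by
  obtain ⟨a, ha, b, hb, hab⟩ := h.exists_bounds (k := k) g
  have hu := h.aemeasurableForm_untrivialize hF.1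
  have hT : trivialize c (untrivialize c F) = F := trivialize_untrivialize h.mem_source _
  refine ⟨⟨untrivialize c F, hu, ?_⟩, hT⟩
  have hF2 : Integrable (fun p => ‖F p‖ ^ 2) ν := hF.integrable_norm_pow (by norm_num)
  refine (hF2.const_mul b).mono' (hu.aemeasurable_inner g hu).aestronglyMeasurable
    (Filter.Eventually.of_forall fun p => ?_)
  rw [Real.norm_of_nonneg (formInner_self_nonneg _ _ _)]
  have := (hab (untrivialize c F) p).2
  rwa [hT] at this

/-- The components of a square-integrable form with respect to the chosen charts. -/
def IsChartChoice.toLp (h : IsChartChoice n t K c) {g : SmoothMetric n M} {ν : Measure M}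
    (u : L2Section g ν k) : Lp (Alt n k) 2 ν := (h.memLp_trivialize u).toLp _

theorem IsChartChoice.toLp_sub (h : IsChartChoice n t K c) {g : SmoothMetric n M} {ν : Measure M}
    (u v : L2Section g ν k) : h.toLp (u - v) = h.toLp u - h.toLp v :=
  MemLp.toLp_sub (h.memLp_trivialize u) (h.memLp_trivialize v)

theorem IsChartChoice.exists_norm_bounds (h : IsChartChoice n t K c) (g : SmoothMetric n M)
    (ν : Measure M) : ∃ a, ∃ b, ∀ u : L2Section g ν k,
      ‖h.toLp u‖ ≤ a * ‖u‖ ∧ ‖u‖ ≤ b * ‖h.toLp u‖ := by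
  obtain ⟨a, ha, b, hb, hab⟩ := h.exists_bounds (k := k) g
  have hsq : ∀ u : L2Section g ν k, ‖h.toLp u‖ ^ 2 = ∫ p, ‖trivialize c u.form p‖ ^ 2 ∂ν :=
    fun u => integral_norm_sq_eq_norm_toLp _
  have hint : ∀ u : L2Section g ν k, Integrable (fun p => ‖trivialize c u.form p‖ ^ 2) ν := fun u =>
    (h.memLp_trivialize u).integrable_norm_pow (by norm_num)
  have hlow : ∀ u : L2Section g ν k, a * ‖h.toLp u‖ ^ 2 ≤ ‖u‖ ^ 2 := fun u => by
    rw [hsq, L2Section.norm_sq, ← integral_const_mul]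
    exact integral_mono ((hint u).const_mul a) u.2.2 fun p => (hab _ p).1
  have hupp : ∀ u : L2Section g ν k, ‖u‖ ^ 2 ≤ b * ‖h.toLp u‖ ^ 2 := fun u => by
    rw [hsq, L2Section.norm_sq, ← integral_const_mul]
    exact integral_mono u.2.2 ((hint u).const_mul b) fun p => (hab _ p).2
  refine ⟨√(a⁻¹), √b, fun u => ⟨?_, ?_⟩⟩
  · rw [← Real.sqrt_sq (norm_nonneg u), ← Real.sqrt_mul (by positivity)]
    refine Real.le_sqrt_of_sq_le ?_
    rw [← div_eq_inv_mul, le_div_iff₀ ha, mul_comm]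
    exact hlow u
  · rw [← Real.sqrt_sq (norm_nonneg (h.toLp u)), ← Real.sqrt_mul hb.le]
    exact Real.le_sqrt_of_sq_le (hupp u)

/-- Taking components in the chosen charts is onto the complete space of square-integrable functions
with values in `Alt n k`, and it distorts norms only by bounded factors, so completeness transfers.
-/
theorem completeSpace_l2Section [T2Space M] (g : SmoothMetric n M) (ν : Measure M) :
    CompleteSpace (L2Section g ν k) := by
  obtain ⟨t, K, c, h⟩ := exists_isChartChoice n M
  obtain ⟨a, b, hab⟩ := h.exists_norm_bounds (k := k) g ν
  have hlip : LipschitzWith a.toNNReal (h.toLp (g := g) (ν := ν) (k := k)) :=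
    LipschitzWith.of_dist_le_mul fun u v => by
      rw [dist_eq_norm, dist_eq_norm, ← h.toLp_sub]
      exact (hab _).1.trans (mul_le_mul_of_nonneg_right (Real.le_coe_toNNReal a) (norm_nonneg _))
  refine Metric.complete_of_cauchySeq_tendsto fun u hu => ?_
  obtain ⟨F, hF⟩ := cauchySeq_tendsto_of_complete (hlip.uniformContinuous.comp_cauchySeq hu)
  obtain ⟨v, hv⟩ := h.exists_section g (Lp.memLp F)
  have hv' : h.toLp v = F := by
    refine Lp.ext ((MemLp.coeFn_toLp _).trans (Filter.Eventually.of_forall fun p => ?_))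
    exact congrFun hv p
  refine ⟨v, tendsto_iff_norm_sub_tendsto_zero.2 ?_⟩
  have h1 : Filter.Tendsto (fun m => b * ‖h.toLp (u m) - h.toLp v‖) Filter.atTop (nhds 0) := by
    rw [hv']
    simpa using (tendsto_iff_norm_sub_tendsto_zero.1 hF).const_mul b
  refine squeeze_zero (fun _ => norm_nonneg _) (fun m => ?_) h1
  rw [← h.toLp_sub]
  exact (hab _).2

theorem completeSpace_l2Form [T2Space M] (g : SmoothMetric n M) (ν : Measure M) :
    CompleteSpace (L2Form g ν k) :=
  have := completeSpace_l2Section (k := k) g ν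
  inferInstance

end Complete

/-! ### Smooth forms with compact support have trivial orthogonal complement in `L²`. -/

section Density
variable {n k : ℕ} {M : Type*} [TopologicalSpace M] [ChartedSpace (Euc n) M]
  [IsManifold (𝓡 n) ∞ M]

theorem rawForm_eq_of_pullChart_eq {u v : KForm n M k} {x p : M}
    (hp : p ∈ (chartAt (Euc n) x).source)
    (h : pullChart x u (coord x p) = pullChart x v (coord x p)) : rawForm u p = rawForm v p := by
  have h1 := coordDeriv_comp_coord_self hp
  have h2 : coordInvDeriv x (coord x p) ∘L coordDeriv x p = ContinuousLinearMap.id ℝ (Euc n) := by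
    have h3 : (coordDeriv (n := n) x p : Euc n →ₗ[ℝ] Euc n) ∘ₗ
        (coordInvDeriv (n := n) x (coord x p) : Euc n →ₗ[ℝ] Euc n) =
        LinearMap.id := by
      ext1 v
      exact congrArg (fun L : Euc n →L[ℝ] Euc n => L v) h1
    -- In finite dimension a one-sided inverse is two-sided.
    have h4 := (LinearMap.comp_eq_id_comm ℝ (Euc n)).1 h3
    ext1 v
    exact congrArg (fun L : Euc n →ₗ[ℝ] Euc n => L v) h4
  have h5 : coordInv (n := n) x (coord x p) = p := coordInv_coord hp
  rw [pullChart_eq, pullChart_eq, h5] at h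
  have h6 : ∀ w : KForm n M k, rawForm w p = ((rawForm w p).compContinuousLinearMap
      (coordInvDeriv x (coord x p))).compContinuousLinearMap (coordDeriv x p) := fun w => by
    have : ((rawForm w p).compContinuousLinearMap
      (coordInvDeriv x (coord x p))).compContinuousLinearMap (coordDeriv x p) =
      (rawForm w p).compContinuousLinearMap
        (coordInvDeriv x (coord x p) ∘L coordDeriv x p) := rfl
    rw [this, h2]
    rfl
  rw [h6 u, h6 v, h]

theorem rawForm_eq_zero_of_pullChart_eq_zero {u : KForm n M k} {x p : M}
    (hp : p ∈ (chartAt (Euc n) x).source) (h : pullChart x u (coord x p) = 0) :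
    rawForm u p = 0 := by
  refine rawForm_eq_of_pullChart_eq (v := 0) hp (h.trans ?_)
  rfl

theorem formInner_zero_left (g : SmoothMetric n M) (p : M)
    (α : TangentSpace (𝓡 n) p [⋀^Fin k]→L[ℝ] ℝ) : formInner g p 0 α = 0 := by
  simpa using formInner_smul_left g p 0 (0 : TangentSpace (𝓡 n) p [⋀^Fin k]→L[ℝ] ℝ) α

theorem eq_zero_of_formInner_self (g : SmoothMetric n M) {u : KForm n M k} {p : M}
    (h : formInner g p (u p) (u p) = 0) : rawForm u p = 0 := by
  have hp := mem_chart_source (Euc n) p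
  rw [formInner_coord g hp] at h
  refine rawForm_eq_zero_of_pullChart_eq_zero hp (by_contra fun h0 => ?_)
  exact (matInner_self_pos ((isLocalMetric_chart g p).posDef _ (coord_mem hp)) h0).ne' h

/-- The form `φ β` on the domain of the chart at `x`, with constant `β`. -/
def cutoffForm (x : M) (φ : M → ℝ) (β : Alt n k) : KForm n M k :=
  pushChart x fun y => φ (coordInv x y) • β

theorem isTestForm_cutoffForm [T2Space M] [CompactSpace M] {x : M} {φ : M → ℝ}
    (hφ : ContMDiff (𝓡 n) 𝓘(ℝ, ℝ) ∞ φ) (hs : tsupport φ ⊆ (chartAt (Euc n) x).source)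
    (β : Alt n k) : IsTestForm Set.univ (cutoffForm x φ β) := by
  refine isTestForm_pushChart (isClosed_tsupport φ).isCompact hs (Set.subset_univ _)
    ((contDiffOn_comp_coordInv hφ x).smul contDiffOn_const) fun p hp hpK => ?_
  have h2 : coordInv (n := n) x (coord x p) = p := coordInv_coord hp
  rw [h2, image_eq_zero_of_notMem_tsupport hpK, zero_smul]

theorem pullChart_cutoffForm {x p : M} (φ : M → ℝ) (hp : p ∈ (chartAt (Euc n) x).source)
    (β : Alt n k) : pullChart x (cutoffForm x φ β) (coord x p) = φ p • β := by
  have h2 : coordInv (n := n) x (coord x p) = p := coordInv_coord hp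
  rw [cutoffForm, pullChart_pushChart _ (coord_mem hp), h2]

theorem IsChartPartition.exists_mem_source {t : Finset M} {χ : M → M → ℝ}
    (h : IsChartPartition n t χ) (p : M) :
    ∃ x ∈ t, χ x p ≠ 0 ∧ p ∈ (chartAt (Euc n) x).source := by
  obtain ⟨x, hx, hx0⟩ := Finset.exists_ne_zero_of_sum_ne_zero
    (s := t) (f := fun x => χ x p) (by rw [h.sum_eq_one]; exact one_ne_zero)
  exact ⟨x, hx, hx0, h.subordinate x (subset_tsupport _ hx0)⟩

variable [MeasurableSpace M] [BorelSpace M] [CompactSpace M]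

theorem L2Section.toL2_eq_zero_iff {g : SmoothMetric n M} {ν : Measure M}
    (u : L2Section g ν k) : u.toL2 = 0 ↔ ∀ᵐ p ∂ν, rawForm u.form p = 0 := by
  have h1 : ‖u.toL2‖ = ‖u‖ := SeparationQuotient.norm_mk u
  rw [← norm_eq_zero, h1, ← sq_eq_zero_iff, L2Section.norm_sq,
    integral_eq_zero_iff_of_nonneg (fun p => formInner_self_nonneg g p _) (u.integrable_inner u)]
  refine Filter.eventually_congr (Filter.Eventually.of_forall fun p => ?_)
  refine ⟨fun h => eq_zero_of_formInner_self g h, fun h => ?_⟩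
  have h2 : formInner g p (rawForm u.form p) (rawForm u.form p) = 0 := by
    rw [h]
    exact formInner_zero_left g p _
  exact h2

theorem L2Section.inner_toL2 {g : SmoothMetric n M} {ν : Measure M} (u v : L2Section g ν k) :
    inner ℝ u.toL2 v.toL2 = ∫ p, formInner g p (u.form p) (v.form p) ∂ν := rfl

theorem exists_toL2_eq {g : SmoothMetric n M} {ν : Measure M} (v : L2Form g ν k) :
    ∃ u : L2Section g ν k, u.toL2 = v := SeparationQuotient.surjective_mk v

/-- The smooth forms with compact support in `Ω` are dense in `L²`. -/
theorem eq_zero_of_inner_testForm [T2Space M] (g : SmoothMetric n M) {Ω : Set M} (hΩ : IsOpen Ω)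
    (ν : Measure M) [IsFiniteMeasure ν] {v : L2Form g (ν.restrict Ω) k}
    (hv : ∀ a : L2Section g (ν.restrict Ω) k, IsTestForm Ω a.form → inner ℝ a.toL2 v = 0) :
    v = 0 := by
  obtain ⟨w, rfl⟩ := exists_toL2_eq v
  rw [L2Section.toL2_eq_zero_iff]
  obtain ⟨t, χ, hχ⟩ := exists_isChartPartition n M
  let b := Module.finBasis ℝ (Alt n k)
  -- For a fixed smooth form `γ`, all products of `γ` with bump functions in `Ω` are test forms, so
  -- the scalar function `⟨γ, w⟩` vanishes almost everywhere on `Ω`. Finitely many cut-off constant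
  -- forms serve as `γ`; at each point, those from a chart whose partition function is nonzero span
  -- the fibre.
  have key : ∀ x ∈ t, ∀ i, ∀ᵐ p ∂ν, p ∈ Ω →
      formInner g p (cutoffForm x (χ x) (b i) p) (w.form p) = 0 := fun x _ i => by
    have hγ := isTestForm_cutoffForm (hχ.smooth x) (hχ.subordinate x) (b i)
    have hint := (smoothSection g (ν.restrict Ω) _ hγ.smooth).integrable_inner w
    refine hΩ.ae_eq_zero_of_integral_contMDiff_smul_eq_zero (𝓡 n)
      (IntegrableOn.locallyIntegrableOn hint) fun φ hφ hc hs => ?_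
    have ht := hγ.smul_of_tsupport hφ hc hs
    have h1 := hv (smoothSection g _ _ ht.smooth) ht
    rw [L2Section.inner_toL2] at h1
    rw [← setIntegral_eq_integral_of_forall_compl_eq_zero (s := Ω) fun p hp => by
      rw [image_eq_zero_of_notMem_tsupport fun h => hp (hs h), zero_smul]]
    rw [← h1]
    refine integral_congr_ae (Filter.Eventually.of_forall fun p => ?_)
    exact (formInner_smul_left g p (φ p) _ _).symm
  have key2 : ∀ᵐ p ∂ν, ∀ x ∈ t, ∀ i, p ∈ Ω →
      formInner g p (cutoffForm x (χ x) (b i) p) (w.form p) = 0 := by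
    rw [Filter.eventually_all_finset]
    exact fun x hx => Filter.eventually_all.2 fun i => key x hx i
  rw [ae_restrict_iff' hΩ.measurableSet]
  filter_upwards [key2] with p hp hpΩ
  obtain ⟨x, hx, hx0, hpx⟩ := hχ.exists_mem_source p
  refine rawForm_eq_zero_of_pullChart_eq_zero hpx (by_contra fun h0 => ?_)
  set S := chartInv g x (coord x p)
  have h1 : ∀ i, matInner S (b i) (pullChart x w.form (coord x p)) = 0 := fun i => by
    have := hp x hx i hpΩ
    rw [formInner_coord g hpx, pullChart_cutoffForm _ hpx, map_smul, smul_apply, smul_eq_mul] at this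
    exact (mul_eq_zero.1 this).resolve_left hx0
  have h2 : (matInner S).flip (pullChart x w.form (coord x p)) = 0 := by
    have : ((matInner S).flip (pullChart x w.form (coord x p)) : Alt n k →ₗ[ℝ] ℝ) = 0 :=
      b.ext fun i => by simpa using h1 i
    ext1 β
    exact congrArg (fun L : Alt n k →ₗ[ℝ] ℝ => L β) this
  have h3 := congrArg (fun L : Alt n k →L[ℝ] ℝ => L (pullChart x w.form (coord x p))) h2
  exact (matInner_self_pos ((isLocalMetric_chart g x).posDef _ (coord_mem hpx)) h0).ne' h3

end Density

/-! ### Extension by zero in a chart and comparison of local with global norms. -/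

section ChartForm
variable {n k : ℕ} {M : Type*} [TopologicalSpace M] [ChartedSpace (Euc n) M]
  [IsManifold (𝓡 n) ∞ M]

/-- The expression of a form in the chart at `x`, extended by zero. -/
def chartForm (x : M) (u : KForm n M k) : Euc n → Alt n k :=
  (coordTarget x).indicator (pullChart x u)

theorem chartForm_of_mem {x : M} (u : KForm n M k) {y : Euc n} (hy : y ∈ coordTarget x) :
    chartForm x u y = pullChart x u y := Set.indicator_of_mem hy _

theorem pullChart_eq_zero {x : M} {u : KForm n M k} {y : Euc n}
    (h : rawForm u (coordInv x y) = 0) : pullChart x u y = 0 := by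
  rw [pullChart_eq, h]
  rfl

theorem support_chartForm_subset {x : M} {u : KForm n M k} {K : Set M}
    (hz : ∀ p ∉ K, u p = 0) : Function.support (chartForm x u) ⊆ coord (n := n) x '' K := by
  intro y hy
  have hyT : y ∈ coordTarget x := by
    by_contra h
    exact hy (Set.indicator_of_notMem h _)
  refine ⟨coordInv x y, by_contra fun h => hy ?_, coord_coordInv hyT⟩
  rw [chartForm_of_mem u hyT]
  exact pullChart_eq_zero (hz _ h)

theorem isCompact_coord_image {x : M} {K : Set M} (hK : IsCompact K)
    (hKx : K ⊆ (chartAt (Euc n) x).source) : IsCompact (coord (n := n) x '' K) :=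
  hK.image_of_continuousOn ((continuousOn_coord x).mono hKx)

theorem coord_image_subset {x : M} {K : Set M} (hKx : K ⊆ (chartAt (Euc n) x).source) :
    coord (n := n) x '' K ⊆ coordTarget x := by
  rintro _ ⟨p, hp, rfl⟩
  exact coord_mem (hKx hp)

theorem coord_image_subset_chartDomain {x : M} {K Ω : Set M}
    (hKx : K ⊆ (chartAt (Euc n) x).source) (hKΩ : K ⊆ Ω) :
    coord (n := n) x '' K ⊆ chartDomain Ω x := by
  rintro _ ⟨p, hp, rfl⟩
  refine ⟨coord_mem (hKx hp), ?_⟩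
  have h2 : coordInv (n := n) x (coord x p) = p := coordInv_coord (hKx hp)
  rw [Set.mem_preimage]
  exact (congrArg (· ∈ Ω) h2).mpr (hKΩ hp)

theorem tsupport_chartForm_subset {x : M} {u : KForm n M k} {K : Set M} (hK : IsCompact K)
    (hKx : K ⊆ (chartAt (Euc n) x).source) (hz : ∀ p ∉ K, u p = 0) :
    tsupport (chartForm x u) ⊆ coord (n := n) x '' K :=
  closure_minimal (support_chartForm_subset hz) (isCompact_coord_image hK hKx).isClosed

theorem contDiff_chartForm {x : M} {u : KForm n M k}
    (hu : ContDiffOn ℝ ∞ (pullChart x u) (coordTarget x)) {K : Set M} (hK : IsCompact K)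
    (hKx : K ⊆ (chartAt (Euc n) x).source) (hz : ∀ p ∉ K, u p = 0) :
    ContDiff ℝ ∞ (chartForm x u) := by
  refine contDiff_iff_contDiffAt.2 fun y => ?_
  by_cases hy : y ∈ tsupport (chartForm x u)
  · have hyT := coord_image_subset hKx (tsupport_chartForm_subset hK hKx hz hy)
    have hn := (isOpen_coordTarget x).mem_nhds hyT
    refine (hu.contDiffAt hn).congr_of_eventuallyEq ?_
    filter_upwards [hn] with z hz
    exact chartForm_of_mem u hz
  · exact contDiffAt_const.congr_of_eventuallyEq (notMem_tsupport_iff_eventuallyEq.1 hy)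

theorem fderiv_chartForm {x : M} (u : KForm n M k) {y : Euc n} (hy : y ∈ coordTarget x) :
    fderiv ℝ (chartForm x u) y = fderiv ℝ (pullChart x u) y := by
  refine Filter.EventuallyEq.fderiv_eq ?_
  filter_upwards [(isOpen_coordTarget x).mem_nhds hy] with z hz
  exact chartForm_of_mem u hz

theorem isOpen_chartDomain {Ω : Set M} (hΩ : IsOpen Ω) (x : M) :
    IsOpen (chartDomain (n := n) Ω x) := isOpen_overlap x hΩ

/-- A smooth function that is `1` near a compact set and supported in a chart domain. -/
theorem exists_cutoff [T2Space M] [CompactSpace M] {x : M} {K : Set (Euc n)} (hK : IsCompact K)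
    (hKx : K ⊆ coordTarget x) : ∃ χ : M → ℝ, ContMDiff (𝓡 n) 𝓘(ℝ, ℝ) ∞ χ ∧
      tsupport χ ⊆ (chartAt (Euc n) x).source ∧ (∀ p, 0 ≤ χ p ∧ χ p ≤ 1) ∧
      ∀ y ∈ K, ∀ᶠ z in nhds y, χ (coordInv (n := n) x z) = 1 := by
  have hs : IsCompact (coordInv (n := n) x '' K) :=
    hK.image_of_continuousOn ((continuousOn_extChartAt_symm x).mono hKx)
  have hsub : coordInv (n := n) x '' K ⊆ (chartAt (Euc n) x).source := by
    rintro _ ⟨y, hy, rfl⟩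
    exact coordInv_mem (hKx hy)
  obtain ⟨U, hU, hsU, hUx⟩ := normal_exists_closure_subset hs.isClosed
    (chartAt (Euc n) x).open_source hsub
  obtain ⟨f, h1, h0, h01⟩ := exists_contMDiffMap_one_nhds_of_subset_interior (n := ⊤) (𝓡 n)
    hs.isClosed (hsU.trans (hU.subset_interior_iff.2 subset_closure))
  refine ⟨f, f.contMDiff, ?_, fun p => h01 p, fun y hy => ?_⟩
  · refine (closure_minimal (fun p hp => ?_) isClosed_closure).trans hUx
    by_contra h
    exact hp (h0 p h)
  · have h2 := h1.filter_mono (nhds_le_nhdsSet (Set.mem_image_of_mem (coordInv (n := n) x) hy))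
    exact ((continuousOn_extChartAt_symm x).continuousAt
      ((isOpen_coordTarget x).mem_nhds (hKx hy))).eventually h2

variable [MeasurableSpace M] [BorelSpace M]

theorem restrict_restrict_chart (g : SmoothMetric n M) {Ω : Set M} (hΩ : MeasurableSet Ω) (x : M) :
    ((riemannianVolume g).restrict Ω).restrict (chartAt (Euc n) x).source =
      (chartMeasure g x).restrict Ω := by
  rw [← restrict_riemannianVolume, Measure.restrict_restrict hΩ,
    Measure.restrict_restrict (chartAt (Euc n) x).open_source.measurableSet, Set.inter_comm]

theorem measurableSet_chartDomain {Ω : Set M} (hΩ : MeasurableSet Ω) (x : M) :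
    MeasurableSet (chartDomain (n := n) Ω x) := measurableSet_coord_preimage hΩ

theorem indicator_chartDomain (Ω : Set M) (x : M) (c : Euc n → ℝ) (f : M → ℝ) :
    (coordTarget x).indicator (fun y => c y * Ω.indicator f (coordInv x y)) =
      (chartDomain Ω x).indicator fun y => c y * f (coordInv x y) := by
  funext y
  by_cases h1 : y ∈ coordTarget x
  · by_cases h2 : coordInv (n := n) x y ∈ Ω
    · rw [Set.indicator_of_mem h1, Set.indicator_of_mem h2,
        Set.indicator_of_mem (show y ∈ chartDomain Ω x from ⟨h1, h2⟩)]
    · rw [Set.indicator_of_mem h1, Set.indicator_of_notMem h2, mul_zero,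
        Set.indicator_of_notMem fun h : y ∈ chartDomain Ω x => h2 h.2]
  · rw [Set.indicator_of_notMem h1,
      Set.indicator_of_notMem fun h : y ∈ chartDomain Ω x => h1 h.1]

theorem ae_restrict_chart_iff (g : SmoothMetric n M) {Ω : Set M} (hΩ : MeasurableSet Ω) (x : M)
    {P : M → Prop} : (∀ᵐ p ∂((riemannianVolume g).restrict Ω).restrict
      (chartAt (Euc n) x).source, P p) ↔
      ∀ᵐ y ∂volume.restrict (chartDomain (n := n) Ω x), P (coordInv x y) := by
  rw [restrict_restrict_chart g hΩ, ae_restrict_iff' hΩ, ae_chartMeasure_iff,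
    ae_restrict_iff' (isOpen_coordTarget x).measurableSet,
    ae_restrict_iff' (measurableSet_chartDomain hΩ x)]
  exact Filter.eventually_congr (Filter.Eventually.of_forall fun y =>
    ⟨fun h hy => h hy.1 hy.2, fun h hy hy' => h ⟨hy, hy'⟩⟩)

theorem integral_restrict_chart (g : SmoothMetric n M) {Ω : Set M} (hΩ : MeasurableSet Ω) (x : M)
    (f : M → ℝ) : ∫ p, f p ∂((riemannianVolume g).restrict Ω).restrict (chartAt (Euc n) x).source =
      ∫ y in chartDomain Ω x, chartDens g x y * f (coordInv x y) := by
  rw [restrict_restrict_chart g hΩ, ← integral_indicator hΩ, integral_chartMeasure,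
    ← integral_indicator (isOpen_coordTarget x).measurableSet,
    ← integral_indicator (measurableSet_chartDomain hΩ x)]
  rw [indicator_chartDomain]

theorem integrable_restrict_chart_iff (g : SmoothMetric n M) {Ω : Set M} (hΩ : MeasurableSet Ω)
    (x : M) {f : M → ℝ} :
    Integrable f (((riemannianVolume g).restrict Ω).restrict (chartAt (Euc n) x).source) ↔
      IntegrableOn (fun y => chartDens g x y * f (coordInv x y)) (chartDomain Ω x) := by
  rw [restrict_restrict_chart g hΩ]
  change IntegrableOn _ _ _ ↔ _
  rw [← integrable_indicator_iff hΩ, integrable_chartMeasure_iff,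
    ← integrable_indicator_iff (isOpen_coordTarget x).measurableSet,
    ← integrable_indicator_iff (measurableSet_chartDomain hΩ x)]
  rw [indicator_chartDomain]

theorem aemeasurable_restrict_chart (g : SmoothMetric n M) {Ω : Set M} (hΩ : MeasurableSet Ω)
    (x : M) {f : M → ℝ} (hf : AEMeasurable f
      (((riemannianVolume g).restrict Ω).restrict (chartAt (Euc n) x).source)) :
    AEMeasurable (fun y => f (coordInv x y)) (volume.restrict (chartDomain (n := n) Ω x)) := by
  rw [restrict_restrict_chart g hΩ, ← aemeasurable_indicator_iff hΩ,
    aemeasurable_chartMeasure_iff] at hf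
  refine (hf.mono_measure (Measure.restrict_mono Set.inter_subset_left le_rfl)).congr ?_
  filter_upwards [ae_restrict_mem (measurableSet_chartDomain hΩ x)] with y hy
  exact Set.indicator_of_mem (s := Ω) hy.2 f

theorem aestronglyMeasurable_pullChart {g : SmoothMetric n M} {Ω : Set M} (hΩ : MeasurableSet Ω)
    (x : M) {u : KForm n M k} (hu : AEMeasurableForm ((riemannianVolume g).restrict Ω) u) :
    AEStronglyMeasurable (pullChart x u) (volume.restrict (chartDomain Ω x)) := by
  refine aemeasurable_alt fun I => (aemeasurable_restrict_chart g hΩ x (hu x I)).congr ?_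
  filter_upwards [ae_restrict_mem (measurableSet_chartDomain hΩ x)] with y hy
  exact (comp_pullChart u hy.1 I).symm

/-- The inner product with a form supported in a chart domain, computed in the chart. -/
theorem integral_formInner_chart (g : SmoothMetric n M) {Ω : Set M} (hΩ : MeasurableSet Ω) {x : M}
    {u : KForm n M k} (v : KForm n M k) {K : Set M} (hKx : K ⊆ (chartAt (Euc n) x).source)
    (hKΩ : K ⊆ Ω) (hz : ∀ p ∉ K, u p = 0) :
    ∫ p in Ω, formInner g p (u p) (v p) ∂riemannianVolume g =
      ∫ y, chartDens g x y * matInner (chartInv g x y) (chartForm x u y) (pullChart x v y) := by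
  have h0 : ∀ p ∉ K, formInner g p (u p) (v p) = 0 := fun p hp => by
    rw [hz p hp]
    exact formInner_zero_left g p _
  have hR : ∫ y in chartDomain Ω x, chartDens g x y *
      matInner (chartInv g x y) (chartForm x u y) (pullChart x v y) =
      ∫ y, chartDens g x y * matInner (chartInv g x y) (chartForm x u y) (pullChart x v y) := by
    refine setIntegral_eq_integral_of_forall_compl_eq_zero fun y hy => ?_
    have : chartForm x u y = 0 := by
      by_contra h
      exact hy (coord_image_subset_chartDomain hKx hKΩ (support_chartForm_subset hz h))
    rw [this]
    simp
  rw [← setIntegral_eq_integral_of_forall_compl_eq_zero (μ := (riemannianVolume g).restrict Ω)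
    (s := (chartAt (Euc n) x).source) fun p hp => h0 p fun h => hp (hKx h),
    integral_restrict_chart g hΩ, ← hR]
  refine setIntegral_congr_fun (measurableSet_chartDomain hΩ x) fun y hy => ?_
  simp only [chartForm_of_mem u hy.1]
  rw [formInner_coordInv g hy.1]

variable [CompactSpace M]

/-- Over a compact part of a chart the Euclidean norm is dominated by the metric, and Lebesgue
measure by the volume. The set `K` may leave the image of `Ω`, where nothing is known about the
form, hence the intersection. -/
theorem exists_restrict_bound (g : SmoothMetric n M) {Ω : Set M} (hΩ : MeasurableSet Ω) (x : M)
    {K : Set (Euc n)} (hK : IsCompact K) (hKx : K ⊆ coordTarget x) (k : ℕ) :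
    ∃ C, ∀ a : L2Section g ((riemannianVolume g).restrict Ω) k,
      MemLp (pullChart x a.form) 2 (volume.restrict (K ∩ chartDomain Ω x)) ∧
      ∫ y in K ∩ chartDomain Ω x, ‖pullChart x a.form y‖ ^ 2 ≤ C * ‖a‖ ^ 2 := by
  have hm := isLocalMetric_chart g x
  obtain ⟨c, hc, hlow⟩ := exists_matInner_lower (k := k) hK (hm.continuousOn_inv.mono hKx)
    fun y hy => hm.posDef y (hKx hy)
  obtain ⟨r, hr, hrK⟩ : ∃ r > 0, ∀ y ∈ K, r ≤ chartDens g x y := by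
    rcases K.eq_empty_or_nonempty with rfl | hne
    · exact ⟨1, one_pos, by simp⟩
    · obtain ⟨y, hy, h⟩ := hK.exists_isMinOn hne (hm.smooth_dens.continuousOn.mono hKx)
      exact ⟨_, hm.dens_pos y (hKx hy), fun z hz => h hz⟩
  refine ⟨(r * c)⁻¹, fun a => ?_⟩
  have hsub : K ∩ chartDomain Ω x ⊆ chartDomain Ω x := Set.inter_subset_right
  have hKm : MeasurableSet (K ∩ chartDomain Ω x) :=
    hK.measurableSet.inter (measurableSet_chartDomain hΩ x)
  have hmeas := (aestronglyMeasurable_pullChart hΩ x a.2.1).mono_measure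
    (Measure.restrict_mono hsub le_rfl)
  have hi : IntegrableOn (fun y => chartDens g x y * formInner g (coordInv x y)
      (a.form (coordInv x y)) (a.form (coordInv x y))) (chartDomain Ω x) :=
    (integrable_restrict_chart_iff g hΩ x).1 (a.integrable_inner a).restrict
  have hpt : ∀ y ∈ K ∩ chartDomain Ω x, ‖pullChart x a.form y‖ ^ 2 ≤ (r * c)⁻¹ *
      (chartDens g x y * formInner g (coordInv x y)
        (a.form (coordInv x y)) (a.form (coordInv x y))) := fun y hy => by
    rw [formInner_coordInv g hy.2.1, ← div_eq_inv_mul, le_div_iff₀ (by positivity)]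
    have h1 := hlow y hy.1 (pullChart x a.form y)
    have h2 := hrK y hy.1
    calc _ = r * (c * ‖pullChart x a.form y‖ ^ 2) := by ring
      _ ≤ _ := mul_le_mul h2 h1 (by positivity) (hr.le.trans h2)
  have hi2 := (hi.mono_set hsub).const_mul (r * c)⁻¹
  have hint : IntegrableOn (fun y => ‖pullChart x a.form y‖ ^ 2) (K ∩ chartDomain Ω x) := by
    refine hi2.mono' (hmeas.norm.pow 2) ?_
    filter_upwards [ae_restrict_mem hKm] with y hy
    rw [Real.norm_of_nonneg (by positivity)]
    exact hpt y hy
  refine ⟨(memLp_two_iff_integrable_sq_norm hmeas).2 hint, ?_⟩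
  calc _ ≤ ∫ y in K ∩ chartDomain Ω x, (r * c)⁻¹ * (chartDens g x y * formInner g (coordInv x y)
        (a.form (coordInv x y)) (a.form (coordInv x y))) := setIntegral_mono_on hint hi2 hKm hpt
    _ = (r * c)⁻¹ * ∫ y in K ∩ chartDomain Ω x, (chartDens g x y * formInner g (coordInv x y)
        (a.form (coordInv x y)) (a.form (coordInv x y))) := integral_const_mul _ _
    _ ≤ (r * c)⁻¹ * ∫ y in chartDomain Ω x, (chartDens g x y * formInner g (coordInv x y)
        (a.form (coordInv x y)) (a.form (coordInv x y))) := by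
      refine mul_le_mul_of_nonneg_left (setIntegral_mono_set hi ?_ hsub.eventuallyLE)
        (by positivity)
      filter_upwards [ae_restrict_mem (measurableSet_chartDomain hΩ x)] with y hy
      exact mul_nonneg (hm.dens_pos y hy.1).le (formInner_self_nonneg _ _ _)
    _ ≤ (r * c)⁻¹ * ‖a‖ ^ 2 := by
      refine mul_le_mul_of_nonneg_left ?_ (by positivity)
      rw [← integral_restrict_chart g hΩ x
        (fun p => formInner g p (a.form p) (a.form p)), L2Section.norm_sq]
      exact setIntegral_le_integral (a.integrable_inner a)
        (Filter.Eventually.of_forall fun p => formInner_self_nonneg g p _)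

end ChartForm

/-! ### Test forms as elements of the Sobolev space, and uniqueness of weak derivatives. -/

section TestTriples
variable {n k : ℕ} {M : Type*} [TopologicalSpace M] [ChartedSpace (Euc n) M]
  [IsManifold (𝓡 n) ∞ M]

theorem extD_add {u v : KForm n M k}
    (hu : ∀ x : M, ContDiffOn ℝ ∞ (pullChart x u) (coordTarget x))
    (hv : ∀ x : M, ContDiffOn ℝ ∞ (pullChart x v) (coordTarget x)) :
    extD (u + v) = extD u + extD v := by
  funext p
  have hn := (isOpen_coordTarget (n := n) p).mem_nhds (coord_mem (mem_chart_source (Euc n) p))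
  have h1 := extDeriv_add (((hu p).contDiffAt hn).differentiableAt (by simp))
    (((hv p).contDiffAt hn).differentiableAt (by simp))
  have h2 : rawForm (extD (u + v)) p = (extDeriv (pullChart p u + pullChart p v)
    (coord p p)).compContinuousLinearMap (coordDeriv p p) := rfl
  rw [h1] at h2
  exact h2

theorem extD_smul (c : ℝ) (u : KForm n M k) : extD (c • u) = c • extD u := by
  funext p
  have h1 := extDeriv_smul (x := coord (n := n) p p) c (pullChart p u)
  have h2 : rawForm (extD (c • u)) p = (extDeriv (c • pullChart p u)
    (coord p p)).compContinuousLinearMap (coordDeriv p p) := rfl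
  rw [h1] at h2
  exact h2

/-- Cauchy–Schwarz, with the metric coefficients bounded on `K`. The constant does not depend on
`W`, which will be the part of `K` over `Ω`, the only place where `η` is controlled. -/
theorem exists_pairing_bound (g : SmoothMetric n M) (x : M) {K : Set (Euc n)} (hK : IsCompact K)
    (hKx : K ⊆ coordTarget x) (k : ℕ) : ∃ C, 0 ≤ C ∧ ∀ (W : Set (Euc n)) (f η : Euc n → Alt n k),
      MeasurableSet W → W ⊆ K → (∀ y ∉ W, f y = 0) → MemLp f 2 (volume.restrict W) →
      MemLp η 2 (volume.restrict W) →
      Integrable (fun y => chartDens g x y * matInner (chartInv g x y) (f y) (η y)) ∧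
      |∫ y, chartDens g x y * matInner (chartInv g x y) (f y) (η y)| ≤
        C * (√(∫ y in W, ‖f y‖ ^ 2) * √(∫ y in W, ‖η y‖ ^ 2)) := by
  have hm := isLocalMetric_chart g x
  obtain ⟨A, hA, hup⟩ := exists_matInner_upper (k := k) hK (hm.continuousOn_inv.mono hKx)
  obtain ⟨R, hR⟩ := hK.exists_bound_of_continuousOn (hm.smooth_dens.continuousOn.mono hKx)
  refine ⟨|R| * A, by positivity, fun W f η hW hWK hz hf hη => ?_⟩
  have hint : IntegrableOn (fun y => |R| * A * (‖f y‖ * ‖η y‖)) W :=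
    (hf.norm.integrable_mul hη.norm).const_mul _
  have hle : ∀ᵐ y ∂volume.restrict W,
      ‖chartDens g x y * matInner (chartInv g x y) (f y) (η y)‖ ≤
        |R| * A * (‖f y‖ * ‖η y‖) := by
    filter_upwards [ae_restrict_mem hW] with y hy
    rw [norm_mul]
    calc _ ≤ |R| * (A * ‖f y‖ * ‖η y‖) :=
          mul_le_mul ((hR y (hWK hy)).trans (le_abs_self R)) (hup y (hWK hy) _ _)
            (abs_nonneg _) (abs_nonneg _)
      _ = _ := by ring
  have hmeas : AEStronglyMeasurable (fun y => chartDens g x y *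
      matInner (chartInv g x y) (f y) (η y)) (volume.restrict W) := by
    have h1 := ((hm.contDiffOn_matInner (k := k)).continuousOn.mono
      (hWK.trans hKx)).aestronglyMeasurable (μ := volume) hW
    have hc : Continuous fun q : (Alt n k →L[ℝ] Alt n k →L[ℝ] ℝ) × Alt n k × Alt n k =>
        q.1 q.2.1 q.2.2 := by fun_prop
    exact hc.comp_aestronglyMeasurable (h1.prodMk (hf.1.prodMk hη.1))
  refine ⟨(integrableOn_iff_integrable_of_support_subset fun y hy => ?_).1
    (hint.mono' hmeas hle), ?_⟩
  · by_contra h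
    exact hy (by simp [hz y h])
  rw [← setIntegral_eq_integral_of_forall_compl_eq_zero (s := W) fun y hy => by simp [hz y hy]]
  refine (norm_integral_le_of_norm_le hint hle).trans ?_
  rw [integral_const_mul]
  exact mul_le_mul_of_nonneg_left (integral_mul_norm_le hf hη) (by positivity)

theorem contDiffOn_codiffSymbol {O : Set (Euc n)} {S : Euc n → Matrix (Fin n) (Fin n) ℝ}
    {ρ : Euc n → ℝ} (h : IsLocalMetric O S ρ) {w : Euc n → Alt n (k + 1)} (hw : ContDiff ℝ ∞ w) :
    ContDiffOn ℝ ∞ (fun y => codiffSymbol (S y) (fderiv ℝ w y)) O := by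
  unfold codiffSymbol
  refine (ContDiffOn.sum fun i _ => ContDiffOn.sum fun j _ => (h.smooth_inv i j).smul ?_).neg
  exact (hook (stdVec i)).contDiff.comp_contDiffOn
    (((hw.fderiv_right (m := ∞) (by simp)).clm_apply contDiff_const).contDiffOn)

theorem codiffSymbol_zero (S : Matrix (Fin n) (Fin n) ℝ) :
    codiffSymbol S (0 : Euc n →L[ℝ] Alt n (k + 1)) = 0 := by
  simp [codiffSymbol]

theorem codiffSymbol_fderiv_eq_zero (S : Euc n → Matrix (Fin n) (Fin n) ℝ)
    {w : Euc n → Alt n (k + 1)} {y : Euc n} (hy : y ∉ tsupport w) :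
    codiffSymbol (S y) (fderiv ℝ w y) = 0 := by
  rw [fderiv_of_notMem_tsupport ℝ hy, codiffSymbol_zero]

variable [MeasurableSpace M] [BorelSpace M] [CompactSpace M] [T2Space M]

theorem ae_of_ae_chart {ν : Measure M} {P : M → Prop}
    (h : ∀ x : M, ∀ᵐ p ∂ν.restrict (chartAt (Euc n) x).source, P p) : ∀ᵐ p ∂ν, P p := by
  obtain ⟨t, χ, hχ⟩ := exists_isChartPartition n M
  have h1 : ∀ᵐ p ∂ν, ∀ x ∈ t, p ∈ (chartAt (Euc n) x).source → P p := by
    rw [Filter.eventually_all_finset]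
    exact fun x _ => (ae_restrict_iff' (chartAt (Euc n) x).open_source.measurableSet).1 (h x)
  filter_upwards [h1] with p hp
  obtain ⟨x, hx, _, hpx⟩ := hχ.exists_mem_source p
  exact hp x hx hpx

/-- Green's formula moves the derivative from `a` to the fixed smooth form `u`, so the pairing of
`u` with the exterior derivative of `a` is bounded by the norm of `a` alone. The constant depends on
`u`. -/
theorem exists_chart_codiff_bound (g : SmoothMetric n M) {Ω : Set M} (hΩ : MeasurableSet Ω) {x : M}
    {u : KForm n M (k + 1)} (hu : ∀ x : M, ContDiffOn ℝ ∞ (pullChart x u) (coordTarget x))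
    {K : Set M} (hK : IsCompact K) (hKx : K ⊆ (chartAt (Euc n) x).source) (hKΩ : K ⊆ Ω)
    (hz : ∀ p ∉ K, u p = 0) :
    ∃ C, ∀ a : L2Section g ((riemannianVolume g).restrict Ω) k,
      (∀ x : M, ContDiffOn ℝ ∞ (pullChart x a.form) (coordTarget x)) →
      |∫ p in Ω, formInner g p (u p) (extD a.form p) ∂riemannianVolume g| ≤ C * ‖a‖ := by
  have hm := isLocalMetric_chart g x
  have hL := isCompact_coord_image hK hKx
  set L := coord (n := n) x '' K
  have hLT : L ⊆ coordTarget x := coord_image_subset hKx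
  have hLD : L ∩ chartDomain Ω x = L :=
    Set.inter_eq_left.2 (coord_image_subset_chartDomain hKx hKΩ)
  set w := chartForm x u
  have hw : ContDiff ℝ ∞ w := contDiff_chartForm (hu x) hK hKx hz
  have hws : tsupport w ⊆ L := tsupport_chartForm_subset hK hKx hz
  set d : Euc n → Alt n k := fun y => codiffSymbol (chartInv g x y) (fderiv ℝ w y)
  have hd : ContDiffOn ℝ ∞ d (coordTarget x) := contDiffOn_codiffSymbol hm hw
  have hd0 : ∀ y ∉ L, d y = 0 := fun y hy =>
    codiffSymbol_fderiv_eq_zero _ fun h => hy (hws h)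
  obtain ⟨C₁, hC₁, hgreen⟩ := hm.exists_green_bound (k := k) hL hLT
  obtain ⟨C₂, hC₂, hpair⟩ := exists_pairing_bound g x hL hLT k
  obtain ⟨C₃, hres⟩ := exists_restrict_bound g hΩ x hL hLT k
  have hdm : MemLp d 2 (volume.restrict L) := by
    obtain ⟨B, hB⟩ := hL.exists_bound_of_continuousOn (hd.continuousOn.mono hLT)
    have : IsFiniteMeasure (volume.restrict L) := ⟨by simpa using hL.measure_lt_top⟩
    exact MemLp.of_bound ((hd.continuousOn.mono hLT).aestronglyMeasurable hL.measurableSet) B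
      (by filter_upwards [ae_restrict_mem hL.measurableSet] with y hy using hB y hy)
  have hwm : MemLp w 2 (volume.restrict L) :=
    (hw.continuous.memLp_of_hasCompactSupport
      (hL.of_isClosed_subset (isClosed_tsupport _) hws)).restrict L
  refine ⟨C₁ * (√(∫ y in L, ‖w y‖ ^ 2) * √C₃) + C₂ * (√(∫ y in L, ‖d y‖ ^ 2) * √C₃),
    fun a ha => ?_⟩
  set η := pullChart x a.form
  obtain ⟨hηm, hηb⟩ := hres a
  rw [hLD] at hηm hηb
  have hη : √(∫ y in L, ‖η y‖ ^ 2) ≤ √C₃ * ‖a‖ := by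
    refine (Real.sqrt_le_sqrt hηb).trans_eq ?_
    rw [Real.sqrt_mul' _ (sq_nonneg _), Real.sqrt_sq (norm_nonneg _)]
  obtain ⟨-, -, hg⟩ := hgreen w η (hw.of_le (by simp)) hws ((ha x).of_le (by simp))
  have e1 : ∫ p in Ω, formInner g p (u p) (extD a.form p) ∂riemannianVolume g =
      ∫ y, chartDens g x y * matInner (chartInv g x y) (w y)
        (ContinuousAlternatingMap.alternatizeUncurryFin (fderiv ℝ η y)) := by
    rw [integral_formInner_chart g hΩ _ hKx hKΩ hz]
    refine integral_congr_ae (Filter.Eventually.of_forall fun y => ?_)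
    by_cases hy : y ∈ coordTarget x
    · simp only [pullChart_extD ha x hy]
      rfl
    · have : chartForm x u y = 0 := Set.indicator_of_notMem hy _
      simp [w, this]
  have e2 := (hpair L d η hL.measurableSet subset_rfl hd0 hdm hηm).2
  have e3 : ∫ y, ‖w y‖ * ‖η y‖ ≤ √(∫ y in L, ‖w y‖ ^ 2) * √(∫ y in L, ‖η y‖ ^ 2) := by
    rw [← setIntegral_eq_integral_of_forall_compl_eq_zero (s := L) fun y hy => by
      rw [image_eq_zero_of_notMem_tsupport fun h => hy (hws h), norm_zero, zero_mul]]
    exact integral_mul_norm_le hwm hηm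
  rw [e1]
  have h0 := abs_sub_abs_le_abs_sub (∫ y, chartDens g x y * matInner (chartInv g x y) (w y)
    (ContinuousAlternatingMap.alternatizeUncurryFin (fderiv ℝ η y)))
    (∫ y, chartDens g x y * matInner (chartInv g x y) (d y) (η y))
  have h1 := mul_le_mul_of_nonneg_left (e3.trans
    (mul_le_mul_of_nonneg_left hη (Real.sqrt_nonneg _))) hC₁
  have h2 := e2.trans (mul_le_mul_of_nonneg_left
    (mul_le_mul_of_nonneg_left hη (Real.sqrt_nonneg _)) hC₂)
  calc _ ≤ C₁ * (√(∫ y in L, ‖w y‖ ^ 2) * (√C₃ * ‖a‖)) +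
        C₂ * (√(∫ y in L, ‖d y‖ ^ 2) * (√C₃ * ‖a‖)) := by linarith
    _ = _ := by ring

/-- Test forms are in the domain of the weak codifferential. -/
theorem exists_codiff (g : SmoothMetric n M) {Ω : Set M} (hΩ : IsOpen Ω)
    {u : KForm n M (k + 1)} (hu : IsTestForm Ω u) :
    ∃ w : L2Form g ((riemannianVolume g).restrict Ω) k,
      ∀ a : L2Section g ((riemannianVolume g).restrict Ω) k, IsTestForm Ω a.form →
        inner ℝ w a.toL2 = ∫ p in Ω, formInner g p (u p) (extD a.form p) ∂riemannianVolume g := by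
  have := isFiniteMeasure_riemannianVolume g
  have := completeSpace_l2Form (k := k) g ((riemannianVolume g).restrict Ω)
  set ν := (riemannianVolume g).restrict Ω
  let D : Submodule ℝ (L2Section g ν k) :=
    { carrier := {a | IsTestForm Ω a.form}
      zero_mem' := by simpa using isTestForm_zero
      add_mem' := fun {a b} ha hb => by simpa using ha.add hb
      smul_mem' := fun c a ha => by simpa using ha.const_smul c }
  have hint : ∀ {v : KForm n M (k + 1)},
      (∀ x : M, ContDiffOn ℝ ∞ (pullChart x v) (coordTarget x)) → ∀ a : D,
      Integrable (fun p => formInner g p (v p) (extD (a : L2Section g ν k).form p)) ν :=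
    fun {v} hv a => (smoothSection g ν v hv).integrable_inner
      (smoothSection g ν _ (smooth_extD a.2.smooth))
  -- Only `u` is cut up by the partition of unity; the test form `a` stays intact, so no derivative
  -- falls on the cutoffs.
  obtain ⟨t, χ, hχ⟩ := exists_isChartPartition n M
  obtain ⟨K, hK, hKΩ, hz⟩ := hu.compact_support
  have hux : ∀ x, IsTestForm Ω fun p => χ x p • u p := fun x => hu.smul (hχ.smooth x)
  have hbd : ∀ x, ∃ C, ∀ a : L2Section g ν k,
      (∀ x : M, ContDiffOn ℝ ∞ (pullChart x a.form) (coordTarget x)) →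
      |∫ p in Ω, formInner g p (χ x p • u p) (extD a.form p) ∂riemannianVolume g| ≤ C * ‖a‖ :=
    fun x => by
    refine exists_chart_codiff_bound g hΩ.measurableSet (hux x).smooth
      (hK.inter_left (isClosed_tsupport (χ x))) (fun p hp => hχ.subordinate x hp.1)
      (fun p hp => hKΩ hp.2) fun p hp => ?_
    by_cases hpK : p ∈ K
    · have : χ x p = 0 := image_eq_zero_of_notMem_tsupport fun h => hp ⟨h, hpK⟩
      simp only [this]
      exact zero_smul ℝ (rawForm u p)
    · simp only [hz p hpK]
      exact smul_zero (A := Alt n (k + 1)) _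
  choose C hC using hbd
  let F : D →ₗ[ℝ] ℝ :=
    { toFun := fun a => ∫ p, formInner g p (u p) (extD (a : L2Section g ν k).form p) ∂ν
      map_add' := fun a b => by
        rw [← integral_add (hint hu.smooth a) (hint hu.smooth b)]
        refine integral_congr_ae (Filter.Eventually.of_forall fun p => ?_)
        simp only [Submodule.coe_add, map_add, extD_add a.2.smooth b.2.smooth]
        rw [formInner_symm, formInner_symm g p (u p), formInner_symm g p (u p)]
        exact formInner_add_left _ _ _ _ _
      map_smul' := fun c a => by
        rw [RingHom.id_apply, smul_eq_mul, ← integral_const_mul]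
        refine integral_congr_ae (Filter.Eventually.of_forall fun p => ?_)
        simp only [Submodule.coe_smul, map_smul, extD_smul]
        rw [formInner_symm, formInner_symm g p (u p)]
        exact formInner_smul_left _ _ _ _ _ }
  have hF : ∀ a : D, ‖F a‖ ≤ (∑ x ∈ t, C x) * ‖a‖ := fun a => by
    have h1 : F a = ∑ x ∈ t, ∫ p, formInner g p (χ x p • u p)
        (extD (a : L2Section g ν k).form p) ∂ν := by
      rw [← integral_finsetSum _ fun x _ => hint (hux x).smooth a]
      refine integral_congr_ae (Filter.Eventually.of_forall fun p => ?_)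
      simp only [formInner_smul_left, ← Finset.sum_mul, hχ.sum_eq_one, one_mul]
    rw [h1, Finset.sum_mul]
    exact (norm_sum_le _ _).trans (Finset.sum_le_sum fun x _ => hC x a a.2.smooth)
  -- The bounded functional on test forms is extended by Hahn–Banach to all square-integrable forms
  -- and then represented by Riesz.
  obtain ⟨ℓ, hℓ, -⟩ := exists_extension_norm_eq D (F.mkContinuous _ hF)
  refine ⟨(InnerProductSpace.toDual ℝ _).symm
    (ℓ ∘L SeparationQuotient.outCLM ℝ (L2Section g ν k)), fun a ha => ?_⟩
  rw [InnerProductSpace.toDual_symm_apply]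
  refine Eq.trans ?_ (hℓ ⟨a, ha⟩)
  -- A continuous functional takes equal values on inseparable forms, so the linear choice of
  -- representatives does not matter.
  have h1 : Inseparable (SeparationQuotient.outCLM ℝ (L2Section g ν k) a.toL2) a :=
    SeparationQuotient.mk_eq_mk.1 (SeparationQuotient.mk_outCLM ℝ _)
  exact (h1.map ℓ.continuous).eq

theorem hasWeakFDerivOn_of_contDiffOn {F : Type*} [NormedAddCommGroup F] [NormedSpace ℝ F]
    {f : Euc n → F} {O : Set (Euc n)} (hO : IsOpen O) (hf : ContDiffOn ℝ ∞ f O) :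
    HasWeakFDerivOn f (fderiv ℝ f) O := by
  have hf' : ContDiffOn ℝ ∞ (fderiv ℝ f) O := hf.fderiv_of_isOpen hO (by simp)
  have hl := hf.continuousOn.locallyIntegrableOn (μ := volume) hO.measurableSet
  have hl' := hf'.continuousOn.locallyIntegrableOn (μ := volume) hO.measurableSet
  refine ⟨hl, hl', fun φ hφ hc hs v => ?_⟩
  have hd : Continuous fun y => fderiv ℝ φ y v :=
    (hφ.continuous_fderiv (by simp)).clm_apply continuous_const
  rw [integral_smul_fderiv_eq_neg_fderiv_smul_of_integrable
    (integrable_smul_of_tsupport hl hd (hc.fderiv_apply ℝ v)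
      ((tsupport_fderiv_apply_subset ℝ v).trans hs))
    ((integrable_smul_of_tsupport hl' hφ.continuous hc hs).apply_continuousLinearMap v)
    (integrable_smul_of_tsupport hl hφ.continuous hc hs)
    (fun y _ => hφ.differentiable (by simp) y)
    (fun y hy => (hf.contDiffAt (hO.mem_nhds (hs hy))).differentiableAt (by simp)), neg_neg]

theorem hasWeakExtDeriv_extD {Ω : Set M} (hΩ : IsOpen Ω) {u : KForm n M k}
    (hu : ∀ x : M, ContDiffOn ℝ ∞ (pullChart x u) (coordTarget x)) :
    HasWeakExtDeriv Ω u (extD u) := by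
  intro x
  have hO : IsOpen (chartDomain (n := n) Ω x) := isOpen_chartDomain hΩ x
  have hsub : chartDomain (n := n) Ω x ⊆ coordTarget x := Set.inter_subset_left
  refine ⟨_, hasWeakFDerivOn_of_contDiffOn hO ((hu x).mono hsub), ?_⟩
  filter_upwards [ae_restrict_mem hO.measurableSet] with y hy
  exact pullChart_extD hu x (hsub hy)

theorem exists_mem_sobolev (g : SmoothMetric n M) {Ω : Set M} (hΩ : IsOpen Ω)
    (u : L2Section g ((riemannianVolume g).restrict Ω) k) (hu : IsTestForm Ω u.form) :
    ∃ t ∈ sobolev g Ω k, t.fst = u.toL2 ∧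
      ∃ v : L2Section g ((riemannianVolume g).restrict Ω) (k + 1),
        v.form = extD u.form ∧ t.snd.fst = v.toL2 := by
  have := isFiniteMeasure_riemannianVolume g
  let v := smoothSection g ((riemannianVolume g).restrict Ω) _ (smooth_extD hu.smooth)
  obtain ⟨w, hw⟩ : ∃ w, HasWeakCodiff g Ω k u.toL2 w := by
    cases k with
    | zero => exact ⟨0, rfl⟩
    | succ k =>
      obtain ⟨w, hw⟩ := exists_codiff g hΩ hu
      refine ⟨w, fun a b ha hb => ?_⟩
      refine (hw a ha).trans ?_
      rw [← hb]
      rfl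
  exact ⟨WithLp.toLp 2 (u.toL2, WithLp.toLp 2 (v.toL2, w)),
    ⟨⟨u, v, rfl, rfl, hasWeakExtDeriv_extD hΩ hu.smooth⟩, hw⟩, rfl, v, rfl, rfl⟩

/-- Weak gradients depend only on the almost-everywhere class of the function: the integral identity
leaves nothing but the gradient, and the fundamental lemma applies in each coordinate direction. -/
theorem ae_eq_zero_of_hasWeakFDerivOn {F : Type*} [NormedAddCommGroup F] [NormedSpace ℝ F]
    [FiniteDimensional ℝ F] {f : Euc n → F} {D : Euc n → Euc n →L[ℝ] F} {O : Set (Euc n)}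
    (hO : IsOpen O) (h : HasWeakFDerivOn f D O) (hf : ∀ᵐ y ∂volume.restrict O, f y = 0) :
    ∀ᵐ y ∂volume.restrict O, D y = 0 := by
  have h1 : ∀ i : Fin n, ∀ᵐ y, y ∈ O → D y (stdVec i) = 0 := fun i => by
    refine hO.ae_eq_zero_of_integral_contDiff_smul_eq_zero ?_ fun φ hφ hc hs => ?_
    · intro y hy
      obtain ⟨s, hs, hi⟩ := h.locallyIntegrableOn_deriv y hy
      exact ⟨s, hs, hi.apply_continuousLinearMap _⟩
    · rw [← neg_eq_zero, ← h.integral_eq φ hφ hc hs]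
      refine integral_eq_zero_of_ae ?_
      filter_upwards [(ae_restrict_iff' hO.measurableSet).1 hf] with y hy
      by_cases hyO : y ∈ O
      · simp [hy hyO]
      · simp [fderiv_of_notMem_tsupport ℝ fun h => hyO (hs h)]
  rw [ae_restrict_iff' hO.measurableSet]
  filter_upwards [Filter.eventually_all.2 h1] with y hy hyO
  ext1 v
  rw [← sum_smul_stdVec v, map_sum]
  simp [hy _ hyO]

/-- An element of the Sobolev space is determined by its first component. -/
theorem eq_zero_of_fst_eq_zero {g : SmoothMetric n M} {Ω : Set M} (hΩ : IsOpen Ω)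
    {s : FormTriple g Ω k} (hs : s ∈ sobolev g Ω k) (h0 : s.fst = 0) : s = 0 := by
  have := isFiniteMeasure_riemannianVolume g
  obtain ⟨⟨u, v, hu, hv, hw⟩, hc⟩ := hs
  have h1 : s.snd.fst = 0 := by
    rw [← hv, L2Section.toL2_eq_zero_iff]
    rw [h0, L2Section.toL2_eq_zero_iff] at hu
    refine ae_of_ae_chart fun x => (ae_restrict_chart_iff g hΩ.measurableSet x).2 ?_
    obtain ⟨D, hD, hDv⟩ := hw x
    have h2 := (ae_restrict_chart_iff g hΩ.measurableSet x).1 (ae_restrict_of_ae hu)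
    have h3 := ae_eq_zero_of_hasWeakFDerivOn (isOpen_chartDomain hΩ x) hD
      (h2.mono fun y hy => pullChart_eq_zero hy)
    filter_upwards [h3, hDv, ae_restrict_mem (isOpen_chartDomain hΩ x).measurableSet]
      with y hy hy' hyD
    rw [hy] at hy'
    have h4 := hy'.trans (map_zero (ContinuousAlternatingMap.alternatizeUncurryFinCLM ℝ (Euc n) ℝ))
    refine rawForm_eq_zero_of_pullChart_eq_zero (coordInv_mem hyD.1) ?_
    rwa [coord_coordInv hyD.1]
  have h2 : s.snd.snd = 0 := by
    rw [h0] at hc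
    cases k with
    | zero => exact hc
    | succ k =>
      refine eq_zero_of_inner_testForm g hΩ _ fun a ha => ?_
      rw [real_inner_comm]
      exact (hc a (smoothSection g _ _ (smooth_extD ha.smooth)) ha rfl).trans (inner_zero_left _)
  rw [← norm_eq_zero, ← sq_eq_zero_iff, WithLp.prod_norm_sq_eq_of_L2, WithLp.prod_norm_sq_eq_of_L2,
    h0, h1, h2]
  simp

/-- A Sobolev triple is determined by its first entry, so the weak exterior derivative of a test
form is the classical one. -/
theorem snd_fst_eq {g : SmoothMetric n M} {Ω : Set M} (hΩ : IsOpen Ω)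
    {t : FormTriple g Ω k} (ht : t ∈ sobolev g Ω k)
    {u : L2Section g ((riemannianVolume g).restrict Ω) k} (hu : IsTestForm Ω u.form)
    (h : u.toL2 = t.fst) : ∃ v : L2Section g ((riemannianVolume g).restrict Ω) (k + 1),
      v.form = extD u.form ∧ v.toL2 = t.snd.fst := by
  obtain ⟨t', ht', h1, v, hv, h2⟩ := exists_mem_sobolev g hΩ u hu
  have h3 : t - t' = 0 := eq_zero_of_fst_eq_zero hΩ (Submodule.sub_mem _ ht ht')
    (by rw [WithLp.sub_fst, h1, h, sub_self])
  exact ⟨v, hv, by rw [sub_eq_zero.1 h3, h2]⟩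

end TestTriples

/-! ### Localization of test forms and of their exterior derivatives. -/

section Gradient
variable {n k : ℕ}

/-- The exterior derivative, as a function of the full derivative. -/
abbrev altL (n k : ℕ) : (Euc n →L[ℝ] Alt n k) →L[ℝ] Alt n (k + 1) :=
  ContinuousAlternatingMap.alternatizeUncurryFinCLM ℝ (Euc n) ℝ

theorem altL_apply (D : Euc n →L[ℝ] Alt n k) :
    altL n k D = ContinuousAlternatingMap.alternatizeUncurryFin D := rfl

/-- The term of order zero in the exterior derivative of `φ η`. -/
def wedgeGrad (φ : Euc n → ℝ) (η : Euc n → Alt n k) (y : Euc n) : Alt n (k + 1) :=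
  altL n k ((fderiv ℝ φ y).smulRight (η y))

theorem alternatize_fderiv_smul {φ : Euc n → ℝ} {η : Euc n → Alt n k} {y : Euc n}
    (hφ : DifferentiableAt ℝ φ y) (hη : DifferentiableAt ℝ η y) :
    ContinuousAlternatingMap.alternatizeUncurryFin (fderiv ℝ (fun z => φ z • η z) y) =
      φ y • ContinuousAlternatingMap.alternatizeUncurryFin (fderiv ℝ η y) + wedgeGrad φ η y := by
  rw [fderiv_fun_smul hφ hη, ← altL_apply, map_add, map_smul]
  rfl

theorem exists_wedgeGrad_bound {φ : Euc n → ℝ} {O K : Set (Euc n)} (hO : IsOpen O)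
    (hφ : ContDiffOn ℝ ∞ φ O) (hK : IsCompact K) (hKO : K ⊆ O) (k : ℕ) :
    ∃ C, 0 ≤ C ∧ ∀ (η : Euc n → Alt n k), ∀ y ∈ K, ‖wedgeGrad φ η y‖ ≤ C * ‖η y‖ := by
  obtain ⟨B, hB⟩ := hK.exists_bound_of_continuousOn
    ((hφ.continuousOn_fderiv_of_isOpen hO (by simp)).mono hKO)
  refine ⟨‖altL n k‖ * |B|, by positivity, fun η y hy => ?_⟩
  refine ((altL n k).le_opNorm _).trans ?_
  rw [mul_assoc, ContinuousLinearMap.norm_smulRight_apply]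
  exact mul_le_mul_of_nonneg_left (mul_le_mul_of_nonneg_right
    ((hB y hy).trans (le_abs_self B)) (norm_nonneg _)) (norm_nonneg _)

theorem sqrt_integral_le {X F G : Type*} [MeasurableSpace X] [NormedAddCommGroup F]
    [NormedAddCommGroup G] {ν : Measure X} {f : X → F} {h : X → G} (hh : MemLp h 2 ν) {C : ℝ}
    (hC : 0 ≤ C) (hfh : ∀ᵐ x ∂ν, ‖f x‖ ≤ C * ‖h x‖) :
    √(∫ x, ‖f x‖ ^ 2 ∂ν) ≤ C * √(∫ x, ‖h x‖ ^ 2 ∂ν) := by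
  conv_rhs => rw [← Real.sqrt_sq hC]
  rw [← Real.sqrt_mul (sq_nonneg C), ← integral_const_mul]
  refine Real.sqrt_le_sqrt (integral_mono_of_nonneg
    (Filter.Eventually.of_forall fun x => by positivity)
    ((hh.integrable_norm_pow (by norm_num)).const_mul _) ?_)
  filter_upwards [hfh] with x hx
  rw [← mul_pow]
  exact pow_le_pow_left₀ (norm_nonneg _) hx 2

variable {M : Type*} [TopologicalSpace M] [ChartedSpace (Euc n) M]
  [IsManifold (𝓡 n) ∞ M]

variable [MeasurableSpace M] [BorelSpace M] [CompactSpace M] [T2Space M]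

theorem norm_fst_le {g : SmoothMetric n M} {Ω : Set M} (t : FormTriple g Ω k) :
    ‖t.fst‖ ≤ ‖t‖ := by
  refine abs_le_of_sq_le_sq' ?_ (norm_nonneg _) |>.2
  rw [WithLp.prod_norm_sq_eq_of_L2]
  exact le_add_of_nonneg_right (sq_nonneg _)

theorem norm_snd_le {g : SmoothMetric n M} {Ω : Set M} (t : FormTriple g Ω k) :
    ‖t.snd‖ ≤ ‖t‖ := by
  have h := WithLp.prod_norm_sq_eq_of_L2 t
  exact (abs_le_of_sq_le_sq' (by linarith [sq_nonneg ‖t.fst‖]) (norm_nonneg _)).2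

theorem norm_snd_sq {g : SmoothMetric n M} {Ω : Set M} (t : FormTriple g Ω k) :
    ‖t.snd‖ ^ 2 = ‖t.snd.fst‖ ^ 2 + ‖t.snd.snd‖ ^ 2 := WithLp.prod_norm_sq_eq_of_L2 _

theorem norm_snd_fst_le {g : SmoothMetric n M} {Ω : Set M} (t : FormTriple g Ω k) :
    ‖t.snd.fst‖ ≤ ‖t‖ := by
  refine (abs_le_of_sq_le_sq' ?_ (norm_nonneg _) |>.2).trans (norm_snd_le t)
  rw [norm_snd_sq]
  exact le_add_of_nonneg_right (sq_nonneg _)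

theorem norm_snd_snd_le {g : SmoothMetric n M} {Ω : Set M} (t : FormTriple g Ω k) :
    ‖t.snd.snd‖ ≤ ‖t‖ := by
  refine (abs_le_of_sq_le_sq' ?_ (norm_nonneg _) |>.2).trans (norm_snd_le t)
  rw [norm_snd_sq]
  exact le_add_of_nonneg_left (sq_nonneg _)

theorem L2Section.norm_toL2 {g : SmoothMetric n M} {ν : Measure M} (u : L2Section g ν k) :
    ‖u.toL2‖ = ‖u‖ := SeparationQuotient.norm_mk u

/-- The part of a form that a function supported in a chart domain cuts out is supported in a
compact subset of the chart domain. -/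
theorem IsTestForm.exists_localized_support {Ω : Set M} {u : KForm n M k} (hu : IsTestForm Ω u)
    {x : M} {χ : M → ℝ} (hs : tsupport χ ⊆ (chartAt (Euc n) x).source) :
    ∃ K : Set M, IsCompact K ∧ K ⊆ tsupport χ ∧ K ⊆ (chartAt (Euc n) x).source ∧ K ⊆ Ω ∧
      ∀ p ∉ K, (χ p • u p) = 0 := by
  obtain ⟨K, hK, hKΩ, hz⟩ := hu.compact_support
  refine ⟨tsupport χ ∩ K, hK.inter_left (isClosed_tsupport χ), Set.inter_subset_left,
    fun p hp => hs hp.1, fun p hp => hKΩ hp.2, fun p hp => ?_⟩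
  by_cases hpK : p ∈ K
  · have : χ p = 0 := image_eq_zero_of_notMem_tsupport fun h => hp ⟨h, hpK⟩
    simp only [this]
    exact zero_smul ℝ (rawForm u p)
  · simp only [hz p hpK]
    exact smul_zero (A := Alt n k) _

theorem alternatize_fderiv_chartForm_smul {x : M} {χ : M → ℝ} (hχ : ContMDiff (𝓡 n) 𝓘(ℝ, ℝ) ∞ χ)
    {u : KForm n M k} (hu : ∀ x : M, ContDiffOn ℝ ∞ (pullChart x u) (coordTarget x))
    {y : Euc n} (hy : y ∈ coordTarget x) :
    ContinuousAlternatingMap.alternatizeUncurryFin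
        (fderiv ℝ (chartForm x (fun p => χ p • u p)) y) =
      χ (coordInv x y) • pullChart x (extD u) y +
        wedgeGrad (fun z => χ (coordInv x z)) (pullChart x u) y := by
  have hn := (isOpen_coordTarget x).mem_nhds hy
  rw [fderiv_chartForm _ hy, pullChart_extD hu x hy]
  exact alternatize_fderiv_smul
    (((contDiffOn_comp_coordInv hχ x).contDiffAt hn).differentiableAt (by simp))
    (((hu x).contDiffAt hn).differentiableAt (by simp))

/-- A localized test form and its exterior derivative are bounded in `L²`. -/
theorem exists_localized_extD_bound (g : SmoothMetric n M) {Ω : Set M} (hΩ : IsOpen Ω) {x : M}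
    {χ : M → ℝ} (hχ : ContMDiff (𝓡 n) 𝓘(ℝ, ℝ) ∞ χ) (hχ1 : ∀ p, |χ p| ≤ 1)
    (hs : tsupport χ ⊆ (chartAt (Euc n) x).source) (k : ℕ) :
    ∃ C, 0 ≤ C ∧ ∀ t ∈ sobolev g Ω k, ∀ u : L2Section g ((riemannianVolume g).restrict Ω) k,
      IsTestForm Ω u.form → u.toL2 = t.fst →
      ∫ y, ‖chartForm x (fun p => χ p • u.form p) y‖ ^ 2 ≤ C * ‖t‖ ^ 2 ∧
      ∫ y, ‖ContinuousAlternatingMap.alternatizeUncurryFin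
        (fderiv ℝ (chartForm x (fun p => χ p • u.form p)) y)‖ ^ 2 ≤ C * ‖t‖ ^ 2 := by
  have hK' : IsCompact (tsupport χ) := (isClosed_tsupport χ).isCompact
  have hKc := isCompact_coord_image hK' hs
  have hKT := coord_image_subset (n := n) hs
  obtain ⟨B, hB, hwedge⟩ := exists_wedgeGrad_bound (isOpen_coordTarget x)
    (contDiffOn_comp_coordInv hχ x) hKc hKT k
  obtain ⟨C₀, h₀⟩ := exists_restrict_bound g hΩ.measurableSet x hKc hKT k
  obtain ⟨C₁, h₁⟩ := exists_restrict_bound g hΩ.measurableSet x hKc hKT (k + 1)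
  set W := coord (n := n) x '' tsupport χ ∩ chartDomain Ω x
  have hW : MeasurableSet W := hKc.measurableSet.inter (isOpen_chartDomain hΩ x).measurableSet
  -- The first summand bounds `χu`; the other two bound `χ du + dχ ∧ u` through `(a + b)² ≤ 2a² +
  -- 2b²`, with `B` a bound for the operation `dχ ∧`.
  refine ⟨|C₀| + 2 * |C₁| + 2 * B ^ 2 * |C₀|, by positivity, fun t ht u hu hut => ?_⟩
  obtain ⟨v, hv, hvt⟩ := snd_fst_eq hΩ ht hu hut
  obtain ⟨K, hK, hKχ, hKx, hKΩ, hz⟩ := hu.exists_localized_support hs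
  have hKW : coord (n := n) x '' K ⊆ W := fun y hy =>
    ⟨Set.image_mono hKχ hy, coord_image_subset_chartDomain hKx hKΩ hy⟩
  obtain ⟨hum, hub⟩ := h₀ u
  obtain ⟨hvm, hvb⟩ := h₁ v
  set w := chartForm x (fun p => χ p • u.form p)
  have hws : tsupport w ⊆ W := (tsupport_chartForm_subset hK hKx hz).trans hKW
  have hun : ‖u‖ ^ 2 ≤ ‖t‖ ^ 2 := by
    rw [← u.norm_toL2, hut]
    exact pow_le_pow_left₀ (norm_nonneg _) (norm_fst_le t) 2
  have hvn : ‖v‖ ^ 2 ≤ ‖t‖ ^ 2 := by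
    rw [← v.norm_toL2, hvt]
    exact pow_le_pow_left₀ (norm_nonneg _) (norm_snd_fst_le t) 2
  have hub' : ∫ y in W, ‖pullChart x u.form y‖ ^ 2 ≤ |C₀| * ‖t‖ ^ 2 :=
    hub.trans (mul_le_mul (le_abs_self _) hun (sq_nonneg _) (abs_nonneg _))
  have hvb' : ∫ y in W, ‖pullChart x v.form y‖ ^ 2 ≤ |C₁| * ‖t‖ ^ 2 :=
    hvb.trans (mul_le_mul (le_abs_self _) hvn (sq_nonneg _) (abs_nonneg _))
  have hui := hum.integrable_norm_pow (p := 2) (by norm_num)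
  have hvi := hvm.integrable_norm_pow (p := 2) (by norm_num)
  have hpos : 0 ≤ ‖t‖ ^ 2 := sq_nonneg _
  constructor
  · rw [← setIntegral_eq_integral_of_forall_compl_eq_zero (s := W) fun y hy => by
      rw [image_eq_zero_of_notMem_tsupport fun h => hy (hws h), norm_zero]; norm_num]
    calc ∫ y in W, ‖w y‖ ^ 2 ≤ ∫ y in W, ‖pullChart x u.form y‖ ^ 2 := by
          refine integral_mono_of_nonneg (Filter.Eventually.of_forall fun _ => by positivity) hui ?_
          filter_upwards [ae_restrict_mem hW] with y hy
          have : w y = χ (coordInv x y) • pullChart x u.form y := chartForm_of_mem _ hy.2.1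
          simp only [this, norm_smul]
          refine pow_le_pow_left₀ (by positivity) ?_ 2
          exact mul_le_of_le_one_left (norm_nonneg _) (hχ1 _)
      _ ≤ |C₀| * ‖t‖ ^ 2 := hub'
      _ ≤ _ := by
          refine mul_le_mul_of_nonneg_right ?_ hpos
          have : 0 ≤ 2 * |C₁| + 2 * B ^ 2 * |C₀| := by positivity
          linarith
  · rw [← setIntegral_eq_integral_of_forall_compl_eq_zero (s := W) fun y hy => by
      rw [fderiv_of_notMem_tsupport ℝ fun h => hy (hws h), ← altL_apply, map_zero, norm_zero]
      norm_num]
    calc _ ≤ ∫ y in W, (2 * ‖pullChart x v.form y‖ ^ 2 +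
            2 * B ^ 2 * ‖pullChart x u.form y‖ ^ 2) := by
          refine integral_mono_of_nonneg (Filter.Eventually.of_forall fun _ => by positivity)
            ((hvi.const_mul 2).add (hui.const_mul _)) ?_
          filter_upwards [ae_restrict_mem hW] with y hy
          simp only [w, alternatize_fderiv_chartForm_smul hχ hu.smooth hy.2.1, ← hv]
          have e1 : ‖χ (coordInv x y) • pullChart x v.form y‖ ≤ ‖pullChart x v.form y‖ := by
            rw [norm_smul]
            exact mul_le_of_le_one_left (norm_nonneg _) (hχ1 _)
          have e2 := (norm_add_le (χ (coordInv x y) • pullChart x v.form y)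
            (wedgeGrad (fun z => χ (coordInv x z)) (pullChart x u.form) y)).trans
            (add_le_add e1 (hwedge (pullChart x u.form) y hy.1))
          refine (pow_le_pow_left₀ (norm_nonneg _) e2 2).trans ?_
          nlinarith [sq_nonneg (‖pullChart x v.form y‖ - B * ‖pullChart x u.form y‖)]
      _ = 2 * (∫ y in W, ‖pullChart x v.form y‖ ^ 2) +
            (2 * B ^ 2) * ∫ y in W, ‖pullChart x u.form y‖ ^ 2 := by
          rw [integral_add (hvi.const_mul 2) (hui.const_mul _), integral_const_mul,
            integral_const_mul]
      _ ≤ 2 * (|C₁| * ‖t‖ ^ 2) + (2 * B ^ 2) * (|C₀| * ‖t‖ ^ 2) := by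
          gcongr
      _ ≤ _ := by
          have : 0 ≤ |C₀| * ‖t‖ ^ 2 := by positivity
          linarith

end Gradient

/-! ### Bounds for the codifferential and the full gradient of localized test forms. -/

section LocalizedCodiff
variable {n k : ℕ} {M : Type*} [TopologicalSpace M] [ChartedSpace (Euc n) M]
  [IsManifold (𝓡 n) ∞ M]

theorem IsLocalMetric.exists_norm_sq_le {O : Set (Euc n)} {S : Euc n → Matrix (Fin n) (Fin n) ℝ}
    {ρ : Euc n → ℝ} (h : IsLocalMetric O S ρ) {K : Set (Euc n)} (hK : IsCompact K) (hKO : K ⊆ O)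
    (k : ℕ) : ∃ C, 0 ≤ C ∧ ∀ y ∈ K, ∀ α : Alt n k, ‖α‖ ^ 2 ≤ C * (ρ y * matInner (S y) α α) := by
  obtain ⟨c, hc, hlow⟩ := exists_matInner_lower (k := k) hK (h.continuousOn_inv.mono hKO)
    fun y hy => h.posDef y (hKO hy)
  obtain ⟨r, hr, hrK⟩ : ∃ r > 0, ∀ y ∈ K, r ≤ ρ y := by
    rcases K.eq_empty_or_nonempty with rfl | hne
    · exact ⟨1, one_pos, by simp⟩
    · obtain ⟨y, hy, hm⟩ := hK.exists_isMinOn hne (h.smooth_dens.continuousOn.mono hKO)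
      exact ⟨_, h.dens_pos y (hKO hy), fun z hz => hm hz⟩
  refine ⟨(r * c)⁻¹, by positivity, fun y hy α => ?_⟩
  rw [← div_eq_inv_mul, le_div_iff₀ (by positivity)]
  calc _ = r * (c * ‖α‖ ^ 2) := by ring
    _ ≤ _ := mul_le_mul (hrK y hy) (hlow y hy α) (by positivity) (h.dens_pos y (hKO hy)).le

variable [MeasurableSpace M] [BorelSpace M] [CompactSpace M] [T2Space M]

theorem le_of_le_add_mul_sqrt {Y C T : ℝ} (hY : 0 ≤ Y)
    (h : Y ≤ C * T * √Y) : Y ≤ C ^ 2 * T ^ 2 := by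
  rcases hY.eq_or_lt with rfl | hY'
  · positivity
  · have h0 := Real.sqrt_pos.2 hY'
    have h1 := Real.sq_sqrt hY
    have h2 : √Y ≤ C * T := by
      refine le_of_mul_le_mul_right ?_ h0
      rw [← sq, h1]
      exact h
    rw [← mul_pow, ← h1]
    exact pow_le_pow_left₀ h0.le h2 2

/-- The principal part of the codifferential of a localized test form is bounded in `L²`. -/
theorem exists_localized_codiff_bound (g : SmoothMetric n M) {Ω : Set M} (hΩ : IsOpen Ω) {x : M}
    {χ : M → ℝ} (hχ : ContMDiff (𝓡 n) 𝓘(ℝ, ℝ) ∞ χ) (hχ1 : ∀ p, |χ p| ≤ 1)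
    (hs : tsupport χ ⊆ (chartAt (Euc n) x).source) (k : ℕ) :
    ∃ C, ∀ t ∈ sobolev g Ω (k + 1),
      ∀ u : L2Section g ((riemannianVolume g).restrict Ω) (k + 1),
      IsTestForm Ω u.form → u.toL2 = t.fst →
      ∫ y, chartDens g x y * matInner (chartInv g x y)
        (codiffSymbol (chartInv g x y) (fderiv ℝ (chartForm x (fun p => χ p • u.form p)) y))
        (codiffSymbol (chartInv g x y) (fderiv ℝ (chartForm x (fun p => χ p • u.form p)) y)) ≤
        C * ‖t‖ ^ 2 := by
  have := isFiniteMeasure_riemannianVolume g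
  have hm := isLocalMetric_chart g x
  have hK' : IsCompact (tsupport χ) := (isClosed_tsupport χ).isCompact
  have hKc := isCompact_coord_image hK' hs
  have hKT := coord_image_subset (n := n) hs
  obtain ⟨B, hB, hwedge⟩ := exists_wedgeGrad_bound (isOpen_coordTarget x)
    (contDiffOn_comp_coordInv hχ x) hKc hKT k
  obtain ⟨C₀, h₀⟩ := exists_restrict_bound g hΩ.measurableSet x hKc hKT (k + 1)
  obtain ⟨C₁, hC₁, hpair⟩ := exists_pairing_bound g x hKc hKT (k + 1)
  obtain ⟨C₁', -, hpair'⟩ := exists_pairing_bound g x hKc hKT k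
  obtain ⟨C₂, hC₂, hgreen⟩ := hm.exists_green_bound (k := k) hKc hKT
  obtain ⟨C₃, hC₃, hloc⟩ := exists_localized_extD_bound g hΩ hχ hχ1 hs (k + 1)
  obtain ⟨C₄, hC₄, hlow⟩ := hm.exists_norm_sq_le hKc hKT k
  set K' := coord (n := n) x '' tsupport χ
  set W := K' ∩ chartDomain Ω x
  have hW : MeasurableSet W := hKc.measurableSet.inter (isOpen_chartDomain hΩ x).measurableSet
  -- The summands come from the norm of `d*u`, from the derivative of the cutoff in the test form,
  -- and from the error in Green's formula.
  refine ⟨(1 + C₁ * (B * √C₄) * √|C₀| + C₂ * (√C₃ * √C₄)) ^ 2, fun t ht u hu hut => ?_⟩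
  obtain ⟨hw2, -⟩ := hloc t ht u hu hut
  obtain ⟨K, hK, hKχ, hKx, hKΩ, hz⟩ := hu.exists_localized_support hs
  have hLW : coord (n := n) x '' K ⊆ W := fun y hy =>
    ⟨Set.image_mono hKχ hy, coord_image_subset_chartDomain hKx hKΩ hy⟩
  obtain ⟨hum, hub⟩ := h₀ u
  set φ : Euc n → ℝ := fun z => χ (coordInv x z)
  have hφ : ContDiffOn ℝ ∞ φ (coordTarget x) := contDiffOn_comp_coordInv hχ x
  set w := chartForm x (fun p => χ p • u.form p)
  have hwc : ContDiff ℝ ∞ w := contDiff_chartForm ((hu.smul hχ).smooth x) hK hKx hz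
  have hws : tsupport w ⊆ coord (n := n) x '' K := tsupport_chartForm_subset hK hKx hz
  -- The weak definition of `d*u` is tested with `χ` times the quantity `d` to be bounded. The
  -- factor `χ` passes to `u`, Green's formula reproduces `Y = ⟨d, d⟩`, and every other term is at
  -- most a multiple of `‖t‖ * √Y`.
  set d : Euc n → Alt n k := fun y => codiffSymbol (chartInv g x y) (fderiv ℝ w y)
  have hd : ContDiffOn ℝ ∞ d (coordTarget x) := contDiffOn_codiffSymbol hm hwc
  have hd0 : ∀ y ∉ coord (n := n) x '' K, d y = 0 := fun y hy =>
    codiffSymbol_fderiv_eq_zero _ fun h => hy (hws h)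
  have hdW : ∀ y ∉ W, d y = 0 := fun y hy => hd0 y fun h => hy (hLW h)
  have hWK : W ⊆ K' := Set.inter_subset_left
  have hWT : W ⊆ coordTarget x := hWK.trans hKT
  have : IsFiniteMeasure (volume.restrict W) :=
    ⟨by simpa using (measure_mono hWK).trans_lt hKc.measure_lt_top⟩
  have hdm : MemLp d 2 (volume.restrict W) := by
    obtain ⟨A, hA⟩ := hKc.exists_bound_of_continuousOn (hd.continuousOn.mono hKT)
    exact MemLp.of_bound ((hd.continuousOn.mono hWT).aestronglyMeasurable hW) A
      (by filter_upwards [ae_restrict_mem hW] with y hy using hA y (hWK hy))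
  have hwm : MemLp w 2 (volume.restrict W) :=
    (hwc.continuous.memLp_of_hasCompactSupport
      ((isCompact_coord_image hK hKx).of_isClosed_subset (isClosed_tsupport _) hws)).restrict W
  have hwW : ∀ y ∉ W, w y = 0 := fun y hy =>
    image_eq_zero_of_notMem_tsupport fun h => hy (hLW (hws h))
  -- the energy of the symbol
  set Y := ∫ y, chartDens g x y * matInner (chartInv g x y) (d y) (d y)
  have hYi : Integrable fun y => chartDens g x y * matInner (chartInv g x y) (d y) (d y) :=
    (hpair' W d d hW hWK hdW hdm hdm).1
  have hY0 : 0 ≤ Y := integral_nonneg fun y => by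
    by_cases hy : y ∈ W
    · exact mul_nonneg (hm.dens_pos y (hWT hy)).le (matInner_self_nonneg (hm.posDef y (hWT hy)) _)
    · simp [hdW y hy]
  have hdY : √(∫ y in W, ‖d y‖ ^ 2) ≤ √C₄ * √Y := by
    rw [← Real.sqrt_mul hC₄]
    refine Real.sqrt_le_sqrt ?_
    rw [← integral_const_mul, setIntegral_eq_integral_of_forall_compl_eq_zero (s := W)
      fun y hy => by rw [hdW y hy, norm_zero]; norm_num]
    refine integral_mono_of_nonneg (Filter.Eventually.of_forall fun _ => by positivity)
      (hYi.const_mul _) (Filter.Eventually.of_forall fun y => ?_)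
    by_cases hy : y ∈ W
    · exact hlow y (hWK hy) _
    · simp [hdW y hy]
  have huT : √(∫ y in W, ‖pullChart x u.form y‖ ^ 2) ≤ √|C₀| * ‖t‖ := by
    have hun : ‖u‖ ≤ ‖t‖ := by
      rw [← u.norm_toL2, hut]
      exact norm_fst_le t
    conv_rhs => rw [← Real.sqrt_sq (norm_nonneg t)]
    rw [← Real.sqrt_mul (abs_nonneg _)]
    exact Real.sqrt_le_sqrt (hub.trans (mul_le_mul (le_abs_self _)
      (pow_le_pow_left₀ (norm_nonneg _) hun 2) (sq_nonneg _) (abs_nonneg _)))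
  have hwT : √(∫ y in W, ‖w y‖ ^ 2) ≤ √C₃ * ‖t‖ := by
    conv_rhs => rw [← Real.sqrt_sq (norm_nonneg t)]
    rw [← Real.sqrt_mul hC₃, setIntegral_eq_integral_of_forall_compl_eq_zero (s := W)
      fun y hy => by rw [hwW y hy, norm_zero]; norm_num]
    exact Real.sqrt_le_sqrt hw2
  -- Green's formula
  obtain ⟨hI1, -, hg⟩ := hgreen w d (hwc.of_le (by simp))
    (hws.trans (hLW.trans hWK)) (hd.of_le (by simp))
  have hgW : ∫ y, ‖w y‖ * ‖d y‖ ≤ (√C₃ * ‖t‖) * (√C₄ * √Y) := by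
    rw [← setIntegral_eq_integral_of_forall_compl_eq_zero (s := W)
      fun y hy => by rw [hwW y hy, norm_zero, zero_mul]]
    exact (integral_mul_norm_le hwm hdm).trans
      (mul_le_mul hwT hdY (Real.sqrt_nonneg _) (by positivity))
  -- the term of lower order
  have hqm : MemLp (wedgeGrad φ d) 2 (volume.restrict W) := by
    refine hdm.of_le_mul (c := B) ?_ ?_
    · refine ContinuousOn.aestronglyMeasurable ?_ hW
      have h1 : ContinuousOn (fun y => (fderiv ℝ φ y).smulRight (d y)) W := by
        have h2 := (hφ.continuousOn_fderiv_of_isOpen (isOpen_coordTarget x) (by simp)).mono hWT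
        have h3 : Continuous fun q : (Euc n →L[ℝ] ℝ) × Alt n k =>
            ContinuousLinearMap.smulRight q.1 q.2 := by
          exact (ContinuousLinearMap.smulRightL ℝ (Euc n) (Alt n k)).continuous₂
        exact h3.comp_continuousOn (h2.prodMk (hd.continuousOn.mono hWT))
      exact (altL n k).continuous.comp_continuousOn h1
    · filter_upwards [ae_restrict_mem hW] with y hy using hwedge d y (hWK hy)
  have hq0 : ∀ y ∉ W, wedgeGrad φ d y = 0 := fun y hy => by
    rw [wedgeGrad, hdW y hy, ContinuousLinearMap.smulRight_zero, map_zero]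
  obtain ⟨hI2, hI2b⟩ := hpair W (wedgeGrad φ d) (pullChart x u.form) hW hWK hq0 hqm hum
  have hq : √(∫ y in W, ‖wedgeGrad φ d y‖ ^ 2) ≤ B * (√C₄ * √Y) :=
    (sqrt_integral_le hdm hB (by
      filter_upwards [ae_restrict_mem hW] with y hy using hwedge d y (hWK hy))).trans
      (mul_le_mul_of_nonneg_left hdY hB)
  -- the test form
  have hzc : ∀ p ∈ (chartAt (Euc n) x).source, p ∉ K →
      φ (coord x p) • d (coord x p) = 0 := fun p hp hpK => by
    have h0 : coord (n := n) x p ∉ coord (n := n) x '' K := by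
      rintro ⟨q, hq, hqp⟩
      have h1 : coordInv (n := n) x (coord x q) = q := coordInv_coord (hKx hq)
      have h2 : coordInv (n := n) x (coord x p) = p := coordInv_coord hp
      exact hpK (by rwa [← h2, ← hqp, h1])
    rw [hd0 _ h0, smul_zero]
  set a0 : KForm n M k := pushChart x fun y => φ y • d y
  have hat : IsTestForm Ω a0 := isTestForm_pushChart hK hKx hKΩ (hφ.smul hd) hzc
  have ha0 : ∀ y ∈ coordTarget x, pullChart x a0 y = φ y • d y := fun y hy =>
    pullChart_pushChart _ hy
  have haz : ∀ p ∉ K, a0 p = 0 := fun p hp => by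
    by_cases hpx : p ∈ (chartAt (Euc n) x).source
    · have h1 := pushChart_of_mem (fun y => φ y • d y) hpx
      rw [hzc p hpx hp] at h1
      exact h1
    · exact pushChart_of_notMem _ hpx
  let a : L2Section g ((riemannianVolume g).restrict Ω) k :=
    smoothSection g _ a0 hat.smooth
  let b : L2Section g ((riemannianVolume g).restrict Ω) (k + 1) :=
    smoothSection g _ _ (smooth_extD hat.smooth)
  have hab : inner ℝ t.snd.snd a.toL2 = inner ℝ u.toL2 b.toL2 := by
    rw [hut]
    exact ht.2 a b hat rfl
  have hb : inner ℝ u.toL2 b.toL2 =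
      (∫ y, chartDens g x y * matInner (chartInv g x y) (w y)
        (ContinuousAlternatingMap.alternatizeUncurryFin (fderiv ℝ d y))) +
      ∫ y, chartDens g x y * matInner (chartInv g x y) (wedgeGrad φ d y)
        (pullChart x u.form y) := by
    rw [← integral_add hI1 hI2]
    have h1 : inner ℝ u.toL2 b.toL2 = ∫ p in Ω, formInner g p (extD a0 p) (u.form p)
        ∂riemannianVolume g :=
      integral_congr_ae (Filter.Eventually.of_forall fun p => formInner_symm g p _ _)
    rw [h1, integral_formInner_chart g hΩ.measurableSet _ hKx hKΩ (extD_eq_zero hK.isClosed haz)]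
    refine integral_congr_ae (Filter.Eventually.of_forall fun y => ?_)
    by_cases hy : y ∈ coordTarget x
    · have hn := (isOpen_coordTarget x).mem_nhds hy
      have e1 : chartForm x (extD a0) y = φ y • ContinuousAlternatingMap.alternatizeUncurryFin
          (fderiv ℝ d y) + wedgeGrad φ d y := by
        rw [chartForm_of_mem _ hy, pullChart_extD hat.smooth x hy]
        have e2 : fderiv ℝ (pullChart x a0) y = fderiv ℝ (fun z => φ z • d z) y := by
          refine Filter.EventuallyEq.fderiv_eq ?_
          filter_upwards [hn] with z hz
          exact ha0 z hz
        refine (congrArg ContinuousAlternatingMap.alternatizeUncurryFin e2).trans ?_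
        exact alternatize_fderiv_smul ((hφ.contDiffAt hn).differentiableAt (by simp))
          ((hd.contDiffAt hn).differentiableAt (by simp))
      have e3 : w y = φ y • pullChart x u.form y := chartForm_of_mem _ hy
      simp only [e1, e3, map_add, add_apply, map_smul, smul_apply, smul_eq_mul]
      rw [matInner_symm (hm.symm hy) (pullChart x u.form y)]
      ring
    · have e1 : chartForm x (extD a0) y = 0 := Set.indicator_of_notMem hy _
      have hyW : y ∉ W := fun h => hy (hWT h)
      simp only [e1, hwW y hyW, hq0 y hyW, map_zero, zero_apply, mul_zero, add_zero]
  have hna : ‖a‖ ≤ √Y := by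
    refine Real.le_sqrt_of_sq_le ?_
    rw [L2Section.norm_sq]
    change ∫ p in Ω, formInner g p (a0 p) (a0 p) ∂riemannianVolume g ≤ _
    rw [integral_formInner_chart g hΩ.measurableSet _ hKx hKΩ haz]
    have h1 : ∀ y, chartDens g x y * matInner (chartInv g x y) (chartForm x a0 y)
        (pullChart x a0 y) = φ y ^ 2 * (chartDens g x y * matInner (chartInv g x y) (d y) (d y)) :=
      fun y => by
      by_cases hy : y ∈ coordTarget x
      · rw [chartForm_of_mem _ hy, ha0 y hy]
        simp only [map_smul, smul_apply, smul_eq_mul]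
        ring
      · have e1 : chartForm x a0 y = 0 := Set.indicator_of_notMem hy _
        simp [e1, hdW y fun h => hy (hWT h)]
    simp only [h1]
    have h2 : ∀ y, 0 ≤ chartDens g x y * matInner (chartInv g x y) (d y) (d y) := fun y => by
      by_cases hy : y ∈ W
      · exact mul_nonneg (hm.dens_pos y (hWT hy)).le
          (matInner_self_nonneg (hm.posDef y (hWT hy)) _)
      · simp [hdW y hy]
    refine integral_mono_of_nonneg (Filter.Eventually.of_forall fun y =>
      mul_nonneg (sq_nonneg _) (h2 y)) hYi (Filter.Eventually.of_forall fun y => ?_)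
    exact mul_le_of_le_one_left (h2 y) ((sq_le_one_iff_abs_le_one _).2 (hχ1 _))
  have hin : |inner ℝ t.snd.snd a.toL2| ≤ ‖t‖ * √Y :=
    (abs_real_inner_le_norm _ _).trans (mul_le_mul (norm_snd_snd_le t)
      (a.norm_toL2.trans_le hna) (norm_nonneg _) (norm_nonneg _))
  refine le_of_le_add_mul_sqrt hY0 ?_
  rw [hab, hb] at hin
  have hI2c := hI2b.trans (mul_le_mul_of_nonneg_left (mul_le_mul hq huT (Real.sqrt_nonneg _)
    (by positivity)) hC₁)
  have hgc := hg.trans (mul_le_mul_of_nonneg_left hgW hC₂)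
  have h1 := (abs_le.1 hin).2
  have h2 := (abs_le.1 hI2c).1
  have h3 := (abs_le.1 hgc).1
  calc Y ≤ ‖t‖ * √Y + C₁ * (B * (√C₄ * √Y) * (√|C₀| * ‖t‖)) +
        C₂ * (√C₃ * ‖t‖ * (√C₄ * √Y)) := by linarith
    _ = _ := by ring

/-- In degree zero the exterior derivative is the gradient. In positive degree Gaffney's inequality
applies, its right-hand side being controlled by the bounds for the localized form, its exterior
derivative and its codifferential symbol. -/
theorem exists_localized_gradient_bound (g : SmoothMetric n M) {Ω : Set M} (hΩ : IsOpen Ω) {x : M}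
    {χ : M → ℝ} (hχ : ContMDiff (𝓡 n) 𝓘(ℝ, ℝ) ∞ χ) (hχ1 : ∀ p, |χ p| ≤ 1)
    (hs : tsupport χ ⊆ (chartAt (Euc n) x).source) :
    ∃ C, ∀ t ∈ sobolev g Ω k, ∀ u : L2Section g ((riemannianVolume g).restrict Ω) k,
      IsTestForm Ω u.form → u.toL2 = t.fst →
      ∫ y, ‖fderiv ℝ (chartForm x (fun p => χ p • u.form p)) y‖ ^ 2 ≤ C * ‖t‖ ^ 2 := by
  have hK' : IsCompact (tsupport χ) := (isClosed_tsupport χ).isCompact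
  have hKc := isCompact_coord_image hK' hs
  have hKT := coord_image_subset (n := n) hs
  obtain ⟨C₁, hC₁, hloc⟩ := exists_localized_extD_bound g hΩ hχ hχ1 hs k
  have hw : ∀ u : KForm n M k, IsTestForm Ω u →
      ContDiff ℝ ∞ (chartForm x (fun p => χ p • u p)) ∧
      tsupport (chartForm x (fun p => χ p • u p)) ⊆ coord (n := n) x '' tsupport χ := fun u hu => by
    obtain ⟨K, hK, hKχ, hKx, hKΩ, hz⟩ := hu.exists_localized_support hs
    exact ⟨contDiff_chartForm ((hu.smul hχ).smooth x) hK hKx hz,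
      (tsupport_chartForm_subset hK hKx hz).trans (Set.image_mono hKχ)⟩
  cases k with
  | zero =>
    refine ⟨C₁, fun t ht u hu hut => le_trans ?_ (hloc t ht u hu hut).2⟩
    obtain ⟨hc, hsup⟩ := hw _ hu
    have hcont : Continuous fun y => ContinuousAlternatingMap.alternatizeUncurryFin
        (fderiv ℝ (chartForm x (fun p => χ p • u.form p)) y) :=
      (altL n 0).continuous.comp (hc.continuous_fderiv (by simp))
    refine integral_mono_of_nonneg (Filter.Eventually.of_forall fun _ => by positivity)
      (MemLp.integrable_norm_pow (hcont.memLp_of_hasCompactSupport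
        (hKc.of_isClosed_subset (isClosed_tsupport _) ?_)) (by norm_num))
      (Filter.Eventually.of_forall fun y =>
        pow_le_pow_left₀ (norm_nonneg _) (norm_le_norm_alternatizeUncurryFin _) 2)
    refine (closure_minimal (fun y hy => ?_) (isClosed_tsupport _)).trans hsup
    by_contra h
    refine hy ?_
    change altL n 0 (fderiv ℝ (chartForm x (fun p => χ p • u.form p)) y) = 0
    rw [fderiv_of_notMem_tsupport ℝ h, map_zero]
  | succ k =>
    obtain ⟨C₂, hcod⟩ := exists_localized_codiff_bound g hΩ hχ hχ1 hs k
    obtain ⟨C₃, hC₃, hgaf⟩ := (isLocalMetric_chart g x).exists_gaffney (k := k) hKc hKT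
    -- In this order the constants belong to the exterior derivative, the codifferential symbol and
    -- the form itself.
    refine ⟨C₃ * (C₁ + C₂ + C₁), fun t ht u hu hut => ?_⟩
    obtain ⟨hc, hsup⟩ := hw _ hu
    obtain ⟨h1, h2⟩ := hloc t ht u hu hut
    have h3 := hcod t ht u hu hut
    refine (hgaf _ (hc.of_le (WithTop.coe_le_coe.2 le_top)) hsup).trans ?_
    rw [mul_assoc]
    refine mul_le_mul_of_nonneg_left ?_ hC₃
    linarith

end LocalizedCodiff

/-! ### Limits in `L²` in terms of integrals. -/

section L2Limits
variable {X F G : Type*} [MeasurableSpace X] {ν : Measure X} [NormedAddCommGroup F]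
  [NormedAddCommGroup G]

theorem tendsto_toLp {f : ℕ → X → F} {f' : X → F} (hf : ∀ m, MemLp (f m) 2 ν)
    (hf' : MemLp f' 2 ν)
    (h : Filter.Tendsto (fun m => ∫ y, ‖f m y - f' y‖ ^ 2 ∂ν) Filter.atTop (nhds 0)) :
    Filter.Tendsto (fun m => (hf m).toLp (f m)) Filter.atTop (nhds (hf'.toLp f')) := by
  rw [tendsto_iff_norm_sub_tendsto_zero]
  have h1 : ∀ m, ‖(hf m).toLp (f m) - hf'.toLp f'‖ = √(∫ y, ‖f m y - f' y‖ ^ 2 ∂ν) := fun m => by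
    rw [← MemLp.toLp_sub, ← Real.sqrt_sq (norm_nonneg _), integral_norm_sq_eq_norm_toLp]
    rfl
  simp only [h1]
  simpa using h.sqrt

theorem tendsto_integral_sq_of_tendsto_toLp {f : ℕ → X → F} {f' : X → F}
    (hf : ∀ m, MemLp (f m) 2 ν) (hf' : MemLp f' 2 ν)
    (h : Filter.Tendsto (fun m => (hf m).toLp (f m)) Filter.atTop (nhds (hf'.toLp f'))) :
    Filter.Tendsto (fun m => ∫ y, ‖f m y - f' y‖ ^ 2 ∂ν) Filter.atTop (nhds 0) := by
  rw [tendsto_iff_norm_sub_tendsto_zero] at h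
  have h1 : ∀ m, ‖(hf m).toLp (f m) - hf'.toLp f'‖ ^ 2 = ∫ y, ‖f m y - f' y‖ ^ 2 ∂ν := fun m => by
    rw [← MemLp.toLp_sub, integral_norm_sq_eq_norm_toLp]
    rfl
  simp only [← h1]
  simpa using h.pow 2

theorem ae_eq_of_tendsto {f : ℕ → X → F} {f' f'' : X → F} (hf : ∀ m, MemLp (f m) 2 ν)
    (hf' : MemLp f' 2 ν) (hf'' : MemLp f'' 2 ν)
    (h' : Filter.Tendsto (fun m => ∫ y, ‖f m y - f' y‖ ^ 2 ∂ν) Filter.atTop (nhds 0))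
    (h'' : Filter.Tendsto (fun m => ∫ y, ‖f m y - f'' y‖ ^ 2 ∂ν) Filter.atTop (nhds 0)) :
    f' =ᵐ[ν] f'' :=
  (MemLp.toLp_eq_toLp_iff hf' hf'').1
    (tendsto_nhds_unique (tendsto_toLp hf hf' h') (tendsto_toLp hf hf'' h''))

theorem cauchySeq_of_dist_le {α β : Type*} [PseudoMetricSpace α] [PseudoMetricSpace β] {f : ℕ → α}
    {h : ℕ → β} {C : ℝ} (hh : CauchySeq h) (hC : ∀ m l, dist (f m) (f l) ≤ C * dist (h m) (h l)) :
    CauchySeq f := by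
  rw [Metric.cauchySeq_iff] at hh ⊢
  intro ε hε
  obtain ⟨N, hN⟩ := hh (ε / (|C| + 1)) (by positivity)
  refine ⟨N, fun m hm l hl => ?_⟩
  have h1 := hN m hm l hl
  rw [lt_div_iff₀ (by positivity)] at h1
  have h2 : C * dist (h m) (h l) ≤ |C| * dist (h m) (h l) :=
    mul_le_mul_of_nonneg_right (le_abs_self C) dist_nonneg
  nlinarith [hC m l, dist_nonneg (x := h m) (y := h l)]

/-- Completeness of `L²`. In the application `f m` is a local gradient and `h m` the sequence of
triples that controls it. -/
theorem exists_tendsto_of_cauchy [CompleteSpace F] {f : ℕ → X → F} (hf : ∀ m, MemLp (f m) 2 ν)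
    {β : Type*} [PseudoMetricSpace β] {h : ℕ → β} (hh : CauchySeq h) {C : ℝ} (hC0 : 0 ≤ C)
    (hC : ∀ m l, ∫ y, ‖f m y - f l y‖ ^ 2 ∂ν ≤ C * dist (h m) (h l) ^ 2) :
    ∃ f' : X → F, MemLp f' 2 ν ∧
      Filter.Tendsto (fun m => ∫ y, ‖f m y - f' y‖ ^ 2 ∂ν) Filter.atTop (nhds 0) := by
  have hc : CauchySeq fun m => (hf m).toLp (f m) := by
    refine cauchySeq_of_dist_le (C := √C) hh fun m l => ?_
    rw [dist_eq_norm, ← MemLp.toLp_sub, ← Real.sqrt_sq (norm_nonneg _),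
      integral_norm_sq_eq_norm_toLp, ← Real.sqrt_sq (dist_nonneg (x := h m) (y := h l)),
      ← Real.sqrt_mul hC0]
    exact Real.sqrt_le_sqrt (hC m l)
  obtain ⟨f', hf'⟩ := cauchySeq_tendsto_of_complete hc
  refine ⟨f', Lp.memLp f', tendsto_integral_sq_of_tendsto_toLp hf (Lp.memLp f') ?_⟩
  rwa [Lp.toLp_coeFn]

theorem tendsto_integral_smul [NormedSpace ℝ F] {f : ℕ → X → F} {f' : X → F} {ψ : X → ℝ}
    (hψ : MemLp ψ 2 ν) (hf : ∀ m, MemLp (f m) 2 ν) (hf' : MemLp f' 2 ν)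
    (h : Filter.Tendsto (fun m => ∫ y, ‖f m y - f' y‖ ^ 2 ∂ν) Filter.atTop (nhds 0)) :
    Filter.Tendsto (fun m => ∫ y, ψ y • f m y ∂ν) Filter.atTop (nhds (∫ y, ψ y • f' y ∂ν)) := by
  have hi : ∀ {f : X → F}, MemLp f 2 ν → Integrable (fun y => ψ y • f y) ν := fun hf =>
    memLp_one_iff_integrable.1 (hf.smul hψ)
  rw [tendsto_iff_norm_sub_tendsto_zero]
  have hl : Filter.Tendsto (fun m => √(∫ y, ‖ψ y‖ ^ 2 ∂ν) * √(∫ y, ‖f m y - f' y‖ ^ 2 ∂ν))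
      Filter.atTop (nhds 0) := by
    have h1 := h.sqrt.const_mul √(∫ y, ‖ψ y‖ ^ 2 ∂ν)
    rwa [Real.sqrt_zero, mul_zero] at h1
  refine squeeze_zero (fun _ => norm_nonneg _) (fun m => ?_) hl
  rw [← integral_sub (hi (hf m)) (hi hf')]
  refine (norm_integral_le_integral_norm _).trans ?_
  simp only [← smul_sub, norm_smul]
  exact integral_mul_norm_le hψ ((hf m).sub hf')

end L2Limits

/-! ### Weak gradients of local `L²` limits. -/

section WeakLimits
variable {n : ℕ} {F : Type*} [NormedAddCommGroup F] [NormedSpace ℝ F] [FiniteDimensional ℝ F]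

theorem exists_compact_exhaustion {O : Set (Euc n)} (hO : IsOpen O) :
    ∃ K : ℕ → Set (Euc n), (∀ j, IsCompact (K j)) ∧ (∀ j, K j ⊆ O) ∧
      ∀ L, IsCompact L → L ⊆ O → ∃ j, L ⊆ K j := by
  have := hO.locallyCompactSpace
  let E := CompactExhaustion.choice O
  refine ⟨fun j => Subtype.val '' E j, fun j => (E.isCompact j).image continuous_subtype_val,
    fun j => by rintro _ ⟨y, -, rfl⟩; exact y.2, fun L hL hLO => ?_⟩
  obtain ⟨j, hj⟩ := E.exists_superset_of_isCompact
    (Topology.IsInducing.subtypeVal.isCompact_preimage_iff (by simpa using hLO) |>.2 hL)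
  exact ⟨j, fun y hy => ⟨⟨y, hLO hy⟩, hj hy, rfl⟩⟩

theorem memLp_of_continuousOn {E : Type*} [NormedAddCommGroup E] {q : Euc n → E} {K : Set (Euc n)}
    (hK : IsCompact K) (hq : ContinuousOn q K) : MemLp q 2 (volume.restrict K) := by
  have : IsFiniteMeasure (volume.restrict K) := ⟨by simpa using hK.measure_lt_top⟩
  obtain ⟨A, hA⟩ := hK.exists_bound_of_continuousOn hq
  exact MemLp.of_bound (hq.aestronglyMeasurable_of_isCompact hK hK.measurableSet) A
    (by filter_upwards [ae_restrict_mem hK.measurableSet] with y hy using hA y hy)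

/-- Weak gradients pass to the limit under local convergence in `L²` of the functions, if the
gradients form local Cauchy sequences. -/
theorem exists_weakFDeriv_limit {O : Set (Euc n)} (hO : IsOpen O) {f : ℕ → Euc n → F}
    {f' : Euc n → F} (hf : ∀ m, ContDiffOn ℝ ∞ (f m) O)
    (hf' : ∀ K, IsCompact K → K ⊆ O → MemLp f' 2 (volume.restrict K))
    (h : ∀ K, IsCompact K → K ⊆ O →
      Filter.Tendsto (fun m => ∫ y in K, ‖f m y - f' y‖ ^ 2) Filter.atTop (nhds 0))
    {β : Type*} [PseudoMetricSpace β] {b : ℕ → β} (hb : CauchySeq b)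
    (hC : ∀ K, IsCompact K → K ⊆ O → ∃ C, 0 ≤ C ∧
      ∀ m l, ∫ y in K, ‖fderiv ℝ (f m) y - fderiv ℝ (f l) y‖ ^ 2 ≤ C * dist (b m) (b l) ^ 2) :
    ∃ D : Euc n → Euc n →L[ℝ] F, HasWeakFDerivOn f' D O ∧
      ∀ K, IsCompact K → K ⊆ O → MemLp D 2 (volume.restrict K) ∧
        Filter.Tendsto (fun m => ∫ y in K, ‖fderiv ℝ (f m) y - D y‖ ^ 2) Filter.atTop (nhds 0) := by
  have hfm : ∀ m K, IsCompact K → K ⊆ O → MemLp (f m) 2 (volume.restrict K) :=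
    fun m K hK hKO => memLp_of_continuousOn hK ((hf m).continuousOn.mono hKO)
  have hdm : ∀ m K, IsCompact K → K ⊆ O → MemLp (fderiv ℝ (f m)) 2 (volume.restrict K) :=
    fun m K hK hKO => memLp_of_continuousOn hK (((hf m).continuousOn_fderiv_of_isOpen hO (by simp)).mono hKO)
  obtain ⟨K, hK, hKO, hex⟩ := exists_compact_exhaustion hO
  have hlim : ∀ j, ∃ D : Euc n → Euc n →L[ℝ] F, MemLp D 2 (volume.restrict (K j)) ∧
      Filter.Tendsto (fun m => ∫ y in K j, ‖fderiv ℝ (f m) y - D y‖ ^ 2) Filter.atTop (nhds 0) :=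
    fun j => by
    obtain ⟨C, hC0, hC⟩ := hC (K j) (hK j) (hKO j)
    exact exists_tendsto_of_cauchy (fun m => hdm m _ (hK j) (hKO j)) hb hC0 hC
  choose E hE hEt using hlim
  have hmono : ∀ {L L' : Set (Euc n)} {q : Euc n → Euc n →L[ℝ] F}, IsCompact L' → L' ⊆ O → L ⊆ L' →
      MemLp q 2 (volume.restrict L') →
      Filter.Tendsto (fun m => ∫ y in L', ‖fderiv ℝ (f m) y - q y‖ ^ 2) Filter.atTop (nhds 0) →
      Filter.Tendsto (fun m => ∫ y in L, ‖fderiv ℝ (f m) y - q y‖ ^ 2) Filter.atTop (nhds 0) :=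
    fun {L L' q} hL' hLO hLL hq ht =>
    squeeze_zero (fun _ => integral_nonneg fun _ => by positivity)
      (fun m => setIntegral_mono_set (((hdm m _ hL' hLO).sub hq).integrable_norm_pow (by norm_num))
        (Filter.Eventually.of_forall fun _ => by positivity) hLL.eventuallyLE) ht
  -- On the intersection of two compact sets both functions are limits in `L²` of the same
  -- gradients, so they agree almost everywhere.
  have hagree : ∀ i j, ∀ᵐ y ∂volume, y ∈ K i → y ∈ K j → E i y = E j y := fun i j => by
    have hc : IsCompact (K i ∩ K j) := (hK i).inter (hK j)
    have hcO : K i ∩ K j ⊆ O := Set.inter_subset_left.trans (hKO i)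
    have h1 := ae_eq_of_tendsto (fun m => hdm m _ hc hcO)
      ((hE i).mono_measure (Measure.restrict_mono Set.inter_subset_left le_rfl))
      ((hE j).mono_measure (Measure.restrict_mono Set.inter_subset_right le_rfl))
      (hmono (hK i) (hKO i) Set.inter_subset_left (hE i) (hEt i))
      (hmono (hK j) (hKO j) Set.inter_subset_right (hE j) (hEt j))
    filter_upwards [(ae_restrict_iff' hc.measurableSet).1 h1] with y hy hi hj using hy ⟨hi, hj⟩
  classical
  -- The limits are glued along the exhaustion: each point uses the first compact set that contains
  -- it.
  let D : Euc n → Euc n →L[ℝ] F := fun y => if hy : ∃ j, y ∈ K j then E (Nat.find hy) y else 0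
  have hD : ∀ j, D =ᵐ[volume.restrict (K j)] E j := fun j => by
    rw [Filter.EventuallyEq, ae_restrict_iff' (hK j).measurableSet]
    filter_upwards [ae_all_iff.2 fun i => hagree i j] with y hy hyj
    have hex : ∃ j, y ∈ K j := ⟨j, hyj⟩
    simp only [D, dif_pos hex]
    exact hy _ (Nat.find_spec hex) hyj
  have hconv : ∀ L, IsCompact L → L ⊆ O → MemLp D 2 (volume.restrict L) ∧
      Filter.Tendsto (fun m => ∫ y in L, ‖fderiv ℝ (f m) y - D y‖ ^ 2) Filter.atTop (nhds 0) :=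
    fun L hL hLO => by
    obtain ⟨j, hj⟩ := hex L hL hLO
    have hm : MemLp D 2 (volume.restrict (K j)) := (hE j).ae_eq (hD j).symm
    refine ⟨hm.mono_measure (Measure.restrict_mono hj le_rfl), hmono (hK j) (hKO j) hj hm ?_⟩
    refine (hEt j).congr fun m => integral_congr_ae ?_
    filter_upwards [hD j] with y hy
    rw [hy]
  refine ⟨D, ⟨?_, ?_, fun φ hφ hc hs v => ?_⟩, hconv⟩
  · refine (locallyIntegrableOn_iff hO.isLocallyClosed).2 fun L hLO hL => ?_
    have : IsFiniteMeasure (volume.restrict L) := ⟨by simpa using hL.measure_lt_top⟩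
    exact (hf' L hL hLO).integrable (by norm_num)
  · refine (locallyIntegrableOn_iff hO.isLocallyClosed).2 fun L hLO hL => ?_
    have : IsFiniteMeasure (volume.restrict L) := ⟨by simpa using hL.measure_lt_top⟩
    exact (hconv L hL hLO).1.integrable (by norm_num)
  · have hd : Continuous fun y => fderiv ℝ φ y v :=
      (hφ.continuous_fderiv (by simp)).clm_apply continuous_const
    set L := tsupport φ
    have hL : IsCompact L := hc
    have e1 : ∀ q : Euc n → F, ∫ y in L, fderiv ℝ φ y v • q y = ∫ y, fderiv ℝ φ y v • q y :=
      fun q => setIntegral_eq_integral_of_forall_compl_eq_zero fun y hy => by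
        rw [fderiv_of_notMem_tsupport ℝ hy, zero_apply, zero_smul]
    have e2 : ∀ q : Euc n → F, ∫ y in L, φ y • q y = ∫ y, φ y • q y :=
      fun q => setIntegral_eq_integral_of_forall_compl_eq_zero fun y hy => by
        rw [image_eq_zero_of_notMem_tsupport hy, zero_smul]
    have l1 := tendsto_integral_smul (memLp_of_continuousOn hL hd.continuousOn) (fun m => hfm m L hL hs)
      (hf' L hL hs) (h L hL hs)
    obtain ⟨hDm, hDt⟩ := hconv L hL hs
    have ev : ∀ T : Euc n →L[ℝ] F, ‖T v‖ ≤ ‖v‖ * ‖T‖ := fun T =>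
      (T.le_opNorm v).trans_eq (mul_comm _ _)
    have hap : ∀ {q : Euc n → Euc n →L[ℝ] F}, MemLp q 2 (volume.restrict L) →
        MemLp (fun y => q y v) 2 (volume.restrict L) := fun {q} hq =>
      hq.of_le_mul (c := ‖v‖) ((ContinuousLinearMap.apply ℝ F v).continuous.comp_aestronglyMeasurable
        hq.1) (Filter.Eventually.of_forall fun y => ev (q y))
    have l2 := tendsto_integral_smul (memLp_of_continuousOn hL hφ.continuous.continuousOn)
      (fun m => hap (hdm m L hL hs)) (hap hDm) (by
        have h0 : Filter.Tendsto (fun m => ‖v‖ ^ 2 * ∫ y in L, ‖fderiv ℝ (f m) y - D y‖ ^ 2)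
            Filter.atTop (nhds 0) := by simpa using hDt.const_mul (‖v‖ ^ 2)
        refine squeeze_zero (fun _ => integral_nonneg fun _ => by positivity) (fun m => ?_) h0
        rw [← integral_const_mul]
        refine integral_mono_of_nonneg (Filter.Eventually.of_forall fun _ => by positivity)
          ((((hdm m L hL hs).sub hDm).integrable_norm_pow (by norm_num)).const_mul _)
          (Filter.Eventually.of_forall fun y => ?_)
        simp only [← mul_pow]
        exact pow_le_pow_left₀ (norm_nonneg _) (ev (fderiv ℝ (f m) y - D y)) 2)
    simp only [e1, e2] at l1 l2
    -- Both sides of the integration by parts formula for `f m` converge, because test functions are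
    -- square-integrable on their compact supports.
    refine tendsto_nhds_unique l1 (l2.neg.congr fun m => ?_)
    exact ((hasWeakFDerivOn_of_contDiffOn hO (hf m)).integral_eq φ hφ hc hs v).symm

end WeakLimits

/-! ### The closure of the test forms stays inside `W^{1,2}`. -/

section Closure
variable {n k : ℕ} {M : Type*} [TopologicalSpace M] [ChartedSpace (Euc n) M]
  [IsManifold (𝓡 n) ∞ M] [MeasurableSpace M] [BorelSpace M] [CompactSpace M] [T2Space M]

/-- Multiplication by a cutoff that equals one in a neighbourhood of every point of `K` does not
change derivatives on `K`, so the localized bound applies. -/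
theorem exists_gradient_bound (g : SmoothMetric n M) {Ω : Set M} (hΩ : IsOpen Ω) {x : M}
    {K : Set (Euc n)} (hK : IsCompact K) (hKx : K ⊆ coordTarget x) (k : ℕ) :
    ∃ C, ∀ t ∈ sobolev g Ω k, ∀ u : L2Section g ((riemannianVolume g).restrict Ω) k,
      IsTestForm Ω u.form → u.toL2 = t.fst →
      ∫ y in K, ‖fderiv ℝ (pullChart x u.form) y‖ ^ 2 ≤ C * ‖t‖ ^ 2 := by
  obtain ⟨χ, hχ, hs, h01, h1⟩ := exists_cutoff hK hKx
  obtain ⟨C, hC⟩ := exists_localized_gradient_bound (k := k) g hΩ hχ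
    (fun p => abs_le.2 ⟨by linarith [(h01 p).1], (h01 p).2⟩) hs
  refine ⟨C, fun t ht u hu hut => le_trans ?_ (hC t ht u hu hut)⟩
  obtain ⟨L, hL, hLχ, hLx, hLΩ, hz⟩ := hu.exists_localized_support hs
  have hw := contDiff_chartForm ((hu.smul hχ).smooth x) hL hLx hz
  have hws := tsupport_chartForm_subset hL hLx hz
  have hint : Integrable fun y => ‖fderiv ℝ (chartForm x (fun p => χ p • u.form p)) y‖ ^ 2 :=
    MemLp.integrable_norm_pow ((hw.continuous_fderiv (by simp)).memLp_of_hasCompactSupport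
      ((isCompact_coord_image hL hLx).of_isClosed_subset (isClosed_tsupport _)
        ((tsupport_fderiv_subset ℝ).trans hws))) (by norm_num)
  refine le_trans (integral_mono_of_nonneg (Filter.Eventually.of_forall fun _ => by positivity)
    hint.integrableOn ?_) (setIntegral_le_integral hint
      (Filter.Eventually.of_forall fun _ => by positivity))
  filter_upwards [ae_restrict_mem hK.measurableSet] with y hy
  rw [fderiv_chartForm _ (hKx hy)]
  have h2 : fderiv ℝ (pullChart x fun p => χ p • u.form p) y = fderiv ℝ (pullChart x u.form) y := by
    refine Filter.EventuallyEq.fderiv_eq ?_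
    filter_upwards [h1 y hy] with z hz
    rw [pullChart_smul, hz, one_smul]
  rw [h2]

theorem tendsto_pullChart (g : SmoothMetric n M) {Ω : Set M} (hΩ : IsOpen Ω) (x : M)
    {u : ℕ → L2Section g ((riemannianVolume g).restrict Ω) k}
    {u' : L2Section g ((riemannianVolume g).restrict Ω) k}
    (h : Filter.Tendsto (fun m => (u m).toL2) Filter.atTop (nhds u'.toL2))
    {K : Set (Euc n)} (hK : IsCompact K) (hKΩ : K ⊆ chartDomain Ω x) :
    Filter.Tendsto (fun m => ∫ y in K, ‖pullChart x (u m).form y - pullChart x u'.form y‖ ^ 2)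
      Filter.atTop (nhds 0) := by
  obtain ⟨C, hC⟩ := exists_restrict_bound g hΩ.measurableSet x hK
    (hKΩ.trans Set.inter_subset_left) k
  rw [Set.inter_eq_left.2 hKΩ] at hC
  rw [tendsto_iff_norm_sub_tendsto_zero] at h
  have h1 := (h.pow 2).const_mul C
  rw [zero_pow two_ne_zero, mul_zero] at h1
  refine squeeze_zero (fun _ => integral_nonneg fun _ => by positivity) (fun m => ?_) h1
  rw [← map_sub, L2Section.norm_toL2]
  refine le_trans (le_of_eq ?_) (hC (u m - u')).2
  rw [map_sub]
  rfl

theorem hasWeakCodiff_of_tendsto (g : SmoothMetric n M) {Ω : Set M} : ∀ {k : ℕ}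
    {t : ℕ → FormTriple g Ω k} {t' : FormTriple g Ω k},
    (∀ m, HasWeakCodiff g Ω k (t m).fst (t m).snd.snd) →
    Filter.Tendsto (fun m => (t m).fst) Filter.atTop (nhds t'.fst) →
    Filter.Tendsto (fun m => (t m).snd.snd) Filter.atTop (nhds t'.snd.snd) →
    HasWeakCodiff g Ω k t'.fst t'.snd.snd
  | 0, _, _, h, _, h2 => by
    refine tendsto_nhds_unique h2 (tendsto_const_nhds.congr fun m => ?_)
    exact (h m).symm
  | k + 1, _, _, h, h1, h2 => fun a b ha hb =>
    tendsto_nhds_unique (h2.inner tendsto_const_nhds)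
      ((h1.inner (tendsto_const_nhds (x := b.toL2))).congr fun m => (h m a b ha hb).symm)

/-- Here Gaffney's inequality is essential: convergence of triples controls only `u`, `du` and
`d*u`, whereas membership in `W^{1,2}` asks for all weak first derivatives. The gradient bound,
applied to differences, makes the chart gradients Cauchy in local `L²`, and their limit is the weak
gradient. The relation between a form and its codifferential is preserved because the pairings
defining it are continuous. -/
theorem testSubmodule_closure_le (g : SmoothMetric n M) {Ω : Set M} (hΩ : IsOpen Ω) :
    (testSubmodule g Ω k).topologicalClosure ≤ sobolev g Ω k := by
  intro t ht
  obtain ⟨s, hs, hst⟩ := mem_closure_iff_seq_limit.1 (show t ∈ closure _ from ht)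
  have hfst : Filter.Tendsto (fun m => (s m).fst) Filter.atTop (nhds t.fst) :=
    ((WithLp.continuous_fst 2 _ _).tendsto t).comp hst
  have hsnd : Filter.Tendsto (fun m => (s m).snd) Filter.atTop (nhds t.snd) :=
    ((WithLp.continuous_snd 2 _ _).tendsto t).comp hst
  have hsf : Filter.Tendsto (fun m => (s m).snd.fst) Filter.atTop (nhds t.snd.fst) :=
    ((WithLp.continuous_fst 2 _ _).tendsto t.snd).comp hsnd
  have hss : Filter.Tendsto (fun m => (s m).snd.snd) Filter.atTop (nhds t.snd.snd) :=
    ((WithLp.continuous_snd 2 _ _).tendsto t.snd).comp hsnd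
  refine ⟨?_, hasWeakCodiff_of_tendsto g (fun m => (hs m).1.2) hfst hss⟩
  choose hsob u hu hus using hs
  choose v hv hvs using fun m => snd_fst_eq hΩ (hsob m) (hu m) (hus m)
  obtain ⟨u', hu'⟩ := exists_toL2_eq t.fst
  obtain ⟨v', hv'⟩ := exists_toL2_eq t.snd.fst
  refine ⟨u', v', hu', hv', fun x => ?_⟩
  have hO := isOpen_chartDomain (n := n) hΩ x
  have hOT : chartDomain (n := n) Ω x ⊆ coordTarget x := Set.inter_subset_left
  have hmem : ∀ {j} (a : L2Section g ((riemannianVolume g).restrict Ω) j) (K : Set (Euc n)),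
      IsCompact K → K ⊆ chartDomain Ω x → MemLp (pullChart x a.form) 2 (volume.restrict K) :=
    fun a K hK hKO => by
    obtain ⟨C, hC⟩ := exists_restrict_bound g hΩ.measurableSet x hK (hKO.trans hOT) _
    rw [Set.inter_eq_left.2 hKO] at hC
    exact (hC a).1
  have hconv : ∀ K, IsCompact K → K ⊆ chartDomain Ω x → Filter.Tendsto (fun m =>
      ∫ y in K, ‖pullChart x (u m).form y - pullChart x u'.form y‖ ^ 2) Filter.atTop (nhds 0) :=
    fun K hK hKO => tendsto_pullChart g hΩ x (by simpa only [hus, hu'] using hfst) hK hKO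
  have hconv' : ∀ K, IsCompact K → K ⊆ chartDomain Ω x → Filter.Tendsto (fun m =>
      ∫ y in K, ‖pullChart x (v m).form y - pullChart x v'.form y‖ ^ 2) Filter.atTop (nhds 0) :=
    fun K hK hKO => tendsto_pullChart g hΩ x (by simpa only [hvs, hv'] using hsf) hK hKO
  obtain ⟨D, hD, hDK⟩ := exists_weakFDeriv_limit hO
    (fun m => ((hu m).smooth x).mono hOT) (hmem u') hconv hst.cauchySeq fun K hK hKO => by
      obtain ⟨C, hC⟩ := exists_gradient_bound g hΩ hK (hKO.trans hOT) k
      refine ⟨|C|, abs_nonneg C, fun m l => ?_⟩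
      have h1 := hC (s m - s l) (Submodule.sub_mem _ (hsob m) (hsob l)) (u m - u l)
        (by
          have := (hu m).add ((hu l).const_smul (-1))
          rwa [neg_one_smul, ← sub_eq_add_neg, ← map_sub] at this)
        (by rw [map_sub, hus, hus, WithLp.sub_fst])
      rw [dist_eq_norm]
      refine le_trans (le_of_eq ?_) (h1.trans (mul_le_mul_of_nonneg_right (le_abs_self C)
        (sq_nonneg _)))
      refine setIntegral_congr_fun hK.measurableSet fun y hy => ?_
      have hn := (isOpen_coordTarget x).mem_nhds (hOT (hKO hy))
      have hdm : ∀ m, DifferentiableAt ℝ (pullChart x (u m).form) y := fun m =>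
        (((hu m).smooth x).contDiffAt hn).differentiableAt (by simp)
      have h2 : pullChart x (u m - u l).form = pullChart x (u m).form - pullChart x (u l).form := by
        rw [map_sub]
        rfl
      simp only [h2, fderiv_sub (hdm m) (hdm l)]
  refine ⟨D, hD, ?_⟩
  obtain ⟨K, hK, hKO, hex⟩ := exists_compact_exhaustion hO
  -- Both sides are the limit in `L²` over `K j` of the classical exterior derivatives.
  have hK1 : ∀ j, ∀ᵐ y ∂volume.restrict (K j), pullChart x v'.form y = altL n k (D y) := fun j => by
    obtain ⟨hDm, hDt⟩ := hDK (K j) (hK j) (hKO j)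
    have hgm : ∀ m, MemLp (fderiv ℝ (pullChart x (u m).form)) 2 (volume.restrict (K j)) := fun m =>
      memLp_of_continuousOn (hK j) (((((hu m).smooth x).mono hOT).continuousOn_fderiv_of_isOpen hO
        (by simp)).mono (hKO j))
    refine ae_eq_of_tendsto (fun m => hmem (v m) (K j) (hK j) (hKO j))
      (hmem v' (K j) (hK j) (hKO j)) (hDm.of_le_mul (c := ‖altL n k‖)
        ((altL n k).continuous.comp_aestronglyMeasurable hDm.1)
        (Filter.Eventually.of_forall fun y => (altL n k).le_opNorm _))
      (hconv' (K j) (hK j) (hKO j)) ?_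
    have h0 := hDt.const_mul (‖altL n k‖ ^ 2)
    rw [mul_zero] at h0
    refine squeeze_zero (fun _ => integral_nonneg fun _ => by positivity) (fun m => ?_) h0
    rw [← integral_const_mul]
    refine integral_mono_of_nonneg (Filter.Eventually.of_forall fun _ => by positivity)
      ((((hgm m).sub hDm).integrable_norm_pow (by norm_num)).const_mul _) ?_
    filter_upwards [ae_restrict_mem (hK j).measurableSet] with y hy
    have h2 : pullChart x (v m).form y = altL n k (fderiv ℝ (pullChart x (u m).form) y) := by
      rw [hv m, pullChart_extD (hu m).smooth x (hOT (hKO j hy))]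
      rfl
    rw [h2, ← map_sub, ← mul_pow]
    exact pow_le_pow_left₀ (norm_nonneg _) ((altL n k).le_opNorm _) 2
  rw [ae_restrict_iff' hO.measurableSet]
  filter_upwards [ae_all_iff.2 fun j => (ae_restrict_iff' (hK j).measurableSet).1 (hK1 j)]
    with y hy hyO
  obtain ⟨j, hj⟩ := hex {y} isCompact_singleton (by simpa using hyO)
  exact hy j (hj rfl)

end Closure

/-! ### Rellich's theorem for test forms on the manifold. -/

section Rellich
variable {n k : ℕ}

variable (n k) in
theorem exists_norm_sq_le_comp : ∃ C, 0 ≤ C ∧ ∀ α : Alt n k,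
    ‖α‖ ^ 2 ≤ C * ∑ I : Fin k → Fin n, ‖comp I α‖ ^ 2 := by
  have hinj : LinearMap.ker (compL n k).toLinearMap = ⊥ := by
    refine LinearMap.ker_eq_bot'.2 fun α hα => alt_ext fun I => ?_
    rw [map_zero]
    exact congrFun hα I
  obtain ⟨K, -, hK⟩ := LinearMap.exists_antilipschitzWith _ hinj
  refine ⟨(K : ℝ) ^ 2, by positivity, fun α => ?_⟩
  have h1 : ‖α‖ ≤ K * ‖compL n k α‖ := by
    simpa using hK.le_mul_dist α 0
  refine (pow_le_pow_left₀ (norm_nonneg _) h1 2).trans ?_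
  rw [mul_pow]
  refine mul_le_mul_of_nonneg_left ?_ (by positivity)
  have h2 : ‖compL n k α‖ ≤ √(∑ I : Fin k → Fin n, ‖comp I α‖ ^ 2) := by
    refine (pi_norm_le_iff_of_nonneg (Real.sqrt_nonneg _)).2 fun I => Real.le_sqrt_of_sq_le ?_
    exact Finset.single_le_sum (f := fun I => ‖comp I α‖ ^ 2) (fun _ _ => sq_nonneg _)
      (Finset.mem_univ I)
  calc _ ≤ √(∑ I : Fin k → Fin n, ‖comp I α‖ ^ 2) ^ 2 := pow_le_pow_left₀ (norm_nonneg _) h2 2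
    _ = _ := Real.sq_sqrt (Finset.sum_nonneg fun _ _ => sq_nonneg _)

variable {M : Type*} [TopologicalSpace M] [ChartedSpace (Euc n) M]
  [IsManifold (𝓡 n) ∞ M] [MeasurableSpace M] [BorelSpace M] [CompactSpace M]

/-- A bounded functional on square-integrable forms descends to classes. -/
theorem exists_functional {g : SmoothMetric n M} {ν : Measure M} (F : L2Section g ν k →ₗ[ℝ] ℝ)
    {C : ℝ} (hF : ∀ a, ‖F a‖ ≤ C * ‖a‖) :
    ∃ ℓ : L2Form g ν k →L[ℝ] ℝ, ∀ a : L2Section g ν k, ℓ a.toL2 = F a := by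
  refine ⟨F.mkContinuous C hF ∘L SeparationQuotient.outCLM ℝ (L2Section g ν k), fun a => ?_⟩
  have h1 : Inseparable (SeparationQuotient.outCLM ℝ (L2Section g ν k) a.toL2) a :=
    SeparationQuotient.mk_eq_mk.1 (SeparationQuotient.mk_outCLM ℝ _)
  exact (h1.map (F.mkContinuous C hF).continuous).eq

variable [T2Space M]

/-- This translates weak convergence of forms on the manifold into convergence of the integrals of
chart components against continuous functions, as Rellich's theorem in `ℝⁿ` requires. -/
theorem exists_chart_functional (g : SmoothMetric n M) {Ω : Set M} (hΩ : IsOpen Ω) {x : M}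
    {K : Set (Euc n)} (hK : IsCompact K) (hKx : K ⊆ coordTarget x) {ψ : Euc n → ℝ}
    (hψ : ContinuousOn ψ K) (I : Fin k → Fin n) :
    ∃ ℓ : L2Form g ((riemannianVolume g).restrict Ω) k →L[ℝ] ℝ,
      ∀ a : L2Section g ((riemannianVolume g).restrict Ω) k,
        ℓ a.toL2 = ∫ y in K ∩ chartDomain Ω x, ψ y * comp I (pullChart x a.form y) := by
  obtain ⟨C, hC⟩ := exists_restrict_bound g hΩ.measurableSet x hK hKx k
  set W := K ∩ chartDomain Ω x
  have hψm : MemLp ψ 2 (volume.restrict W) := (memLp_of_continuousOn hK hψ).mono_measure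
    (Measure.restrict_mono Set.inter_subset_left le_rfl)
  have hcm : ∀ a : L2Section g ((riemannianVolume g).restrict Ω) k,
      MemLp (fun y => comp I (pullChart x a.form y)) 2 (volume.restrict W) := fun a =>
    (hC a).1.of_le_mul (c := ‖comp (n := n) I‖)
      ((comp I).continuous.comp_aestronglyMeasurable (hC a).1.1)
      (Filter.Eventually.of_forall fun y => (comp I).le_opNorm _)
  have hint : ∀ a : L2Section g ((riemannianVolume g).restrict Ω) k,
      Integrable (fun y => ψ y * comp I (pullChart x a.form y)) (volume.restrict W) := fun a =>
    hψm.integrable_mul (hcm a)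
  let F : L2Section g ((riemannianVolume g).restrict Ω) k →ₗ[ℝ] ℝ :=
    { toFun := fun a => ∫ y in W, ψ y * comp I (pullChart x a.form y)
      map_add' := fun a b => by
        rw [← integral_add (hint a) (hint b)]
        refine integral_congr_ae (Filter.Eventually.of_forall fun y => ?_)
        have : pullChart x (a + b).form y = pullChart x a.form y + pullChart x b.form y := by
          rw [map_add]; rfl
        beta_reduce
        rw [this, map_add, mul_add]
      map_smul' := fun c a => by
        rw [RingHom.id_apply, smul_eq_mul, ← integral_const_mul]
        refine integral_congr_ae (Filter.Eventually.of_forall fun y => ?_)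
        have : pullChart x (c • a).form y = c • pullChart x a.form y := by
          rw [map_smul]; rfl
        beta_reduce
        rw [this, map_smul, smul_eq_mul]
        ring }
  refine exists_functional F (C := √(∫ y in W, ‖ψ y‖ ^ 2) * (‖comp (n := n) I‖ * √|C|)) fun a => ?_
  refine (norm_integral_le_integral_norm _).trans ?_
  simp only [norm_mul]
  refine (integral_mul_norm_le hψm (hcm a)).trans ?_
  rw [mul_assoc]
  refine mul_le_mul_of_nonneg_left ?_ (Real.sqrt_nonneg _)
  refine (sqrt_integral_le (hC a).1 (norm_nonneg (comp (n := n) I))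
    (Filter.Eventually.of_forall fun y => (comp I).le_opNorm _)).trans ?_
  rw [mul_assoc]
  refine mul_le_mul_of_nonneg_left ?_ (norm_nonneg _)
  conv_rhs => rw [← Real.sqrt_sq (norm_nonneg a)]
  rw [← Real.sqrt_mul (abs_nonneg _)]
  exact Real.sqrt_le_sqrt ((hC a).2.trans
    (mul_le_mul_of_nonneg_right (le_abs_self _) (sq_nonneg _)))

/-- Rellich's theorem for localized test forms. -/
theorem tendsto_localized (g : SmoothMetric n M) {Ω : Set M} (hΩ : IsOpen Ω) {x : M}
    {χ : M → ℝ} (hχ : ContMDiff (𝓡 n) 𝓘(ℝ, ℝ) ∞ χ) (hχ1 : ∀ p, |χ p| ≤ 1)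
    (hs : tsupport χ ⊆ (chartAt (Euc n) x).source) {t : ℕ → FormTriple g Ω k}
    (ht : ∀ m, t m ∈ sobolev g Ω k) {u : ℕ → L2Section g ((riemannianVolume g).restrict Ω) k}
    (hu : ∀ m, IsTestForm Ω (u m).form) (hut : ∀ m, (u m).toL2 = (t m).fst)
    {R : ℝ} (hR : ∀ m, ‖t m‖ ≤ R)
    (hw : ∀ ℓ : FormTriple g Ω k →L[ℝ] ℝ,
      Filter.Tendsto (fun m => ℓ (t m)) Filter.atTop (nhds 0)) :
    Filter.Tendsto (fun m => ∫ y, ‖chartForm x (fun p => χ p • (u m).form p) y‖ ^ 2)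
      Filter.atTop (nhds 0) := by
  have hK' : IsCompact (tsupport χ) := (isClosed_tsupport χ).isCompact
  have hKc := isCompact_coord_image hK' hs
  have hKT := coord_image_subset (n := n) hs
  have hR0 : 0 ≤ R := (norm_nonneg _).trans (hR 0)
  obtain ⟨C₁, hC₁, h1⟩ := exists_localized_extD_bound g hΩ hχ hχ1 hs k
  obtain ⟨C₂, h2⟩ := exists_localized_gradient_bound (k := k) g hΩ hχ hχ1 hs
  obtain ⟨C₃, hC₃, h3⟩ := exists_norm_sq_le_comp n k
  set K := coord (n := n) x '' tsupport χ
  let w : ℕ → Euc n → Alt n k := fun m => chartForm x (fun p => χ p • (u m).form p)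
  have hsm : ∀ m, ContDiff ℝ ∞ (w m) ∧ tsupport (w m) ⊆ K ∩ chartDomain Ω x := fun m => by
    obtain ⟨L, hL, hLχ, hLx, hLΩ, hz⟩ := (hu m).exists_localized_support hs
    exact ⟨contDiff_chartForm (((hu m).smul hχ).smooth x) hL hLx hz,
      (tsupport_chartForm_subset hL hLx hz).trans fun y hy =>
        ⟨Set.image_mono hLχ hy, coord_image_subset_chartDomain hLx hLΩ hy⟩⟩
  have hcs : ∀ m, HasCompactSupport (w m) := fun m =>
    hKc.of_isClosed_subset (isClosed_tsupport _) ((hsm m).2.trans Set.inter_subset_left)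
  have hwi : ∀ m, Integrable fun y => ‖w m y‖ ^ 2 := fun m =>
    ((hsm m).1.continuous.memLp_of_hasCompactSupport (hcs m)).integrable_norm_pow (by norm_num)
  have hdi : ∀ m, Integrable fun y => ‖fderiv ℝ (w m) y‖ ^ 2 := fun m =>
    (((hsm m).1.continuous_fderiv (by simp)).memLp_of_hasCompactSupport
      ((hcs m).fderiv ℝ)).integrable_norm_pow (by norm_num)
  have hcomp : ∀ I : Fin k → Fin n, Filter.Tendsto (fun m => ∫ y, ‖comp I (w m y)‖ ^ 2)
      Filter.atTop (nhds 0) := fun I => by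
    set c := ‖comp (n := n) I‖
    have hle : ∀ {C : ℝ} (m : ℕ), C * ‖t m‖ ^ 2 ≤ |C| * R ^ 2 := fun {C} m =>
      mul_le_mul (le_abs_self C) (pow_le_pow_left₀ (norm_nonneg _) (hR m) 2) (sq_nonneg _)
        (abs_nonneg _)
    refine tendsto_integral_sq_of_weakly_null hKc (f := fun m y => comp I (w m y))
      (C := c ^ 2 * (|C₁| * R ^ 2 + |C₂| * R ^ 2))
      (fun m => ((comp I).contDiff.comp (hsm m).1).of_le (by simp)) (fun m => ?_) (fun m => ?_)
      (fun m => ?_) fun φ hφ hφc => ?_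
    · refine (closure_mono fun y hy => ?_).trans ((hsm m).2.trans Set.inter_subset_left)
      intro h0
      exact hy (by simp only [h0, map_zero])
    · calc ∫ y, ‖comp I (w m y)‖ ^ 2 ≤ c ^ 2 * ∫ y, ‖w m y‖ ^ 2 := by
            rw [← integral_const_mul]
            refine integral_mono_of_nonneg (Filter.Eventually.of_forall fun _ => by positivity)
              ((hwi m).const_mul _) (Filter.Eventually.of_forall fun y => ?_)
            simp only [← mul_pow]
            exact pow_le_pow_left₀ (norm_nonneg _) ((comp I).le_opNorm _) 2
        _ ≤ _ := by
            refine mul_le_mul_of_nonneg_left ?_ (sq_nonneg c)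
            have h4 := ((h1 _ (ht m) _ (hu m) (hut m)).1).trans (hle m)
            have : 0 ≤ |C₂| * R ^ 2 := by positivity
            linarith
    · calc ∫ y, ‖fderiv ℝ (fun y => comp I (w m y)) y‖ ^ 2
          ≤ c ^ 2 * ∫ y, ‖fderiv ℝ (w m) y‖ ^ 2 := by
            rw [← integral_const_mul]
            refine integral_mono_of_nonneg (Filter.Eventually.of_forall fun _ => by positivity)
              ((hdi m).const_mul _) (Filter.Eventually.of_forall fun y => ?_)
            have h4 : fderiv ℝ (fun y => comp I (w m y)) y = comp I ∘L fderiv ℝ (w m) y :=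
              ((comp I).hasFDerivAt.comp y
                ((hsm m).1.differentiable (by simp) y).hasFDerivAt).fderiv
            simp only [h4, ← mul_pow]
            exact pow_le_pow_left₀ (norm_nonneg _) (ContinuousLinearMap.opNorm_comp_le _ _) 2
        _ ≤ _ := by
            refine mul_le_mul_of_nonneg_left ?_ (sq_nonneg c)
            have h4 := (h2 _ (ht m) _ (hu m) (hut m)).trans (hle m)
            have : 0 ≤ |C₁| * R ^ 2 := by positivity
            linarith
    -- The cutoff is moved from the form to the test function.
    · obtain ⟨ℓ, hℓ⟩ := exists_chart_functional g hΩ hKc hKT (ψ := fun y => φ y * χ (coordInv x y))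
        (hφ.continuousOn.mul ((contDiffOn_comp_coordInv hχ x).continuousOn.mono hKT)) I
      refine (hw (ℓ ∘L WithLp.fstL 2 ℝ _ _)).congr fun m => ?_
      have h4 : (ℓ ∘L WithLp.fstL 2 ℝ _ _) (t m) = ℓ (t m).fst := rfl
      have h6 : ∫ y in K ∩ chartDomain Ω x, φ y * comp I (w m y) = ∫ y, φ y * comp I (w m y) :=
        setIntegral_eq_integral_of_forall_compl_eq_zero fun y hy => by
          have : w m y = 0 := image_eq_zero_of_notMem_tsupport fun h => hy ((hsm m).2 h)
          rw [this, map_zero, mul_zero]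
      rw [h4, ← hut, hℓ, ← h6]
      refine setIntegral_congr_fun
        (hKc.measurableSet.inter (isOpen_chartDomain hΩ x).measurableSet) fun y hy => ?_
      have h5 : w m y = χ (coordInv x y) • pullChart x (u m).form y := chartForm_of_mem _ hy.2.1
      simp only [h5, map_smul, smul_eq_mul, mul_assoc]
  have hsum := (tendsto_finsetSum Finset.univ fun I _ => hcomp I).const_mul C₃
  rw [Finset.sum_const_zero, mul_zero] at hsum
  refine squeeze_zero (fun _ => integral_nonneg fun _ => by positivity) (fun m => ?_) hsum
  have hci : ∀ I : Fin k → Fin n, Integrable fun y => ‖comp I (w m y)‖ ^ 2 := fun I => by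
    refine MemLp.integrable_norm_pow (((comp I).continuous.comp
      (hsm m).1.continuous).memLp_of_hasCompactSupport ((hcs m).comp_left (map_zero _)))
      (by norm_num)
  rw [← integral_finsetSum _ fun I _ => hci I, ← integral_const_mul]
  exact integral_mono_of_nonneg (Filter.Eventually.of_forall fun _ => by positivity)
    ((integrable_finsetSum _ fun I _ => hci I).const_mul _)
    (Filter.Eventually.of_forall fun y => h3 _)

/-- The embedding of `W₀^{1,2}` into `L²` maps weakly null bounded sequences of test forms to null
sequences. -/
theorem tendsto_norm_fst (g : SmoothMetric n M) {Ω : Set M} (hΩ : IsOpen Ω)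
    {t : ℕ → FormTriple g Ω k} (ht : ∀ m, t m ∈ testSubmodule g Ω k)
    {R : ℝ} (hR : ∀ m, ‖t m‖ ≤ R)
    (hw : ∀ ℓ : FormTriple g Ω k →L[ℝ] ℝ,
      Filter.Tendsto (fun m => ℓ (t m)) Filter.atTop (nhds 0)) :
    Filter.Tendsto (fun m => ‖(t m).fst‖ ^ 2) Filter.atTop (nhds 0) := by
  choose hts u hu hut using ht
  obtain ⟨T, χ, hχ⟩ := exists_isChartPartition n M
  have := isFiniteMeasure_riemannianVolume g
  have hχ1 : ∀ x ∈ T, ∀ p, |χ x p| ≤ 1 := fun x hx p => by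
    rw [abs_of_nonneg (hχ.nonneg x p), ← hχ.sum_eq_one p]
    exact Finset.single_le_sum (f := fun x => χ x p) (fun x _ => hχ.nonneg x p) hx
  -- Only one factor of `⟨u, u⟩` is localized. Cauchy–Schwarz then bounds each summand by the norm
  -- of the localized form, which tends to zero, times a bounded factor.
  have hbd : ∀ x : M, ∃ C, ∀ m,
      ∫ p in Ω, formInner g p (χ x p • (u m).form p) ((u m).form p) ∂riemannianVolume g ≤
        C * √(∫ y, ‖chartForm x (fun p => χ x p • (u m).form p) y‖ ^ 2) := fun x => by
    have hs := hχ.subordinate x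
    have hK' : IsCompact (tsupport (χ x)) := (isClosed_tsupport (χ x)).isCompact
    have hKc := isCompact_coord_image hK' hs
    have hKT := coord_image_subset (n := n) hs
    obtain ⟨C₁, hC₁, hpair⟩ := exists_pairing_bound g x hKc hKT k
    obtain ⟨C₀, h₀⟩ := exists_restrict_bound g hΩ.measurableSet x hKc hKT k
    refine ⟨C₁ * (√|C₀| * R), fun m => ?_⟩
    obtain ⟨L, hL, hLχ, hLx, hLΩ, hz⟩ := (hu m).exists_localized_support hs
    have hsm := contDiff_chartForm (((hu m).smul (hχ.smooth x)).smooth x) hL hLx hz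
    have hsup := tsupport_chartForm_subset hL hLx hz
    set w := chartForm x (fun p => χ x p • (u m).form p)
    set W := coord (n := n) x '' tsupport (χ x) ∩ chartDomain Ω x
    have hLW : coord (n := n) x '' L ⊆ W := fun y hy =>
      ⟨Set.image_mono hLχ hy, coord_image_subset_chartDomain hLx hLΩ hy⟩
    have hw0 : ∀ y ∉ W, w y = 0 := fun y hy =>
      image_eq_zero_of_notMem_tsupport fun h => hy (hLW (hsup h))
    have hwm : MemLp w 2 (volume.restrict W) :=
      (hsm.continuous.memLp_of_hasCompactSupport ((isCompact_coord_image hL hLx).of_isClosed_subset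
        (isClosed_tsupport _) hsup)).restrict W
    have h1 := (hpair W w (pullChart x (u m).form)
      (hKc.measurableSet.inter (isOpen_chartDomain hΩ x).measurableSet) Set.inter_subset_left
      hw0 hwm (h₀ (u m)).1).2
    rw [integral_formInner_chart g hΩ.measurableSet _ hLx hLΩ hz]
    refine (le_abs_self _).trans (h1.trans ?_)
    rw [setIntegral_eq_integral_of_forall_compl_eq_zero (s := W)
      fun y hy => by rw [hw0 y hy, norm_zero]; norm_num]
    have h2 : √(∫ y in W, ‖pullChart x (u m).form y‖ ^ 2) ≤ √|C₀| * R := by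
      have h3 : ‖u m‖ ≤ R := by
        rw [← (u m).norm_toL2, hut]
        exact (norm_fst_le _).trans (hR m)
      conv_rhs => rw [← Real.sqrt_sq ((norm_nonneg _).trans (hR 0))]
      rw [← Real.sqrt_mul (abs_nonneg _)]
      exact Real.sqrt_le_sqrt ((h₀ (u m)).2.trans (mul_le_mul (le_abs_self _)
        (pow_le_pow_left₀ (norm_nonneg _) h3 2) (sq_nonneg _) (abs_nonneg _)))
    calc _ ≤ C₁ * (√(∫ y, ‖w y‖ ^ 2) * (√|C₀| * R)) :=
          mul_le_mul_of_nonneg_left (mul_le_mul_of_nonneg_left h2 (Real.sqrt_nonneg _)) hC₁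
      _ = _ := by ring
  choose C hC using hbd
  have hlim := tendsto_finsetSum T fun x hx => ((tendsto_localized g hΩ (hχ.smooth x) (hχ1 x hx)
    (hχ.subordinate x) hts hu hut hR hw).sqrt).const_mul (C x)
  simp only [Real.sqrt_zero, mul_zero, Finset.sum_const_zero] at hlim
  refine squeeze_zero (fun _ => sq_nonneg _) (fun m => ?_) hlim
  rw [← hut, L2Section.norm_toL2, L2Section.norm_sq]
  have hux : ∀ x, IsTestForm Ω fun p => χ x p • (u m).form p := fun x => (hu m).smul (hχ.smooth x)
  have h1 : ∫ p in Ω, formInner g p ((u m).form p) ((u m).form p) ∂riemannianVolume g =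
      ∑ x ∈ T, ∫ p in Ω, formInner g p (χ x p • (u m).form p) ((u m).form p)
        ∂riemannianVolume g := by
    have hi : ∀ x ∈ T, Integrable (fun p => formInner g p (χ x p • (u m).form p) ((u m).form p))
        ((riemannianVolume g).restrict Ω) := fun x _ =>
      (smoothSection g _ _ (hux x).smooth).integrable_inner (u m)
    rw [← integral_finsetSum _ hi]
    refine integral_congr_ae (Filter.Eventually.of_forall fun p => ?_)
    simp only [formInner_smul_left, ← Finset.sum_mul, hχ.sum_eq_one, one_mul]
  rw [h1]
  exact Finset.sum_le_sum fun x _ => hC x m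

end Rellich

/-! ### Weak convergence in Hilbert spaces and the abstract gap argument. -/

section WeakConvergence

/-- Bounded sequences in a Hilbert space have weakly convergent subsequences. -/
theorem exists_weak_limit {H : Type*} [NormedAddCommGroup H] [InnerProductSpace ℝ H]
    [CompleteSpace H] {a : ℕ → H} {R : ℝ} (hR : ∀ m, ‖a m‖ ≤ R) :
    ∃ φ : ℕ → ℕ, StrictMono φ ∧ ∃ b : H, ∀ ℓ : H →L[ℝ] ℝ,
      Filter.Tendsto (fun m => ℓ (a (φ m))) Filter.atTop (nhds (ℓ b)) := by
  set S := (Submodule.span ℝ (Set.range a)).topologicalClosure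
  have hS : IsClosed (S : Set H) := Submodule.isClosed_topologicalClosure _
  -- The closed span of the sequence is separable, so bounded balls of its dual are weak-*
  -- sequentially compact.
  have : CompleteSpace S := hS.completeSpace_coe
  have : TopologicalSpace.SeparableSpace S :=
    (Set.countable_range a).isSeparable.span.closure.separableSpace
  have haS : ∀ m, a m ∈ S := fun m =>
    Submodule.le_topologicalClosure _ (Submodule.subset_span ⟨m, rfl⟩)
  let f : ℕ → WeakDual ℝ S := fun m =>
    StrongDual.toWeakDual (InnerProductSpace.toDual ℝ S ⟨a m, haS m⟩)
  have hf : ∀ m, f m ∈ WeakDual.toStrongDual ⁻¹' Metric.closedBall (0 : StrongDual ℝ S) R :=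
    fun m => by
    rw [Set.mem_preimage, mem_closedBall_zero_iff]
    exact (LinearIsometryEquiv.norm_map (InnerProductSpace.toDual ℝ S) _).trans_le (hR m)
  obtain ⟨f', -, φ, hφ, hlim⟩ := WeakDual.isSeqCompact_closedBall ℝ S 0 R hf
  refine ⟨φ, hφ, ((InnerProductSpace.toDual ℝ S).symm (WeakDual.toStrongDual f') : S),
    fun ℓ => ?_⟩
  set y := (InnerProductSpace.toDual ℝ S).symm (ℓ ∘L S.subtypeL)
  have hy : ∀ z : S, ℓ z = inner ℝ y z := fun z =>
    (InnerProductSpace.toDual_symm_apply (x := z) (y := ℓ ∘L S.subtypeL)).symm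
  have h1 := ((WeakDual.eval_continuous (𝕜 := ℝ) y).tendsto f').comp hlim
  have h2 : ℓ ((InnerProductSpace.toDual ℝ S).symm (WeakDual.toStrongDual f') : S) = f' y := by
    rw [hy, real_inner_comm]
    exact InnerProductSpace.toDual_symm_apply
  rw [h2]
  refine h1.congr fun m => ?_
  rw [show ℓ (a (φ m)) = inner ℝ y ⟨a (φ m), haS (φ m)⟩ from hy ⟨a (φ m), haS (φ m)⟩,
    real_inner_comm]
  rfl

/-- Closed subspaces are weakly sequentially closed. -/
theorem mem_of_weak_limit {X : Type*} [NormedAddCommGroup X] [NormedSpace ℝ X]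
    {V : Submodule ℝ X} (hV : IsClosed (V : Set X)) {a : ℕ → X} {b : X} (ha : ∀ m, a m ∈ V)
    (h : ∀ ℓ : X →L[ℝ] ℝ, Filter.Tendsto (fun m => ℓ (a m)) Filter.atTop (nhds (ℓ b))) :
    b ∈ V := by
  by_contra hb
  -- A functional on the quotient by `V` that does not vanish at the class of `b` separates `b` from
  -- `V`.
  have h0 : V.mkQ b ≠ 0 := by simpa using hb
  obtain ⟨f, hf⟩ := SeparatingDual.exists_ne_zero (R := ℝ) h0
  refine hf (tendsto_nhds_unique (h (f ∘L V.mkQL)) (tendsto_const_nhds.congr fun m => ?_))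
  have h1 : V.mkQ (a m) = 0 := by simpa using ha m
  exact ((congrArg f h1).trans (map_zero f)).symm

/-- Sequences whose difference tends to zero have the same weak limits. -/
theorem tendsto_apply_of_tendsto_sub {X : Type*} [NormedAddCommGroup X] [NormedSpace ℝ X]
    {a s : ℕ → X} (h : Filter.Tendsto (fun m => s m - a m) Filter.atTop (nhds 0)) {ℓ : X →L[ℝ] ℝ}
    {c : ℝ} (ha : Filter.Tendsto (fun m => ℓ (a m)) Filter.atTop (nhds c)) :
    Filter.Tendsto (fun m => ℓ (s m)) Filter.atTop (nhds c) := by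
  have h1 := ((ℓ.continuous.tendsto 0).comp h).add ha
  rw [map_zero, zero_add] at h1
  refine h1.congr fun m => ?_
  simp

variable {E F H : Type*} [NormedAddCommGroup E] [InnerProductSpace ℝ E] [CompleteSpace E]
  [NormedAddCommGroup F] [InnerProductSpace ℝ F] [CompleteSpace F]
  [NormedAddCommGroup H] [NormedSpace ℝ H]

/-- If weakly null sequences in a dense subspace have null first components, then the second
component controls the first on the orthogonal complement of the kernel of a map that is bounded
by the second component. -/
theorem exists_gap {G : Submodule ℝ (WithLp 2 (E × F) × H)}
    (hG : IsClosed (G : Set (WithLp 2 (E × F) × H))) {S N : Submodule ℝ (WithLp 2 (E × F))}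
    (hN : ∀ t, t ∈ S.topologicalClosure → (t, 0) ∈ G → t ∈ N)
    (hex : ∀ t ∈ S.topologicalClosure, ∃ f, (t, f) ∈ G) {C : ℝ}
    (hC : ∀ t f, (t, f) ∈ G → ‖f‖ ^ 2 ≤ C * ‖t.snd‖ ^ 2)
    (hcomp : ∀ s : ℕ → WithLp 2 (E × F), (∀ m, s m ∈ S) → ∀ R : ℝ, (∀ m, ‖s m‖ ≤ R) →
      (∀ ℓ : WithLp 2 (E × F) →L[ℝ] ℝ,
        Filter.Tendsto (fun m => ℓ (s m)) Filter.atTop (nhds 0)) →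
      Filter.Tendsto (fun m => ‖(s m).fst‖ ^ 2) Filter.atTop (nhds 0)) :
    ∃ c, 0 ≤ c ∧ ∀ t ∈ S.topologicalClosure ⊓ Nᗮ, ‖t.fst‖ ≤ c * ‖t.snd‖ := by
  by_contra hcon
  push Not at hcon
  have hVc : IsClosed ((S.topologicalClosure ⊓ Nᗮ : Submodule ℝ (WithLp 2 (E × F))) :
      Set (WithLp 2 (E × F))) :=
    (Submodule.isClosed_topologicalClosure S).inter (Submodule.isClosed_orthogonal N)
  -- Counterexamples to the bound with constants `m + 1` are normalized, so their second components
  -- tend to zero.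
  have hunit : ∀ m : ℕ, ∃ a ∈ S.topologicalClosure ⊓ Nᗮ, ‖a‖ = 1 ∧
      ‖a.snd‖ ≤ 1 / ((m : ℝ) + 1) := fun m => by
    obtain ⟨t, ht, hlt⟩ := hcon ((m : ℝ) + 1) (by positivity)
    have hsq := WithLp.prod_norm_sq_eq_of_L2 t
    have h0 : 0 < ‖t‖ := by
      rw [norm_pos_iff]
      rintro rfl
      simp at hlt
    refine ⟨‖t‖⁻¹ • t, Submodule.smul_mem _ _ ht, ?_, ?_⟩
    · rw [norm_smul, norm_inv, norm_norm, inv_mul_cancel₀ h0.ne']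
    · have h1 : ‖t.fst‖ ≤ ‖t‖ := abs_le_of_sq_le_sq' (by nlinarith [sq_nonneg ‖t.snd‖])
        (norm_nonneg _) |>.2
      rw [WithLp.smul_snd, norm_smul, norm_inv, norm_norm, ← div_eq_inv_mul,
        div_le_div_iff₀ h0 (by positivity)]
      nlinarith
  choose a haV ha1 has using hunit
  obtain ⟨φ, hφ, b, hb⟩ := exists_weak_limit (R := 1) fun m => (ha1 m).le
  have hsnd : Filter.Tendsto (fun m => ‖(a (φ m)).snd‖ ^ 2) Filter.atTop (nhds 0) := by
    have h1 := (tendsto_one_div_add_atTop_nhds_zero_nat (𝕜 := ℝ)).comp hφ.tendsto_atTop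
    have h2 := squeeze_zero (fun m => norm_nonneg _) (fun m => has (φ m)) h1
    simpa using h2.pow 2
  have hbV := mem_of_weak_limit hVc (fun m => haV (φ m)) hb
  choose f hf using fun m => hex _ (haV (φ m)).1
  -- The images are controlled by the second components alone, hence converge in norm.
  have hf0 : Filter.Tendsto f Filter.atTop (nhds 0) := by
    have h1 := hsnd.const_mul C
    rw [mul_zero] at h1
    have h2 := squeeze_zero (fun m => sq_nonneg ‖f m‖) (fun m => hC _ _ (hf m)) h1
    rw [tendsto_zero_iff_norm_tendsto_zero]
    simpa [Real.sqrt_sq] using h2.sqrt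
  -- The pairs converge weakly, and the closed subspace `G` is weakly sequentially closed; no
  -- continuity of the map with graph `G` is invoked.
  have hbG : (b, (0 : H)) ∈ G := by
    refine mem_of_weak_limit hG hf fun ℓ => ?_
    have h1 := (hb (ℓ ∘L ContinuousLinearMap.inl ℝ _ _)).add
      (((ℓ ∘L ContinuousLinearMap.inr ℝ _ _).continuous.tendsto 0).comp hf0)
    have h2 : ∀ q : WithLp 2 (E × F) × H, (ℓ ∘L ContinuousLinearMap.inl ℝ _ _) q.1 +
        (ℓ ∘L ContinuousLinearMap.inr ℝ _ _) q.2 = ℓ q := fun q => by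
      simp [← map_add]
    have h3 := h2 (b, 0)
    simp only at h3
    rw [h3] at h1
    exact h1.congr fun m => h2 (_, _)
  have hb0 : b = 0 := inner_self_eq_zero.1 (hbV.2 b (hN b hbV.1 hbG))
  subst hb0
  -- The compactness hypothesis concerns elements of `S` only, so the unit vectors are replaced by
  -- norm-close elements of `S`, which have the same weak limit.
  have happ : ∀ m : ℕ, ∃ s ∈ S, dist (a (φ m)) s < 1 / ((m : ℝ) + 1) := fun m =>
    Metric.mem_closure_iff.1 (haV (φ m)).1 _ (by positivity)
  choose s hsS hsd using happ
  have hsub : Filter.Tendsto (fun m => s m - a (φ m)) Filter.atTop (nhds 0) := by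
    rw [tendsto_zero_iff_norm_tendsto_zero]
    refine squeeze_zero (fun m => norm_nonneg _) (fun m => ?_)
      (tendsto_one_div_add_atTop_nhds_zero_nat (𝕜 := ℝ))
    rw [← dist_eq_norm, dist_comm]
    exact (hsd m).le
  -- The bound `2` comes from the unit norm plus an approximation error of at most `1`.
  have hs0 := hcomp s hsS 2 (fun m => ?_) fun ℓ => ?_
  · have h1 : Filter.Tendsto (fun m => ‖(a (φ m)).fst‖ ^ 2) Filter.atTop (nhds 0) := by
      have h2 : Filter.Tendsto (fun m => ‖(s m).fst‖) Filter.atTop (nhds 0) := by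
        simpa [Real.sqrt_sq] using hs0.sqrt
      have h3 : Filter.Tendsto (fun m => (a (φ m)).fst) Filter.atTop (nhds 0) := by
        have h4 := (((WithLp.continuous_fst 2 E F).tendsto 0).comp hsub)
        have h5 := (tendsto_zero_iff_norm_tendsto_zero.2 h2).sub h4
        rw [WithLp.zero_fst, sub_zero] at h5
        refine h5.congr fun m => ?_
        simp
      simpa using h3.norm.pow 2
    -- Both components tend to zero although their squared norms always add up to one.
    have h2 := h1.add hsnd
    have h3 : ∀ m, ‖(a (φ m)).fst‖ ^ 2 + ‖(a (φ m)).snd‖ ^ 2 = 1 := fun m => by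
      rw [← WithLp.prod_norm_sq_eq_of_L2, ha1, one_pow]
    simp only [h3, add_zero] at h2
    exact one_ne_zero (tendsto_nhds_unique tendsto_const_nhds h2)
  · have h1 : ‖s m‖ ≤ ‖a (φ m)‖ + dist (s m) (a (φ m)) := by
      rw [dist_eq_norm]
      exact norm_le_norm_add_norm_sub' _ _
    rw [ha1, dist_comm] at h1
    have h2 : 1 / ((m : ℝ) + 1) ≤ 1 := by
      rw [div_le_one (by positivity)]
      linarith [(Nat.cast_nonneg m : (0 : ℝ) ≤ m)]
    linarith [hsd m]
  · have h1 := tendsto_apply_of_tendsto_sub hsub (hb ℓ)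
    rwa [map_zero] at h1

/-- Sequential criterion for completeness of an inner product. -/
theorem completeSpace_of_core {X : Type*} [AddCommGroup X] [Module ℝ X]
    (c : InnerProductSpace.Core ℝ X)
    (h : ∀ u : ℕ → X, (∀ ε > 0, ∃ N, ∀ m ≥ N, ∀ l ≥ N, c.inner (u m - u l) (u m - u l) < ε) →
      ∃ x, Filter.Tendsto (fun m => c.inner (u m - x) (u m - x)) Filter.atTop (nhds 0)) :
    @CompleteSpace X c.toNormedAddCommGroup.toUniformSpace := by
  let _ := c.toNormedAddCommGroup
  have hn : ∀ x : X, ‖x‖ ^ 2 = c.inner x x := fun x => by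
    let _ := InnerProductSpace.ofCore c.toCore
    exact (real_inner_self_eq_norm_sq x).symm
  refine Metric.complete_of_cauchySeq_tendsto fun u hu => ?_
  obtain ⟨x, hx⟩ := h u fun ε hε => by
    obtain ⟨N, hN⟩ := Metric.cauchySeq_iff.1 hu (√ε) (Real.sqrt_pos.2 hε)
    refine ⟨N, fun m hm l hl => ?_⟩
    have h1 := hN m hm l hl
    rw [dist_eq_norm] at h1
    rw [← hn]
    calc _ < √ε ^ 2 := pow_lt_pow_left₀ h1 (norm_nonneg _) two_ne_zero
      _ = ε := Real.sq_sqrt hε.le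
  refine ⟨x, ?_⟩
  rw [tendsto_iff_norm_sub_tendsto_zero]
  simp only [← hn] at hx
  simpa [Real.sqrt_sq] using hx.sqrt

end WeakConvergence

/-! ### The form `𝓔`, its domain, and the three assertions. -/

section FormDomain
variable {n k : ℕ} {M : Type*} [TopologicalSpace M] [ChartedSpace (Euc n) M]
  [IsManifold (𝓡 n) ∞ M] [MeasurableSpace M] [BorelSpace M] [CompactSpace M] [T2Space M]
  {g : SmoothMetric n M} {Ω : Set M} {μ : Measure M}

theorem sobolevZero_eq (hΩ : IsOpen Ω) :
    sobolevZero g Ω k = (testSubmodule g Ω k).topologicalClosure :=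
  inf_eq_right.2 (testSubmodule_closure_le g hΩ)

/-- Both sides are continuous in the pair, so the Poincaré inequality passes from test forms to the
closure of their graph. -/
theorem norm_sq_le_of_mem_iotaGraph {C : ℝ} (hC : ∀ t ∈ sobolev g Ω k,
      ∀ u : L2Section g ((riemannianVolume g).restrict Ω) k, IsTestForm Ω u.form →
      u.toL2 = t.fst → ∫ p in Ω, formInner g p (u.form p) (u.form p) ∂μ ≤
        C * (‖t.snd.fst‖ ^ 2 + ‖t.snd.snd‖ ^ 2)) (t : FormTriple g Ω k)
    (f : L2Form g (μ.restrict Ω) k) (h : (t, f) ∈ iotaGraph g Ω μ k) :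
    ‖f‖ ^ 2 ≤ C * ‖t.snd‖ ^ 2 := by
  have hcl : IsClosed {q : FormTriple g Ω k × L2Form g (μ.restrict Ω) k |
      ‖q.2‖ ^ 2 ≤ C * ‖q.1.snd‖ ^ 2} := by
    have h1 : Continuous fun q : FormTriple g Ω k × L2Form g (μ.restrict Ω) k => q.1.snd :=
      (WithLp.continuous_snd 2 _ _).comp continuous_fst
    exact isClosed_le (continuous_snd.norm.pow 2) (continuous_const.mul (h1.norm.pow 2))
  refine closure_minimal (fun q hq => ?_) hcl (show (t, f) ∈ closure _ from h)
  obtain ⟨hs, u, u', hu, huu, h1, h2⟩ := hq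
  rw [Set.mem_ofPred_eq, norm_snd_sq, ← h2, L2Section.norm_toL2, L2Section.norm_sq, huu]
  exact hC _ hs u hu h1

theorem mem_sobolevZero_of_mem_iotaGraph (hΩ : IsOpen Ω) {t : FormTriple g Ω k}
    {f : L2Form g (μ.restrict Ω) k} (h : (t, f) ∈ iotaGraph g Ω μ k) :
    t ∈ sobolevZero g Ω k := by
  rw [sobolevZero_eq hΩ]
  refine map_mem_closure continuous_fst (show (t, f) ∈ closure _ from h) fun q hq => ?_
  obtain ⟨hs, u, u', hu, -, h1, -⟩ := hq
  exact ⟨hs, u, hu, h1⟩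

theorem isClosed_iotaGraph : IsClosed (iotaGraph g Ω μ k :
    Set (FormTriple g Ω k × L2Form g (μ.restrict Ω) k)) :=
  Submodule.isClosed_topologicalClosure _

theorem isClosed_nullPerp (hΩ : IsOpen Ω) :
    IsClosed (nullPerp g Ω μ k : Set (FormTriple g Ω k)) := by
  refine IsClosed.inter ?_ (Submodule.isClosed_orthogonal _)
  rw [sobolevZero_eq hΩ]
  exact Submodule.isClosed_topologicalClosure _

theorem isClosed_nullSpace (hΩ : IsOpen Ω) :
    IsClosed (nullSpace g Ω μ k : Set (FormTriple g Ω k)) := by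
  refine IsClosed.inter ?_ (isClosed_iotaGraph.preimage (f := fun t : FormTriple g Ω k =>
    (t, (0 : L2Form g (μ.restrict Ω) k))) (continuous_id.prodMk continuous_const))
  rw [sobolevZero_eq hΩ]
  exact Submodule.isClosed_topologicalClosure _

theorem completeSpace_formTriple (g : SmoothMetric n M) (Ω : Set M) (k : ℕ) :
    CompleteSpace (FormTriple g Ω k) := by
  have h1 := completeSpace_l2Form (k := k) g ((riemannianVolume g).restrict Ω)
  have h2 := completeSpace_l2Form (k := k + 1) g ((riemannianVolume g).restrict Ω)
  have h3 := completeSpace_l2Form (k := k - 1) g ((riemannianVolume g).restrict Ω)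
  infer_instance

theorem mem_testGraph {t : FormTriple g Ω k} (ht : t ∈ sobolev g Ω k)
    {u : L2Section g ((riemannianVolume g).restrict Ω) k} {u' : L2Section g (μ.restrict Ω) k}
    (hu : IsTestForm Ω u.form) (h : u'.form = u.form) (hut : u.toL2 = t.fst) :
    (t, u'.toL2) ∈ testGraph g Ω μ k := ⟨ht, u, u', hu, h, hut, rfl⟩

/-- A test form as an element of the graph of `ι`. -/
theorem exists_mem_testGraph [IsFiniteMeasure μ] (hΩ : IsOpen Ω)
    (a : L2Section g (μ.restrict Ω) k) (ha : IsTestForm Ω a.form) :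
    ∃ t, (t, a.toL2) ∈ testGraph g Ω μ k := by
  have := isFiniteMeasure_riemannianVolume g
  have h0 := smoothSection_form g ((riemannianVolume g).restrict Ω) _ ha.smooth
  generalize smoothSection g ((riemannianVolume g).restrict Ω) _ ha.smooth = u at h0
  have hu : IsTestForm Ω u.form := by rwa [h0]
  obtain ⟨t, ht, h1, -⟩ := exists_mem_sobolev g hΩ u hu
  exact ⟨t, mem_testGraph ht hu h0.symm h1.symm⟩

/-- Every element of `W₀^{1,2}` has an `L²(μ)`-representative. -/
theorem exists_mem_iotaGraph [IsFiniteMeasure μ]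
    (hPI : PoincareInequality g Ω μ k) {t : FormTriple g Ω k}
    (ht : t ∈ (testSubmodule g Ω k).topologicalClosure) :
    ∃ f, (t, f) ∈ iotaGraph g Ω μ k := by
  obtain ⟨C, hC0, hC⟩ := hPI
  have := completeSpace_l2Form (k := k) g (μ.restrict Ω)
  obtain ⟨s, hs, hst⟩ := mem_closure_iff_seq_limit.1 (show t ∈ closure _ from ht)
  choose hsob u hu hus using hs
  have hsec : ∀ m, ∃ u' : L2Section g (μ.restrict Ω) k, u'.form = (u m).form := fun m =>
    ⟨_, smoothSection_form g (μ.restrict Ω) _ (hu m).smooth⟩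
  choose u' hu' using hsec
  have hmem : ∀ m, (s m, (u' m).toL2) ∈ testGraph g Ω μ k := fun m =>
    mem_testGraph (hsob m) (hu m) (hu' m) (hus m)
  -- The Poincaré inequality, applied to differences, turns convergence of triples into a Cauchy
  -- sequence in `L²(μ)`.
  have hcauchy : CauchySeq fun m => (u' m).toL2 := by
    refine cauchySeq_of_dist_le (C := √C) hst.cauchySeq fun m l => ?_
    have h1 := norm_sq_le_of_mem_iotaGraph hC _ _
      (Submodule.le_topologicalClosure _ (Submodule.sub_mem _ (hmem m) (hmem l)))
    rw [dist_eq_norm, dist_eq_norm, ← Real.sqrt_sq (norm_nonneg (s m - s l)),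
      ← Real.sqrt_mul hC0.le]
    refine Real.le_sqrt_of_sq_le (h1.trans (mul_le_mul_of_nonneg_left ?_ hC0.le))
    exact pow_le_pow_left₀ (norm_nonneg _) (norm_snd_le _) 2
  obtain ⟨f, hf⟩ := cauchySeq_tendsto_of_complete hcauchy
  exact ⟨f, isClosed_iotaGraph.mem_of_tendsto (hst.prodMk_nhds hf)
    (Filter.Eventually.of_forall fun m => Submodule.le_topologicalClosure _ (hmem m))⟩

/-- The decisive estimate. The energy is the squared norm of the pair `(du, d*u)`; that it also
controls the norm of `u` in `L²(dV_g)` on `N^⊥` is not contained in the Poincaré inequality and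
follows by combining that inequality with Rellich's theorem. -/
theorem exists_energy_gap [IsFiniteMeasure μ] (hΩ : IsOpen Ω) (hPI : PoincareInequality g Ω μ k) :
    ∃ c, 0 ≤ c ∧ ∀ t ∈ nullPerp g Ω μ k, ‖t‖ ≤ c * ‖t.snd‖ := by
  have h1 := completeSpace_l2Form (k := k) g ((riemannianVolume g).restrict Ω)
  have h2 := completeSpace_l2Form (k := k + 1) g ((riemannianVolume g).restrict Ω)
  have h3 := completeSpace_l2Form (k := k - 1) g ((riemannianVolume g).restrict Ω)
  obtain ⟨C, hC0, hC⟩ := hPI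
  obtain ⟨c, hc, hgap⟩ := exists_gap (G := iotaGraph g Ω μ k) (S := testSubmodule g Ω k)
    (N := nullSpace g Ω μ k) isClosed_iotaGraph
    (fun t ht h0 => ⟨by rwa [sobolevZero_eq hΩ], h0⟩)
    (fun t ht => exists_mem_iotaGraph ⟨C, hC0, hC⟩ ht) (norm_sq_le_of_mem_iotaGraph hC)
    (fun s hs R hR hw => tendsto_norm_fst g hΩ hs hR hw)
  -- The gap for the first component gives `‖t‖² ≤ (c² + 1) ‖t.snd‖²`, and `c² + 1 ≤ (c + 1)²`.
  refine ⟨c + 1, by positivity, fun t ht => ?_⟩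
  have h4 := hgap t ⟨by rw [← sobolevZero_eq hΩ]; exact ht.1, ht.2⟩
  have h5 := WithLp.prod_norm_sq_eq_of_L2 t
  have h6 := norm_nonneg t.snd
  refine abs_le_of_sq_le_sq' ?_ (by positivity) |>.2
  have h7 := pow_le_pow_left₀ (norm_nonneg _) h4 2
  nlinarith [mul_nonneg hc (sq_nonneg ‖t.snd‖)]

theorem lift_mem (f : formDomain g Ω μ k) : lift f ∈ nullPerp g Ω μ k :=
  (exists_lift f).choose_spec.1

theorem lift_mem_iotaGraph (f : formDomain g Ω μ k) :
    (lift f, (f : L2Form g (μ.restrict Ω) k)) ∈ iotaGraph g Ω μ k :=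
  (exists_lift f).choose_spec.2

theorem lift_add (f h : formDomain g Ω μ k) : lift (f + h) = lift f + lift h :=
  (eq_lift (Submodule.add_mem _ (lift_mem f) (lift_mem h))
    (Submodule.add_mem _ (lift_mem_iotaGraph f) (lift_mem_iotaGraph h))).symm

theorem lift_smul (c : ℝ) (f : formDomain g Ω μ k) : lift (c • f) = c • lift f :=
  (eq_lift (Submodule.smul_mem _ c (lift_mem f))
    (Submodule.smul_mem _ c (lift_mem_iotaGraph f))).symm

theorem lift_sub (f h : formDomain g Ω μ k) : lift (f - h) = lift f - lift h :=
  (eq_lift (Submodule.sub_mem _ (lift_mem f) (lift_mem h))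
    (Submodule.sub_mem _ (lift_mem_iotaGraph f) (lift_mem_iotaGraph h))).symm

theorem energy_eq (f h : formDomain g Ω μ k) :
    energy f h = inner ℝ (lift f).snd (lift h).snd :=
  (WithLp.prod_inner_apply _ _).symm

theorem energy_self (f : formDomain g Ω μ k) : energy f f = ‖(lift f).snd‖ ^ 2 := by
  rw [energy_eq, real_inner_self_eq_norm_sq]

theorem mem_formDomain {t : FormTriple g Ω k} {f : L2Form g (μ.restrict Ω) k}
    (ht : t ∈ nullPerp g Ω μ k) (h : (t, f) ∈ iotaGraph g Ω μ k) : f ∈ formDomain g Ω μ k :=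
  ⟨(t, f), ⟨h, ht⟩, rfl⟩

/-- The component in `N` has image zero, so the orthogonal projection off `N` keeps the image and
lands in `N^⊥`. Thus `ι` has the same range on `N^⊥` as on all of `W₀^{1,2}`. -/
theorem mem_formDomain_of_mem_iotaGraph (hΩ : IsOpen Ω) {t : FormTriple g Ω k}
    {f : L2Form g (μ.restrict Ω) k} (h : (t, f) ∈ iotaGraph g Ω μ k) :
    f ∈ formDomain g Ω μ k := by
  have := completeSpace_formTriple g Ω k
  have : CompleteSpace (nullSpace g Ω μ k) := (isClosed_nullSpace hΩ).completeSpace_coe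
  obtain ⟨a, ha, b, hb, hab⟩ := (nullSpace g Ω μ k).exists_add_mem_mem_orthogonal t
  have h1 : (b, f) ∈ iotaGraph g Ω μ k := by
    have h2 := Submodule.sub_mem _ h (show (a, 0) ∈ iotaGraph g Ω μ k from ha.2)
    rwa [Prod.mk_sub_mk, sub_zero, hab, add_sub_cancel_left] at h2
  exact mem_formDomain ⟨mem_sobolevZero_of_mem_iotaGraph hΩ h1, hb⟩ h1

/-- The domain contains the class of every test form, and a class orthogonal to all of them is zero.
-/
theorem dense_formDomain [IsFiniteMeasure μ] (hΩ : IsOpen Ω) :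
    Dense (formDomain g Ω μ k : Set (L2Form g (μ.restrict Ω) k)) := by
  have := completeSpace_l2Form (k := k) g (μ.restrict Ω)
  rw [Submodule.dense_iff_topologicalClosure_eq_top, Submodule.topologicalClosure_eq_top_iff,
    Submodule.eq_bot_iff]
  refine fun v hv => eq_zero_of_inner_testForm g hΩ μ fun a ha => ?_
  obtain ⟨t, ht⟩ := exists_mem_testGraph hΩ a ha
  exact hv _ (mem_formDomain_of_mem_iotaGraph hΩ (Submodule.le_topologicalClosure _ ht))

/-- By the gap, lifts of a sequence that is Cauchy for the energy are Cauchy in the full norm.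
Closedness of `N^⊥` and of the graph of `ι` then identifies their limit as the lift of `f`. -/
theorem isClosedForm_energy [IsFiniteMeasure μ] (hΩ : IsOpen Ω)
    (hPI : PoincareInequality g Ω μ k) :
    IsClosedForm (energy (g := g) (Ω := Ω) (μ := μ) (k := k)) := by
  intro u f hu hcau
  have := completeSpace_formTriple g Ω k
  obtain ⟨c, hc, hgap⟩ := exists_energy_gap hΩ hPI
  have hl : CauchySeq fun m => lift (u m) := by
    rw [Metric.cauchySeq_iff]
    intro ε hε
    -- The gap constant is enlarged to `c + 1` so that division is possible even if `c = 0`.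
    obtain ⟨N, hN⟩ := hcau ((ε / (c + 1)) ^ 2) (by positivity)
    refine ⟨N, fun m hm l hl => ?_⟩
    have h1 := hN m hm l hl
    rw [energy_self] at h1
    have h2 := lt_of_pow_lt_pow_left₀ 2 (by positivity) h1
    have h3 := hgap _ (lift_mem (u m - u l))
    rw [lt_div_iff₀ (by positivity)] at h2
    rw [dist_eq_norm, ← lift_sub]
    nlinarith [norm_nonneg (lift (u m - u l)).snd]
  obtain ⟨t, ht⟩ := cauchySeq_tendsto_of_complete hl
  have h1 : t ∈ nullPerp g Ω μ k := (isClosed_nullPerp hΩ).mem_of_tendsto ht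
    (Filter.Eventually.of_forall fun m => lift_mem (u m))
  have h2 : (t, f) ∈ iotaGraph g Ω μ k := isClosed_iotaGraph.mem_of_tendsto (ht.prodMk_nhds hu)
    (Filter.Eventually.of_forall fun m => lift_mem_iotaGraph (u m))
  refine ⟨mem_formDomain h1 h2, ?_⟩
  have h3 : t = lift ⟨f, mem_formDomain h1 h2⟩ := eq_lift h1 h2
  have h4 := ((WithLp.continuous_snd 2 _ _).tendsto t).comp ht
  have h5 := (tendsto_iff_norm_sub_tendsto_zero.1 h4).pow 2
  rw [zero_pow two_ne_zero] at h5
  refine h5.congr fun m => ?_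
  rw [energy_self, lift_sub, ← h3, WithLp.sub_snd]
  rfl

/-- `𝓔_*` as an inner product on `dom(𝓔)`. -/
@[reducible]
def energyCore : InnerProductSpace.Core ℝ (formDomain g Ω μ k) where
  inner := energyStar
  conj_inner_symm f h := by
    simp only [energyStar, energy_eq, conj_trivial]
    rw [real_inner_comm, real_inner_comm (f : L2Form g (μ.restrict Ω) k)]
  re_inner_nonneg f := by
    simp only [energyStar, energy_self, real_inner_self_eq_norm_sq, RCLike.re_to_real]
    positivity
  add_left f f' h := by
    simp only [energyStar, energy_eq, lift_add, WithLp.add_snd, inner_add_left, Submodule.coe_add]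
    ring
  smul_left f h c := by
    simp only [energyStar, energy_eq, lift_smul, WithLp.smul_snd, real_inner_smul_left,
      Submodule.coe_smul, conj_trivial]
    ring
  definite f hf := by
    simp only [energyStar, energy_self, real_inner_self_eq_norm_sq] at hf
    -- Definiteness comes from the `L²(μ)` summand alone.
    have h1 : ‖(f : L2Form g (μ.restrict Ω) k)‖ ^ 2 = 0 := by
      have h2 := sq_nonneg ‖(lift f).snd‖
      have h3 := sq_nonneg ‖(f : L2Form g (μ.restrict Ω) k)‖
      linarith
    exact Subtype.ext (norm_eq_zero.1 (pow_eq_zero_iff two_ne_zero |>.1 h1))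

/-- The two nonnegative summands of `𝓔_*` are each bounded by it, so a Cauchy sequence converges in
`L²(μ)` and is Cauchy for the energy; closedness of the energy form makes the same limit serve for
both. -/
theorem isHilbert_energyStar [IsFiniteMeasure μ] (hΩ : IsOpen Ω)
    (hPI : PoincareInequality g Ω μ k) :
    IsHilbert (energyStar (g := g) (Ω := Ω) (μ := μ) (k := k)) := by
  refine ⟨energyCore (g := g) (Ω := Ω) (μ := μ) (k := k), fun _ _ => rfl, completeSpace_of_core _ fun u hu => ?_⟩
  have := completeSpace_l2Form (k := k) g (μ.restrict Ω)
  have hstar : ∀ f : formDomain g Ω μ k, (energyCore (g := g) (Ω := Ω) (μ := μ) (k := k)).inner f f =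
      energy f f + ‖(f : L2Form g (μ.restrict Ω) k)‖ ^ 2 := fun f => by
    rw [← real_inner_self_eq_norm_sq]
    rfl
  have he : ∀ f : formDomain g Ω μ k, 0 ≤ energy f f := fun f => by
    rw [energy_self]
    exact sq_nonneg _
  simp only [hstar] at hu ⊢
  have hc : CauchySeq fun m => (u m : L2Form g (μ.restrict Ω) k) := by
    rw [Metric.cauchySeq_iff]
    intro ε hε
    obtain ⟨N, hN⟩ := hu (ε ^ 2) (by positivity)
    refine ⟨N, fun m hm l hl => ?_⟩
    rw [dist_eq_norm, ← Submodule.coe_sub]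
    refine lt_of_pow_lt_pow_left₀ 2 hε.le ?_
    linarith [hN m hm l hl, he (u m - u l)]
  obtain ⟨f, hf⟩ := cauchySeq_tendsto_of_complete hc
  obtain ⟨hfD, hlim⟩ := isClosedForm_energy hΩ hPI u f hf fun ε hε => by
    obtain ⟨N, hN⟩ := hu ε hε
    refine ⟨N, fun m hm l hl => ?_⟩
    have := sq_nonneg ‖((u m - u l : formDomain g Ω μ k) : L2Form g (μ.restrict Ω) k)‖
    linarith [hN m hm l hl]
  refine ⟨⟨f, hfD⟩, ?_⟩
  have h1 := hlim.add ((tendsto_iff_norm_sub_tendsto_zero.1 hf).pow 2)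
  rw [zero_pow two_ne_zero, add_zero] at h1
  exact h1

end FormDomain

end
end KreinFeller

theorem proposition2p3 {n : ℕ} {M : Type*} [TopologicalSpace M] [T2Space M] [CompactSpace M]
    [ChartedSpace (EuclideanSpace ℝ (Fin n)) M] [IsManifold (𝓡 n) ∞ M]
    [MeasurableSpace M] [BorelSpace M] (g : KreinFeller.SmoothMetric n M)
    (Ω : Set M) (hΩ : IsOpen Ω) (μ : Measure M) [IsFiniteMeasure μ]
    (hsupp : μ.support ⊆ closure Ω) (hpos : 0 < μ Ω) (k : ℕ)
    (hPI : KreinFeller.PoincareInequality g Ω μ k) :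
    Dense (KreinFeller.formDomain g Ω μ k : Set (KreinFeller.L2Form g (μ.restrict Ω) k)) ∧
    KreinFeller.IsHilbert (KreinFeller.energyStar (g := g) (Ω := Ω) (μ := μ) (k := k)) ∧
    KreinFeller.IsClosedForm (KreinFeller.energy (g := g) (Ω := Ω) (μ := μ) (k := k)) := by
  exact ⟨KreinFeller.dense_formDomain hΩ, KreinFeller.isHilbert_energyStar hΩ hPI,
    KreinFeller.isClosedForm_energy hΩ hPI⟩
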